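/- **Setting.** Let $k$ be an algebraically closed field of characteristic $p>0$, let $\mathcal{O}$ be a discrete valuation ring that is a finite extension of the Witt ring $W(k)$, with fraction field $\mathcal{O}[\frac1p]$ and absolute value normalized by $|p|=p^{-1}$. Let $\sigma$ be an automorphism of $\mathcal{O}$ lifting the Frobenius $x\mapsto x^p$ on $k$, and let $\mathcal{O}_0$ be the ring of elements of $\mathcal{O}$ fixed by $\sigma$. Let $\Gamma^{\mathrm{imm}}_{\mathrm{an,con}}$ be the ring of generalized power series $x=\sum_{n\in\mathbb{Q}}x_nt^n$ with $x_n\in\mathcal{O}[\frac1p]$ such that: 1. for each $r\in\mathbb{R}$, the set of $n$ with $|x_n|>p^r$ is well-ordered; 2. for each $j\in\mathbb{Q}$, the coefficients $x_n$ with $n\le j$ are bounded; 3. for some $c>0$, $|x_n|<p^{cn}$ for all sufficiently negative $n$; 4. for every $d>0$, $|x_n|<p^{dn}$ for all sufficiently positive $n$; with multiplication $(xy)_n=\sum_{i}x_iy_{n-i}$ and Frobenius $x^\sigma=\sum_n x_n^\sigma t^{pn}$. Let $\Gamma^{\mathrm{imm}}_{\mathrm{con}}$ be the subring of series with all $x_n\in\mathcal{O}$.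 Let $K^{\mathrm{alg}}$ be the algebraic closure of $k((t))$ inside the field of generalized power series $\sum_{n\in\mathbb{Q}}a_nt^n$ over $k$ with well-ordered support, and let $\Gamma^{\mathrm{alg}}_{\mathrm{con}}\subset\Gamma^{\mathrm{imm}}_{\mathrm{con}}$ consist of the elements lying in $\Gamma^{\mathrm{alg}}=W(K^{\mathrm{alg}})\otimes_{W(k)}\mathcal{O}$, that is, in the $p$-adic closure of the subring generated by $\mathcal{O}$ and the Teichmüller lifts of the elements of $K^{\mathrm{alg}}$ (the series $z$ over $\mathcal{O}$ with $z^\sigma=z^p$ and reduction in $K^{\mathrm{alg}}$). Let $\Gamma^{\mathrm{alg}}_{\mathrm{an,con}}$ be the subring of those $x\in\Gamma^{\mathrm{imm}}_{\mathrm{an,con}}$ such that $\sum_{i<j}x_it^i\in\Gamma^{\mathrm{alg}}_{\mathrm{con}}[\frac1p]$ for every $j\in\mathbb{Q}$. For $R=\Gamma^{\mathrm{alg}}_{\mathrm{an,con}}$ or $R=\Gamma^{\mathrm{imm}}_{\mathrm{an,con}}$, an *$F$-crystal* over $R$ is a finite free $R$-module $M$ with a $\sigma$-semilinear map $F:M\to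 M$ whose linearization $\sigma^*M\to M$ becomes an isomorphism after inverting $p$. **Lemma.** Let $M$ be an $F$-crystal over $R=\Gamma^{\mathrm{alg}}_{\mathrm{an,con}}$ or $R=\Gamma^{\mathrm{imm}}_{\mathrm{an,con}}$, let $\lambda\in\mathcal{O}_0$ be a uniformizer, and let $n\ge1$. Suppose that $M$ admits a basis $\mathbf{v}_1,\dots,\mathbf{v}_n,\mathbf{w}$ such that for some $c_1,\dots,c_n\in R$, $$F\mathbf{v}_i=\mathbf{v}_{i+1}\quad(1\le i\le n-1),\qquad F\mathbf{v}_n=\lambda^{n+1}\mathbf{v}_1,\qquad F\mathbf{w}=\mathbf{w}+\sum_{i=1}^n c_i\mathbf{v}_i.$$ Then $M$ has an eigenvector $\mathbf{y}$ with $F\mathbf{y}=\lambda\mathbf{y}$; that is, there is a nonzero $\mathbf{y}\in M$ with $F\mathbf{y}=\lambda\mathbf{y}$. -/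

import Mathlib

open Filter Topology

namespace GenSeries

noncomputable section

section Weighted

variable (p : ℕ) {K : Type*} [NormedField K]

/-- The weight `p ^ (-s n)`. -/
def wt (s : ℝ) (n : ℚ) : ℝ := (p : ℝ) ^ (-(s * (n : ℝ)))

/-- For the Gauss norm `sup |x_n| p ^ (-s n)`: it is finite, and for every `ε > 0` the set of
indices that contribute at least `ε` is well-ordered. -/
def Good (s : ℝ) (x : ℚ → K) : Prop :=
  (∃ B : ℝ, 0 < B ∧ ∀ n, ‖x n‖ * wt p s n ≤ B) ∧
    ∀ ε : ℝ, 0 < ε → {n : ℚ | ε ≤ ‖x n‖ * wt p s n}.IsPWO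

/-- The coefficient at `t ^ n` of the product of two generalized series. -/
def conv (x y : ℚ → K) (n : ℚ) : K := ∑' i : ℚ, x i * y (n - i)

/-- The conditions defining the generalized series `∑ x_n t ^ n` that belong to
`Γ^imm_{an,con}`. -/
structure IsImmAnCon (x : ℚ → K) : Prop where
  /-- for each `r`, the set of `n` with `|x_n| > p ^ r` is well-ordered -/
  isWF : ∀ r : ℝ, {n : ℚ | (p : ℝ) ^ r < ‖x n‖}.IsWF
  /-- the coefficients of index at most `j` are bounded, for each `j` -/
  bounded : ∀ j : ℚ, ∃ B : ℝ, ∀ n ≤ j, ‖x n‖ ≤ B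
  /-- for some `c > 0`, `|x_n| < p ^ (c n)` for `n` sufficiently negative -/
  neg : ∃ c : ℝ, 0 < c ∧ ∀ᶠ n : ℚ in atBot, ‖x n‖ < (p : ℝ) ^ (c * (n : ℝ))
  /-- for every `d > 0`, `|x_n| < p ^ (d n)` for `n` sufficiently positive -/
  pos : ∀ d : ℝ, 0 < d → ∀ᶠ n : ℚ in atTop, ‖x n‖ < (p : ℝ) ^ (d * (n : ℝ))

variable [hp : Fact p.Prime]

lemma one_lt_base : (1 : ℝ) < (p : ℝ) := by exact_mod_cast hp.out.one_lt

lemma base_pos : (0 : ℝ) < (p : ℝ) := zero_lt_one.trans (one_lt_base p)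

lemma wt_pos (s : ℝ) (n : ℚ) : 0 < wt p s n := Real.rpow_pos_of_pos (base_pos p) _

lemma wt_add (s : ℝ) (m n : ℚ) : wt p s (m + n) = wt p s m * wt p s n := by
  unfold wt
  rw [← Real.rpow_add (base_pos p)]
  congr 1
  push_cast
  ring

lemma wt_sub (s : ℝ) (i n : ℚ) : wt p s n = wt p s i * wt p s (n - i) := by
  rw [← wt_add]
  congr 1
  ring

lemma rpow_mul_wt (a s : ℝ) (n : ℚ) :
    (p : ℝ) ^ (a * (n : ℝ)) * wt p s n = (p : ℝ) ^ ((a - s) * (n : ℝ)) := by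
  unfold wt
  rw [← Real.rpow_add (base_pos p)]
  congr 1
  ring

lemma tendsto_ratCast_atTop : Tendsto (fun n : ℚ => (n : ℝ)) atTop atTop :=
  tendsto_ratCast_atTop_iff.2 tendsto_id

lemma tendsto_ratCast_atBot : Tendsto (fun n : ℚ => (n : ℝ)) atBot atBot :=
  tendsto_ratCast_atBot_iff.2 tendsto_id

lemma eventually_rpow_lt_atBot {a ε : ℝ} (ha : 0 < a) (hε : 0 < ε) :
    ∀ᶠ n : ℚ in atBot, (p : ℝ) ^ (a * (n : ℝ)) < ε := by
  have h1 : Tendsto (fun n : ℚ => a * (n : ℝ)) atBot atBot :=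
    tendsto_ratCast_atBot.const_mul_atBot ha
  exact ((tendsto_rpow_atBot_of_base_gt_one _ (one_lt_base p)).comp h1).eventually_lt_const hε

lemma eventually_rpow_lt_atTop {a ε : ℝ} (ha : a < 0) (hε : 0 < ε) :
    ∀ᶠ n : ℚ in atTop, (p : ℝ) ^ (a * (n : ℝ)) < ε := by
  have h1 : Tendsto (fun n : ℚ => a * (n : ℝ)) atTop atBot :=
    tendsto_ratCast_atTop.const_mul_atTop_of_neg ha
  exact ((tendsto_rpow_atBot_of_base_gt_one _ (one_lt_base p)).comp h1).eventually_lt_const hε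

variable {p}

/-- The defining conditions in terms of weighted sup norms. -/
lemma isImmAnCon_iff {x : ℚ → K} :
    IsImmAnCon p x ↔ ∃ c : ℝ, 0 < c ∧ ∀ s, 0 < s → s ≤ c → Good p s x := by
  constructor
  · intro hx
    obtain ⟨c, hc, hneg⟩ := hx.neg
    refine ⟨c / 2, by positivity, fun s hs hsc => ?_⟩
    have key : ∀ ε : ℝ, 0 < ε → ∃ a b : ℚ, ∀ n, ε ≤ ‖x n‖ * wt p s n → a ≤ n ∧ n ≤ b := by
      intro ε hε
      obtain ⟨a, ha⟩ := eventually_atBot.1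
        (hneg.and (eventually_rpow_lt_atBot p (show 0 < c - s by linarith) hε))
      obtain ⟨b, hb⟩ := eventually_atTop.1
        ((hx.pos (s / 2) (by positivity)).and
          (eventually_rpow_lt_atTop p (show s / 2 - s < 0 by linarith) hε))
      refine ⟨a, b, fun n hn => ⟨?_, ?_⟩⟩
      · by_contra! h
        obtain ⟨h1, h2⟩ := ha n h.le
        have := mul_le_mul_of_nonneg_right h1.le (wt_pos p s n).le
        rw [rpow_mul_wt] at this
        linarith
      · by_contra! h
        obtain ⟨h1, h2⟩ := hb n h.le
        have := mul_le_mul_of_nonneg_right h1.le (wt_pos p s n).le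
        rw [rpow_mul_wt] at this
        linarith
    have wle : ∀ (a n : ℚ), a ≤ n → wt p s n ≤ wt p s a := by
      intro a n h
      apply Real.rpow_le_rpow_of_exponent_le (one_lt_base p).le
      have : (a : ℝ) ≤ n := by exact_mod_cast h
      nlinarith
    refine ⟨?_, fun ε hε => ?_⟩
    · obtain ⟨a, b, hab⟩ := key 1 one_pos
      obtain ⟨B, hB⟩ := hx.bounded b
      refine ⟨max 1 (|B| * wt p s a), by positivity, fun n => ?_⟩
      by_cases h : 1 ≤ ‖x n‖ * wt p s n
      · obtain ⟨h1, h2⟩ := hab n h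
        refine le_max_of_le_right ?_
        exact mul_le_mul ((hB n h2).trans (le_abs_self B)) (wle a n h1) (wt_pos p s n).le
          (abs_nonneg B)
      · exact le_max_of_le_left (not_le.1 h).le
    · obtain ⟨a, b, hab⟩ := key ε hε
      have hpos : 0 < ε / wt p s a / 2 := by have := wt_pos p s a; positivity
      have h2 := (hx.isWF (Real.logb p (ε / wt p s a / 2))).isPWO
      refine h2.mono fun n hn => ?_
      have hn' : ε ≤ ‖x n‖ * wt p s n := hn
      obtain ⟨h3, -⟩ := hab n hn'
      have h4 : ε ≤ ‖x n‖ * wt p s a :=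
        hn'.trans (mul_le_mul_of_nonneg_left (wle a n h3) (norm_nonneg _))
      show (p : ℝ) ^ Real.logb p (ε / wt p s a / 2) < ‖x n‖
      rw [Real.rpow_logb (base_pos p) (one_lt_base p).ne' hpos]
      have h5 : ε / wt p s a ≤ ‖x n‖ := (div_le_iff₀ (wt_pos p s a)).2 h4
      have : 0 < ε / wt p s a := by have := wt_pos p s a; positivity
      linarith
  · rintro ⟨c, hc, hx⟩
    have bd : ∀ s, 0 < s → s ≤ c → ∃ B : ℝ, 0 < B ∧ ∀ n, ‖x n‖ ≤ B * (p : ℝ) ^ (s * (n : ℝ)) := by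
      intro s hs hsc
      obtain ⟨⟨B, hB0, hB⟩, -⟩ := hx s hs hsc
      refine ⟨B, hB0, fun n => ?_⟩
      have h1 := hB n
      have h2 : 0 < (p : ℝ) ^ (s * (n : ℝ)) := Real.rpow_pos_of_pos (base_pos p) _
      have h3 := rpow_mul_wt p s s n
      rw [sub_self, zero_mul, Real.rpow_zero] at h3
      calc ‖x n‖ = ‖x n‖ * wt p s n * (p : ℝ) ^ (s * (n : ℝ)) := by
            rw [mul_assoc, mul_comm (wt p s n), h3, mul_one]
        _ ≤ _ := mul_le_mul_of_nonneg_right h1 h2.le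
    refine ⟨?_, ?_, ?_, ?_⟩
    · intro r
      obtain ⟨B, hB0, hB⟩ := bd c hc le_rfl
      have hpr : 0 < (p : ℝ) ^ r := Real.rpow_pos_of_pos (base_pos p) _
      rw [Set.isWF_iff_no_descending_seq]
      intro f hf hmem
      have h1 := (hx c hc le_rfl).2 ((p : ℝ) ^ r * wt p c (f 0))
        (mul_pos hpr (wt_pos p c _))
      have h2 := h1.isWF
      rw [Set.isWF_iff_no_descending_seq] at h2
      refine h2 f hf fun n => ?_
      have h3 : (p : ℝ) ^ r < ‖x (f n)‖ := hmem n
      have h4 : f n ≤ f 0 := hf.antitone (Nat.zero_le n)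
      show (p : ℝ) ^ r * wt p c (f 0) ≤ ‖x (f n)‖ * wt p c (f n)
      refine mul_le_mul h3.le ?_ (wt_pos p c _).le (norm_nonneg _)
      apply Real.rpow_le_rpow_of_exponent_le (one_lt_base p).le
      have : ((f n : ℚ) : ℝ) ≤ (f 0 : ℚ) := by exact_mod_cast h4
      nlinarith
    · intro j
      obtain ⟨B, hB0, hB⟩ := bd c hc le_rfl
      refine ⟨B * (p : ℝ) ^ (c * (j : ℝ)), fun n hn => (hB n).trans ?_⟩
      refine mul_le_mul_of_nonneg_left ?_ hB0.le
      apply Real.rpow_le_rpow_of_exponent_le (one_lt_base p).le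
      have : (n : ℝ) ≤ j := by exact_mod_cast hn
      nlinarith
    · obtain ⟨B, hB0, hB⟩ := bd c hc le_rfl
      refine ⟨c / 2, by positivity, ?_⟩
      filter_upwards [eventually_rpow_lt_atBot p (show 0 < c / 2 by positivity)
        (show 0 < B⁻¹ by positivity)] with n hn
      refine (hB n).trans_lt ?_
      have h2 : 0 < (p : ℝ) ^ (c / 2 * (n : ℝ)) := Real.rpow_pos_of_pos (base_pos p) _
      have h3 : (p : ℝ) ^ (c * (n : ℝ)) =
          (p : ℝ) ^ (c / 2 * (n : ℝ)) * (p : ℝ) ^ (c / 2 * (n : ℝ)) := by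
        rw [← Real.rpow_add (base_pos p)]
        congr 1
        ring
      rw [h3, ← mul_assoc]
      have h4 : B * (p : ℝ) ^ (c / 2 * (n : ℝ)) < 1 := by
        calc _ < B * B⁻¹ := mul_lt_mul_of_pos_left hn hB0
          _ = 1 := mul_inv_cancel₀ hB0.ne'
      nlinarith
    · intro d hd
      obtain ⟨B, hB0, hB⟩ := bd (min c (d / 2)) (by positivity) (min_le_left _ _)
      filter_upwards [eventually_rpow_lt_atTop p (show min c (d / 2) - d < 0 by
        have := min_le_right c (d / 2); linarith) (show 0 < B⁻¹ by positivity)] with n hn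
      refine (hB n).trans_lt ?_
      have h2 : 0 < (p : ℝ) ^ (d * (n : ℝ)) := Real.rpow_pos_of_pos (base_pos p) _
      have h3 : (p : ℝ) ^ (min c (d / 2) * (n : ℝ)) =
          (p : ℝ) ^ ((min c (d / 2) - d) * (n : ℝ)) * (p : ℝ) ^ (d * (n : ℝ)) := by
        rw [← Real.rpow_add (base_pos p)]
        congr 1
        ring
      rw [h3, ← mul_assoc]
      have h4 : B * (p : ℝ) ^ ((min c (d / 2) - d) * (n : ℝ)) < 1 := by
        calc _ < B * B⁻¹ := mul_lt_mul_of_pos_left hn hB0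
          _ = 1 := mul_inv_cancel₀ hB0.ne'
      nlinarith

end Weighted

section Ring

set_option linter.unusedSectionVars false

variable {p : ℕ} {K : Type*} [NormedField K] [IsUltrametricDist K]

lemma norm_tsum_le_of_forall {ι : Type*} {f : ι → K} {C : ℝ} (hC : 0 ≤ C)
    (h : ∀ i, ‖f i‖ ≤ C) : ‖∑' i, f i‖ ≤ C := by
  by_cases hf : Summable f
  · have h1 : Tendsto (fun s : Finset ι => ‖∑ i ∈ s, f i‖) atTop (𝓝 ‖∑' i, f i‖) :=
      hf.hasSum.norm
    exact le_of_tendsto' h1 fun s =>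
      IsUltrametricDist.norm_sum_le_of_forall_le_of_nonneg hC fun i _ => h i
  · rw [tsum_eq_zero_of_not_summable hf, norm_zero]
    exact hC

lemma summable_of_finite [CompleteSpace K] {ι : Type*} {f : ι → K}
    (h : ∀ ε : ℝ, 0 < ε → {i | ε ≤ ‖f i‖}.Finite) : Summable f := by
  apply NonarchimedeanAddGroup.summable_of_tendsto_cofinite_zero
  rw [Metric.tendsto_nhds]
  intro ε hε
  have := h ε hε
  rw [eventually_cofinite]
  refine this.subset fun i hi => ?_
  have hi' : ¬ dist (f i) 0 < ε := hi
  rw [dist_zero_right, not_lt] at hi'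
  exact hi'

variable [hp : Fact p.Prime]

lemma finite_pairs {S T : Set ℚ} (hS : S.IsPWO) (hT : T.IsPWO) (n : ℚ) :
    {i : ℚ | i ∈ S ∧ n - i ∈ T}.Finite := by
  refine ((Set.AddAntidiagonal.finite_of_isPWO hS hT n).image Prod.fst).subset ?_
  rintro i ⟨h1, h2⟩
  refine ⟨(i, n - i), ?_, rfl⟩
  exact ⟨h1, h2, by ring⟩

/-- A lower bound for a product of two factors bounded by `B` and `C`. -/
lemma le_of_le_mul {a b B C ε : ℝ} (ha : 0 ≤ a) (hb : 0 ≤ b) (hB : 0 < B) (hC : 0 < C)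
    (haB : a ≤ B) (hbC : b ≤ C) (h : ε ≤ a * b) : ε / C ≤ a ∧ ε / B ≤ b := by
  constructor
  · rw [div_le_iff₀ hC]
    exact h.trans (mul_le_mul_of_nonneg_left hbC ha)
  · rw [div_le_iff₀ hB]
    exact h.trans ((mul_le_mul_of_nonneg_right haB hb).trans (mul_comm _ _).le)

lemma norm_mul_wt (s : ℝ) (x y : ℚ → K) (n i : ℚ) :
    ‖x i * y (n - i)‖ * wt p s n =
      (‖x i‖ * wt p s i) * (‖y (n - i)‖ * wt p s (n - i)) := by
  rw [norm_mul, wt_sub p s i n]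
  ring

lemma nn (s : ℝ) (x : ℚ → K) (n : ℚ) : 0 ≤ ‖x n‖ * wt p s n :=
  mul_nonneg (norm_nonneg _) (wt_pos p s n).le

lemma Good.finite_mul {s : ℝ} {x y : ℚ → K} (hx : Good p s x) (hy : Good p s y) (n : ℚ) {ε : ℝ}
    (hε : 0 < ε) : {i : ℚ | ε ≤ ‖x i * y (n - i)‖}.Finite := by
  obtain ⟨⟨B, hB, hxB⟩, hx2⟩ := hx
  obtain ⟨⟨C, hC, hyC⟩, hy2⟩ := hy
  have hw := wt_pos p s n
  refine (finite_pairs (hx2 (ε * wt p s n / C) (by positivity))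
    (hy2 (ε * wt p s n / B) (by positivity)) n).subset fun i hi => ?_
  have h1 : ε * wt p s n ≤ _ := mul_le_mul_of_nonneg_right (show ε ≤ _ from hi) hw.le
  rw [norm_mul_wt] at h1
  exact le_of_le_mul (nn s x i) (nn s y _) hB hC (hxB i) (hyC _) h1

lemma Good.summable [CompleteSpace K] {s : ℝ} {x y : ℚ → K} (hx : Good p s x) (hy : Good p s y)
    (n : ℚ) : Summable fun i => x i * y (n - i) :=
  summable_of_finite fun _ hε => hx.finite_mul hy n hε

lemma Good.finite_mul₃ {s : ℝ} {x y z : ℚ → K} (hx : Good p s x) (hy : Good p s y)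
    (hz : Good p s z) (n : ℚ) {ε : ℝ} (hε : 0 < ε) :
    {q : ℚ × ℚ | ε ≤ ‖x q.1 * y (q.2 - q.1) * z (n - q.2)‖}.Finite := by
  obtain ⟨⟨B, hB, hxB⟩, hx2⟩ := hx
  obtain ⟨⟨C, hC, hyC⟩, hy2⟩ := hy
  obtain ⟨⟨D, hD, hzD⟩, hz2⟩ := hz
  have hw := wt_pos p s n
  have hS := hx2 (ε * wt p s n / D / C) (by positivity)
  have hT := hy2 (ε * wt p s n / D / B) (by positivity)
  have hU := hz2 (ε * wt p s n / (B * C)) (by positivity)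
  refine ((finite_pairs (hS.add hT) hU n).biUnion fun k _ =>
    (finite_pairs hS hT k).image fun i => (i, k)).subset ?_
  rintro ⟨i, k⟩ hq
  have h1 : ε * wt p s n ≤ ‖x i * y (k - i) * z (n - k)‖ * wt p s n :=
    mul_le_mul_of_nonneg_right (show ε ≤ _ from hq) hw.le
  rw [norm_mul, wt_sub p s k n, ← mul_mul_mul_comm, norm_mul_wt] at h1
  rw [← wt_sub] at h1
  have h2 := mul_le_mul (hxB i) (hyC (k - i)) (nn s y _) hB.le
  obtain ⟨h3, h4⟩ := le_of_le_mul (mul_nonneg (nn s x i) (nn s y (k - i))) (nn s z _)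
    (mul_pos hB hC) hD h2 (hzD _) h1
  obtain ⟨h5, h6⟩ := le_of_le_mul (nn s x i) (nn s y _) hB hC (hxB i) (hyC _) h3
  simp only [Set.mem_iUnion, Set.mem_image]
  refine ⟨k, ⟨⟨i, h5, k - i, h6, by ring⟩, h4⟩, i, ⟨h5, h6⟩, rfl⟩

lemma Good.conv {s : ℝ} {x y : ℚ → K} (hx : Good p s x) (hy : Good p s y) :
    Good p s (conv x y) := by
  obtain ⟨⟨B, hB, hxB⟩, hx2⟩ := hx
  obtain ⟨⟨C, hC, hyC⟩, hy2⟩ := hy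
  have key : ∀ (n : ℚ) (M : ℝ), 0 ≤ M →
      (∀ i, (‖x i‖ * wt p s i) * (‖y (n - i)‖ * wt p s (n - i)) ≤ M) →
      ‖GenSeries.conv x y n‖ * wt p s n ≤ M := by
    intro n M hM h
    have hw := wt_pos p s n
    rw [← le_div_iff₀ hw]
    refine norm_tsum_le_of_forall (by positivity) fun i => ?_
    rw [le_div_iff₀ hw, norm_mul_wt]
    exact h i
  refine ⟨⟨B * C, by positivity, fun n => key n _ (by positivity) fun i =>
    mul_le_mul (hxB i) (hyC _) (nn s y _) hB.le⟩, fun ε hε => ?_⟩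
  refine ((hx2 (ε / 2 / C) (by positivity)).add (hy2 (ε / 2 / B) (by positivity))).mono
    fun n hn => ?_
  have hn' : ε ≤ ‖GenSeries.conv x y n‖ * wt p s n := hn
  obtain ⟨i, hi⟩ : ∃ i, ε / 2 ≤ (‖x i‖ * wt p s i) * (‖y (n - i)‖ * wt p s (n - i)) := by
    by_contra! h
    have := key n (ε / 2) (by positivity) fun i => (h i).le
    linarith
  obtain ⟨h1, h2⟩ := le_of_le_mul (nn s x i) (nn s y _) hB hC (hxB i) (hyC _) hi
  exact ⟨i, h1, n - i, h2, by ring⟩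

lemma Good.add {s : ℝ} {x y : ℚ → K} (hx : Good p s x) (hy : Good p s y) :
    Good p s (fun n => x n + y n) := by
  obtain ⟨⟨B, hB, hxB⟩, hx2⟩ := hx
  obtain ⟨⟨C, hC, hyC⟩, hy2⟩ := hy
  have key : ∀ n, ‖x n + y n‖ * wt p s n ≤ max (‖x n‖ * wt p s n) (‖y n‖ * wt p s n) := by
    intro n
    rw [← max_mul_of_nonneg _ _ (wt_pos p s n).le]
    exact mul_le_mul_of_nonneg_right (IsUltrametricDist.norm_add_le_max _ _) (wt_pos p s n).le
  refine ⟨⟨max B C, lt_max_of_lt_left hB, fun n => (key n).trans (max_le_max (hxB n) (hyC n))⟩,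
    fun ε hε => ((hx2 ε hε).union (hy2 ε hε)).mono fun n hn => ?_⟩
  exact le_max_iff.1 ((show ε ≤ _ from hn).trans (key n))

lemma Good.neg {s : ℝ} {x : ℚ → K} (hx : Good p s x) : Good p s (fun n => -x n) := by
  simpa only [Good, norm_neg] using hx

/-- The constant series `a`. -/
def constFun (a : K) (n : ℚ) : K := if n = 0 then a else 0

lemma good_constFun (s : ℝ) (a : K) : Good p s (constFun a) := by
  have h0 : ∀ n : ℚ, n ≠ 0 → ‖constFun a n‖ * wt p s n = 0 := by
    intro n hn
    simp [constFun, hn]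
  refine ⟨⟨‖constFun a 0‖ * wt p s 0 + 1, by have := nn (p := p) s (constFun a) 0; linarith,
    fun n => ?_⟩, fun ε hε => ?_⟩
  · have := nn (p := p) s (constFun a) 0
    by_cases hn : n = 0
    · subst hn
      linarith
    · rw [h0 n hn]
      linarith
  · refine (Set.finite_singleton (0 : ℚ)).isPWO.mono fun n hn => ?_
    by_contra hne
    have h1 : ε ≤ ‖constFun a n‖ * wt p s n := hn
    rw [h0 n hne] at h1
    linarith

lemma conv_comm (x y : ℚ → K) : conv x y = conv y x := by
  funext n
  unfold conv
  rw [← (Equiv.subLeft n).tsum_eq]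
  refine tsum_congr fun i => ?_
  simp [mul_comm]

lemma const_conv (a : K) (x : ℚ → K) (n : ℚ) : conv (constFun a) x n = a * x n := by
  unfold conv
  rw [tsum_eq_single 0]
  · simp [constFun]
  · intro i hi
    simp [constFun, hi]

lemma conv_add [CompleteSpace K] {s : ℝ} {x y z : ℚ → K} (hx : Good p s x) (hy : Good p s y)
    (hz : Good p s z) : conv x (fun n => y n + z n) = fun n => conv x y n + conv x z n := by
  funext n
  unfold conv
  rw [← (hx.summable hy n).tsum_add (hx.summable hz n)]
  exact tsum_congr fun i => mul_add _ _ _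

lemma conv_assoc [CompleteSpace K] {s : ℝ} {x y z : ℚ → K} (hx : Good p s x) (hy : Good p s y)
    (hz : Good p s z) : conv (conv x y) z = conv x (conv y z) := by
  funext n
  have h : Summable (Function.uncurry fun i k : ℚ => x i * y (k - i) * z (n - k)) :=
    summable_of_finite fun ε hε => hx.finite_mul₃ hy hz n hε
  have h1 := h.tsum_comm
  have h2 : conv (conv x y) z n = ∑' k : ℚ, ∑' i : ℚ, x i * y (k - i) * z (n - k) := by
    unfold conv
    exact tsum_congr fun k => tsum_mul_right.symm
  have h3 : conv x (conv y z) n = ∑' i : ℚ, ∑' k : ℚ, x i * y (k - i) * z (n - k) := by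
    unfold conv
    refine tsum_congr fun i => ?_
    rw [← tsum_mul_left, ← (Equiv.addRight (-i)).tsum_eq]
    refine tsum_congr fun k => ?_
    simp only [Equiv.coe_addRight]
    rw [mul_assoc]
    congr 3
    · ring_nf
    · ring_nf
  rw [h2, h3, h1]

end Ring

variable (p : ℕ) (K : Type*) [NormedField K]

/-- The ring `Γ^imm_{an,con}` of generalized power series `∑_{n ∈ ℚ} x_n t ^ n` with
coefficients in the field `K`, where `|p| = 1 / p`. -/
@[ext]
structure GammaImmAnCon where
  /-- the coefficients of the series -/
  coeff : ℚ → K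
  /-- the convergence conditions -/
  isImmAnCon : IsImmAnCon p coeff

namespace GammaImmAnCon

variable {p K}
variable [hp : Fact p.Prime]

lemma exists_good (x : GammaImmAnCon p K) :
    ∃ c : ℝ, 0 < c ∧ ∀ s, 0 < s → s ≤ c → Good p s x.coeff := isImmAnCon_iff.1 x.isImmAnCon

lemma exists_good₂ (x y : GammaImmAnCon p K) :
    ∃ c : ℝ, 0 < c ∧ ∀ s, 0 < s → s ≤ c → Good p s x.coeff ∧ Good p s y.coeff := by
  obtain ⟨c, hc, hx⟩ := x.exists_good
  obtain ⟨d, hd, hy⟩ := y.exists_good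
  exact ⟨min c d, lt_min hc hd, fun s hs h =>
    ⟨hx s hs (h.trans (min_le_left _ _)), hy s hs (h.trans (min_le_right _ _))⟩⟩

lemma exists_good₃ (x y z : GammaImmAnCon p K) :
    ∃ s : ℝ, Good p s x.coeff ∧ Good p s y.coeff ∧ Good p s z.coeff := by
  obtain ⟨c, hc, hxy⟩ := exists_good₂ x y
  obtain ⟨d, hd, hz⟩ := z.exists_good
  have h := hxy (min c d) (lt_min hc hd) (min_le_left _ _)
  exact ⟨min c d, h.1, h.2, hz _ (lt_min hc hd) (min_le_right _ _)⟩

variable [IsUltrametricDist K]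

/-- The constant series. -/
def const (a : K) : GammaImmAnCon p K :=
  ⟨constFun a, isImmAnCon_iff.2 ⟨1, one_pos, fun s _ _ => good_constFun s a⟩⟩

set_option linter.unusedSectionVars false

instance : Zero (GammaImmAnCon p K) := ⟨const 0⟩

instance : One (GammaImmAnCon p K) := ⟨const 1⟩

instance : Add (GammaImmAnCon p K) :=
  ⟨fun x y => ⟨fun n => x.coeff n + y.coeff n, by
    obtain ⟨c, hc, h⟩ := exists_good₂ x y
    exact isImmAnCon_iff.2 ⟨c, hc, fun s hs hsc => (h s hs hsc).1.add (h s hs hsc).2⟩⟩⟩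

instance : Neg (GammaImmAnCon p K) :=
  ⟨fun x => ⟨fun n => -x.coeff n, by
    obtain ⟨c, hc, h⟩ := x.exists_good
    exact isImmAnCon_iff.2 ⟨c, hc, fun s hs hsc => (h s hs hsc).neg⟩⟩⟩

instance : Mul (GammaImmAnCon p K) :=
  ⟨fun x y => ⟨conv x.coeff y.coeff, by
    obtain ⟨c, hc, h⟩ := exists_good₂ x y
    exact isImmAnCon_iff.2 ⟨c, hc, fun s hs hsc => (h s hs hsc).1.conv (h s hs hsc).2⟩⟩⟩

@[simp] lemma coeff_zero (n : ℚ) : (0 : GammaImmAnCon p K).coeff n = 0 := by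
  show constFun (0 : K) n = 0
  simp [constFun]

@[simp] lemma coeff_add (x y : GammaImmAnCon p K) (n : ℚ) :
    (x + y).coeff n = x.coeff n + y.coeff n := rfl

@[simp] lemma coeff_neg (x : GammaImmAnCon p K) (n : ℚ) : (-x).coeff n = -x.coeff n := rfl

lemma coeff_mul (x y : GammaImmAnCon p K) (n : ℚ) :
    (x * y).coeff n = ∑' i : ℚ, x.coeff i * y.coeff (n - i) := rfl

lemma coeff_const (a : K) (n : ℚ) :
    (const a : GammaImmAnCon p K).coeff n = if n = 0 then a else 0 := rfl

lemma coeff_const_mul (a : K) (x : GammaImmAnCon p K) (n : ℚ) :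
    (const a * x).coeff n = a * x.coeff n := const_conv a x.coeff n

variable [CompleteSpace K]

instance : CommRing (GammaImmAnCon p K) := by
  have hmc : ∀ x y : GammaImmAnCon p K, x * y = y * x := fun x y =>
    GammaImmAnCon.ext (conv_comm _ _)
  have hom : ∀ x : GammaImmAnCon p K, 1 * x = x := fun x => by
    ext n
    exact (const_conv (1 : K) x.coeff n).trans (one_mul _)
  have hzm : ∀ x : GammaImmAnCon p K, 0 * x = 0 := fun x => by
    ext n
    rw [coeff_zero]
    exact (const_conv (0 : K) x.coeff n).trans (zero_mul _)
  have hld : ∀ x y z : GammaImmAnCon p K, x * (y + z) = x * y + x * z := fun x y z => by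
    obtain ⟨s, hx, hy, hz⟩ := exists_good₃ x y z
    exact GammaImmAnCon.ext (conv_add hx hy hz)
  exact
    { add_assoc := fun x y z => by ext n; simp [add_assoc]
      zero_add := fun x => by ext n; simp
      add_zero := fun x => by ext n; simp
      add_comm := fun x y => by ext n; simp [add_comm]
      neg_add_cancel := fun x => by ext n; simp
      nsmul := nsmulRec
      zsmul := zsmulRec
      left_distrib := hld
      right_distrib := fun x y z => by rw [hmc, hld, hmc z x, hmc z y]
      zero_mul := hzm
      mul_zero := fun x => by rw [hmc, hzm]
      mul_assoc := fun x y z => by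
        obtain ⟨s, hx, hy, hz⟩ := exists_good₃ x y z
        exact GammaImmAnCon.ext (conv_assoc hx hy hz)
      one_mul := hom
      mul_one := fun x => by rw [hmc, hom]
      mul_comm := hmc }

@[simp] lemma coeff_sub (x y : GammaImmAnCon p K) (n : ℚ) :
    (x - y).coeff n = x.coeff n - y.coeff n := by
  rw [sub_eq_add_neg, coeff_add, coeff_neg, sub_eq_add_neg]

/-- The constant series form a subfield. -/
def constHom : K →+* GammaImmAnCon p K where
  toFun := const
  map_zero' := rfl
  map_one' := rfl
  map_add' a b := by
    ext n
    simp only [coeff_add, coeff_const]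
    split_ifs <;> simp
  map_mul' a b := by
    ext n
    rw [coeff_const_mul, coeff_const, coeff_const]
    split_ifs <;> simp

lemma coeff_constHom (a : K) (n : ℚ) :
    (constHom a : GammaImmAnCon p K).coeff n = if n = 0 then a else 0 := rfl

lemma coeff_constHom_mul (a : K) (x : GammaImmAnCon p K) (n : ℚ) :
    (constHom a * x).coeff n = a * x.coeff n := coeff_const_mul a x n

/-- The Frobenius `∑ x_n t ^ n ↦ ∑ τ(x_n) t ^ (p n)` attached to an isometric automorphism `τ` of
the coefficient field. -/
def frob (τ : K ≃+* K) (hτ : ∀ a, ‖τ a‖ = ‖a‖) : GammaImmAnCon p K →+* GammaImmAnCon p K where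
  toFun x := ⟨fun n => τ (x.coeff (n / p)), by
    have hp0 := base_pos p
    have hpq : (0 : ℚ) < p := by exact_mod_cast hp.out.pos
    obtain ⟨c, hc, h⟩ := x.exists_good
    refine isImmAnCon_iff.2 ⟨c / p, by positivity, fun s hs hsc => ?_⟩
    obtain ⟨⟨B, hB, h1⟩, h2⟩ := h (s * p) (by positivity) ((le_div_iff₀ hp0).1 hsc)
    have key : ∀ n : ℚ, ‖τ (x.coeff (n / p))‖ * wt p s n =
        ‖x.coeff (n / p)‖ * wt p (s * p) (n / p) := by
      intro n
      rw [hτ]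
      unfold wt
      congr 3
      push_cast
      field_simp
    refine ⟨⟨B, hB, fun n => (key n).trans_le (h1 _)⟩, fun ε hε => ?_⟩
    refine ((h2 ε hε).image_of_monotone (f := fun n : ℚ => n * p)
      (fun a b hab => mul_le_mul_of_nonneg_right hab hpq.le)).mono fun n hn => ?_
    refine ⟨n / p, ?_, by field_simp⟩
    have hn' : ε ≤ ‖τ (x.coeff (n / p))‖ * wt p s n := hn
    rw [key] at hn'
    exact hn'⟩
  map_zero' := by
    ext n
    simp
  map_one' := by
    have hpq : (p : ℚ) ≠ 0 := by exact_mod_cast hp.out.ne_zero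
    ext n
    show τ (constFun (1 : K) (n / p)) = constFun (1 : K) n
    unfold constFun
    by_cases h : n = 0 <;> simp [h, hpq]
  map_add' x y := by
    ext n
    simp
  map_mul' x y := by
    have hpq : (p : ℚ) ≠ 0 := by exact_mod_cast hp.out.ne_zero
    ext n
    show τ (∑' i : ℚ, x.coeff i * y.coeff (n / p - i)) =
      ∑' i : ℚ, τ (x.coeff (i / p)) * τ (y.coeff ((n - i) / p))
    obtain ⟨c, hc, h⟩ := exists_good₂ x y
    have hs := (h c hc le_rfl).1.summable (h c hc le_rfl).2 (n / p)
    have hcont : Continuous τ :=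
      AddMonoidHomClass.continuous_of_bound τ 1 fun a => by rw [hτ, one_mul]
    rw [hs.map_tsum τ hcont, ← (Equiv.divRight₀ (p : ℚ) hpq).tsum_eq]
    refine tsum_congr fun i => ?_
    simp only [Equiv.divRight₀_apply, map_mul]
    rw [sub_div]

end GammaImmAnCon

section Coefficients

variable (p : ℕ) (O K : Type*) [CommRing O] [NormedField K] [Algebra O K]

/-- The absolute value of `K` is the one with valuation ring `O`, normalized by `|p| = 1 / p`. -/
class IsNormalizedAbs : Prop where
  norm_le_one_iff : ∀ x : K, ‖x‖ ≤ 1 ↔ ∃ a : O, algebraMap O K a = x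
  norm_p : ‖(p : K)‖ = (p : ℝ)⁻¹

variable {O}

section Norm

lemma norm_algebraMap_le_one {p : ℕ} (hN : IsNormalizedAbs p O K) (a : O) : ‖algebraMap O K a‖ ≤ 1 :=
  (hN.norm_le_one_iff _).2 ⟨a, rfl⟩

lemma norm_unit {p : ℕ} (hN : IsNormalizedAbs p O K) (u : Oˣ) : ‖algebraMap O K u‖ = 1 := by
  refine le_antisymm (norm_algebraMap_le_one K hN _) ?_
  have h1 := norm_algebraMap_le_one K hN ((u⁻¹ : Oˣ) : O)
  have h2 : ‖algebraMap O K u‖ * ‖algebraMap O K ((u⁻¹ : Oˣ) : O)‖ = 1 := by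
    rw [← norm_mul, ← map_mul, Units.mul_inv, map_one, norm_one]
  nlinarith [norm_nonneg (algebraMap O K u)]

/-- An automorphism of `O` induces an isometry of its fraction field. -/
lemma norm_ringEquiv {p : ℕ} [IsDomain O] [IsDiscreteValuationRing O] [IsFractionRing O K]
    (hN : IsNormalizedAbs p O K) (σ : O ≃+* O) (x : K) :
    ‖IsFractionRing.ringEquivOfRingEquiv (K := K) (L := K) σ x‖ = ‖x‖ := by
  have key : ∀ a : O, ‖algebraMap O K (σ a)‖ = ‖algebraMap O K a‖ := by
    intro a
    by_cases ha : a = 0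
    · simp [ha]
    obtain ⟨π, hπ⟩ := IsDiscreteValuationRing.exists_irreducible O
    have hπ' : Irreducible (σ π) := (MulEquiv.irreducible_iff σ).2 hπ
    obtain ⟨v, hv⟩ := IsDiscreteValuationRing.associated_of_irreducible O hπ hπ'
    obtain ⟨n, u, rfl⟩ := IsDiscreteValuationRing.eq_unit_mul_pow_irreducible ha hπ
    have h1 : ‖algebraMap O K (σ u)‖ = 1 := norm_unit K hN (Units.map σ.toMonoidHom u)
    simp only [map_mul, map_pow, norm_mul, norm_pow, h1, norm_unit K hN u, ← hv,
      norm_unit K hN v, mul_one]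
  obtain ⟨a, b, hb, rfl⟩ := IsFractionRing.div_surjective (A := O) x
  simp only [map_div₀, norm_div, IsFractionRing.ringEquivOfRingEquiv_algebraMap, key]

end Norm

variable {K}
variable {p}
variable [hp : Fact p.Prime] [IsUltrametricDist K] [CompleteSpace K]

variable (p K) in
/-- The ring `Γ^imm_con`: the series in `Γ^imm_{an,con}` with coefficients in `O`, which is the
closed unit disc of `K`. -/
def GammaImmCon : Subring (GammaImmAnCon p K) where
  carrier := {x | ∀ n, ‖x.coeff n‖ ≤ 1}
  zero_mem' n := by simp
  one_mem' n := by
    show ‖constFun (1 : K) n‖ ≤ 1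
    unfold constFun
    split_ifs <;> simp
  add_mem' {x y} hx hy n :=
    (IsUltrametricDist.norm_add_le_max _ _).trans (max_le (hx n) (hy n))
  neg_mem' {x} hx n := by simpa using hx n
  mul_mem' {x y} hx hy n := by
    refine norm_tsum_le_of_forall zero_le_one fun i => ?_
    rw [norm_mul]
    exact mul_le_one₀ (hx i) (norm_nonneg _) (hy _)

/-- The Hahn series `h` over the residue field of `O` is the reduction of the series `x`. -/
def IsReduction [IsLocalRing O] (x : GammaImmAnCon p K)
    (h : HahnSeries ℚ (IsLocalRing.ResidueField O)) : Prop :=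
  ∀ n, ∃ a : O, algebraMap O K a = x.coeff n ∧ IsLocalRing.residue O a = h.coeff n

/-- The inclusion of the field `k((t))` of Laurent series into the field of generalized power
series `∑_{n ∈ ℚ} x_n t ^ n` with well-ordered support. -/
def laurentToHahn (k : Type*) [Field k] : LaurentSeries k →+* HahnSeries ℚ k :=
  HahnSeries.embDomainRingHom (Int.castAddHom ℚ) Int.cast_injective
    fun _ _ => Int.cast_le

/-- `h` lies in the algebraic closure `K^alg` of `k((t))` inside the field of generalized power
series over `k`. -/
def IsAlgOverLaurent {k : Type*} [Field k] (h : HahnSeries ℚ k) : Prop :=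
  ∃ f : Polynomial (LaurentSeries k), f ≠ 0 ∧ f.eval₂ (laurentToHahn k) h = 0

variable [IsDomain O] [IsDiscreteValuationRing O] [IsFractionRing O K]
  [hN : IsNormalizedAbs p O K]

set_option linter.unusedSectionVars false

variable (p K) in
/-- The Frobenius `∑ x_n t ^ n ↦ ∑ σ(x_n) t ^ (p n)` on `Γ^imm_{an,con}`. -/
def frobImm (σ : O ≃+* O) : GammaImmAnCon p K →+* GammaImmAnCon p K :=
  GammaImmAnCon.frob (IsFractionRing.ringEquivOfRingEquiv σ) (norm_ringEquiv K hN σ)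

lemma coeff_frobImm (σ : O ≃+* O) (x : GammaImmAnCon p K) (n : ℚ) :
    (frobImm p K σ x).coeff n =
      IsFractionRing.ringEquivOfRingEquiv (K := K) (L := K) σ (x.coeff (n / p)) := rfl

lemma norm_coeff_frobImm (σ : O ≃+* O) (x : GammaImmAnCon p K) (n : ℚ) :
    ‖(frobImm p K σ x).coeff n‖ = ‖x.coeff (n / p)‖ := by
  rw [coeff_frobImm, norm_ringEquiv K hN]

lemma frobImm_constHom (σ : O ≃+* O) (a : O) :
    frobImm p K σ (GammaImmAnCon.constHom (algebraMap O K a)) =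
      GammaImmAnCon.constHom (algebraMap O K (σ a)) := by
  have hpq : (p : ℚ) ≠ 0 := by exact_mod_cast hp.out.ne_zero
  ext n
  rw [coeff_frobImm, GammaImmAnCon.coeff_constHom, GammaImmAnCon.coeff_constHom]
  by_cases h : n = 0 <;> simp [h, hpq]

variable (p K) in
/-- The Teichmüller lifts of the elements of `K^alg`: the series `x` over `O` with `x ^ σ = x ^ p`
whose reduction is algebraic over `k((t))`. All of them satisfy the convergence condition in
`Γ^imm_con`, since a series over `k` has support bounded below. -/
def teichmullerAlg (σ : O ≃+* O) : Set (GammaImmAnCon p K) :=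
  {x | frobImm p K σ x = x ^ p ∧
    ∃ h : HahnSeries ℚ (IsLocalRing.ResidueField O), IsReduction x h ∧ IsAlgOverLaurent h}

variable (p K) in
/-- The subring generated by the constants in `O` and the Teichmüller lifts of the elements of
`K^alg`. -/
def teichSubring (σ : O ≃+* O) : Subring (GammaImmAnCon p K) :=
  Subring.closure (Set.range (fun a : O => GammaImmAnCon.constHom (algebraMap O K a)) ∪
    teichmullerAlg p K σ)

lemma const_mem_teichSubring (σ : O ≃+* O) (a : O) :
    GammaImmAnCon.constHom (algebraMap O K a) ∈ teichSubring p K σ :=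
  Subring.subset_closure (Or.inl ⟨a, rfl⟩)

lemma constHom_mem_immCon (a : O) :
    (GammaImmAnCon.constHom (algebraMap O K a) : GammaImmAnCon p K) ∈ GammaImmCon p K := by
  intro n
  rw [GammaImmAnCon.coeff_constHom]
  split_ifs
  · exact norm_algebraMap_le_one K hN a
  · simp

lemma teichSubring_le (σ : O ≃+* O) : teichSubring p K σ ≤ GammaImmCon p K := by
  refine Subring.closure_le.2 ?_
  rintro x (⟨a, rfl⟩ | ⟨-, h, hh, -⟩)
  · exact constHom_mem_immCon a
  · intro n
    obtain ⟨a, ha, -⟩ := hh n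
    rw [← ha]
    exact norm_algebraMap_le_one K hN a

lemma frobImm_mem_teichSubring (σ : O ≃+* O) {x : GammaImmAnCon p K}
    (hx : x ∈ teichSubring p K σ) : frobImm p K σ x ∈ teichSubring p K σ := by
  suffices h : teichSubring p K σ ≤ (teichSubring p K σ).comap (frobImm p K σ) from h hx
  refine Subring.closure_le.2 ?_
  rintro x (⟨a, rfl⟩ | hx)
  · show frobImm p K σ (GammaImmAnCon.constHom (algebraMap O K a)) ∈ teichSubring p K σ
    rw [frobImm_constHom]
    exact const_mem_teichSubring σ (σ a)
  · show frobImm p K σ x ∈ teichSubring p K σ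
    have h : x ∈ teichSubring p K σ := Subring.subset_closure (Or.inr hx)
    rw [hx.1]
    exact (teichSubring p K σ).pow_mem h p

lemma norm_coeff_mul_le {x y : GammaImmAnCon p K} {C : ℝ} (hC : 0 ≤ C)
    (hx : ∀ n, ‖x.coeff n‖ ≤ C) (hy : y ∈ GammaImmCon p K) (n : ℚ) : ‖(x * y).coeff n‖ ≤ C := by
  refine norm_tsum_le_of_forall hC fun i => ?_
  rw [norm_mul]
  exact (mul_le_of_le_one_right (norm_nonneg _) (hy _)).trans (hx i)

variable (p K) in
/-- The ring `Γ^alg_con = Γ^alg ∩ Γ^imm_con`. Here `Γ^alg`, the `p`-adically complete extension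
of `Γ` with residue field `K^alg`, is the ring of Witt vectors `W(K^alg) ⊗_{W(k)} O`, that is, the
`p`-adic closure of the subring generated by `O` and the Teichmüller lifts from `K^alg`. -/
def GammaAlgCon (σ : O ≃+* O) : Subring (GammaImmAnCon p K) where
  carrier := {x | x ∈ GammaImmCon p K ∧
    ∀ N : ℕ, ∃ y ∈ teichSubring p K σ, ∀ n, ‖(x - y).coeff n‖ ≤ ‖(p : K)‖ ^ N}
  zero_mem' := ⟨zero_mem _, fun N => ⟨0, zero_mem _, fun n => by simp⟩⟩
  one_mem' := ⟨one_mem _, fun N => ⟨1, one_mem _, fun n => by simp⟩⟩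
  add_mem' {x y} hx hy := ⟨add_mem hx.1 hy.1, fun N => by
    obtain ⟨a, ha, hxa⟩ := hx.2 N
    obtain ⟨b, hb, hyb⟩ := hy.2 N
    refine ⟨a + b, add_mem ha hb, fun n => ?_⟩
    rw [add_sub_add_comm]
    exact (IsUltrametricDist.norm_add_le_max _ _).trans (max_le (hxa n) (hyb n))⟩
  neg_mem' {x} hx := ⟨neg_mem hx.1, fun N => by
    obtain ⟨a, ha, hxa⟩ := hx.2 N
    refine ⟨-a, neg_mem ha, fun n => ?_⟩
    rw [neg_sub_neg, ← neg_sub, GammaImmAnCon.coeff_neg, norm_neg]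
    exact hxa n⟩
  mul_mem' {x y} hx hy := ⟨mul_mem hx.1 hy.1, fun N => by
    obtain ⟨a, ha, hxa⟩ := hx.2 N
    obtain ⟨b, hb, hyb⟩ := hy.2 N
    refine ⟨a * b, mul_mem ha hb, fun n => ?_⟩
    have h : x * y - a * b = (x - a) * y + (y - b) * a := by ring
    rw [h]
    exact (IsUltrametricDist.norm_add_le_max _ _).trans
      (max_le (norm_coeff_mul_le (by positivity) hxa hy.1 n)
        (norm_coeff_mul_le (by positivity) hyb (teichSubring_le σ ha) n))⟩

lemma frobImm_mem_algCon (σ : O ≃+* O) {x : GammaImmAnCon p K}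
    (hx : x ∈ GammaAlgCon p K σ) : frobImm p K σ x ∈ GammaAlgCon p K σ := by
  refine ⟨fun n => ?_, fun N => ?_⟩
  · rw [norm_coeff_frobImm]
    exact hx.1 _
  · obtain ⟨y, hy, h⟩ := hx.2 N
    refine ⟨_, frobImm_mem_teichSubring σ hy, fun n => ?_⟩
    rw [← map_sub, norm_coeff_frobImm]
    exact h _

lemma const_mem_algCon (σ : O ≃+* O) (a : O) :
    GammaImmAnCon.constHom (algebraMap O K a) ∈ GammaAlgCon p K σ :=
  ⟨constHom_mem_immCon a, fun N => ⟨_, const_mem_teichSubring σ a, fun n => by simp⟩⟩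

variable (p K) in
/-- The set underlying `Γ^alg_con[1/p]`. -/
def algConInvP (σ : O ≃+* O) : Set (GammaImmAnCon p K) :=
  {x | ∃ N : ℕ, (p : GammaImmAnCon p K) ^ N * x ∈ GammaAlgCon p K σ}

variable (p K) in
/-- The series `x` all of whose truncations `∑_{i < j} x_i t ^ i` lie in `Γ^alg_con[1/p]`. -/
def truncAlg (σ : O ≃+* O) : Set (GammaImmAnCon p K) :=
  {x | ∀ j : ℚ, ∃ y ∈ algConInvP p K σ, ∀ i, y.coeff i = if i < j then x.coeff i else 0}

variable (p K) in
/-- The ring `Γ^alg_{an,con}` of the series in `Γ^imm_{an,con}` all of whose truncations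
`∑_{i < j} x_i t ^ i` lie in `Γ^alg_con[1/p]`. (These series form a subring; passing to the subring
that they generate makes this part of the definition.) -/
def GammaAlgAnCon (σ : O ≃+* O) : Subring (GammaImmAnCon p K) :=
  Subring.closure (truncAlg p K σ)

lemma frobImm_mem_truncAlg (σ : O ≃+* O) {x : GammaImmAnCon p K}
    (hx : x ∈ truncAlg p K σ) : frobImm p K σ x ∈ truncAlg p K σ := by
  have hpq : (0 : ℚ) < p := by exact_mod_cast hp.out.pos
  intro j
  obtain ⟨y, ⟨N, hN⟩, hy⟩ := hx (j / p)
  refine ⟨frobImm p K σ y, ⟨N, ?_⟩, fun i => ?_⟩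
  · have h := frobImm_mem_algCon σ hN
    rwa [map_mul, map_pow, map_natCast] at h
  · rw [coeff_frobImm, coeff_frobImm, hy, apply_ite (IsFractionRing.ringEquivOfRingEquiv σ), map_zero]
    simp only [div_lt_div_iff_of_pos_right hpq]

lemma frobImm_mem_algAnCon (σ : O ≃+* O) {x : GammaImmAnCon p K}
    (hx : x ∈ GammaAlgAnCon p K σ) : frobImm p K σ x ∈ GammaAlgAnCon p K σ := by
  suffices h : GammaAlgAnCon p K σ ≤ (GammaAlgAnCon p K σ).comap (frobImm p K σ) from h hx
  exact Subring.closure_le.2 fun x hx => Subring.subset_closure (frobImm_mem_truncAlg σ hx)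

lemma const_mem_algAnCon (σ : O ≃+* O) (a : O) :
    GammaImmAnCon.constHom (algebraMap O K a) ∈ GammaAlgAnCon p K σ := by
  refine Subring.subset_closure fun j => ?_
  by_cases hj : 0 < j
  · refine ⟨_, ⟨0, by simpa using const_mem_algCon σ a⟩, fun i => ?_⟩
    rw [GammaImmAnCon.coeff_constHom]
    by_cases hi : i = 0
    · simp [hi, hj]
    · simp [hi]
  · refine ⟨0, ⟨0, by simp⟩, fun i => ?_⟩
    rw [GammaImmAnCon.coeff_constHom, GammaImmAnCon.coeff_zero]
    by_cases hi : i = 0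
    · simp [hi, hj]
    · simp [hi]

/-- The two decorations of the analytic rings. -/
inductive Decoration
  | alg
  | imm

variable (p K) in
/-- The ring `Γ^*_{an,con}` for `* = alg` or `* = imm`. -/
def analyticRing (σ : O ≃+* O) : Decoration → Subring (GammaImmAnCon p K)
  | .alg => GammaAlgAnCon p K σ
  | .imm => ⊤

variable (p K) in
/-- The Frobenius on `Γ^*_{an,con}`. -/
def frobenius (σ : O ≃+* O) (d : Decoration) :
    analyticRing p K σ d →+* analyticRing p K σ d :=
  RingHom.restrict (frobImm p K σ) _ _ (by
    cases d with
    | alg => exact fun x hx => frobImm_mem_algAnCon σ hx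
    | imm => exact fun x _ => Subring.mem_top _)

variable (p K) in
/-- The structure map from `O` to `Γ^*_{an,con}`, sending `a` to the constant series `a`. -/
def ofO (σ : O ≃+* O) (d : Decoration) : O →+* analyticRing p K σ d :=
  (GammaImmAnCon.constHom.comp (algebraMap O K)).codRestrict _ (by
    cases d with
    | alg => exact fun a => const_mem_algAnCon σ a
    | imm => exact fun a => Subring.mem_top _)

end Coefficients

/-- `(M, F)` is an `F`-crystal over the ring `R` with Frobenius `φ`: a finite free `R`-module with a
`φ`-semilinear map `F` whose linearization becomes an isomorphism after inverting `p`. (Between free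
modules of the same finite rank over `R[1/p]`, this amounts to surjectivity.) -/
structure IsFCrystal (p : ℕ) {R M : Type*} [CommRing R] [AddCommGroup M] [Module R M]
    (φ : R →+* R) (F : M →ₛₗ[φ] M) : Prop where
  free : Module.Free R M
  finite : Module.Finite R M
  isogeny : ∃ m : ℕ, ∀ x : M, (p : R) ^ m • x ∈ Submodule.span R (Set.range F)

end

end GenSeries

/-! Write φ for the Frobenius, q = p^n, and [h] for the Teichmüller lift of a series h over the
residue field.

Reduction to one equation. A vector d w + Σ β_i v_i is an eigenvector for λ once φ(d) = λd and the
β_i solve a cyclic system of semilinear equations. Eliminating all but one β leaves e - λφ^n(e) =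
dC, with C in R built from the c_i (`exists_eigenvector`). So it is enough to find, for each C, a
nonzero d with φ(d) = λd such that dC is a coboundary for 1 - λφ^n
(`exists_eigen_mul_eq_coboundary`).

Coboundaries. Multiplication by q acts on the negative exponents with fundamental domain [-qr, -r).
Geometric series, run forwards to the right of -r and backwards to the left of it, replace f modulo
the image of 1 - μφ^n by a series supported in that domain, whose coefficients are the orbit sums
Σ_j μ^j σ^{nj}(f_{m/q^j}) (`exists_coboundary`). Hence f is a coboundary if its orbit sums vanish on
one fundamental domain. With μ = λ^{n+1} this moves C into [-q, -1): since φ^n(d) = λ^n d,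
multiplication by d turns coboundaries for 1 - λ^{n+1}φ^n into coboundaries for 1 - λφ^n. After
scaling, C becomes an integral series x.

Eigenvectors. For u of positive valuation, δ(u) = Σ_i λ^{-i}φ^i[u] converges and is an eigenvector.
Expand x = Σ λ^l [c_l]. The j-th orbit term of δ(u) λ^l [c_l] is a coefficient of
δ(u^{p^{(n+1)j+l}}) [c_l^{q^j}], because λδ(u) = δ(u^p). So modulo λ the orbit sums of δ(u)x are the
coefficients of the additive polynomial P(u) = Σ c_l^{q^j} u^{p^{(n+1)j+l}}, where only finitely
many (j, l) matter. Let γ be the abscissa of a breakpoint of the Newton polygon of P: two monomials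
share the least valuation -r < 0 (`Hahn.exists_break_digit`). There P has a zero u of valuation
exactly γ, and it represents every t of valuation at least -r by some u of valuation at least γ
(`Hahn.exists_digitPoly_solutions`). Replacing δ(v) by [v] costs, modulo λ, only exponents from
p·val(v) on; for the term (j, l) this gives 1/q times the valuation of the term (j+1, l), so at
least -r/q, outside the domain [-r, -r/q) (`exists_norm_orbitSum_sub_le`). Starting from the zero of
P and adding corrections λ^k δ(w_k), the orbit sums become divisible by ever higher powers of λ. In
the limit they vanish, and d = Σ λ^k δ(w_k) is nonzero because its coefficient at γ is a unit
(`exists_mul_eq_coboundary`).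

Both rings at once. The argument needs a perfect ring L of series over the residue field that
contains monomials and is closed under truncation and under solving additive equations; R is then
recovered from L by Teichmüller expansions (`exists_ringL`). For the immediate ring L is everything.
For the algebraic ring L consists of the series all of whose truncations are algebraic over k((t)).
That it is a ring is `Hahn.IsAlgTrunc.mul`, that it contains the solutions of additive equations is
`Hahn.IsAlgTrunc.of_addPoly`; solutions exist in the full field by a maximality argument
(`Hahn.exists_addPoly_eq`). -/

namespace GenSeries

noncomputable section

namespace Hahn

open HahnSeries

/-! ### Truncations and supports of generalized power series. -/

section General

variable {k : Type*} [Field k]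

lemma coeff_truncLT_ite (j i : ℚ) (h : HahnSeries ℚ k) :
    (truncLT j h).coeff i = if i < j then h.coeff i else 0 := by
  split_ifs with hi
  · exact coeff_truncLT_of_lt hi h
  · exact coeff_truncLT_of_le (not_lt.1 hi) h

lemma truncLT_add (j : ℚ) (x y : HahnSeries ℚ k) :
    truncLT j (x + y) = truncLT j x + truncLT j y := by
  ext i
  simp only [coeff_truncLT_ite, coeff_add]
  split_ifs <;> simp

lemma truncLT_neg (j : ℚ) (x : HahnSeries ℚ k) : truncLT j (-x) = -truncLT j x := by
  ext i
  simp only [coeff_truncLT_ite, coeff_neg]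
  split_ifs <;> simp

lemma truncLT_truncLT (i j : ℚ) (x : HahnSeries ℚ k) :
    truncLT i (truncLT j x) = truncLT (min i j) x := by
  ext l
  simp only [coeff_truncLT_ite, lt_min_iff]
  by_cases h1 : l < i <;> by_cases h2 : l < j <;> simp [h1, h2]

lemma coeff_sum' {ι : Type*} (s : Finset ι) (f : ι → HahnSeries ℚ k) (i : ℚ) :
    (∑ a ∈ s, f a).coeff i = ∑ a ∈ s, (f a).coeff i := by
  classical
  induction s using Finset.induction_on with
  | empty => simp
  | insert a s ha ih => rw [Finset.sum_insert ha, Finset.sum_insert ha, coeff_add, ih]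

lemma exists_of_coeff_mul_ne_zero {x y : HahnSeries ℚ k} {n : ℚ} (h : (x * y).coeff n ≠ 0) :
    ∃ i j, x.coeff i ≠ 0 ∧ y.coeff j ≠ 0 ∧ i + j = n := by
  obtain ⟨i, hi, j, hj, hij⟩ := support_mul_subset (x := x) (y := y) h
  exact ⟨i, j, hi, hj, hij⟩

lemma truncLT_eq_zero {j : ℚ} {x : HahnSeries ℚ k} (h : ∀ i, x.coeff i ≠ 0 → j ≤ i) :
    truncLT j x = 0 := by
  ext i
  rw [coeff_truncLT_ite, coeff_zero]
  split_ifs with hi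
  · by_contra hne
    exact absurd (h i hne) (not_le.2 hi)
  · rfl

lemma truncLT_eq_self {j : ℚ} {x : HahnSeries ℚ k} (h : ∀ i, x.coeff i ≠ 0 → i < j) :
    truncLT j x = x := by
  ext i
  rw [coeff_truncLT_ite]
  split_ifs with hi
  · rfl
  · by_contra hne
    exact hi (h i (Ne.symm hne))

lemma lt_of_coeff_truncLT_ne_zero {j i : ℚ} {x : HahnSeries ℚ k}
    (h : (truncLT j x).coeff i ≠ 0) : i < j ∧ x.coeff i ≠ 0 := by
  rw [coeff_truncLT_ite] at h
  split_ifs at h with hi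
  · exact ⟨hi, h⟩
  · exact absurd rfl h

lemma le_of_coeff_sub_truncLT_ne_zero {j i : ℚ} {x : HahnSeries ℚ k}
    (h : (x - truncLT j x).coeff i ≠ 0) : j ≤ i ∧ x.coeff i ≠ 0 := by
  rw [coeff_sub, coeff_truncLT_ite] at h
  split_ifs at h with hi
  · exact absurd (sub_self _) h
  · exact ⟨not_lt.1 hi, by simpa using h⟩

lemma truncLT_single (j q : ℚ) (a : k) :
    truncLT j (single q a) = if q < j then single q a else 0 := by
  split_ifs with h
  · exact truncLT_eq_self fun i hi => by rwa [eq_of_mem_support_single hi]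
  · exact truncLT_eq_zero fun i hi => by rw [eq_of_mem_support_single hi]; exact not_lt.1 h

lemma coeff_pow_ne_zero_lt {x : HahnSeries ℚ k} {a : ℚ} (h : ∀ i, x.coeff i ≠ 0 → i < a)
    {m : ℕ} (hm : m ≠ 0) {i : ℚ} (hi : (x ^ m).coeff i ≠ 0) : i < m * a := by
  induction m generalizing i with
  | zero => exact absurd rfl hm
  | succ m ih =>
    rw [pow_succ] at hi
    obtain ⟨u, v, hu, hv, rfl⟩ := exists_of_coeff_mul_ne_zero hi
    rcases eq_or_ne m 0 with rfl | h0
    · rw [pow_zero, coeff_one] at hu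
      have hu0 : u = 0 := by
        by_contra hne
        simp [hne] at hu
      have := h v hv
      subst hu0
      push_cast
      linarith
    · have h1 := ih h0 hu
      have h2 := h v hv
      push_cast
      linarith

lemma coeff_pow_ne_zero_le {x : HahnSeries ℚ k} {a : ℚ} (h : ∀ i, x.coeff i ≠ 0 → a ≤ i)
    {m : ℕ} {i : ℚ} (hi : (x ^ m).coeff i ≠ 0) : m * a ≤ i := by
  induction m generalizing i with
  | zero =>
    rw [pow_zero, coeff_one] at hi
    have hu0 : i = 0 := by
      by_contra hne
      simp [hne] at hi
    simp [hu0]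
  | succ m ih =>
    rw [pow_succ] at hi
    obtain ⟨u, v, hu, hv, rfl⟩ := exists_of_coeff_mul_ne_zero hi
    have h1 := ih hu
    have h2 := h v hv
    push_cast
    linarith

end General

/-! ### The p-power map on generalized power series. -/

section CharP

set_option linter.unusedSectionVars false

variable {k : Type*} [Field k] (p : ℕ) [hp : Fact p.Prime] [CharP k p]

instance charP_hahn : CharP (HahnSeries ℚ k) p :=
  charP_of_injective_ringHom (f := (C : k →+* HahnSeries ℚ k)) C_injective p

lemma pq_pos : (0 : ℚ) < p := by exact_mod_cast hp.out.pos

/-- The p-th power is additive, so h can be split at n/p into a lower part, one monomial and an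
upper part; only the p-th power of the monomial reaches the exponent n. -/
lemma coeff_pow_char (h : HahnSeries ℚ k) (n : ℚ) : (h ^ p).coeff n = h.coeff (n / p) ^ p := by
  have hpq := pq_pos p
  set a := n / (p : ℚ) with ha
  have hn : n = p * a := by rw [ha]; field_simp
  have key : h = truncLT a h + single a (h.coeff a)
      + (h - truncLT a h - single a (h.coeff a)) := by ring
  set y := h - truncLT a h - single a (h.coeff a) with hy
  have hysupp : ∀ i, y.coeff i ≠ 0 → a < i := by
    intro i hi
    by_contra! hle
    apply hi
    rw [hy, coeff_sub, coeff_sub, coeff_truncLT_ite, coeff_single]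
    rcases hle.lt_or_eq with h1 | h1
    · simp [h1, h1.ne]
    · simp [h1]
  have e1 : ((truncLT a h) ^ p).coeff n = 0 := by
    by_contra hne
    have := coeff_pow_ne_zero_lt (a := a) (fun i hi => (lt_of_coeff_truncLT_ne_zero hi).1)
      hp.out.ne_zero hne
    linarith
  have e3 : (y ^ p).coeff n = 0 := by
    rcases eq_or_ne y 0 with h0 | h0
    · rw [h0, zero_pow hp.out.ne_zero, coeff_zero]
    by_contra hne
    have h1 := coeff_pow_ne_zero_le (a := y.order) (fun i hi => order_le_of_coeff_ne_zero hi) hne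
    have h2 := hysupp y.order (by rwa [Ne, coeff_order_eq_zero])
    have := mul_lt_mul_of_pos_left h2 hpq
    linarith
  conv_lhs => rw [key]
  rw [add_pow_char, add_pow_char, coeff_add, coeff_add, e1, e3, single_pow, coeff_single]
  have : n = p • a := by rw [nsmul_eq_mul]; exact hn
  simp [this]

lemma coeff_pow_char_pow (h : HahnSeries ℚ k) (m : ℕ) (n : ℚ) :
    (h ^ p ^ m).coeff n = h.coeff (n / p ^ m) ^ p ^ m := by
  induction m generalizing n with
  | zero => simp
  | succ m ih =>
    rw [pow_succ, pow_mul, coeff_pow_char, ih, ← pow_mul, pow_succ, div_div, mul_comm (p : ℚ)]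

lemma truncLT_pow_char (h : HahnSeries ℚ k) (j : ℚ) :
    truncLT j (h ^ p) = truncLT (j / p) h ^ p := by
  ext i
  rw [coeff_pow_char, coeff_truncLT_ite, coeff_truncLT_ite, coeff_pow_char]
  simp only [div_lt_div_iff_of_pos_right (pq_pos p)]
  split_ifs
  · rfl
  · rw [zero_pow hp.out.ne_zero]

lemma exists_pow_char_eq [IsAlgClosed k] (h : HahnSeries ℚ k) : ∃ g : HahnSeries ℚ k, g ^ p = h := by
  have hpq := pq_pos p
  have hr : ∀ x : k, ∃ y : k, y ^ p = x := fun x => IsAlgClosed.exists_pow_nat_eq x hp.out.pos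
  choose r hr using hr
  refine ⟨⟨fun n => r (h.coeff (p * n)), ?_⟩, ?_⟩
  · refine (h.isPWO_support.image_of_monotone (f := fun n : ℚ => n / p)
      (fun a b hab => div_le_div_of_nonneg_right hab hpq.le)).mono fun n hn => ?_
    refine ⟨p * n, ?_, by field_simp⟩
    rw [mem_support]
    intro h0
    rw [Function.mem_support, h0] at hn
    have := hr 0
    exact hn (pow_eq_zero_iff hp.out.ne_zero |>.1 this)
  · ext n
    rw [coeff_pow_char]
    show r (h.coeff (p * (n / p))) ^ p = _
    rw [hr]
    congr 1
    field_simp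

lemma pow_char_injective : Function.Injective fun h : HahnSeries ℚ k => h ^ p :=
  frobenius_inj (HahnSeries ℚ k) p

end CharP

end Hahn

namespace Hahn

open HahnSeries

/-! ### Additive polynomial equations over generalized power series. -/

section AddPoly

set_option linter.unusedSectionVars false

variable {k : Type*} [Field k] (p : ℕ) [hp : Fact p.Prime] [CharP k p]

/-- The value at `z` of the additive polynomial `∑ A_a X ^ (p ^ a)`. -/
def addPoly (N : ℕ) (A : ℕ → HahnSeries ℚ k) (z : HahnSeries ℚ k) : HahnSeries ℚ k :=
  ∑ a ∈ Finset.range N, A a * z ^ p ^ a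

variable {p}

lemma addPoly_add (N : ℕ) (A : ℕ → HahnSeries ℚ k) (y z : HahnSeries ℚ k) :
    addPoly p N A (y + z) = addPoly p N A y + addPoly p N A z := by
  unfold addPoly
  rw [← Finset.sum_add_distrib]
  exact Finset.sum_congr rfl fun a _ => by rw [add_pow_char_pow, mul_add]

lemma coeff_mul_pow_eq_zero {A z : HahnSeries ℚ k} {a : ℕ} {v g i : ℚ}
    (hA : ∀ j, A.coeff j ≠ 0 → v ≤ j) (hz : ∀ j, z.coeff j ≠ 0 → g ≤ j)
    (hi : i < v + p ^ a * g) : (A * z ^ p ^ a).coeff i = 0 := by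
  by_contra hne
  obtain ⟨u, w, hu, hw, rfl⟩ := exists_of_coeff_mul_ne_zero hne
  have h1 := hA u hu
  have h2 := coeff_pow_ne_zero_le hz hw
  push_cast at h2
  linarith

lemma coeff_mul_pow_eq_zero' {A z : HahnSeries ℚ k} {a : ℕ} {v g i : ℚ}
    (hA : ∀ j, A.coeff j ≠ 0 → v ≤ j) (hz : ∀ j, z.coeff j ≠ 0 → g < j)
    (hi : i ≤ v + p ^ a * g) : (A * z ^ p ^ a).coeff i = 0 := by
  rcases eq_or_ne z 0 with rfl | h0
  · rw [zero_pow (pow_ne_zero _ hp.out.ne_zero), mul_zero, coeff_zero]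
  have hpq := pq_pos p
  refine coeff_mul_pow_eq_zero (g := z.order) hA (fun j hj => order_le_of_coeff_ne_zero hj) ?_
  have h2 := hz z.order (by rwa [Ne, coeff_order_eq_zero])
  have := mul_lt_mul_of_pos_left h2 (pow_pos hpq a)
  linarith

lemma exists_root_addPoly_field [IsAlgClosed k] (N : ℕ) (α : ℕ → k) (η : k)
    (h : ∃ a ∈ Finset.range N, α a ≠ 0) : ∃ b : k, ∑ a ∈ Finset.range N, α a * b ^ p ^ a = η := by
  open Polynomial in
  let f : k[X] := ∑ a ∈ Finset.range N, Polynomial.C (α a) * X ^ p ^ a - Polynomial.C η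
  obtain ⟨a, ha, hα⟩ := h
  have hinj : Function.Injective fun a : ℕ => p ^ a := Nat.pow_right_injective hp.out.two_le
  have hc : f.coeff (p ^ a) = α a := by
    simp only [f, Polynomial.coeff_sub, Polynomial.finsetSum_coeff, Polynomial.coeff_C_mul,
      Polynomial.coeff_X_pow]
    rw [Finset.sum_eq_single a]
    · rw [Polynomial.coeff_C_of_ne_zero (pow_ne_zero _ hp.out.ne_zero)]
      simp
    · intro b _ hb
      have : p ^ a ≠ p ^ b := fun h => hb (hinj h).symm
      simp [this]
    · intro h; exact absurd ha h
  have hdeg : f.degree ≠ 0 := by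
    intro h
    have : (p ^ a : ℕ) ≤ f.degree := Polynomial.le_degree_of_ne_zero (by rwa [hc])
    rw [h] at this
    have h2 : p ^ a ≤ 0 := by exact_mod_cast this
    exact absurd (Nat.le_zero.1 h2) (pow_ne_zero _ hp.out.ne_zero)
  obtain ⟨b, hb⟩ := IsAlgClosed.exists_root f hdeg
  refine ⟨b, ?_⟩
  have : f.eval b = 0 := hb
  simp only [f, Polynomial.eval_sub, Polynomial.eval_finsetSum, Polynomial.eval_mul,
    Polynomial.eval_C, Polynomial.eval_pow, Polynomial.eval_X] at this
  exact sub_eq_zero.1 this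

/-- Dividing by X^{p^m}, with m the least index of a nonzero coefficient, leaves a polynomial that
is nonconstant, thanks to the second nonzero coefficient, and has nonzero constant term. -/
lemma exists_ne_zero_root_addPoly_field [IsAlgClosed k] (N : ℕ) (α : ℕ → k)
    (h : ∃ a ∈ Finset.range N, ∃ a' ∈ Finset.range N, a ≠ a' ∧ α a ≠ 0 ∧ α a' ≠ 0) :
    ∃ b : k, b ≠ 0 ∧ ∑ a ∈ Finset.range N, α a * b ^ p ^ a = 0 := by
  classical
  obtain ⟨a, ha, a', ha', hne, h1, h2⟩ := h
  let S := (Finset.range N).filter fun a => α a ≠ 0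
  have hS : S.Nonempty := ⟨a, Finset.mem_filter.2 ⟨ha, h1⟩⟩
  let m := S.min' hS
  have hm := Finset.mem_filter.1 (S.min'_mem hS)
  obtain ⟨a₁, ha₁, hα₁, hlt⟩ : ∃ a₁ ∈ Finset.range N, α a₁ ≠ 0 ∧ m < a₁ := by
    rcases eq_or_ne a m with rfl | h
    · exact ⟨a', ha', h2, lt_of_le_of_ne (S.min'_le _ (Finset.mem_filter.2 ⟨ha', h2⟩)) hne⟩
    · exact ⟨a, ha, h1, lt_of_le_of_ne (S.min'_le _ (Finset.mem_filter.2 ⟨ha, h1⟩)) h.symm⟩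
  have hp1 := hp.out.one_lt
  open Polynomial in
  let f : k[X] := ∑ a ∈ S, Polynomial.C (α a) * X ^ (p ^ a - p ^ m)
  have hle : ∀ a ∈ S, p ^ m ≤ p ^ a := fun a ha => Nat.pow_le_pow_right hp.out.pos (S.min'_le _ ha)
  have hcoeff : ∀ a ∈ S, f.coeff (p ^ a - p ^ m) = α a := by
    intro a ha
    simp only [f, Polynomial.finsetSum_coeff, Polynomial.coeff_C_mul, Polynomial.coeff_X_pow]
    rw [Finset.sum_eq_single a]
    · simp
    · intro b hb hba
      have h3 : p ^ a ≠ p ^ b := fun h => hba (Nat.pow_right_injective hp.out.two_le h).symm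
      have h4 : p ^ a - p ^ m ≠ p ^ b - p ^ m := by
        have := hle a ha
        have := hle b hb
        omega
      simp [h4]
    · intro h; exact absurd ha h
  have hdeg : f.degree ≠ 0 := by
    intro h
    have h5 := hcoeff a₁ (Finset.mem_filter.2 ⟨ha₁, hα₁⟩)
    have : ((p ^ a₁ - p ^ m : ℕ) : WithBot ℕ) ≤ f.degree :=
      Polynomial.le_degree_of_ne_zero (by rwa [h5])
    rw [h] at this
    have h2 : p ^ a₁ - p ^ m ≤ 0 := by exact_mod_cast this
    have := Nat.pow_lt_pow_right hp1 hlt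
    omega
  obtain ⟨b, hb⟩ := IsAlgClosed.exists_root f hdeg
  have hb' : ∑ a ∈ S, α a * b ^ (p ^ a - p ^ m) = 0 := by
    have : f.eval b = 0 := hb
    simpa only [f, Polynomial.eval_finsetSum, Polynomial.eval_mul, Polynomial.eval_C,
      Polynomial.eval_pow, Polynomial.eval_X] using this
  refine ⟨b, ?_, ?_⟩
  · rintro rfl
    have h0 : f.coeff 0 = 0 := by rw [Polynomial.coeff_zero_eq_eval_zero]; exact hb
    have := hcoeff m (S.min'_mem hS)
    rw [Nat.sub_self, h0] at this
    exact hm.2 this.symm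
  · rw [← Finset.sum_filter_add_sum_filter_not _ (fun a => α a ≠ 0)]
    have e1 : ∑ a ∈ S, α a * b ^ p ^ a = b ^ p ^ m * ∑ a ∈ S, α a * b ^ (p ^ a - p ^ m) := by
      rw [Finset.mul_sum]
      refine Finset.sum_congr rfl fun a ha => ?_
      rw [mul_left_comm, ← _root_.pow_add, Nat.add_sub_cancel' (hle a ha)]
    change ∑ a ∈ S, _ + _ = _
    rw [e1, hb', mul_zero, zero_add]
    refine Finset.sum_eq_zero fun a ha => ?_
    have := (Finset.mem_filter.1 ha).2
    rw [not_not] at this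
    rw [this, zero_mul]

/-- An additive polynomial equation over a field of generalized power series has a solution, with
a lower bound for its support that is optimal for the Newton polygon. -/
theorem exists_addPoly_eq [IsAlgClosed k] (N : ℕ) (A : ℕ → HahnSeries ℚ k) (B : HahnSeries ℚ k)
    (g β : ℚ) (hB : ∀ i, B.coeff i ≠ 0 → β ≤ i)
    (hA : ∃ a ∈ Finset.range N, ∃ e, (A a).coeff e ≠ 0 ∧ e + p ^ a * g ≤ β) :
    ∃ z : HahnSeries ℚ k, (∀ i, z.coeff i ≠ 0 → g ≤ i) ∧ addPoly p N A z = B := by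
  classical
  have hpq := pq_pos p
  let I := (Finset.range N).filter fun a => A a ≠ 0
  have hI : I.Nonempty := by
    obtain ⟨a, ha, e, he, -⟩ := hA
    exact ⟨a, Finset.mem_filter.2 ⟨ha, fun h => he (by rw [h, coeff_zero])⟩⟩
  -- The least valuation among the terms when z has valuation γ. It is strictly increasing and
  -- piecewise linear, with inverse ψ.
  let φ : ℚ → ℚ := fun γ => I.inf' hI fun a => (A a).order + p ^ a * γ
  let ψ : ℚ → ℚ := fun b => I.sup' hI fun a => (b - (A a).order) / p ^ a
  have hφle : ∀ γ, ∀ a ∈ I, φ γ ≤ (A a).order + p ^ a * γ := fun γ a ha =>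
    Finset.inf'_le (fun a => (A a).order + p ^ a * γ) ha
  have hφmono : StrictMono φ := by
    intro x y hxy
    rw [Finset.lt_inf'_iff]
    intro a ha
    have := mul_lt_mul_of_pos_left hxy (pow_pos hpq a)
    have := hφle x a ha
    linarith
  have hψ : ∀ b, (∃ a ∈ I, (A a).order + p ^ a * ψ b = b) ∧ φ (ψ b) = b := by
    intro b
    have h1 : ∃ a ∈ I, (A a).order + p ^ a * ψ b = b := by
      obtain ⟨a, ha, he⟩ := Finset.exists_mem_eq_sup' hI fun a => (b - (A a).order) / (p : ℚ) ^ a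
      refine ⟨a, ha, ?_⟩
      show _ + _ * I.sup' hI _ = b
      rw [he]
      have := (pow_pos hpq a).ne'
      field_simp
      ring
    refine ⟨h1, le_antisymm ?_ ?_⟩
    · obtain ⟨a, ha, he⟩ := h1
      exact (hφle _ a ha).trans he.le
    · rw [Finset.le_inf'_iff]
      intro a ha
      have h2 : (b - (A a).order) / p ^ a ≤ ψ b :=
        Finset.le_sup' (fun a => (b - (A a).order) / (p : ℚ) ^ a) ha
      rw [div_le_iff₀ (pow_pos hpq a)] at h2
      linarith
  have hord : ∀ a j, (A a).coeff j ≠ 0 → (A a).order ≤ j := fun a j hj =>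
    order_le_of_coeff_ne_zero hj
  have hzero : ∀ a ∈ Finset.range N, a ∉ I → A a = 0 := by
    intro a ha hI
    by_contra h
    exact hI (Finset.mem_filter.2 ⟨ha, h⟩)
  have P1 : ∀ (z : HahnSeries ℚ k) (γ i : ℚ), (∀ j, z.coeff j ≠ 0 → γ ≤ j) → i < φ γ →
      (addPoly p N A z).coeff i = 0 := by
    intro z γ i hz hi
    rw [addPoly, coeff_sum']
    refine Finset.sum_eq_zero fun a ha => ?_
    by_cases haI : a ∈ I
    · exact coeff_mul_pow_eq_zero (hord a) hz (hi.trans_le (hφle γ a haI))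
    · rw [hzero a ha haI, zero_mul, coeff_zero]
  have P2 : ∀ (z : HahnSeries ℚ k) (γ i : ℚ), (∀ j, z.coeff j ≠ 0 → γ < j) → i ≤ φ γ →
      (addPoly p N A z).coeff i = 0 := by
    intro z γ i hz hi
    rw [addPoly, coeff_sum']
    refine Finset.sum_eq_zero fun a ha => ?_
    by_cases haI : a ∈ I
    · exact coeff_mul_pow_eq_zero' (hord a) hz (hi.trans (hφle γ a haI))
    · rw [hzero a ha haI, zero_mul, coeff_zero]
  have Pneg : ∀ z, addPoly p N A (-z) = -addPoly p N A z := by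
    intro z
    have h0 : addPoly p N A 0 = 0 := by
      have := addPoly_add (p := p) N A 0 0
      rw [add_zero] at this
      exact left_eq_add.1 this
    rw [eq_neg_iff_add_eq_zero, ← addPoly_add, neg_add_cancel, h0]
  have P3 : ∀ (y z : HahnSeries ℚ k) (γ : ℚ), (∀ j ≤ γ, y.coeff j = z.coeff j) → ∀ i ≤ φ γ,
      (addPoly p N A y).coeff i = (addPoly p N A z).coeff i := by
    intro y z γ h i hi
    have h1 := P2 (y + -z) γ i (fun j hj => by
      by_contra! hle
      exact hj (by rw [coeff_add, coeff_neg, h j hle, add_neg_cancel])) hi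
    rw [addPoly_add, Pneg, coeff_add, coeff_neg] at h1
    exact eq_of_sub_eq_zero (by rwa [sub_eq_add_neg])
  have hg : φ g ≤ β := by
    obtain ⟨a, ha, e, he, hle⟩ := hA
    have haI : a ∈ I := Finset.mem_filter.2 ⟨ha, fun h => he (by rw [h, coeff_zero])⟩
    have := hφle g a haI
    have := hord a e he
    linarith
  -- Partial solutions: the equation holds up to φ(δ) for every δ in the support. The relation `r`
  -- says that z prolongs y, and Zorn's lemma gives a partial solution without proper prolongation.
  let S := {z : HahnSeries ℚ k // (∀ i, z.coeff i ≠ 0 → g ≤ i) ∧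
    ∀ δ, z.coeff δ ≠ 0 → ∀ i ≤ φ δ, (addPoly p N A z).coeff i = B.coeff i}
  let r : S → S → Prop := fun y z => ∀ δ, y.1.coeff δ ≠ 0 → ∀ i ≤ δ, z.1.coeff i = y.1.coeff i
  obtain ⟨⟨z, hz1, hz2⟩, hmax⟩ : ∃ m : S, ∀ a, r m a → r a m := by
    refine exists_maximal_of_chains_bounded ?_ ?_
    · intro c hc
      let Q : ℚ → S → Prop := fun i z => z ∈ c ∧ ∃ δ, z.1.coeff δ ≠ 0 ∧ i ≤ δ
      -- The union of the chain: the coefficient at i is read off from any member whose support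
      -- reaches i or beyond; members of the chain agree there.
      let f : ℚ → k := fun i => if h : ∃ z, Q i z then h.choose.1.coeff i else 0
      have hf : ∀ z ∈ c, ∀ δ, z.1.coeff δ ≠ 0 → ∀ i ≤ δ, f i = z.1.coeff i := by
        intro z hz δ hδ i hi
        have hex : ∃ z, Q i z := ⟨z, hz, δ, hδ, hi⟩
        have hfi : f i = hex.choose.1.coeff i := dif_pos hex
        obtain ⟨hy, δ', hδ', hi'⟩ := hex.choose_spec
        rw [hfi]
        rcases eq_or_ne hex.choose z with h | h
        · rw [h]
        · rcases hc hy hz h with h | h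
          · exact (h δ' hδ' i hi').symm
          · exact h δ hδ i hi
      have hsupp : ∀ i, f i ≠ 0 → ∃ z ∈ c, z.1.coeff i ≠ 0 := by
        intro i hi
        by_cases hex : ∃ z, Q i z
        · have hfi : f i = hex.choose.1.coeff i := dif_pos hex
          exact ⟨_, hex.choose_spec.1, hfi ▸ hi⟩
        · exact absurd (dif_neg hex) hi
      have hpwo : (Function.support f).IsPWO := by
        refine Set.IsWF.isPWO ?_
        rw [Set.isWF_iff_no_descending_seq]
        -- A descending sequence in the support of the union starts in the support of one member and
        -- then never leaves it.
        intro s hs hmem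
        obtain ⟨z, hz, h0⟩ := hsupp _ (hmem 0)
        have hw := z.1.isWF_support
        rw [Set.isWF_iff_no_descending_seq] at hw
        refine hw s hs fun n => ?_
        have := hf z hz _ h0 (s n) (hs.antitone (Nat.zero_le n))
        rw [mem_support, ← this]
        exact hmem n
      let Z : HahnSeries ℚ k := ⟨f, hpwo⟩
      refine ⟨⟨Z, ?_, ?_⟩, fun z hz δ hδ i hi => hf z hz δ hδ i hi⟩
      · intro i hi
        obtain ⟨z, -, h⟩ := hsupp i hi
        exact z.2.1 i h
      · intro δ hδ i hi
        obtain ⟨z, hz, h⟩ := hsupp δ hδ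
        rw [P3 Z z.1 δ (fun j hj => hf z hz δ h j hj) i hi]
        exact z.2.2 δ h i hi
    · intro x y z hxy hyz δ hδ i hi
      have h1 := hxy δ hδ
      rw [hyz δ (by rwa [h1 δ le_rfl]) i hi, h1 i hi]
  refine ⟨z, hz1, ?_⟩
  by_contra hne
  have hD : B - addPoly p N A z ≠ 0 := sub_ne_zero.2 (Ne.symm hne)
  set D := B - addPoly p N A z with hDdef
  set b := D.order with hb
  have hDb : D.coeff b ≠ 0 := by rwa [Ne, coeff_order_eq_zero]
  obtain ⟨⟨a₀, ha₀, he₀⟩, hψb⟩ := hψ b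
  -- The only exponent at which a new monomial can cancel the leading term, of order b, of the
  -- error. It lies above the whole support of z, so adding that monomial prolongs z, against
  -- maximality.
  set γ := ψ b with hγ
  have hgγ : g ≤ γ := by
    rw [← hφmono.le_iff_le, hψb]
    by_contra! hlt
    refine hDb ?_
    rw [hDdef, coeff_sub, P1 z g b hz1 hlt, sub_zero]
    by_contra hne
    have := hB b hne
    linarith
  have hδ : ∀ δ, z.coeff δ ≠ 0 → δ < γ := by
    intro δ h
    rw [← hφmono.lt_iff_lt, hψb]
    by_contra! hle
    exact hDb (by rw [hDdef, coeff_sub, hz2 δ h b hle, sub_self])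
  obtain ⟨x, hx⟩ := exists_root_addPoly_field (p := p) N
    (fun a => (A a).coeff (b - p ^ a * γ)) (D.coeff b) ⟨a₀, (Finset.mem_filter.1 ha₀).1, by
      have : b - p ^ a₀ * γ = (A a₀).order := by linarith
      simp only [this]
      rw [Ne, coeff_order_eq_zero]
      exact (Finset.mem_filter.1 ha₀).2⟩
  have hsing : ∀ i ≤ b, (addPoly p N A (single γ x)).coeff i = D.coeff i := by
    intro i hi
    rcases hi.lt_or_eq with hlt | rfl
    · rw [P1 (single γ x) γ i (fun j hj => (eq_of_mem_support_single hj).ge) (by rwa [hψb])]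
      exact (coeff_eq_zero_of_lt_order hlt).symm
    · rw [← hx, addPoly, coeff_sum']
      refine Finset.sum_congr rfl fun a _ => ?_
      rw [single_pow, nsmul_eq_mul, coeff_mul_single]
      push_cast
      rfl
  have hx0 : x ≠ 0 := by
    rintro rfl
    have := hsing b le_rfl
    rw [single_eq_zero] at this
    rw [P1 0 (γ + 1) b (by simp) (by rw [← hψb]; exact hφmono (by linarith))] at this
    exact hDb this.symm
  have hcoeff : ∀ j, j ≠ γ → (z + single γ x).coeff j = z.coeff j := by
    intro j hj
    rw [coeff_add, coeff_single_of_ne hj, add_zero]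
  have hval : ∀ i ≤ b, (addPoly p N A (z + single γ x)).coeff i = B.coeff i := by
    intro i hi
    rw [addPoly_add, coeff_add, hsing i hi, hDdef, coeff_sub]
    ring
  have hnew : (∀ i, (z + single γ x).coeff i ≠ 0 → g ≤ i) ∧
      ∀ δ, (z + single γ x).coeff δ ≠ 0 → ∀ i ≤ φ δ,
        (addPoly p N A (z + single γ x)).coeff i = B.coeff i := by
    constructor
    · intro i hi
      rcases eq_or_ne i γ with rfl | h
      · exact hgγ
      · exact hz1 i (by rwa [hcoeff i h] at hi)
    · intro δ h i hi
      refine hval i (hi.trans ?_)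
      rw [← hψb, hφmono.le_iff_le]
      rcases eq_or_ne δ γ with rfl | hne
      · exact le_rfl
      · exact (hδ δ (by rwa [hcoeff δ hne] at h)).le
  have hzγ : z.coeff γ = 0 := by
    by_contra h
    exact absurd (hδ γ h) (lt_irrefl _)
  have h1 := hmax ⟨_, hnew⟩ (fun δ h i hi => hcoeff i (hi.trans_lt (hδ δ h)).ne) γ (by
    show (z + single γ x).coeff γ ≠ 0
    rw [coeff_add, hzγ, coeff_single_same, zero_add]
    exact hx0) γ le_rfl
  change z.coeff γ = (z + single γ x).coeff γ at h1
  rw [coeff_add, hzγ, coeff_single_same, zero_add] at h1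
  exact hx0 h1.symm

end AddPoly

end Hahn

namespace Hahn

open HahnSeries

/-! ### Truncation at real cuts. -/

section Trunc

variable {k : Type*} [Field k]

/-- The truncation at a real cut. -/
def truncReal (s : ℝ) (h : HahnSeries ℚ k) : HahnSeries ℚ k :=
  ⟨fun i => open Classical in if (i : ℝ) < s then h.coeff i else 0,
    h.isPWO_support.mono fun i hi => by
      rw [Function.mem_support] at hi
      rw [mem_support]
      intro h0
      rw [h0] at hi
      simp at hi⟩

lemma coeff_truncReal_of_lt {s : ℝ} {i : ℚ} (hi : (i : ℝ) < s) (h : HahnSeries ℚ k) :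
    (truncReal s h).coeff i = h.coeff i := if_pos hi

lemma coeff_truncReal_of_le {s : ℝ} {i : ℚ} (hi : s ≤ i) (h : HahnSeries ℚ k) :
    (truncReal s h).coeff i = 0 := if_neg (not_lt.2 hi)

lemma truncReal_add (s : ℝ) (x y : HahnSeries ℚ k) :
    truncReal s (x + y) = truncReal s x + truncReal s y := by
  ext i
  rcases lt_or_ge (i : ℝ) s with h | h
  · simp only [coeff_add, coeff_truncReal_of_lt h]
  · simp only [coeff_add, coeff_truncReal_of_le h, add_zero]

lemma truncReal_sum {ι : Type*} (s : ℝ) (t : Finset ι) (f : ι → HahnSeries ℚ k) :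
    truncReal s (∑ i ∈ t, f i) = ∑ i ∈ t, truncReal s (f i) := by
  classical
  induction t using Finset.induction_on with
  | empty =>
    ext i
    rcases lt_or_ge (i : ℝ) s with h | h
    · simp [coeff_truncReal_of_lt h]
    · simp [coeff_truncReal_of_le h]
  | insert a t ha ih => rw [Finset.sum_insert ha, Finset.sum_insert ha, truncReal_add, ih]

lemma truncReal_eq_self {s : ℝ} {x : HahnSeries ℚ k} (h : ∀ i, x.coeff i ≠ 0 → (i : ℝ) < s) :
    truncReal s x = x := by
  ext i
  rcases lt_or_ge (i : ℝ) s with hi | hi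
  · exact coeff_truncReal_of_lt hi x
  · rw [coeff_truncReal_of_le hi]
    by_contra hne
    exact absurd (h i (Ne.symm hne)) (not_lt.2 hi)

lemma truncReal_eq_of_sub {s : ℝ} {x y : HahnSeries ℚ k}
    (h : ∀ i, (x - y).coeff i ≠ 0 → s ≤ i) : truncReal s x = truncReal s y := by
  ext i
  rcases lt_or_ge (i : ℝ) s with hi | hi
  · rw [coeff_truncReal_of_lt hi, coeff_truncReal_of_lt hi]
    by_contra hne
    exact absurd (h i (by rwa [coeff_sub, sub_ne_zero])) (not_le.2 hi)
  · rw [coeff_truncReal_of_le hi, coeff_truncReal_of_le hi]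

/-- A truncation at a real cut is either trivial or a truncation at an element of the support. -/
lemma truncReal_eq (s : ℝ) (x : HahnSeries ℚ k) :
    truncReal s x = x ∨ ∃ δ, x.coeff δ ≠ 0 ∧ s ≤ δ ∧ truncReal s x = truncLT δ x := by
  by_cases hex : ∃ δ, x.coeff δ ≠ 0 ∧ s ≤ δ
  · right
    have hwf : ({δ | x.coeff δ ≠ 0 ∧ s ≤ δ} : Set ℚ).IsWF := x.isWF_support.mono fun i hi => hi.1
    obtain ⟨h1, h2⟩ := hwf.min_mem hex
    refine ⟨hwf.min hex, h1, h2, ?_⟩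
    ext i
    rw [coeff_truncLT_ite]
    rcases lt_or_ge (i : ℝ) s with hi | hi
    · rw [coeff_truncReal_of_lt hi, if_pos]
      have := hi.trans_le h2
      exact_mod_cast this
    · rw [coeff_truncReal_of_le hi]
      split_ifs with hlt
      · by_contra hne
        exact hwf.not_lt_min hex ⟨Ne.symm hne, hi⟩ hlt
      · rfl
  · left
    push Not at hex
    exact truncReal_eq_self hex

lemma truncLT_eq_truncReal (j : ℚ) (x : HahnSeries ℚ k) : truncLT j x = truncReal j x := by
  ext i
  rw [coeff_truncLT_ite]
  split_ifs with h
  · exact (coeff_truncReal_of_lt (by exact_mod_cast h) x).symm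
  · exact (coeff_truncReal_of_le (by exact_mod_cast not_lt.1 h) x).symm

end Trunc

/-! ### The algebraic closure of k((t)) among generalized power series. -/

section Alg

set_option linter.unusedSectionVars false

variable (k : Type*) [Field k]

/-- The algebraic closure of `k((t))` in the field of generalized power series. -/
def algField : Subfield (HahnSeries ℚ k) :=
  letI := (laurentToHahn k).toAlgebra
  (algebraicClosure (LaurentSeries k) (HahnSeries ℚ k)).toSubfield

variable {k}

lemma mem_algField {h : HahnSeries ℚ k} : h ∈ algField k ↔ IsAlgOverLaurent h := by
  let := (laurentToHahn k).toAlgebra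
  exact mem_algebraicClosure_iff

/-- Transitivity of algebraicity: the relative algebraic closure is algebraically closed in the
field of generalized power series. -/
lemma mem_algField_of_root {f : Polynomial (HahnSeries ℚ k)} (hf : f ≠ 0)
    (hc : ∀ i, f.coeff i ∈ algField k) {z : HahnSeries ℚ k} (hz : f.eval z = 0) :
    z ∈ algField k := by
  let := (laurentToHahn k).toAlgebra
  let E := algebraicClosure (LaurentSeries k) (HahnSeries ℚ k)
  have hl : f ∈ Polynomial.lifts (algebraMap E (HahnSeries ℚ k)) := by
    rw [Polynomial.lifts_iff_coeff_lifts]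
    exact fun i => ⟨⟨f.coeff i, hc i⟩, rfl⟩
  obtain ⟨g, rfl⟩ := hl
  have hzE : IsAlgebraic E z := ⟨g, fun h => hf (by simp [h]), by
    rw [Polynomial.aeval_def, ← Polynomial.eval_map]
    exact hz⟩
  exact mem_algebraicClosure_iff.2 (hzE.restrictScalars (LaurentSeries k))

lemma mem_algField_of_pow {z : HahnSeries ℚ k} {m : ℕ} (hm : 0 < m) (h : z ^ m ∈ algField k) :
    z ∈ algField k := by
  refine mem_algField_of_root (f := Polynomial.X ^ m - Polynomial.C (z ^ m))
    (Polynomial.X_pow_sub_C_ne_zero hm _) (fun i => ?_) (by simp)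
  rw [Polynomial.coeff_sub, Polynomial.coeff_X_pow, Polynomial.coeff_C]
  refine sub_mem ?_ ?_ <;> split_ifs
  · exact one_mem _
  · exact zero_mem _
  · exact h
  · exact zero_mem _

lemma laurentToHahn_mem (f : LaurentSeries k) : laurentToHahn k f ∈ algField k :=
  mem_algField.2 ⟨Polynomial.X - Polynomial.C f, Polynomial.X_sub_C_ne_zero f, by simp⟩

lemma laurentToHahn_single (m : ℤ) (a : k) :
    laurentToHahn k (single m a) = single (m : ℚ) a :=
  embDomain_single

lemma single_mem_algField (q : ℚ) (a : k) : single q a ∈ algField k := by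
  have h0 : ∀ a : k, single (0 : ℚ) a ∈ algField k := fun a => by
    have := laurentToHahn_mem (single (0 : ℤ) a)
    rwa [laurentToHahn_single, Int.cast_zero] at this
  have h1 : single q (1 : k) ∈ algField k := by
    refine mem_algField_of_pow (Rat.den_pos q) ?_
    have := laurentToHahn_mem (single q.num (1 : k))
    rw [laurentToHahn_single] at this
    rwa [single_pow, one_pow, nsmul_eq_mul, Rat.den_mul_eq_num]
  have := mul_mem (h0 a) h1
  rwa [single_mul_single, zero_add, mul_one] at this

variable (p : ℕ) [hp : Fact p.Prime] [CharP k p]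

lemma mem_algField_of_addPoly {N : ℕ} {A : ℕ → HahnSeries ℚ k} {z : HahnSeries ℚ k}
    (hA : ∀ a, A a ∈ algField k) (hne : ∃ a ∈ Finset.range N, A a ≠ 0)
    (hz : addPoly p N A z ∈ algField k) : z ∈ algField k := by
  let f : Polynomial (HahnSeries ℚ k) :=
    ∑ a ∈ Finset.range N, Polynomial.C (A a) * Polynomial.X ^ p ^ a -
      Polynomial.C (addPoly p N A z)
  have hcoeff : ∀ i, f.coeff i = (∑ a ∈ Finset.range N, if i = p ^ a then A a else 0) -
      if i = 0 then addPoly p N A z else 0 := by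
    intro i
    simp only [f, Polynomial.coeff_sub, Polynomial.finsetSum_coeff, Polynomial.coeff_C_mul,
      Polynomial.coeff_X_pow, Polynomial.coeff_C, mul_ite, mul_one, mul_zero]
  refine mem_algField_of_root (f := f) ?_ (fun i => ?_) ?_
  · intro h
    obtain ⟨a, ha, h1⟩ := hne
    have := hcoeff (p ^ a)
    rw [h, Polynomial.coeff_zero, Finset.sum_eq_single a, if_pos rfl,
      if_neg (pow_ne_zero _ hp.out.ne_zero), sub_zero] at this
    · exact h1 this.symm
    · intro b _ hb
      exact if_neg fun h => hb (Nat.pow_right_injective hp.out.two_le h).symm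
    · intro h; exact absurd ha h
  · rw [hcoeff]
    refine sub_mem (sum_mem fun a _ => ?_) ?_ <;> split_ifs
    · exact hA a
    · exact zero_mem _
    · exact hz
    · exact zero_mem _
  · simp only [f, Polynomial.eval_sub, Polynomial.eval_finsetSum, Polynomial.eval_mul,
      Polynomial.eval_C, Polynomial.eval_pow, Polynomial.eval_X]
    exact sub_self _

end Alg

/-! ### Series with algebraic truncations: products and additive equations. -/

section AlgTrunc

set_option linter.unusedSectionVars false

variable {k : Type*} [Field k]

/-- All truncations of the series are algebraic over `k((t))`. -/
def IsAlgTrunc (h : HahnSeries ℚ k) : Prop :=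
  h ∈ algField k ∧ ∀ j, truncLT j h ∈ algField k

lemma IsAlgTrunc.truncReal_mem {h : HahnSeries ℚ k} (hh : IsAlgTrunc h) (s : ℝ) :
    truncReal s h ∈ algField k := by
  rcases truncReal_eq s h with h1 | ⟨δ, -, -, h1⟩ <;> rw [h1]
  · exact hh.1
  · exact hh.2 δ

lemma IsAlgTrunc.trunc {h : HahnSeries ℚ k} (hh : IsAlgTrunc h) (j : ℚ) :
    IsAlgTrunc (truncLT j h) :=
  ⟨hh.2 j, fun i => by rw [truncLT_truncLT]; exact hh.2 _⟩

lemma IsAlgTrunc.add {x y : HahnSeries ℚ k} (hx : IsAlgTrunc x) (hy : IsAlgTrunc y) :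
    IsAlgTrunc (x + y) :=
  ⟨add_mem hx.1 hy.1, fun j => by rw [truncLT_add]; exact add_mem (hx.2 j) (hy.2 j)⟩

lemma IsAlgTrunc.neg {x : HahnSeries ℚ k} (hx : IsAlgTrunc x) : IsAlgTrunc (-x) :=
  ⟨neg_mem hx.1, fun j => by rw [truncLT_neg]; exact neg_mem (hx.2 j)⟩

lemma isAlgTrunc_single (q : ℚ) (a : k) : IsAlgTrunc (single q a) :=
  ⟨single_mem_algField q a, fun j => by
    rw [truncLT_single]
    split_ifs
    · exact single_mem_algField q a
    · exact zero_mem _⟩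

/-- Well-founded induction along the support of x, replacing x by its truncations. Each step cuts
the new part of the product into a piece entirely below j and a piece entirely at or above j. -/
lemma IsAlgTrunc.mul {x y : HahnSeries ℚ k} (hx : IsAlgTrunc x) (hy : IsAlgTrunc y) :
    IsAlgTrunc (x * y) := by
  refine ⟨mul_mem hx.1 hy.1, fun j => ?_⟩
  have step : ∀ a : ℚ, (∀ δ < a, x.coeff δ ≠ 0 →
      truncLT j (truncLT δ x * y) ∈ algField k) →
      truncLT j (truncLT a x * y) ∈ algField k := by
    intro a ih
    -- The exponents of y that can reach j. For the least one b, with partner δ, the part of x in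
    -- [δ, a) times y below b stays below j, and times the rest of y it starts at δ + b ≥ j; x below
    -- δ falls to the induction.
    let T : Set ℚ := {b | y.coeff b ≠ 0 ∧ ∃ δ < a, x.coeff δ ≠ 0 ∧ j ≤ δ + b}
    by_cases hT : T.Nonempty
    · have hwf : T.IsWF := y.isWF_support.mono fun i hi => hi.1
      obtain ⟨hb, δ, hδa, hδ, hj⟩ := hwf.min_mem hT
      have hmin : ∀ i, y.coeff i ≠ 0 → i < hwf.min hT → ∀ δ < a, x.coeff δ ≠ 0 → δ + i < j := by
        intro i hi hlt δ h1 h2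
        by_contra! hle
        exact hwf.not_lt_min hT ⟨hi, δ, h1, h2, hle⟩ hlt
      set b := hwf.min hT
      have e : truncLT a x * y = truncLT δ x * y +
          (truncLT a x - truncLT δ x) * truncLT b y +
          (truncLT a x - truncLT δ x) * (y - truncLT b y) := by
        ring
      have hsub : ∀ i, (truncLT a x - truncLT δ x).coeff i ≠ 0 →
          δ ≤ i ∧ i < a ∧ x.coeff i ≠ 0 := by
        intro i hi
        have h3 : truncLT a x - truncLT δ x =
            truncLT a x - truncLT δ (truncLT a x) := by
          rw [truncLT_truncLT, min_eq_left hδa.le]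
        rw [h3] at hi
        obtain ⟨h4, h5⟩ := le_of_coeff_sub_truncLT_ne_zero hi
        exact ⟨h4, lt_of_coeff_truncLT_ne_zero h5⟩
      rw [e, truncLT_add, truncLT_add]
      refine add_mem (add_mem (ih δ hδa hδ) ?_) ?_
      · rw [truncLT_eq_self]
        · exact mul_mem (sub_mem (hx.2 a) (hx.2 δ)) (hy.2 b)
        · intro i hi
          obtain ⟨u, v, hu, hv, rfl⟩ := exists_of_coeff_mul_ne_zero hi
          obtain ⟨-, hu1, hu2⟩ := hsub u hu
          obtain ⟨hv1, hv2⟩ := lt_of_coeff_truncLT_ne_zero hv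
          exact hmin v hv2 hv1 u hu1 hu2
      · rw [truncLT_eq_zero]
        · exact zero_mem _
        · intro i hi
          obtain ⟨u, v, hu, hv, rfl⟩ := exists_of_coeff_mul_ne_zero hi
          have h1 := (hsub u hu).1
          have h2 := (le_of_coeff_sub_truncLT_ne_zero hv).1
          linarith
    · rw [truncLT_eq_self]
      · exact mul_mem (hx.2 a) hy.1
      · intro i hi
        obtain ⟨u, v, hu, hv, rfl⟩ := exists_of_coeff_mul_ne_zero hi
        obtain ⟨hu1, hu2⟩ := lt_of_coeff_truncLT_ne_zero hu
        by_contra! hle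
        exact hT ⟨v, hv, u, hu1, hu2, hle⟩
  have hsupp : ∀ δ ∈ x.support,
      truncLT j (truncLT δ x * y) ∈ algField k := by
    intro δ hδ
    refine x.isWF_support.induction hδ fun a _ ih => step a fun δ hlt h => ih δ h hlt
  have h := step (j - y.order) fun δ _ h => hsupp δ h
  have e : x * y = truncLT (j - y.order) x * y +
      (x - truncLT (j - y.order) x) * y := by ring
  -- Exponents of x from j - ord(y) on contribute nothing below j, so the induction is used just
  -- once, at this cut.
  have e0 : truncLT j ((x - truncLT (j - y.order) x) * y) = 0 := by
    refine truncLT_eq_zero fun i hi => ?_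
    obtain ⟨u, v, hu, hv, rfl⟩ := exists_of_coeff_mul_ne_zero hi
    have h1 := (le_of_coeff_sub_truncLT_ne_zero hu).1
    have h2 := order_le_of_coeff_ne_zero hv
    linarith
  rw [e, truncLT_add, e0, add_zero]
  exact h

variable (k) in
/-- The ring of the series all of whose truncations are algebraic over `k((t))`. -/
def algTrunc : Subring (HahnSeries ℚ k) where
  carrier := {h | IsAlgTrunc h}
  zero_mem' := by simpa using isAlgTrunc_single (0 : ℚ) (0 : k)
  one_mem' := isAlgTrunc_single (0 : ℚ) (1 : k)
  add_mem' := IsAlgTrunc.add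
  neg_mem' := IsAlgTrunc.neg
  mul_mem' := IsAlgTrunc.mul

variable (p : ℕ) [hp : Fact p.Prime] [CharP k p]

lemma IsAlgTrunc.of_pow {h : HahnSeries ℚ k} (hh : IsAlgTrunc (h ^ p)) : IsAlgTrunc h := by
  have hpq := pq_pos p
  refine ⟨mem_algField_of_pow hp.out.pos hh.1, fun j => mem_algField_of_pow hp.out.pos ?_⟩
  have := truncLT_pow_char p h (j * p)
  rw [mul_div_cancel_right₀ _ hpq.ne'] at this
  rw [← this]
  exact hh.2 _

variable {p}

lemma real_le_of_coeff_mul_pow_ne_zero {A z : HahnSeries ℚ k} {a : ℕ} {v g : ℝ} {i : ℚ}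
    (hA : ∀ j, A.coeff j ≠ 0 → v ≤ j) (hz : ∀ j, z.coeff j ≠ 0 → g ≤ j)
    (hi : (A * z ^ p ^ a).coeff i ≠ 0) : v + p ^ a * g ≤ i := by
  obtain ⟨u, w, hu, hw, rfl⟩ := exists_of_coeff_mul_ne_zero hi
  rcases eq_or_ne z 0 with rfl | h0
  · rw [zero_pow (pow_ne_zero _ hp.out.ne_zero), coeff_zero] at hw
    exact absurd rfl hw
  have h1 := hA u hu
  have h2 := coeff_pow_ne_zero_le (a := z.order) (fun j hj => order_le_of_coeff_ne_zero hj) hw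
  have h3 := hz z.order (by rwa [Ne, coeff_order_eq_zero])
  have h4 : (p : ℝ) ^ a * z.order ≤ w := by exact_mod_cast h2
  have h5 : (p : ℝ) ^ a * g ≤ (p : ℝ) ^ a * z.order :=
    mul_le_mul_of_nonneg_left h3 (by positivity)
  push_cast
  linarith

lemma addPoly_sub (N : ℕ) (A : ℕ → HahnSeries ℚ k) (y z : HahnSeries ℚ k) :
    addPoly p N A (y - z) = addPoly p N A y - addPoly p N A z := by
  rw [eq_sub_iff_add_eq, ← addPoly_add, sub_add_cancel]

/-- Well-founded induction on the truncation point γ. At a limit stage the truncation y of z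
satisfies an additive equation of its own: its coefficients are leading monomials of the A_a, and
its right side involves only a truncation of B, the value of the polynomial at z, and an earlier
truncation of y. -/
lemma IsAlgTrunc.of_addPoly {N : ℕ} {A : ℕ → HahnSeries ℚ k} {z : HahnSeries ℚ k}
    (hA : ∀ a, IsAlgTrunc (A a)) (hne : ∃ a ∈ Finset.range N, A a ≠ 0)
    (hB : IsAlgTrunc (addPoly p N A z)) : IsAlgTrunc z := by
  classical
  have hzalg := mem_algField_of_addPoly p (fun a => (hA a).1) hne hB.1
  suffices h : ∀ δ ∈ z.support, truncLT δ z ∈ algField k by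
    refine ⟨hzalg, fun j => ?_⟩
    rw [truncLT_eq_truncReal]
    rcases truncReal_eq j z with h1 | ⟨δ, hδ, -, h1⟩ <;> rw [h1]
    · exact hzalg
    · exact h δ hδ
  intro δ hδ
  refine Set.WellFoundedOn.induction (P := fun δ => truncLT δ z ∈ algField k)
    z.isWF_support hδ fun γ hγ ih => ?_
  set y := truncLT γ z with hy
  have hyz : ∀ i, y.coeff i ≠ 0 → i < γ ∧ z.coeff i ≠ 0 := fun i hi =>
    lt_of_coeff_truncLT_ne_zero hi
  by_cases hy0 : y = 0
  · rw [hy0]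
    exact zero_mem _
  -- Successor stage: y is an earlier truncation plus one monomial.
  by_cases hmax : ∃ m, y.coeff m ≠ 0 ∧ ∀ i, y.coeff i ≠ 0 → i ≤ m
  · obtain ⟨m, hm, hle⟩ := hmax
    obtain ⟨hmγ, hzm⟩ := hyz m hm
    have e : y = truncLT m z + single m (y.coeff m) := by
      ext i
      rw [coeff_add, coeff_single, coeff_truncLT_ite m]
      rcases lt_trichotomy i m with h | rfl | h
      · rw [if_pos h, if_neg h.ne, add_zero, hy, coeff_truncLT_of_lt (h.trans hmγ)]
      · rw [if_neg (lt_irrefl _), if_pos rfl, zero_add]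
      · rw [if_neg h.not_gt, if_neg h.ne', add_zero]
        by_contra hne
        exact absurd (hle i hne) (not_le.2 h)
    rw [e]
    exact add_mem (ih m hzm hmγ) (single_mem_algField _ _)
  push Not at hmax
  -- Limit stage. The supremum of the support may be irrational, which is why cuts at real numbers
  -- are needed.
  let S : Set ℝ := (fun i : ℚ => (i : ℝ)) '' {i | y.coeff i ≠ 0}
  have hSne : S.Nonempty := ⟨_, y.order, by rwa [Set.mem_ofPred_eq, Ne, coeff_order_eq_zero], rfl⟩
  have hSbdd : BddAbove S := ⟨γ, by
    rintro _ ⟨i, hi, rfl⟩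
    exact Rat.cast_le.2 (hyz i hi).1.le⟩
  set s := sSup S with hs
  have hlt : ∀ i, y.coeff i ≠ 0 → (i : ℝ) < s := by
    intro i hi
    obtain ⟨i', hi', h⟩ := hmax i hi
    refine lt_of_lt_of_le ?_ (le_csSup hSbdd ⟨i', hi', rfl⟩)
    exact Rat.cast_lt.2 h
  have hsγ : s ≤ γ := csSup_le hSne (by
    rintro _ ⟨i, hi, rfl⟩
    exact Rat.cast_le.2 (hyz i hi).1.le)
  have htr : ∀ j : ℚ, (j : ℝ) < s → truncLT j y ∈ algField k := by
    intro j hj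
    obtain ⟨_, ⟨δ, hδ, rfl⟩, hjδ⟩ := exists_lt_of_lt_csSup hSne hj
    have hjδ' : j < δ := Rat.cast_lt.1 hjδ
    have hj' : j < γ := by exact_mod_cast hj.trans_le hsγ
    rw [hy, truncLT_truncLT, min_eq_left hj'.le, truncLT_eq_truncReal]
    rcases truncReal_eq j z with h1 | ⟨δ', hδ', -, h1⟩
    · exfalso
      have := congr_arg (fun h => h.coeff δ) h1
      simp only [coeff_truncReal_of_le hjδ.le] at this
      exact (hyz δ hδ).2 this.symm
    · rw [h1]
      refine ih δ' hδ' ?_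
      by_contra! hle
      have := congr_arg (fun h => h.coeff δ) h1
      simp only [coeff_truncReal_of_le hjδ.le] at this
      rw [coeff_truncLT_of_lt ((hyz δ hδ).1.trans_le hle)] at this
      exact (hyz δ hδ).2 this.symm
  have htr' : ∀ j : ℚ, (j : ℝ) < s → IsAlgTrunc (truncLT j y) := fun j hj =>
    ⟨htr j hj, fun i => by
      rw [truncLT_truncLT]
      refine htr _ (lt_of_le_of_lt ?_ hj)
      exact_mod_cast min_le_right i j⟩
  let I := (Finset.range N).filter fun a => A a ≠ 0
  have hI : I.Nonempty := by
    obtain ⟨a, ha, h⟩ := hne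
    exact ⟨a, Finset.mem_filter.2 ⟨ha, h⟩⟩
  set m : ℝ := I.inf' hI fun a => ((A a).order : ℝ) + p ^ a * s with hm
  have hmle : ∀ a ∈ I, m ≤ (A a).order + p ^ a * s := fun a ha =>
    Finset.inf'_le (fun a => ((A a).order : ℝ) + (p : ℝ) ^ a * s) ha
  obtain ⟨a₀, ha₀, hma₀⟩ := Finset.exists_mem_eq_inf' hI
    fun a => ((A a).order : ℝ) + (p : ℝ) ^ a * s
  let J := I.filter fun a => m = (A a).order + p ^ a * s
  -- The leading monomial of A_a for the indices attaining the minimum m at s. As the support of y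
  -- stays strictly below s, the polynomial with coefficients α takes at y a value supported
  -- strictly below m.
  let α : ℕ → HahnSeries ℚ k := fun a =>
    if a ∈ J then single (A a).order ((A a).coeff (A a).order) else 0
  have hα : ∀ a, IsAlgTrunc (α a) := by
    intro a
    simp only [α]
    split_ifs
    · exact isAlgTrunc_single _ _
    · exact (algTrunc k).zero_mem
  -- The remaining coefficients leave room above m. So, below m, their products with powers of y
  -- depend only on y below some j < s, where the induction hypothesis applies.
  have hrest : ∀ a ∈ Finset.range N, ∃ e : ℝ, m < e + p ^ a * s ∧
      ∀ i, (A a - α a).coeff i ≠ 0 → e ≤ i := by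
    intro a ha
    by_cases h0 : A a - α a = 0
    · exact ⟨m - p ^ a * s + 1, by linarith, fun i hi => absurd (by rw [h0, coeff_zero]) hi⟩
    refine ⟨(A a - α a).order, ?_, fun i hi => by exact_mod_cast order_le_of_coeff_ne_zero hi⟩
    have hc : (A a - α a).coeff (A a - α a).order ≠ 0 := by rwa [Ne, coeff_order_eq_zero]
    set o := (A a - α a).order
    by_cases haI : a ∈ I
    · by_cases haJ : a ∈ J
      · have hαa : α a = single (A a).order ((A a).coeff (A a).order) := if_pos haJ
        have h1 := (Finset.mem_filter.1 haJ).2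
        rw [hαa, coeff_sub, coeff_single] at hc
        have h2 : o ≠ (A a).order := by
          intro h
          rw [h] at hc
          simp at hc
        rw [if_neg h2, sub_zero] at hc
        have h3 : (A a).order < o := lt_of_le_of_ne (order_le_of_coeff_ne_zero hc) h2.symm
        have h4 : ((A a).order : ℝ) < o := by exact_mod_cast h3
        linarith
      · have hαa : α a = 0 := if_neg haJ
        rw [hαa, sub_zero] at hc
        have h3 : ((A a).order : ℝ) ≤ o := by exact_mod_cast order_le_of_coeff_ne_zero hc
        have h4 := lt_of_le_of_ne (hmle a haI) fun h => haJ (Finset.mem_filter.2 ⟨haI, h⟩)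
        linarith
    · have hA0 : A a = 0 := by
        by_contra h
        exact haI (Finset.mem_filter.2 ⟨ha, h⟩)
      have hαa : α a = 0 := if_neg fun h => haI (Finset.mem_filter.1 h).1
      exact absurd (by rw [hA0, hαa, sub_zero]) h0
  have hcut : ∀ a ∈ Finset.range N, ∃ j : ℚ, (j : ℝ) < s ∧ ∀ j' : ℚ, j ≤ j' →
      ∀ i, (A a - α a).coeff i ≠ 0 → m - p ^ a * j' ≤ i := by
    intro a ha
    obtain ⟨e, he, hi⟩ := hrest a ha
    have hpa : (0 : ℝ) < (p : ℝ) ^ a := pow_pos (by exact_mod_cast hp.out.pos) a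
    obtain ⟨j, hj1, hj2⟩ := exists_rat_btwn (show (m - e) / (p : ℝ) ^ a < s by
      rw [div_lt_iff₀ hpa]
      linarith)
    refine ⟨j, hj2, fun j' hj' i h => le_trans ?_ (hi i h)⟩
    rw [div_lt_iff₀ hpa] at hj1
    have : (p : ℝ) ^ a * j ≤ (p : ℝ) ^ a * j' :=
      mul_le_mul_of_nonneg_left (by exact_mod_cast hj') hpa.le
    linarith
  choose! jc hjc1 hjc2 using hcut
  obtain ⟨aN, haN, hjmax⟩ := Finset.exists_max_image (Finset.range N) jc
    ⟨a₀, (Finset.mem_filter.1 ha₀).1⟩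
  set j := jc aN
  have hjs := hjc1 aN haN
  have e1 : truncReal m (addPoly p N A y) = truncReal m (addPoly p N A z) := by
    refine truncReal_eq_of_sub fun i hi => ?_
    rw [← addPoly_sub, addPoly, coeff_sum'] at hi
    obtain ⟨a, ha, h⟩ := Finset.exists_ne_zero_of_sum_ne_zero hi
    have haI : a ∈ I := by
      refine Finset.mem_filter.2 ⟨ha, fun h0 => h ?_⟩
      rw [h0, zero_mul, coeff_zero]
    refine (hmle a haI).trans (real_le_of_coeff_mul_pow_ne_zero (v := (A a).order) (g := s)
      (fun i hi => by exact_mod_cast order_le_of_coeff_ne_zero hi) (fun i hi => ?_) h)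
    refine hsγ.trans ?_
    have h1 : (z - y).coeff i ≠ 0 := by
      rw [← neg_sub, coeff_neg, neg_ne_zero]
      exact hi
    exact_mod_cast (le_of_coeff_sub_truncLT_ne_zero h1).1
  have e2 : addPoly p N A y = addPoly p N α y +
      ∑ a ∈ Finset.range N, (A a - α a) * y ^ p ^ a := by
    rw [addPoly, addPoly, ← Finset.sum_add_distrib]
    exact Finset.sum_congr rfl fun a _ => by ring
  have e3 : truncReal m (addPoly p N α y) = addPoly p N α y := by
    refine truncReal_eq_self fun i hi => ?_
    rw [addPoly, coeff_sum'] at hi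
    obtain ⟨a, ha, h⟩ := Finset.exists_ne_zero_of_sum_ne_zero hi
    have haJ : a ∈ J := by
      by_contra hJ
      have hαa : α a = 0 := if_neg hJ
      rw [hαa, zero_mul, coeff_zero] at h
      exact h rfl
    have hαa : α a = single (A a).order ((A a).coeff (A a).order) := if_pos haJ
    rw [hαa] at h
    obtain ⟨u, v, hu, hv, rfl⟩ := exists_of_coeff_mul_ne_zero h
    rw [eq_of_mem_support_single hu, (Finset.mem_filter.1 haJ).2]
    rw [coeff_pow_char_pow] at hv
    have hpa : (0 : ℝ) < (p : ℝ) ^ a := pow_pos (by exact_mod_cast hp.out.pos) a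
    have h1 := hlt _ fun h0 => hv (by rw [h0, zero_pow (pow_ne_zero _ hp.out.ne_zero)])
    push_cast at h1 ⊢
    rw [div_lt_iff₀ hpa] at h1
    linarith
  have e4 : ∀ a ∈ Finset.range N, truncReal m ((A a - α a) * y ^ p ^ a) =
      truncReal m ((A a - α a) * truncLT j y ^ p ^ a) := by
    intro a ha
    refine truncReal_eq_of_sub fun i hi => ?_
    rw [← mul_sub, ← sub_pow_char_pow] at hi
    have := real_le_of_coeff_mul_pow_ne_zero (g := j)
      (hjc2 a ha j (hjmax a ha)) (fun i hi => by
        exact_mod_cast (le_of_coeff_sub_truncLT_ne_zero hi).1) hi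
    linarith
  -- The additive equation for y. Its right side is algebraic and some α_a is nonzero, so y is
  -- algebraic.
  have e5 : addPoly p N α y = truncReal m (addPoly p N A z) -
      ∑ a ∈ Finset.range N, truncReal m ((A a - α a) * truncLT j y ^ p ^ a) := by
    rw [← e1, e2, truncReal_add, e3, truncReal_sum, Finset.sum_congr rfl e4, add_sub_cancel_right]
  refine mem_algField_of_addPoly (N := N) p (fun a => (hα a).1) ⟨a₀, (Finset.mem_filter.1 ha₀).1, ?_⟩ ?_
  · have hαa : α a₀ = single (A a₀).order ((A a₀).coeff (A a₀).order) :=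
      if_pos (Finset.mem_filter.2 ⟨ha₀, hma₀⟩)
    rw [hαa]
    refine single_ne_zero ?_
    rw [Ne, coeff_order_eq_zero]
    exact (Finset.mem_filter.1 ha₀).2
  · rw [e5]
    refine sub_mem (hB.truncReal_mem m) (sum_mem fun a _ => IsAlgTrunc.truncReal_mem ?_ m)
    exact (algTrunc k).mul_mem ((algTrunc k).sub_mem (hA a) (hα a))
      ((algTrunc k).pow_mem (htr' j hjs) _)

end AlgTrunc

/-! ### Admissible coefficient rings: all series, or those with algebraic truncations. -/

section Admissible

set_option linter.unusedSectionVars false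

variable {k : Type*} [Field k]

/-- A perfect ring of generalized power series that contains the monomials. -/
structure IsPerfectSub (p : ℕ) (L : Subring (HahnSeries ℚ k)) : Prop where
  single_mem : ∀ q a, single q a ∈ L
  root_mem : ∀ h, h ^ p ∈ L → h ∈ L

/-- A perfect ring of generalized power series that contains the monomials and is closed under
truncations and under solving additive polynomial equations. -/
structure IsAdmissible (p : ℕ) [Fact p.Prime] (L : Subring (HahnSeries ℚ k)) : Prop
    extends IsPerfectSub p L where
  trunc_mem : ∀ j, ∀ h ∈ L, truncLT j h ∈ L
  solve : ∀ (N : ℕ) (A : ℕ → HahnSeries ℚ k) (B : HahnSeries ℚ k) (g β : ℚ),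
    (∀ a, A a ∈ L) → B ∈ L → (∀ i, B.coeff i ≠ 0 → β ≤ i) →
    (∃ a ∈ Finset.range N, ∃ e, (A a).coeff e ≠ 0 ∧ e + p ^ a * g ≤ β) →
    ∃ z ∈ L, (∀ i, z.coeff i ≠ 0 → g ≤ i) ∧ addPoly p N A z = B

variable (p : ℕ) [hp : Fact p.Prime] [CharP k p]

lemma isPerfectSub_algField : IsPerfectSub p (algField k).toSubring :=
  ⟨single_mem_algField, fun _ h => mem_algField_of_pow hp.out.pos h⟩

lemma isAdmissible_top [IsAlgClosed k] : IsAdmissible p (⊤ : Subring (HahnSeries ℚ k)) where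
  single_mem _ _ := trivial
  root_mem _ _ := trivial
  trunc_mem _ _ _ := trivial
  solve N A B g β _ _ hB hA := by
    obtain ⟨z, hz⟩ := exists_addPoly_eq N A B g β hB hA
    exact ⟨z, trivial, hz⟩

lemma isAdmissible_algTrunc [IsAlgClosed k] : IsAdmissible p (algTrunc k) where
  single_mem := isAlgTrunc_single
  root_mem _ h := IsAlgTrunc.of_pow p h
  trunc_mem j _ h := IsAlgTrunc.trunc h j
  solve N A B g β hAL hBL hB hA := by
    obtain ⟨z, hz1, hz2⟩ := exists_addPoly_eq N A B g β hB hA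
    refine ⟨z, IsAlgTrunc.of_addPoly hAL ?_ (hz2 ▸ hBL), hz1, hz2⟩
    obtain ⟨a, ha, e, he, -⟩ := hA
    exact ⟨a, ha, fun h => he (by rw [h, coeff_zero])⟩

end Admissible

end Hahn

/-! ### Reduction of O modulo its maximal ideal, extended to K. -/

section Residue

set_option linter.unusedSectionVars false

variable {p : ℕ} {O K : Type*} [CommRing O] [NormedField K] [Algebra O K]
  [hp : Fact p.Prime] [IsUltrametricDist K] [CompleteSpace K]
  [IsDomain O] [IsDiscreteValuationRing O] [IsFractionRing O K] [hN : IsNormalizedAbs p O K]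
  {lam : O} [hl : Fact (Irreducible lam)]

open IsLocalRing

variable (K) in
/-- The absolute value of the uniformizer `lam`. -/
def rho (lam : O) : ℝ := ‖algebraMap O K lam‖

include hN in
lemma norm_algebraMap_eq_one {a : O} (ha : IsUnit a) : ‖algebraMap O K a‖ = 1 := by
  obtain ⟨u, rfl⟩ := ha
  exact norm_unit K hN u

include hN in
lemma norm_algebraMap_lt_one_iff (a : O) : ‖algebraMap O K a‖ < 1 ↔ residue O a = 0 := by
  rw [residue_eq_zero_iff, mem_maximalIdeal, mem_nonunits_iff]
  constructor
  · intro h hu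
    exact absurd (norm_algebraMap_eq_one (hN := hN) hu) h.ne
  · intro h
    refine lt_of_le_of_ne (norm_algebraMap_le_one K hN a) fun h1 => h ?_
    have ha0 : algebraMap O K a ≠ 0 := by
      intro h0
      rw [h0, norm_zero] at h1
      exact zero_ne_one h1
    obtain ⟨b, hb⟩ := (hN.norm_le_one_iff (algebraMap O K a)⁻¹).1 (by rw [norm_inv, h1, inv_one])
    refine IsUnit.of_mul_eq_one b ?_
    apply IsFractionRing.injective O K
    rw [map_mul, hb, map_one, mul_inv_cancel₀ ha0]

include hl in
variable (K) in
lemma rho_pos : 0 < rho K lam := by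
  rw [rho, norm_pos_iff]
  intro h
  exact hl.out.ne_zero ((map_eq_zero_iff _ (IsFractionRing.injective O K)).1 h)

lemma algebraMap_lam_ne_zero (K : Type*) [NormedField K] [Algebra O K] [IsFractionRing O K]
    {lam : O} [hl : Fact (Irreducible lam)] : algebraMap O K lam ≠ 0 :=
  fun h => hl.out.ne_zero ((map_eq_zero_iff _ (IsFractionRing.injective O K)).1 h)

include hN hl in
lemma rho_lt_one : rho K lam < 1 := by
  rw [rho, norm_algebraMap_lt_one_iff (hN := hN), residue_eq_zero_iff, mem_maximalIdeal]
  exact hl.out.not_isUnit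

include hN hl in
-- The valuation is discrete: an element of O that is not a unit is a multiple of the uniformizer.
-- This gap turns "small" into "at most ρ" throughout.
lemma norm_le_rho {x : K} (hx : ‖x‖ < 1) : ‖x‖ ≤ rho K lam := by
  obtain ⟨a, rfl⟩ := (hN.norm_le_one_iff x).1 hx.le
  rw [norm_algebraMap_lt_one_iff (hN := hN), residue_eq_zero_iff,
    (IsDiscreteValuationRing.irreducible_iff_uniformizer lam).1 hl.out,
    Ideal.mem_span_singleton] at hx
  obtain ⟨b, rfl⟩ := hx
  rw [map_mul, norm_mul]
  exact mul_le_of_le_one_right (norm_nonneg _) (norm_algebraMap_le_one K hN b)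

include hN hl in
lemma norm_p_le_rho : ‖(p : K)‖ ≤ rho K lam := by
  refine norm_le_rho (hN := hN) ?_
  rw [hN.norm_p]
  exact inv_lt_one_of_one_lt₀ (one_lt_base p)

include hN hl in
lemma exists_rho_pow_lt {ε : ℝ} (hε : 0 < ε) : ∃ N : ℕ, rho K lam ^ N < ε :=
  exists_pow_lt_of_lt_one hε (rho_lt_one (hN := hN))

include hN hl in
lemma eq_zero_of_forall_norm_le {x : K} (h : ∀ N : ℕ, ‖x‖ ≤ rho K lam ^ N) : x = 0 := by
  by_contra hne
  obtain ⟨N, hN'⟩ := exists_rho_pow_lt (hN := hN) (lam := lam) (norm_pos_iff.2 hne)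
  exact absurd (h N) (not_le.2 hN')

open Classical in
variable (O) in
/-- The residue class of an element of `K`, extended by zero outside of the unit disc. -/
def resK (p : ℕ) [hN : IsNormalizedAbs p O K] (x : K) : ResidueField O :=
  if h : ‖x‖ ≤ 1 then residue O ((hN.norm_le_one_iff x).1 h).choose else 0

lemma resK_algebraMap (a : O) : resK O p (algebraMap O K a) = residue O a := by
  have h := norm_algebraMap_le_one K hN a
  rw [resK, dif_pos h]
  congr 1
  exact IsFractionRing.injective O K ((hN.norm_le_one_iff _).1 h).choose_spec

@[simp] lemma resK_zero : resK O p (0 : K) = 0 := by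
  simpa using resK_algebraMap (p := p) (K := K) (0 : O)

lemma resK_eq_zero_iff {x : K} (hx : ‖x‖ ≤ 1) : resK O p x = 0 ↔ ‖x‖ < 1 := by
  obtain ⟨a, rfl⟩ := (hN.norm_le_one_iff x).1 hx
  rw [resK_algebraMap, norm_algebraMap_lt_one_iff (hN := hN)]

lemma norm_eq_one_of_resK_ne_zero {x : K} (hx : resK O p x ≠ 0) : ‖x‖ = 1 := by
  by_cases h : ‖x‖ ≤ 1
  · rw [Ne, resK_eq_zero_iff h, not_lt] at hx
    exact le_antisymm h hx
  · rw [resK, dif_neg h] at hx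
    exact absurd rfl hx

lemma resK_add {x y : K} (hx : ‖x‖ ≤ 1) (hy : ‖y‖ ≤ 1) :
    resK O p (x + y) = resK O p x + resK O p y := by
  obtain ⟨a, rfl⟩ := (hN.norm_le_one_iff x).1 hx
  obtain ⟨b, rfl⟩ := (hN.norm_le_one_iff y).1 hy
  rw [← map_add, resK_algebraMap, resK_algebraMap, resK_algebraMap, map_add]

lemma resK_mul {x y : K} (hx : ‖x‖ ≤ 1) (hy : ‖y‖ ≤ 1) :
    resK O p (x * y) = resK O p x * resK O p y := by
  obtain ⟨a, rfl⟩ := (hN.norm_le_one_iff x).1 hx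
  obtain ⟨b, rfl⟩ := (hN.norm_le_one_iff y).1 hy
  rw [← map_mul, resK_algebraMap, resK_algebraMap, resK_algebraMap, map_mul]

lemma resK_neg {x : K} (hx : ‖x‖ ≤ 1) : resK O p (-x) = -resK O p x := by
  obtain ⟨a, rfl⟩ := (hN.norm_le_one_iff x).1 hx
  rw [← map_neg, resK_algebraMap, resK_algebraMap, map_neg]

lemma resK_eq_of_norm_sub_lt {x y : K} (hy : ‖y‖ ≤ 1) (h : ‖x - y‖ < 1) :
    resK O p x = resK O p y := by
  have : x = (x - y) + y := by ring
  rw [this, resK_add h.le hy, (resK_eq_zero_iff h.le).2 h, zero_add]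

lemma norm_sum_le_one {ι : Type*} {s : Finset ι} {f : ι → K} (h : ∀ i ∈ s, ‖f i‖ ≤ 1) :
    ‖∑ i ∈ s, f i‖ ≤ 1 :=
  IsUltrametricDist.norm_sum_le_of_forall_le_of_nonneg zero_le_one h

lemma resK_sum {ι : Type*} (s : Finset ι) (f : ι → K) (h : ∀ i ∈ s, ‖f i‖ ≤ 1) :
    resK O p (∑ i ∈ s, f i) = ∑ i ∈ s, resK O p (f i) := by
  classical
  induction s using Finset.induction_on with
  | empty => simp
  | insert a s ha ih =>
    rw [Finset.sum_insert ha, Finset.sum_insert ha, resK_add (h a (Finset.mem_insert_self a s)),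
      ih fun i hi => h i (Finset.mem_insert_of_mem hi)]
    exact norm_sum_le_one fun i hi => h i (Finset.mem_insert_of_mem hi)

lemma norm_sub_sum_tsum_le {ι : Type*} {f : ι → K} (hf : Summable f) (s : Finset ι) {C : ℝ}
    (hC : 0 ≤ C) (h : ∀ i ∉ s, ‖f i‖ ≤ C) : ‖∑' i, f i - ∑ i ∈ s, f i‖ ≤ C := by
  rw [← hf.sum_add_tsum_subtype_compl s, add_sub_cancel_left]
  exact norm_tsum_le_of_forall hC fun i => h i i.2

include hl in
-- By discreteness the terms outside s are bounded uniformly by ρ < 1, hence so is their sum.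
lemma resK_tsum {ι : Type*} {f : ι → K} (hf : Summable f) (h1 : ∀ i, ‖f i‖ ≤ 1) (s : Finset ι)
    (h : ∀ i ∉ s, resK O p (f i) = 0) :
    resK O p (∑' i, f i) = ∑ i ∈ s, resK O p (f i) := by
  rw [← resK_sum s f fun i _ => h1 i]
  refine resK_eq_of_norm_sub_lt (norm_sum_le_one fun i _ => h1 i) ?_
  refine (norm_sub_sum_tsum_le hf s (rho_pos (lam := lam) K).le fun i hi => ?_).trans_lt
    (rho_lt_one (hN := hN))
  exact norm_le_rho (hN := hN) ((resK_eq_zero_iff (h1 i)).1 (h i hi))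

end Residue

/-! ### The sup norm on coefficients. -/

section SupNorm

set_option linter.unusedSectionVars false

variable {p : ℕ} {K : Type*} [NormedField K]
  [hp : Fact p.Prime] [IsUltrametricDist K] [CompleteSpace K]

/-- All coefficients have absolute value at most `C`. -/
def SupLe (x : GammaImmAnCon p K) (C : ℝ) : Prop := ∀ n, ‖x.coeff n‖ ≤ C

lemma SupLe.mono {x : GammaImmAnCon p K} {C D : ℝ} (hx : SupLe x C) (h : C ≤ D) : SupLe x D :=
  fun n => (hx n).trans h

lemma SupLe.add {x y : GammaImmAnCon p K} {C : ℝ} (hx : SupLe x C) (hy : SupLe y C) :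
    SupLe (x + y) C := fun n =>
  (IsUltrametricDist.norm_add_le_max _ _).trans (max_le (hx n) (hy n))

lemma SupLe.neg {x : GammaImmAnCon p K} {C : ℝ} (hx : SupLe x C) : SupLe (-x) C := fun n => by
  rw [GammaImmAnCon.coeff_neg, norm_neg]
  exact hx n

lemma SupLe.sub {x y : GammaImmAnCon p K} {C : ℝ} (hx : SupLe x C) (hy : SupLe y C) :
    SupLe (x - y) C := by
  rw [sub_eq_add_neg]
  exact hx.add hy.neg

lemma SupLe.mul {x y : GammaImmAnCon p K} {C D : ℝ} (hx : SupLe x C) (hy : SupLe y D) :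
    SupLe (x * y) (C * D) := fun n => by
  have hC : 0 ≤ C := (norm_nonneg _).trans (hx 0)
  have hD : 0 ≤ D := (norm_nonneg _).trans (hy 0)
  refine norm_tsum_le_of_forall (mul_nonneg hC hD) fun i => ?_
  rw [norm_mul]
  exact mul_le_mul (hx _) (hy _) (norm_nonneg _) hC

lemma supLe_zero {C : ℝ} (hC : 0 ≤ C) : SupLe (0 : GammaImmAnCon p K) C := fun n => by
  simpa using hC

lemma SupLe.trans_sub {x y z : GammaImmAnCon p K} {C : ℝ} (h1 : SupLe (x - y) C)
    (h2 : SupLe (y - z) C) : SupLe (x - z) C := by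
  have := h1.add h2
  rwa [sub_add_sub_cancel] at this

lemma SupLe.symm_sub {x y : GammaImmAnCon p K} {C : ℝ} (h1 : SupLe (x - y) C) :
    SupLe (y - x) C := by
  have := h1.neg
  rwa [neg_sub] at this

lemma mem_immCon_iff {x : GammaImmAnCon p K} : x ∈ GammaImmCon p K ↔ SupLe x 1 := Iff.rfl

lemma SupLe.mul_left {x y : GammaImmAnCon p K} {C : ℝ} (hx : x ∈ GammaImmCon p K)
    (hy : SupLe y C) : SupLe (x * y) C := by
  have := SupLe.mul (mem_immCon_iff.1 hx) hy
  rwa [one_mul] at this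

lemma SupLe.const_mul {x : GammaImmAnCon p K} {C : ℝ} (a : K) (hx : SupLe x C) :
    SupLe (GammaImmAnCon.constHom a * x) (‖a‖ * C) := fun n => by
  rw [GammaImmAnCon.coeff_constHom_mul, norm_mul]
  exact mul_le_mul_of_nonneg_left (hx n) (norm_nonneg _)

lemma coeff_sum {ι : Type*} (s : Finset ι) (f : ι → GammaImmAnCon p K) (n : ℚ) :
    (∑ i ∈ s, f i).coeff n = ∑ i ∈ s, (f i).coeff n := by
  classical
  induction s using Finset.induction_on with
  | empty => simp
  | insert a s ha ih =>
    rw [Finset.sum_insert ha, Finset.sum_insert ha, GammaImmAnCon.coeff_add, ih]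

lemma exists_of_coeff_mul_ne_zero {x y : GammaImmAnCon p K} {n : ℚ} (h : (x * y).coeff n ≠ 0) :
    ∃ i j, x.coeff i ≠ 0 ∧ y.coeff j ≠ 0 ∧ i + j = n := by
  by_contra! hc
  apply h
  rw [GammaImmAnCon.coeff_mul]
  convert tsum_zero with i
  by_contra hne
  obtain ⟨h1, h2⟩ := mul_ne_zero_iff.1 hne
  exact hc i (n - i) h1 h2 (by ring)

lemma coeff_pow_ne_zero_le {x : GammaImmAnCon p K} {a : ℚ} (h : ∀ i, x.coeff i ≠ 0 → a ≤ i)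
    {m : ℕ} {i : ℚ} (hi : (x ^ m).coeff i ≠ 0) : m * a ≤ i := by
  induction m generalizing i with
  | zero =>
    rw [pow_zero, ← map_one GammaImmAnCon.constHom, GammaImmAnCon.coeff_constHom] at hi
    have hu0 : i = 0 := by
      by_contra hne
      simp [hne] at hi
    simp [hu0]
  | succ m ih =>
    rw [pow_succ] at hi
    obtain ⟨u, v, hu, hv, rfl⟩ := exists_of_coeff_mul_ne_zero hi
    have h1 := ih hu
    have h2 := h v hv
    push_cast
    linarith

lemma coeff_pow_ne_zero_lt {x : GammaImmAnCon p K} {a : ℚ} (h : ∀ i, x.coeff i ≠ 0 → i < a)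
    {m : ℕ} (hm : m ≠ 0) {i : ℚ} (hi : (x ^ m).coeff i ≠ 0) : i < m * a := by
  induction m generalizing i with
  | zero => exact absurd rfl hm
  | succ m ih =>
    rw [pow_succ] at hi
    obtain ⟨u, v, hu, hv, rfl⟩ := exists_of_coeff_mul_ne_zero hi
    rcases eq_or_ne m 0 with rfl | h0
    · rw [pow_zero, ← map_one GammaImmAnCon.constHom, GammaImmAnCon.coeff_constHom] at hu
      have hu0 : u = 0 := by
        by_contra hne
        simp [hne] at hu
      have := h v hv
      subst hu0
      push_cast
      linarith
    · have h1 := ih h0 hu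
      have h2 := h v hv
      push_cast
      linarith

lemma GammaImmAnCon.isPWO (x : GammaImmAnCon p K) {ε : ℝ} (hε : 0 < ε) :
    {n : ℚ | ε ≤ ‖x.coeff n‖}.IsPWO := by
  refine (x.isImmAnCon.isWF (Real.logb p (ε / 2))).isPWO.mono fun n hn => ?_
  show (p : ℝ) ^ Real.logb p (ε / 2) < ‖x.coeff n‖
  rw [Real.rpow_logb (base_pos p) (one_lt_base p).ne' (by positivity)]
  have : ε ≤ ‖x.coeff n‖ := hn
  linarith

lemma isImmAnCon_of_bounded {f : ℚ → K} {B : ℝ} (hB : ∀ n, ‖f n‖ ≤ B) {a : ℚ}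
    (ha : ∀ n, f n ≠ 0 → a ≤ n) (h : ∀ ε : ℝ, 0 < ε → {n | ε ≤ ‖f n‖}.IsPWO) :
    IsImmAnCon p f where
  isWF r := by
    refine ((h _ (Real.rpow_pos_of_pos (base_pos p) r)).mono fun n hn => ?_).isWF
    exact le_of_lt (show (p : ℝ) ^ r < ‖f n‖ from hn)
  bounded j := ⟨B, fun n _ => hB n⟩
  neg := ⟨1, one_pos, by
    filter_upwards [eventually_lt_atBot a] with n hn
    have : f n = 0 := by
      by_contra hne
      exact absurd (ha n hne) (not_le.2 hn)
    rw [this, norm_zero]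
    exact Real.rpow_pos_of_pos (base_pos p) _⟩
  pos d hd := by
    have h0 : 0 < (|B| + 1)⁻¹ := by positivity
    filter_upwards [eventually_rpow_lt_atTop p (neg_neg_of_pos hd) h0] with n hn
    have h1 : (p : ℝ) ^ (-d * (n : ℝ)) = ((p : ℝ) ^ (d * (n : ℝ)))⁻¹ := by
      rw [neg_mul, Real.rpow_neg (base_pos p).le]
    rw [h1, inv_lt_inv₀ (Real.rpow_pos_of_pos (base_pos p) _) (by positivity)] at hn
    exact ((hB n).trans (le_abs_self B)).trans_lt ((lt_add_one _).trans hn)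

/-- Uniform limits of sequences of integral series with support bounded below. -/
lemma exists_limit {r : ℝ} (hr0 : 0 < r) (hr : r < 1) {x : ℕ → GammaImmAnCon p K} {B : ℝ}
    (hB : ∀ m, SupLe (x m) B)
    (hx : ∀ m, SupLe (x (m + 1) - x m) (r ^ m)) {a : ℚ} (ha : ∀ m n, (x m).coeff n ≠ 0 → a ≤ n) :
    ∃ X : GammaImmAnCon p K, (∀ m, SupLe (X - x m) (r ^ m)) ∧
      ∀ n, X.coeff n ≠ 0 → ∃ m, (x m).coeff n ≠ 0 := by
  have hdist : ∀ m i, SupLe (x (m + i) - x m) (r ^ m) := by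
    intro m i
    induction i with
    | zero =>
      rw [add_zero, sub_self]
      exact supLe_zero (by positivity)
    | succ i ih =>
      have h1 : SupLe (x (m + i + 1) - x (m + i)) (r ^ m) :=
        (hx (m + i)).mono (pow_le_pow_of_le_one hr0.le hr.le (Nat.le_add_right _ _))
      exact h1.trans_sub ih
  have hc : ∀ n, ∃ l, Tendsto (fun m => (x m).coeff n) atTop (𝓝 l) := by
    intro n
    refine cauchySeq_tendsto_of_complete (cauchySeq_of_le_geometric r 1 hr fun m => ?_)
    rw [dist_comm, dist_eq_norm, one_mul, ← GammaImmAnCon.coeff_sub]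
    exact hx m n
  choose f hf using hc
  have hfd : ∀ m n, ‖f n - (x m).coeff n‖ ≤ r ^ m := by
    intro m n
    have h1 : Tendsto (fun i => ‖(x i).coeff n - (x m).coeff n‖) atTop
        (𝓝 ‖f n - (x m).coeff n‖) := ((hf n).sub_const _).norm
    refine le_of_tendsto h1 ?_
    filter_upwards [eventually_ge_atTop m] with i hi
    obtain ⟨j, rfl⟩ := Nat.exists_eq_add_of_le hi
    rw [← GammaImmAnCon.coeff_sub]
    exact hdist m j n
  have hne : ∀ n, f n ≠ 0 → ∃ m, (x m).coeff n ≠ 0 := by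
    intro n hn
    by_contra! h
    exact hn (tendsto_nhds_unique (by simpa only [h] using hf n) tendsto_const_nhds)
  have him : IsImmAnCon p f := by
    refine isImmAnCon_of_bounded (B := B)
      (fun n => le_of_tendsto (hf n).norm (Eventually.of_forall fun m => hB m n)) (a := a)
      (fun n hn => ?_) fun ε hε => ?_
    · obtain ⟨m, hm⟩ := hne n hn
      exact ha m n hm
    · obtain ⟨m, hm⟩ := exists_pow_lt_of_lt_one hε hr
      refine ((x m).isPWO hε).mono fun n hn => ?_
      by_contra hlt
      have hlt' : ‖(x m).coeff n‖ < ε := not_le.1 hlt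
      have e : f n = (f n - (x m).coeff n) + (x m).coeff n := by ring
      have h2 : ε ≤ ‖f n‖ := hn
      rw [e] at h2
      exact absurd (h2.trans (IsUltrametricDist.norm_add_le_max _ _))
        (not_le.2 (max_lt ((hfd m n).trans_lt hm) hlt'))
  exact ⟨⟨f, him⟩, fun m n => by rw [GammaImmAnCon.coeff_sub]; exact hfd m n, hne⟩

end SupNorm

/-! ### The Frobenius automorphism φ and the reduction of integral series. -/

section Frobenius

set_option linter.unusedSectionVars false

variable {p : ℕ} {O K : Type*} [CommRing O] [NormedField K] [Algebra O K]
  [hp : Fact p.Prime] [IsUltrametricDist K] [CompleteSpace K]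
  [IsDomain O] [IsDiscreteValuationRing O] [IsFractionRing O K] [hN : IsNormalizedAbs p O K]
  {lam : O} [hl : Fact (Irreducible lam)] {σ : O ≃+* O}

open IsLocalRing

variable (K) in
/-- The automorphism of `K` induced by `σ`. -/
def tau (σ : O ≃+* O) : RingAut K := IsFractionRing.ringEquivOfRingEquiv (K := K) (L := K) σ

include hN in
lemma norm_tau (x : K) : ‖tau K σ x‖ = ‖x‖ := norm_ringEquiv K hN σ x

lemma tau_algebraMap (a : O) : tau K σ (algebraMap O K a) = algebraMap O K (σ a) :=
  IsFractionRing.ringEquivOfRingEquiv_algebraMap σ a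

include hN in
lemma norm_tau_zpow (j : ℤ) (x : K) : ‖(tau K σ ^ j) x‖ = ‖x‖ := by
  have hinv : ∀ x : K, ‖(tau K σ)⁻¹ x‖ = ‖x‖ := fun x => by
    rw [← norm_tau (hN := hN) (σ := σ), ← RingAut.mul_apply, mul_inv_cancel, RingAut.one_apply]
  induction j generalizing x with
  | zero => rw [zpow_zero, RingAut.one_apply]
  | succ i ih => rw [zpow_add_one, RingAut.mul_apply, ih, norm_tau (hN := hN)]
  | pred i ih => rw [zpow_sub_one, RingAut.mul_apply, ih, hinv]

lemma frobImm_bijective : Function.Bijective (frobImm p K σ) := by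
  have hp0 := base_pos p
  have hpq : (0 : ℚ) < p := by exact_mod_cast hp.out.pos
  constructor
  · intro x y h
    ext n
    have h1 := congr_arg (fun z => z.coeff (n * p)) h
    simp only [coeff_frobImm, mul_div_cancel_right₀ _ hpq.ne'] at h1
    exact (IsFractionRing.ringEquivOfRingEquiv σ).injective h1
  · intro x
    let e := IsFractionRing.ringEquivOfRingEquiv (K := K) (L := K) σ
    have hn : ∀ a, ‖e.symm a‖ = ‖a‖ := fun a => by
      rw [← norm_ringEquiv K hN σ]
      show ‖e (e.symm a)‖ = _
      rw [e.apply_symm_apply]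
    refine ⟨⟨fun n => e.symm (x.coeff (n * p)), ?_⟩, ?_⟩
    · obtain ⟨c, hc, h⟩ := x.exists_good
      refine isImmAnCon_iff.2 ⟨c * p, by positivity, fun s hs hsc => ?_⟩
      obtain ⟨⟨B, hB, h1⟩, h2⟩ := h (s / p) (by positivity) ((div_le_iff₀ hp0).2 hsc)
      have key : ∀ n : ℚ, ‖e.symm (x.coeff (n * p))‖ * wt p s n =
          ‖x.coeff (n * p)‖ * wt p (s / p) (n * p) := by
        intro n
        rw [hn]
        unfold wt
        congr 3
        push_cast
        field_simp
      refine ⟨⟨B, hB, fun n => (key n).trans_le (h1 _)⟩, fun ε hε => ?_⟩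
      refine ((h2 ε hε).image_of_monotone (f := fun n : ℚ => n / p)
        (fun a b hab => div_le_div_of_nonneg_right hab hpq.le)).mono fun n hn => ?_
      refine ⟨n * p, ?_, by field_simp⟩
      have hn' : ε ≤ ‖e.symm (x.coeff (n * p))‖ * wt p s n := hn
      rw [key] at hn'
      exact hn'
    · ext n
      rw [coeff_frobImm]
      show e (e.symm (x.coeff (n / p * p))) = _
      rw [e.apply_symm_apply, div_mul_cancel₀ _ hpq.ne']

variable (p K) in
/-- The Frobenius as an automorphism of `Γ^imm_{an,con}`. -/
def phi (σ : O ≃+* O) : RingAut (GammaImmAnCon p K) :=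
  RingEquiv.ofBijective (frobImm p K σ) frobImm_bijective

lemma coeff_phi (x : GammaImmAnCon p K) (n : ℚ) :
    (phi p K σ x).coeff n = tau K σ (x.coeff (n / p)) := rfl

lemma coeff_phi_zpow (j : ℤ) (x : GammaImmAnCon p K) (n : ℚ) :
    ((phi p K σ ^ j) x).coeff n = (tau K σ ^ j) (x.coeff (n / (p : ℚ) ^ j)) := by
  have hpq : (p : ℚ) ≠ 0 := by exact_mod_cast hp.out.ne_zero
  have hinv : ∀ (x : GammaImmAnCon p K) n,
      ((phi p K σ)⁻¹ x).coeff n = (tau K σ)⁻¹ (x.coeff (n * p)) := fun x n => by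
    have h : x = phi p K σ ((phi p K σ)⁻¹ x) := by
      rw [← RingAut.mul_apply, mul_inv_cancel, RingAut.one_apply]
    conv_rhs => rw [h, coeff_phi, mul_div_cancel_right₀ _ hpq, ← RingAut.mul_apply,
      inv_mul_cancel, RingAut.one_apply]
  induction j generalizing x n with
  | zero => simp
  | succ i ih =>
    rw [zpow_add_one, zpow_add_one, RingAut.mul_apply, RingAut.mul_apply, ih, coeff_phi,
      zpow_add_one₀ hpq, div_div]
  | pred i ih =>
    rw [zpow_sub_one, zpow_sub_one, RingAut.mul_apply, RingAut.mul_apply, ih, hinv,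
      zpow_sub_one₀ hpq]
    congr 3
    field_simp

lemma norm_coeff_phi_zpow (j : ℤ) (x : GammaImmAnCon p K) (n : ℚ) :
    ‖((phi p K σ ^ j) x).coeff n‖ = ‖x.coeff (n / (p : ℚ) ^ j)‖ := by
  rw [coeff_phi_zpow, norm_tau_zpow (hN := hN)]

lemma SupLe.phi_zpow {x : GammaImmAnCon p K} {C : ℝ} (hx : SupLe x C) (j : ℤ) :
    SupLe ((phi p K σ ^ j) x) C := fun n => by
  rw [norm_coeff_phi_zpow]
  exact hx _

lemma SupLe.phi {x : GammaImmAnCon p K} {C : ℝ} (hx : SupLe x C) :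
    SupLe (phi p K σ x) C := by
  simpa using hx.phi_zpow (σ := σ) 1

lemma supLe_phi_iff {x : GammaImmAnCon p K} {C : ℝ} :
    SupLe (phi p K σ x) C ↔ SupLe x C := by
  refine ⟨fun h => ?_, SupLe.phi⟩
  have := h.phi_zpow (σ := σ) (-1)
  rwa [zpow_neg_one, ← RingAut.mul_apply, inv_mul_cancel, RingAut.one_apply] at this

lemma phi_const (a : O) :
    phi p K σ (GammaImmAnCon.constHom (algebraMap O K a)) =
      GammaImmAnCon.constHom (algebraMap O K (σ a)) := frobImm_constHom σ a

/-- The reduction of an integral series. -/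
def red (x : GammaImmAnCon p K) : HahnSeries ℚ (ResidueField O) :=
  ⟨fun n => resK O p (x.coeff n), (x.isPWO one_pos).mono fun _ hn =>
    (norm_eq_one_of_resK_ne_zero hn).ge⟩

lemma coeff_red (x : GammaImmAnCon p K) (n : ℚ) :
    (red (O := O) x).coeff n = resK O p (x.coeff n) := rfl

lemma red_zero : red (O := O) (0 : GammaImmAnCon p K) = 0 := by
  ext n
  rw [coeff_red, GammaImmAnCon.coeff_zero, resK_zero, HahnSeries.coeff_zero]

lemma red_add {x y : GammaImmAnCon p K} (hx : x ∈ GammaImmCon p K) (hy : y ∈ GammaImmCon p K) :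
    red (O := O) (x + y) = red x + red y := by
  ext n
  rw [HahnSeries.coeff_add, coeff_red, coeff_red, coeff_red, GammaImmAnCon.coeff_add,
    resK_add (hx n) (hy n)]

lemma red_neg {x : GammaImmAnCon p K} (hx : x ∈ GammaImmCon p K) :
    red (O := O) (-x) = -red x := by
  ext n
  rw [HahnSeries.coeff_neg, coeff_red, coeff_red, GammaImmAnCon.coeff_neg, resK_neg (hx n)]

lemma red_sub {x y : GammaImmAnCon p K} (hx : x ∈ GammaImmCon p K) (hy : y ∈ GammaImmCon p K) :
    red (O := O) (x - y) = red x - red y := by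
  rw [sub_eq_add_neg, red_add hx (neg_mem hy), red_neg hy, sub_eq_add_neg]

lemma red_eq_zero_iff {x : GammaImmAnCon p K} (hx : x ∈ GammaImmCon p K) :
    red (O := O) x = 0 ↔ ∀ n, ‖x.coeff n‖ < 1 := by
  rw [HahnSeries.ext_iff, funext_iff]
  refine forall_congr' fun n => ?_
  rw [coeff_red, HahnSeries.coeff_zero, resK_eq_zero_iff (hx n)]

include hl in
lemma supLe_rho_of_red_eq_zero {x : GammaImmAnCon p K} (hx : x ∈ GammaImmCon p K)
    (h : red (O := O) x = 0) : SupLe x (rho K lam) := fun n =>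
  norm_le_rho (hN := hN) ((red_eq_zero_iff hx).1 h n)

include hl in
lemma red_eq_zero_of_supLe {x : GammaImmAnCon p K} (h : SupLe x (rho K lam)) :
    red (O := O) x = 0 := by
  have hr := rho_lt_one (hN := hN) (lam := lam)
  rw [red_eq_zero_iff fun n => (h n).trans hr.le]
  exact fun n => (h n).trans_lt hr

include hl in
lemma red_eq_of_supLe_sub {x y : GammaImmAnCon p K} (hy : y ∈ GammaImmCon p K)
    (h : SupLe (x - y) (rho K lam)) : red (O := O) x = red y := by
  have e : x = (x - y) + y := by ring
  have hr := rho_lt_one (hN := hN) (lam := lam)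
  rw [e, red_add (mem_immCon_iff.2 (h.mono hr.le)) hy, red_eq_zero_of_supLe h, zero_add]

include hl in
lemma supLe_sub_of_red_eq {x y : GammaImmAnCon p K} (hx : x ∈ GammaImmCon p K)
    (hy : y ∈ GammaImmCon p K) (h : red (O := O) x = red y) : SupLe (x - y) (rho K lam) :=
  supLe_rho_of_red_eq_zero (O := O) (sub_mem hx hy) (by rw [red_sub hx hy, h, sub_self])

include hl in
-- A coefficient of the product is an infinite sum over K, but only the finitely many pairs with
-- both factors units survive reduction; these are the antidiagonal of the reduced supports.
lemma red_mul {x y : GammaImmAnCon p K} (hx : x ∈ GammaImmCon p K) (hy : y ∈ GammaImmCon p K) :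
    red (O := O) (x * y) = red x * red y := by
  ext n
  rw [coeff_red, GammaImmAnCon.coeff_mul, HahnSeries.coeff_mul]
  obtain ⟨s, h1, h2, -⟩ := GammaImmAnCon.exists_good₃ x y y
  rw [resK_tsum (lam := lam) (h1.summable h2 n) (fun i => by
      rw [norm_mul]
      exact mul_le_one₀ (hx i) (norm_nonneg _) (hy _))
    ((Finset.antidiagonal (red (O := O) x).isPWO_support
      (red (O := O) y).isPWO_support n).image Prod.fst)]
  · rw [Finset.sum_image]
    · refine Finset.sum_congr rfl fun ij hij => ?_
      have h3 : ij.1 + ij.2 = n := by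
        simp only [Finset.mem_antidiagonal] at hij
        exact hij.2.2
      rw [resK_mul (hx _) (hy _), coeff_red, coeff_red, ← h3, add_sub_cancel_left]
    · intro a ha b hb hab
      have ha' : a.1 + a.2 = n := by
        have := Finset.mem_coe.1 ha
        simp only [Finset.mem_antidiagonal] at this
        exact this.2.2
      have hb' : b.1 + b.2 = n := by
        have := Finset.mem_coe.1 hb
        simp only [Finset.mem_antidiagonal] at this
        exact this.2.2
      refine Prod.ext hab ?_
      have : a.1 = b.1 := hab
      linarith
  · intro i hi
    rw [resK_mul (hx _) (hy _)]
    by_contra hne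
    obtain ⟨h3, h4⟩ := mul_ne_zero_iff.1 hne
    apply hi
    refine Finset.mem_image.2 ⟨(i, n - i), ?_, rfl⟩
    simp only [Finset.mem_antidiagonal]
    exact ⟨h3, h4, by ring⟩

lemma red_const (a : O) : red (O := O) (GammaImmAnCon.constHom (algebraMap O K a) :
    GammaImmAnCon p K) = HahnSeries.single 0 (residue O a) := by
  ext n
  rw [coeff_red, GammaImmAnCon.coeff_constHom, HahnSeries.coeff_single]
  split_ifs
  · exact resK_algebraMap a
  · exact resK_zero

include hl in
lemma red_pow {x : GammaImmAnCon p K} (hx : x ∈ GammaImmCon p K) (m : ℕ) :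
    red (O := O) (x ^ m) = red x ^ m := by
  induction m with
  | zero =>
    have := red_const (p := p) (K := K) (1 : O)
    simp only [map_one] at this
    rw [pow_zero, pow_zero, this]
    rfl
  | succ m ih => rw [pow_succ, pow_succ, red_mul (lam := lam) (pow_mem hx m) hx, ih]

variable [CharP (ResidueField O) p] [hs : Fact (∀ a : O, σ a - a ^ p ∈ maximalIdeal O)]

include hs in
lemma resK_tau {x : K} (hx : ‖x‖ ≤ 1) : resK O p (tau K σ x) = resK O p x ^ p := by
  obtain ⟨a, rfl⟩ := (hN.norm_le_one_iff x).1 hx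
  rw [tau_algebraMap, resK_algebraMap, resK_algebraMap, ← map_pow, ← sub_eq_zero, ← map_sub,
    residue_eq_zero_iff]
  exact hs.out a

include hs in
lemma red_phi {x : GammaImmAnCon p K} (hx : x ∈ GammaImmCon p K) :
    red (O := O) (phi p K σ x) = red x ^ p := by
  ext n
  rw [coeff_red, coeff_phi, resK_tau (hx _), Hahn.coeff_pow_char, coeff_red]

lemma exists_lift (h : HahnSeries ℚ (ResidueField O)) :
    ∃ x ∈ GammaImmCon p K, red x = h ∧ ∀ n, x.coeff n ≠ 0 → h.coeff n ≠ 0 := by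
  classical
  -- Sending 0 to 0 keeps the support of the lift inside that of h.
  let s : ResidueField O → O := fun a => if a = 0 then 0 else (residue_surjective a).choose
  have hs : ∀ a, residue O (s a) = a := by
    intro a
    by_cases h : a = 0
    · simp [s, h]
    · simp only [s, if_neg h]
      exact (residue_surjective a).choose_spec
  have hf : ∀ n, ‖algebraMap O K (s (h.coeff n))‖ ≤ 1 := fun n => norm_algebraMap_le_one K hN _
  have hne : ∀ n, algebraMap O K (s (h.coeff n)) ≠ 0 → h.coeff n ≠ 0 := by
    intro n hn h0
    rw [h0] at hn
    simp [s] at hn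
  refine ⟨⟨fun n => algebraMap O K (s (h.coeff n)), isImmAnCon_of_bounded hf (a := h.order)
    (fun n hn => HahnSeries.order_le_of_coeff_ne_zero (hne n hn)) fun ε hε =>
      h.isPWO_support.mono fun n hn => hne n ?_⟩, hf, ?_, hne⟩
  · intro h0
    have : ε ≤ ‖algebraMap O K (s (h.coeff n))‖ := hn
    rw [h0, norm_zero] at this
    linarith
  · ext n
    rw [coeff_red, resK_algebraMap, hs]

end Frobenius

/-! ### Teichmüller lifts. -/

section Teichmuller

set_option linter.unusedSectionVars false

variable {p : ℕ} {O K : Type*} [CommRing O] [NormedField K] [Algebra O K]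
  [hp : Fact p.Prime] [IsUltrametricDist K] [CompleteSpace K]
  [IsDomain O] [IsDiscreteValuationRing O] [IsFractionRing O K] [hN : IsNormalizedAbs p O K]
  {lam : O} [hl : Fact (Irreducible lam)] {σ : O ≃+* O}

open IsLocalRing

lemma natCast_eq_constHom (m : ℕ) :
    (m : GammaImmAnCon p K) = GammaImmAnCon.constHom (m : K) := (map_natCast _ m).symm

include hN hl in
lemma SupLe.p_mul {x : GammaImmAnCon p K} {C : ℝ} (hx : SupLe x C) (hC : 0 ≤ C) :
    SupLe ((p : GammaImmAnCon p K) * x) (rho K lam * C) := by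
  rw [natCast_eq_constHom]
  exact (hx.const_mul _).mono (mul_le_mul_of_nonneg_right (norm_p_le_rho (hN := hN)) hC)

lemma SupLe.pow {x : GammaImmAnCon p K} {C : ℝ} (hx : SupLe x C) {m : ℕ} (hm : m ≠ 0) :
    SupLe (x ^ m) (C ^ m) := by
  induction m with
  | zero => exact absurd rfl hm
  | succ m ih =>
    rcases eq_or_ne m 0 with rfl | h
    · simpa using hx
    · rw [pow_succ, pow_succ]
      exact (ih h).mul hx

include hN hl in
-- With a = b + ε, the mixed terms of (b + ε)^p carry the factor pε, and λ divides p; the last term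
-- is ε^p, with p ≥ 2 and j ≥ 1.
lemma SupLe.pow_sub_pow {a b : GammaImmAnCon p K} (ha : a ∈ GammaImmCon p K)
    (hb : b ∈ GammaImmCon p K) {j : ℕ} (hj : j ≠ 0) (h : SupLe (a - b) (rho K lam ^ j)) :
    SupLe (a ^ p - b ^ p) (rho K lam ^ (j + 1)) := by
  have hr0 := rho_pos (lam := lam) K
  have hr1 := rho_lt_one (hN := hN) (lam := lam)
  obtain ⟨r, hr⟩ := exists_add_pow_prime_eq hp.out
    (⟨b, hb⟩ : GammaImmCon p K) (⟨a - b, sub_mem ha hb⟩ : GammaImmCon p K)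
  have hr' := congr_arg (Subtype.val) hr
  simp only [Subring.coe_add, Subring.coe_pow, Subring.coe_mul, Subring.coe_natCast,
    add_sub_cancel] at hr'
  have e : a ^ p - b ^ p = (a - b) ^ p + (p : GammaImmAnCon p K) * (b * ((a - b) * r)) := by
    rw [hr']; ring
  rw [e]
  refine SupLe.add ((h.pow hp.out.ne_zero).mono ?_) ?_
  · rw [← pow_mul]
    refine pow_le_pow_of_le_one hr0.le hr1.le ?_
    have := hp.out.two_le
    have : 1 ≤ j := Nat.one_le_iff_ne_zero.2 hj
    nlinarith
  · rw [pow_succ, mul_comm (rho K lam ^ j)]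
    refine SupLe.p_mul (SupLe.mul_left hb ?_) (pow_nonneg hr0.le j)
    rw [mul_comm]
    exact SupLe.mul_left r.2 h

include hN hl in
lemma SupLe.pow_pow_sub {a b : GammaImmAnCon p K} (ha : a ∈ GammaImmCon p K)
    (hb : b ∈ GammaImmCon p K) (h : SupLe (a - b) (rho K lam)) (m : ℕ) :
    SupLe (a ^ p ^ m - b ^ p ^ m) (rho K lam ^ (m + 1)) := by
  induction m with
  | zero => simpa using h
  | succ m ih =>
    rw [pow_succ p, pow_mul, pow_mul]
    exact SupLe.pow_sub_pow (pow_mem ha _) (pow_mem hb _) (Nat.succ_ne_zero m) ih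

include hN hl in
lemma eq_of_forall_supLe {x y : GammaImmAnCon p K} (h : ∀ m : ℕ, SupLe (x - y) (rho K lam ^ m)) :
    x = y := by
  ext n
  refine sub_eq_zero.1 (eq_zero_of_forall_norm_le (hN := hN) (lam := lam) fun m => ?_)
  rw [← GammaImmAnCon.coeff_sub]
  exact h m n

variable [CharP (ResidueField O) p] [hs : Fact (∀ a : O, σ a - a ^ p ∈ maximalIdeal O)]

include hs in
-- The lift is the limit of (φ^{-m} x)^{p^m} for any lift x of h. Here φ^{-m} divides exponents by
-- p^m and the power multiplies them back, so bounds on the support of h pass to the limit.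
lemma exists_teich (h : HahnSeries ℚ (ResidueField O)) :
    ∃ z : GammaImmAnCon p K, z ∈ GammaImmCon p K ∧ phi p K σ z = z ^ p ∧ red z = h ∧
      (∀ a : ℚ, (∀ n, h.coeff n ≠ 0 → a ≤ n) → ∀ n, z.coeff n ≠ 0 → a ≤ n) ∧
      (∀ b : ℚ, (∀ n, h.coeff n ≠ 0 → n < b) → ∀ n, z.coeff n ≠ 0 → n < b) := by
  obtain ⟨lam, hlam⟩ := IsDiscreteValuationRing.exists_irreducible O
  have hl : Fact (Irreducible lam) := ⟨hlam⟩
  have hr0 := rho_pos (lam := lam) K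
  have hr1 := rho_lt_one (hN := hN) (lam := lam)
  have hpq : (0 : ℚ) < p := by exact_mod_cast hp.out.pos
  obtain ⟨x, hx, hred, hsupp⟩ := exists_lift (p := p) (K := K) h
  let z : ℕ → GammaImmAnCon p K := fun m => ((phi p K σ ^ (-(m : ℤ))) x) ^ p ^ m
  have hphi : ∀ j : ℤ, (phi p K σ ^ j) x ∈ GammaImmCon p K := fun j =>
    SupLe.phi_zpow (mem_immCon_iff.1 hx) j
  have hz1 : ∀ m, z m ∈ GammaImmCon p K := fun m => pow_mem (hphi _) _
  have hzlow : ∀ a : ℚ, (∀ n, h.coeff n ≠ 0 → a ≤ n) → ∀ m n, (z m).coeff n ≠ 0 → a ≤ n := by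
    intro a ha m n hn
    have h1 : ∀ i, ((phi p K σ ^ (-(m : ℤ))) x).coeff i ≠ 0 → a / p ^ m ≤ i := by
      intro i hi
      rw [coeff_phi_zpow, Ne, map_eq_zero] at hi
      have := ha _ (hsupp _ hi)
      rw [zpow_neg, zpow_natCast, div_inv_eq_mul] at this
      rwa [div_le_iff₀ (pow_pos hpq m)]
    have := coeff_pow_ne_zero_le h1 hn
    push_cast at this
    rwa [mul_div_cancel₀ _ (pow_pos hpq m).ne'] at this
  have hzup : ∀ b : ℚ, (∀ n, h.coeff n ≠ 0 → n < b) → ∀ m n, (z m).coeff n ≠ 0 → n < b := by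
    intro a ha m n hn
    have h1 : ∀ i, ((phi p K σ ^ (-(m : ℤ))) x).coeff i ≠ 0 → i < a / p ^ m := by
      intro i hi
      rw [coeff_phi_zpow, Ne, map_eq_zero] at hi
      have := ha _ (hsupp _ hi)
      rw [zpow_neg, zpow_natCast, div_inv_eq_mul] at this
      rwa [lt_div_iff₀ (pow_pos hpq m)]
    have := coeff_pow_ne_zero_lt h1 (pow_ne_zero m hp.out.ne_zero) hn
    push_cast at this
    rwa [mul_div_cancel₀ _ (pow_pos hpq m).ne'] at this
  have hphiz : ∀ m, phi p K σ (z (m + 1)) = z m ^ p := by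
    intro m
    simp only [z]
    rw [map_pow, ← RingAut.mul_apply, ← zpow_one_add, pow_succ, pow_mul]
    congr 4
    push_cast
    ring
  -- Apply φ, an isometry with φ(z_{m+1}) = z_m^p: the first difference is small because φ(x) and
  -- x^p have the same reduction, and each p-th power gains a factor λ.
  have h0 : SupLe (z 1 - z 0) (rho K lam) := by
    rw [← supLe_phi_iff (σ := σ), map_sub, hphiz 0]
    refine supLe_sub_of_red_eq (O := O) (pow_mem (hz1 0) p) (SupLe.phi (hz1 0)) ?_
    rw [red_pow (lam := lam) (hz1 0), red_phi (hz1 0)]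
  have hstep : ∀ m, SupLe (z (m + 1) - z m) (rho K lam ^ (m + 1)) := by
    intro m
    induction m with
    | zero => simpa using h0
    | succ m ih =>
      rw [← supLe_phi_iff (σ := σ), map_sub, hphiz, hphiz]
      exact SupLe.pow_sub_pow (hz1 _) (hz1 _) (Nat.succ_ne_zero m) ih
  obtain ⟨Z, hZ, hZsupp⟩ := exists_limit hr0 hr1 (x := fun m => z m) (B := 1) (fun m => hz1 m)
    (fun m => (hstep m).mono (pow_le_pow_of_le_one hr0.le hr1.le (Nat.le_succ m)))
    (hzlow h.order fun n hn => HahnSeries.order_le_of_coeff_ne_zero hn)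
  have hZ1 : Z ∈ GammaImmCon p K := by
    have h1 := hZ 0
    rw [pow_zero] at h1
    have := h1.add (mem_immCon_iff.1 (hz1 0))
    rwa [sub_add_cancel] at this
  refine ⟨Z, hZ1, ?_, ?_, ?_, ?_⟩
  · refine eq_of_forall_supLe (hN := hN) (lam := lam) fun m => ?_
    have h1 : SupLe (phi p K σ Z - z m ^ p) (rho K lam ^ m) := by
      rw [← hphiz, ← map_sub]
      exact (hZ (m + 1)).phi.mono (pow_le_pow_of_le_one hr0.le hr1.le (Nat.le_succ m))
    refine h1.trans_sub ?_
    rcases eq_or_ne m 0 with rfl | hm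
    · rw [pow_zero]
      exact mem_immCon_iff.1 (sub_mem (pow_mem (hz1 0) p) (pow_mem hZ1 p))
    · exact (SupLe.pow_sub_pow (hz1 m) hZ1 hm (hZ m).symm_sub).mono
        (pow_le_pow_of_le_one hr0.le hr1.le (Nat.le_succ m))
  · have h1 : SupLe (Z - z 0) (rho K lam) := by
      refine SupLe.trans_sub (y := z 1) ?_ h0
      simpa using hZ 1
    rw [red_eq_of_supLe_sub (O := O) (hz1 0) h1]
    have e0 : z 0 = x := by simp only [z, Nat.cast_zero, neg_zero, zpow_zero, pow_zero, pow_one,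
      RingAut.one_apply]
    rw [e0, hred]
  · intro a ha n hn
    obtain ⟨m, hm⟩ := hZsupp n hn
    exact hzlow a ha m n hm
  · intro a ha n hn
    obtain ⟨m, hm⟩ := hZsupp n hn
    exact hzup a ha m n hm

variable (p K σ) in
/-- The Teichmüller lift of a generalized power series. -/
def teich (h : HahnSeries ℚ (ResidueField O)) : GammaImmAnCon p K :=
  (exists_teich (p := p) (K := K) (σ := σ) h).choose

section

variable (h g : HahnSeries ℚ (ResidueField O))

lemma teich_mem : teich p K σ h ∈ GammaImmCon p K :=
  (exists_teich (p := p) (K := K) (σ := σ) h).choose_spec.1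

lemma phi_teich : phi p K σ (teich p K σ h) = teich p K σ h ^ p :=
  (exists_teich (p := p) (K := K) (σ := σ) h).choose_spec.2.1

lemma red_teich : red (teich p K σ h) = h :=
  (exists_teich (p := p) (K := K) (σ := σ) h).choose_spec.2.2.1

variable {h} in
lemma le_of_coeff_teich_ne_zero {a : ℚ} (ha : ∀ n, h.coeff n ≠ 0 → a ≤ n) {n : ℚ}
    (hn : (teich p K σ h).coeff n ≠ 0) : a ≤ n :=
  (exists_teich (p := p) (K := K) (σ := σ) h).choose_spec.2.2.2.1 a ha n hn

variable {h} in
lemma lt_of_coeff_teich_ne_zero {b : ℚ} (hb : ∀ n, h.coeff n ≠ 0 → n < b) {n : ℚ}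
    (hn : (teich p K σ h).coeff n ≠ 0) : n < b :=
  (exists_teich (p := p) (K := K) (σ := σ) h).choose_spec.2.2.2.2 b hb n hn

/-- A congruence modulo λ^j improves to λ^{j+1} on applying φ, which acts as the p-th power on both
series and preserves norms. -/
lemma eq_of_phi_eq_pow {x y : GammaImmAnCon p K} (hx : x ∈ GammaImmCon p K)
    (hy : y ∈ GammaImmCon p K) (h1 : phi p K σ x = x ^ p) (h2 : phi p K σ y = y ^ p)
    (h : red (O := O) x = red y) : x = y := by
  obtain ⟨lam, hlam⟩ := IsDiscreteValuationRing.exists_irreducible O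
  have hl : Fact (Irreducible lam) := ⟨hlam⟩
  have key : ∀ m : ℕ, SupLe (x - y) (rho K lam ^ (m + 1)) := by
    intro m
    induction m with
    | zero => simpa using supLe_sub_of_red_eq (O := O) (lam := lam) hx hy h
    | succ m ih =>
      rw [← supLe_phi_iff (σ := σ), map_sub, h1, h2]
      exact SupLe.pow_sub_pow hx hy (Nat.succ_ne_zero m) ih
  exact eq_of_forall_supLe (hN := hN) (lam := lam) fun m => (key m).mono
    (pow_le_pow_of_le_one (rho_pos (lam := lam) K).le (rho_lt_one (hN := hN)).le (Nat.le_succ m))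

lemma eq_teich {x : GammaImmAnCon p K} (hx : x ∈ GammaImmCon p K) (h1 : phi p K σ x = x ^ p) :
    x = teich p K σ (red x) :=
  eq_of_phi_eq_pow (σ := σ) hx (teich_mem _) h1 (phi_teich _) (red_teich _).symm

lemma teich_mul : teich p K σ (h * g) = teich p K σ h * teich p K σ g := by
  obtain ⟨lam, hlam⟩ := IsDiscreteValuationRing.exists_irreducible O
  have hl : Fact (Irreducible lam) := ⟨hlam⟩
  have := eq_teich (σ := σ) (mul_mem (teich_mem (p := p) (K := K) (σ := σ) h)
    (teich_mem (p := p) (K := K) (σ := σ) g)) (by rw [map_mul, phi_teich, phi_teich, mul_pow])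
  rw [this, red_mul (lam := lam) (teich_mem _) (teich_mem _), red_teich, red_teich]

lemma teich_zero : teich p K σ (0 : HahnSeries ℚ (ResidueField O)) = 0 := by
  have := eq_teich (σ := σ) (zero_mem (GammaImmCon p K)) (by
    rw [map_zero, zero_pow hp.out.ne_zero])
  rw [this, red_zero]

lemma red_one : red (O := O) (1 : GammaImmAnCon p K) = 1 := by
  have := red_const (p := p) (K := K) (1 : O)
  simp only [map_one] at this
  exact this

lemma teich_one : teich p K σ (1 : HahnSeries ℚ (ResidueField O)) = 1 := by
  have := eq_teich (σ := σ) (one_mem (GammaImmCon p K)) (by rw [map_one, one_pow])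
  rw [this, red_one]

lemma teich_pow (m : ℕ) : teich p K σ (h ^ m) = teich p K σ h ^ m := by
  induction m with
  | zero => rw [pow_zero, pow_zero, teich_one]
  | succ m ih => rw [pow_succ, pow_succ, teich_mul, ih]

lemma phi_teich' : phi p K σ (teich p K σ h) = teich p K σ (h ^ p) := by
  rw [phi_teich, teich_pow]

/-- The Teichmüller lift of a constant is a constant. -/
lemma exists_teich_single (a : ResidueField O) : ∃ o : O, residue O o = a ∧
    teich p K σ (HahnSeries.single 0 a) = GammaImmAnCon.constHom (algebraMap O K o) := by
  obtain ⟨o, ho⟩ := (hN.norm_le_one_iff _).1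
    (teich_mem (p := p) (K := K) (σ := σ) (HahnSeries.single 0 a) 0)
  refine ⟨o, ?_, ?_⟩
  · rw [← resK_algebraMap (p := p) (K := K), ho, ← coeff_red, red_teich,
      HahnSeries.coeff_single_same]
  · ext n
    rw [GammaImmAnCon.coeff_constHom, ho]
    split_ifs with hn
    · rw [hn]
    · by_contra hne
      -- The lift inherits the lower bound 0 and every upper bound b > 0 of the support, which
      -- leaves only the exponent 0.
      have h1 : 0 ≤ n := le_of_coeff_teich_ne_zero
        (fun i hi => (HahnSeries.eq_of_mem_support_single hi).ge) hne
      have h2 : ∀ b : ℚ, 0 < b → n < b := fun b hb => lt_of_coeff_teich_ne_zero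
        (fun i hi => by rwa [HahnSeries.eq_of_mem_support_single hi]) hne
      exact hn (le_antisymm (le_of_forall_gt fun b hb => h2 b hb) h1)

end

end Teichmuller

/-! ### Restricting a series to a set of exponents. -/

section Cut

set_option linter.unusedSectionVars false

variable {p : ℕ} {K : Type*} [NormedField K]
  [hp : Fact p.Prime] [IsUltrametricDist K] [CompleteSpace K]

lemma IsImmAnCon.of_norm_le {f g : ℚ → K} (hg : IsImmAnCon p g) (h : ∀ n, ‖f n‖ ≤ ‖g n‖) :
    IsImmAnCon p f where
  isWF r := (hg.isWF r).mono fun n hn => lt_of_lt_of_le hn (h n)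
  bounded j := by
    obtain ⟨B, hB⟩ := hg.bounded j
    exact ⟨B, fun n hn => (h n).trans (hB n hn)⟩
  neg := by
    obtain ⟨c, hc, hn⟩ := hg.neg
    exact ⟨c, hc, hn.mono fun n => (h n).trans_lt⟩
  pos d hd := (hg.pos d hd).mono fun n => (h n).trans_lt

open Classical in
/-- The part of a series supported in `S`. -/
def cut (S : Set ℚ) : GammaImmAnCon p K →+ GammaImmAnCon p K where
  toFun x := ⟨fun n => if n ∈ S then x.coeff n else 0, x.isImmAnCon.of_norm_le fun n => by
    split_ifs
    · exact le_rfl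
    · rw [norm_zero]
      exact norm_nonneg _⟩
  map_zero' := by
    ext n
    simp
  map_add' x y := by
    ext n
    simp only [GammaImmAnCon.coeff_add]
    split_ifs <;> simp

open Classical in
lemma coeff_cut (S : Set ℚ) (x : GammaImmAnCon p K) (n : ℚ) :
    (cut S x).coeff n = if n ∈ S then x.coeff n else 0 := rfl

lemma coeff_cut_of_mem {S : Set ℚ} {n : ℚ} (h : n ∈ S) (x : GammaImmAnCon p K) :
    (cut S x).coeff n = x.coeff n := if_pos h

lemma coeff_cut_of_notMem {S : Set ℚ} {n : ℚ} (h : n ∉ S) (x : GammaImmAnCon p K) :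
    (cut S x).coeff n = 0 := if_neg h

lemma SupLe.cut {x : GammaImmAnCon p K} {C : ℝ} (hx : SupLe x C) (S : Set ℚ) :
    SupLe (cut S x) C := fun n => by
  rw [coeff_cut]
  split_ifs
  · exact hx n
  · rw [norm_zero]
    exact (norm_nonneg _).trans (hx n)

lemma cut_constHom_mul (S : Set ℚ) (a : K) (x : GammaImmAnCon p K) :
    cut S (GammaImmAnCon.constHom a * x) = GammaImmAnCon.constHom a * cut S x := by
  ext n
  rw [coeff_cut, GammaImmAnCon.coeff_constHom_mul, GammaImmAnCon.coeff_constHom_mul, coeff_cut]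
  split_ifs
  · rfl
  · rw [mul_zero]

lemma cut_eq_self {S : Set ℚ} {x : GammaImmAnCon p K} (h : ∀ n, x.coeff n ≠ 0 → n ∈ S) :
    cut S x = x := by
  ext n
  rw [coeff_cut]
  split_ifs with hn
  · rfl
  · by_contra hne
    exact hn (h n (Ne.symm hne))

lemma cut_eq_zero {S : Set ℚ} {x : GammaImmAnCon p K} (h : ∀ n, x.coeff n ≠ 0 → n ∉ S) :
    cut S x = 0 := by
  ext n
  rw [coeff_cut, GammaImmAnCon.coeff_zero]
  split_ifs with hn
  · by_contra hne
    exact h n hne hn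
  · rfl

lemma cut_cut (S T : Set ℚ) (x : GammaImmAnCon p K) : cut S (cut T x) = cut (S ∩ T) x := by
  ext n
  rw [coeff_cut, coeff_cut, coeff_cut]
  by_cases h1 : n ∈ S <;> by_cases h2 : n ∈ T <;> simp [h1, h2]

lemma cut_compl (S : Set ℚ) (x : GammaImmAnCon p K) : cut Sᶜ x = x - cut S x := by
  ext n
  rw [GammaImmAnCon.coeff_sub, coeff_cut, coeff_cut]
  by_cases h1 : n ∈ S <;> simp [h1]

end Cut

/-! ### The integral ring attached to a coefficient ring L by Teichmüller expansions. -/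

section GammaL

set_option linter.unusedSectionVars false

variable {p : ℕ} {O K : Type*} [CommRing O] [NormedField K] [Algebra O K]
  [hp : Fact p.Prime] [IsUltrametricDist K] [CompleteSpace K]
  [IsDomain O] [IsDiscreteValuationRing O] [IsFractionRing O K] [hN : IsNormalizedAbs p O K]
  {lam : O} [hl : Fact (Irreducible lam)] {σ : O ≃+* O}

open IsLocalRing

variable (p K) in
/-- The constant series with coefficient in `O`. -/
def constO : O →+* GammaImmAnCon p K := GammaImmAnCon.constHom.comp (algebraMap O K)

lemma constO_apply (a : O) : constO p K a = GammaImmAnCon.constHom (algebraMap O K a) := rfl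

lemma constO_mem (a : O) : constO p K a ∈ GammaImmCon p K := constHom_mem_immCon a

lemma phi_constO (a : O) : phi p K σ (constO p K a) = constO p K (σ a) := phi_const a

variable [CharP (ResidueField O) p] [hs : Fact (∀ a : O, σ a - a ^ p ∈ maximalIdeal O)]

variable (p K σ) in
/-- The additive group generated by the series `o [h]` with `o ∈ O` and `h ∈ L`. -/
def teichSpan (L : Subring (HahnSeries ℚ (ResidueField O))) : AddSubgroup (GammaImmAnCon p K) :=
  AddSubgroup.closure {x | ∃ o : O, ∃ h ∈ L, x = constO p K o * teich p K σ h}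

variable {L : Subring (HahnSeries ℚ (ResidueField O))}

lemma constO_mul_teich_mem (o : O) {h : HahnSeries ℚ (ResidueField O)} (hh : h ∈ L) :
    constO p K o * teich p K σ h ∈ teichSpan p K σ L :=
  AddSubgroup.subset_closure ⟨o, h, hh, rfl⟩

lemma teich_mem_teichSpan {h : HahnSeries ℚ (ResidueField O)} (hh : h ∈ L) :
    teich p K σ h ∈ teichSpan p K σ L := by
  have := constO_mul_teich_mem (p := p) (K := K) (σ := σ) (1 : O) hh
  rwa [map_one, one_mul] at this

lemma teichSpan_le {x : GammaImmAnCon p K} (hx : x ∈ teichSpan p K σ L) :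
    x ∈ GammaImmCon p K := by
  suffices h : teichSpan p K σ L ≤ (GammaImmCon p K).toAddSubgroup from h hx
  refine (AddSubgroup.closure_le _).2 ?_
  rintro _ ⟨o, h, -, rfl⟩
  exact (GammaImmCon p K).mul_mem (constO_mem o) (teich_mem h)

lemma teichSpan_mul {x y : GammaImmAnCon p K} (hx : x ∈ teichSpan p K σ L)
    (hy : y ∈ teichSpan p K σ L) : x * y ∈ teichSpan p K σ L := by
  induction hx using AddSubgroup.closure_induction with
  | mem x hx =>
    obtain ⟨o, h, hh, rfl⟩ := hx
    induction hy using AddSubgroup.closure_induction with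
    | mem y hy =>
      obtain ⟨o', h', hh', rfl⟩ := hy
      rw [mul_mul_mul_comm, ← map_mul, ← teich_mul]
      exact constO_mul_teich_mem _ (L.mul_mem hh hh')
    | zero => rw [mul_zero]; exact zero_mem _
    | add a b _ _ ha hb => rw [mul_add]; exact add_mem ha hb
    | neg a _ ha => rw [mul_neg]; exact neg_mem ha
  | zero => rw [zero_mul]; exact zero_mem _
  | add a b _ _ ha hb => rw [add_mul]; exact add_mem ha hb
  | neg a _ ha => rw [neg_mul]; exact neg_mem ha

lemma constO_mul_mem_teichSpan (o : O) {x : GammaImmAnCon p K} (hx : x ∈ teichSpan p K σ L) :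
    constO p K o * x ∈ teichSpan p K σ L := by
  have := teichSpan_mul (constO_mul_teich_mem (p := p) (K := K) (σ := σ) o L.one_mem) hx
  rwa [teich_one, mul_one] at this

lemma exists_pow_char_pow (hL : Hahn.IsPerfectSub p L) [IsAlgClosed (ResidueField O)] (m : ℕ)
    {a : HahnSeries ℚ (ResidueField O)} (ha : a ∈ L) : ∃ b ∈ L, b ^ p ^ m = a := by
  induction m with
  | zero => exact ⟨a, ha, by simp⟩
  | succ m ih =>
    obtain ⟨b, hb, rfl⟩ := ih
    obtain ⟨c, rfl⟩ := Hahn.exists_pow_char_eq p b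
    exact ⟨c, hL.root_mem c hb, by rw [pow_succ', pow_mul]⟩

variable [IsAlgClosed (ResidueField O)]

include hl in
/-- Teichmüller lifts are additive up to multiples of `p`. -/
lemma exists_teich_add (hL : Hahn.IsPerfectSub p L) {a b : HahnSeries ℚ (ResidueField O)}
    (ha : a ∈ L) (hb : b ∈ L) (m : ℕ) : ∃ s ∈ teichSpan p K σ L,
      SupLe (teich p K σ (a + b) - (teich p K σ a + teich p K σ b + (p : GammaImmAnCon p K) * s))
        (rho K lam ^ (m + 1)) := by
  -- Pass to p^m-th roots, still named a and b. Then [a + b] ≡ [a] + [b] modulo λ becomes, after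
  -- raising to the power p^m, a congruence modulo λ^{m+1}.
  obtain ⟨a, ha', rfl⟩ := exists_pow_char_pow hL m ha
  obtain ⟨b, hb', rfl⟩ := exists_pow_char_pow hL m hb
  have hta := teich_mem_teichSpan (p := p) (K := K) (σ := σ) ha'
  have htb := teich_mem_teichSpan (p := p) (K := K) (σ := σ) hb'
  have ht1 := teich_mem_teichSpan (p := p) (K := K) (σ := σ) L.one_mem
  have hpow : ∀ {x : GammaImmAnCon p K}, x ∈ teichSpan p K σ L → ∀ i : ℕ,
      x ^ i ∈ teichSpan p K σ L := by
    intro x hx i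
    induction i with
    | zero => rwa [pow_zero, ← teich_one (σ := σ)]
    | succ i ih => rw [pow_succ]; exact teichSpan_mul ih hx
  have hpm : p ^ m ≠ 0 := pow_ne_zero m hp.out.ne_zero
  obtain ⟨M, hM⟩ := Nat.exists_eq_add_one_of_ne_zero hpm
  -- The inner part of the binomial expansion of ([a] + [b])^{p^m}, divided by p; the sum runs over
  -- 0 < i + 1 < p^m, where p divides the binomial coefficient.
  refine ⟨∑ i ∈ Finset.range M, ((p ^ m).choose (i + 1) / p : ℕ) •
    (teich p K σ a ^ (i + 1) * teich p K σ b ^ (p ^ m - (i + 1))), sum_mem fun i _ =>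
      nsmul_mem (teichSpan_mul (hpow hta _) (hpow htb _)) _, ?_⟩
  have e : teich p K σ (a ^ p ^ m) + teich p K σ (b ^ p ^ m) + p * ∑ i ∈ Finset.range M,
      ((p ^ m).choose (i + 1) / p : ℕ) •
      (teich p K σ a ^ (i + 1) * teich p K σ b ^ (p ^ m - (i + 1))) =
      (teich p K σ a + teich p K σ b) ^ p ^ m := by
    rw [add_pow, Finset.sum_range_succ, teich_pow, teich_pow]
    conv_rhs => rw [hM, Finset.sum_range_succ']
    rw [← hM]
    have h1 : (p : GammaImmAnCon p K) * ∑ i ∈ Finset.range M,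
        ((p ^ m).choose (i + 1) / p : ℕ) •
        (teich p K σ a ^ (i + 1) * teich p K σ b ^ (p ^ m - (i + 1))) =
        ∑ i ∈ Finset.range M, teich p K σ a ^ (i + 1) * teich p K σ b ^ (p ^ m - (i + 1)) *
          ((p ^ m).choose (i + 1) : GammaImmAnCon p K) := by
      rw [Finset.mul_sum]
      refine Finset.sum_congr rfl fun i hi => ?_
      have hdvd : p ∣ (p ^ m).choose (i + 1) := by
        refine hp.out.dvd_choose_pow (Nat.succ_ne_zero i) ?_
        have := Finset.mem_range.1 hi
        omega
      obtain ⟨c, hc⟩ := hdvd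
      rw [hc, Nat.mul_div_cancel_left _ hp.out.pos, nsmul_eq_mul]
      push_cast
      ring
    rw [h1]
    simp
    ring
  rw [e, ← add_pow_char_pow, teich_pow]
  refine SupLe.pow_pow_sub (teich_mem _) (add_mem (teich_mem _) (teich_mem _)) ?_ m
  refine supLe_sub_of_red_eq (O := O) (teich_mem _) (add_mem (teich_mem _) (teich_mem _)) ?_
  rw [red_add (teich_mem _) (teich_mem _), red_teich, red_teich, red_teich]

include hN hl in
lemma SupLe.constO_lam_mul {x : GammaImmAnCon p K} {C : ℝ} (hx : SupLe x C) :
    SupLe (constO p K lam * x) (rho K lam * C) := hx.const_mul _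

lemma lam_dvd_of_residue_eq_zero {a : O} (h : residue O a = 0) (lam : O)
    [hl : Fact (Irreducible lam)] : ∃ b, a = lam * b := by
  rw [residue_eq_zero_iff, (IsDiscreteValuationRing.irreducible_iff_uniformizer lam).1 hl.out,
    Ideal.mem_span_singleton] at h
  exact h

lemma exists_p_eq (lam : O) [hl : Fact (Irreducible lam)] : ∃ b : O, (p : O) = lam * b :=
  lam_dvd_of_residue_eq_zero (by rw [map_natCast, CharP.cast_eq_zero]) lam

include hl in
/-- The first step of the expansion of an element of the span of Teichmüller lifts. -/
lemma exists_expansion (hL : Hahn.IsPerfectSub p L) {y : GammaImmAnCon p K}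
    (hy : y ∈ teichSpan p K σ L) (N : ℕ) :
    red y ∈ L ∧ ∃ y' ∈ teichSpan p K σ L,
      SupLe (y - (teich p K σ (red y) + constO p K lam * y')) (rho K lam ^ (N + 1)) := by
  have hr0 := rho_pos (lam := lam) K
  obtain ⟨π, hπ⟩ := exists_p_eq (p := p) lam
  have hpc : (p : GammaImmAnCon p K) = constO p K lam * constO p K π := by
    rw [← map_mul, ← hπ, map_natCast]
  induction hy using AddSubgroup.closure_induction with
  | mem y hy =>
    obtain ⟨o, h, hh, rfl⟩ := hy
    have hred : red (constO p K o * teich p K σ h) = HahnSeries.single 0 (residue O o) * h := by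
      rw [red_mul (lam := lam) (constO_mem o) (teich_mem h), red_teich, constO_apply, red_const]
    rw [hred]
    refine ⟨L.mul_mem (hL.single_mem _ _) hh, ?_⟩
    -- The scalar o is replaced by the Teichmüller representative of its residue; the difference is
    -- a multiple of λ.
    obtain ⟨o', ho', he⟩ := exists_teich_single (p := p) (K := K) (σ := σ) (residue O o)
    obtain ⟨b, hb⟩ := lam_dvd_of_residue_eq_zero (a := o - o') (by rw [map_sub, ho', sub_self]) lam
    refine ⟨constO p K b * teich p K σ h, constO_mul_teich_mem b hh, ?_⟩
    rw [teich_mul, he, ← constO_apply, ← mul_assoc, ← map_mul, ← hb, map_sub]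
    have : constO p K o * teich p K σ h - (constO p K o' * teich p K σ h +
      (constO p K o - constO p K o') * teich p K σ h) = 0 := by ring
    rw [this]
    exact supLe_zero (by positivity)
  | zero =>
    rw [red_zero]
    refine ⟨zero_mem _, 0, zero_mem _, ?_⟩
    rw [teich_zero, mul_zero, add_zero, sub_zero]
    exact supLe_zero (by positivity)
  | add a b ha hb iha ihb =>
    obtain ⟨ha1, a', ha', ha2⟩ := iha
    obtain ⟨hb1, b', hb', hb2⟩ := ihb
    rw [red_add (teichSpan_le ha) (teichSpan_le hb)]
    refine ⟨add_mem ha1 hb1, ?_⟩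
    obtain ⟨s, hs, hs'⟩ := exists_teich_add (K := K) (lam := lam) (σ := σ) hL ha1 hb1 N
    refine ⟨a' + b' - constO p K π * s,
      sub_mem (add_mem ha' hb') (constO_mul_mem_teichSpan π hs), ?_⟩
    have h1 := (ha2.add hb2).sub hs'
    convert h1 using 1
    rw [hpc]
    ring
  | neg a ha iha =>
    obtain ⟨ha1, a', ha', ha2⟩ := iha
    rw [red_neg (teichSpan_le ha)]
    refine ⟨neg_mem ha1, ?_⟩
    -- Comparing [-a] with -[a] through a + (-a) = 0 works for p = 2 as well.
    obtain ⟨s, hs, hs'⟩ := exists_teich_add (K := K) (lam := lam) (σ := σ) hL ha1 (neg_mem ha1) N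
    rw [add_neg_cancel, teich_zero] at hs'
    refine ⟨-a' + constO p K π * s,
      add_mem (neg_mem ha') (constO_mul_mem_teichSpan π hs), ?_⟩
    have h1 := ha2.neg.add hs'
    convert h1 using 1
    rw [hpc]
    ring

variable (p K σ) in
/-- The integral series that are limits of combinations of Teichmüller lifts of elements of `L`. -/
def gammaL (L : Subring (HahnSeries ℚ (ResidueField O))) : Subring (GammaImmAnCon p K) where
  carrier := {x | x ∈ GammaImmCon p K ∧ ∀ ε : ℝ, 0 < ε → ∃ y ∈ teichSpan p K σ L, SupLe (x - y) ε}
  zero_mem' := ⟨zero_mem _, fun ε hε => ⟨0, zero_mem _, by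
    rw [sub_zero]; exact supLe_zero hε.le⟩⟩
  one_mem' := ⟨one_mem _, fun ε hε => ⟨teich p K σ 1, teich_mem_teichSpan L.one_mem, by
    rw [teich_one, sub_self]; exact supLe_zero hε.le⟩⟩
  add_mem' {x y} hx hy := ⟨add_mem hx.1 hy.1, fun ε hε => by
    obtain ⟨a, ha, hxa⟩ := hx.2 ε hε
    obtain ⟨b, hb, hyb⟩ := hy.2 ε hε
    refine ⟨a + b, add_mem ha hb, ?_⟩
    rw [add_sub_add_comm]
    exact hxa.add hyb⟩
  neg_mem' {x} hx := ⟨neg_mem hx.1, fun ε hε => by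
    obtain ⟨a, ha, hxa⟩ := hx.2 ε hε
    refine ⟨-a, neg_mem ha, ?_⟩
    rw [neg_sub_neg]
    exact hxa.symm_sub⟩
  mul_mem' {x y} hx hy := ⟨mul_mem hx.1 hy.1, fun ε hε => by
    obtain ⟨a, ha, hxa⟩ := hx.2 ε hε
    obtain ⟨b, hb, hyb⟩ := hy.2 ε hε
    refine ⟨a * b, teichSpan_mul ha hb, ?_⟩
    have h : x * y - a * b = y * (x - a) + a * (y - b) := by ring
    rw [h]
    exact (SupLe.mul_left hy.1 hxa).add (SupLe.mul_left (teichSpan_le ha) hyb)⟩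

lemma teichSpan_le_gammaL {x : GammaImmAnCon p K} (hx : x ∈ teichSpan p K σ L) :
    x ∈ gammaL p K σ L :=
  ⟨teichSpan_le hx, fun ε hε => ⟨x, hx, by rw [sub_self]; exact supLe_zero hε.le⟩⟩

lemma teich_mem_gammaL {h : HahnSeries ℚ (ResidueField O)} (hh : h ∈ L) :
    teich p K σ h ∈ gammaL p K σ L := teichSpan_le_gammaL (teich_mem_teichSpan hh)

lemma constO_mem_gammaL (o : O) : constO p K o ∈ gammaL p K σ L := by
  have := constO_mul_teich_mem (p := p) (K := K) (σ := σ) o L.one_mem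
  rw [teich_one, mul_one] at this
  exact teichSpan_le_gammaL this

include hN hl in
lemma inv_lam_mul_constO (x : GammaImmAnCon p K) :
    constO p K lam * (GammaImmAnCon.constHom (algebraMap O K lam)⁻¹ * x) = x := by
  rw [← mul_assoc, constO_apply, ← map_mul, mul_inv_cancel₀ (algebraMap_lam_ne_zero K), map_one,
    one_mul]

include hN hl in
lemma SupLe.of_constO_lam_mul {x : GammaImmAnCon p K} {C : ℝ}
    (hx : SupLe (constO p K lam * x) (rho K lam * C)) : SupLe x C := by
  intro n
  have := hx n
  rw [constO_apply, GammaImmAnCon.coeff_constHom_mul, norm_mul] at this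
  exact le_of_mul_le_mul_left this (rho_pos (lam := lam) K)

include hl in
/-- The ring `gammaL` is saturated. -/
lemma mem_gammaL_of_lam_mul (hL : Hahn.IsPerfectSub p L) {x : GammaImmAnCon p K}
    (hx : x ∈ GammaImmCon p K) (h : constO p K lam * x ∈ gammaL p K σ L) :
    x ∈ gammaL p K σ L := by
  have hr0 := rho_pos (lam := lam) K
  have hr1 := rho_lt_one (hN := hN) (lam := lam)
  refine ⟨hx, fun ε hε => ?_⟩
  obtain ⟨N, hN'⟩ := exists_rho_pow_lt (hN := hN) (lam := lam) hε
  obtain ⟨y, hy, hxy⟩ := h.2 (rho K lam ^ (N + 1)) (by positivity)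
  -- The approximant y of λx has zero reduction, so its expansion starts with λy', and y'
  -- approximates x.
  have hy0 : red (O := O) y = 0 := by
    have h1 : SupLe y (rho K lam) := by
      have h2 : SupLe (constO p K lam * x) (rho K lam) := by
        simpa using SupLe.constO_lam_mul (lam := lam) (mem_immCon_iff.1 hx)
      have h3 := h2.sub (hxy.mono (pow_le_of_le_one hr0.le hr1.le (Nat.succ_ne_zero N)))
      rwa [sub_sub_cancel] at h3
    exact red_eq_zero_of_supLe h1
  obtain ⟨-, y', hy', h1⟩ := exists_expansion (K := K) (lam := lam) hL hy N
  rw [hy0, teich_zero, zero_add] at h1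
  refine ⟨y', hy', SupLe.mono ?_ hN'.le⟩
  have h2 := hxy.trans_sub h1
  rw [← mul_sub, pow_succ'] at h2
  exact h2.of_constO_lam_mul

include hl in
lemma red_mem (hL : Hahn.IsPerfectSub p L) {x : GammaImmAnCon p K}
    (hx : x ∈ gammaL p K σ L) : red x ∈ L := by
  obtain ⟨y, hy, hxy⟩ := hx.2 (rho K lam) (rho_pos (lam := lam) K)
  rw [red_eq_of_supLe_sub (teichSpan_le hy) hxy]
  exact (exists_expansion (K := K) (lam := lam) hL hy 0).1

include hl in
/-- The first step of the expansion of an integral series. -/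
lemma exists_eq_teich_add (x : GammaImmAnCon p K) (hx : x ∈ GammaImmCon p K) :
    ∃ x' ∈ GammaImmCon p K, x = teich p K σ (red x) + constO p K lam * x' := by
  have h1 : SupLe (x - teich p K σ (red x)) (rho K lam) :=
    supLe_sub_of_red_eq hx (teich_mem _) (red_teich _).symm
  refine ⟨GammaImmAnCon.constHom (algebraMap O K lam)⁻¹ * (x - teich p K σ (red x)), ?_, ?_⟩
  · refine mem_immCon_iff.2 (SupLe.of_constO_lam_mul (lam := lam) ?_)
    rwa [inv_lam_mul_constO, mul_one]
  · rw [inv_lam_mul_constO]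
    ring

include hl in
lemma exists_eq_teich_add_of_mem (hL : Hahn.IsPerfectSub p L) {x : GammaImmAnCon p K}
    (hx : x ∈ gammaL p K σ L) :
    ∃ x' ∈ gammaL p K σ L, x = teich p K σ (red x) + constO p K lam * x' := by
  obtain ⟨x', hx', h⟩ := exists_eq_teich_add (lam := lam) (σ := σ) x hx.1
  refine ⟨x', mem_gammaL_of_lam_mul (lam := lam) hL hx' ?_, h⟩
  have e : constO p K lam * x' = x - teich p K σ (red x) := by
    rw [eq_sub_iff_add_eq, add_comm]
    exact h.symm
  rw [e]
  exact sub_mem hx (teich_mem_gammaL (red_mem (lam := lam) hL hx))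

lemma gammaL_of_forall {x : GammaImmAnCon p K}
    (h : ∀ ε : ℝ, 0 < ε → ∃ y ∈ gammaL p K σ L, SupLe (x - y) ε) : x ∈ gammaL p K σ L := by
  refine ⟨?_, fun ε hε => ?_⟩
  · obtain ⟨y, hy, hxy⟩ := h 1 one_pos
    have := hxy.add (mem_immCon_iff.1 hy.1)
    rwa [sub_add_cancel] at this
  · obtain ⟨y, hy, hxy⟩ := h ε hε
    obtain ⟨z, hz, hyz⟩ := hy.2 ε hε
    exact ⟨z, hz, hxy.trans_sub hyz⟩

lemma phi_mem_teichSpan {x : GammaImmAnCon p K} (hx : x ∈ teichSpan p K σ L) :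
    phi p K σ x ∈ teichSpan p K σ L := by
  induction hx using AddSubgroup.closure_induction with
  | mem y hy =>
    obtain ⟨o, h, hh, rfl⟩ := hy
    rw [map_mul, phi_constO, phi_teich']
    exact constO_mul_teich_mem _ (pow_mem hh p)
  | zero => rw [map_zero]; exact zero_mem _
  | add a b _ _ ha hb => rw [map_add]; exact add_mem ha hb
  | neg a _ ha => rw [map_neg]; exact neg_mem ha

lemma phi_inv_mem_teichSpan (hL : Hahn.IsPerfectSub p L) {x : GammaImmAnCon p K}
    (hx : x ∈ teichSpan p K σ L) : (phi p K σ)⁻¹ x ∈ teichSpan p K σ L := by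
  induction hx using AddSubgroup.closure_induction with
  | mem y hy =>
    obtain ⟨o, h, hh, rfl⟩ := hy
    obtain ⟨g, rfl⟩ := Hahn.exists_pow_char_eq p h
    have e : constO p K o * teich p K σ (g ^ p) =
        phi p K σ (constO p K (σ.symm o) * teich p K σ g) := by
      rw [map_mul, phi_constO, phi_teich', σ.apply_symm_apply]
    rw [e, ← RingAut.mul_apply, inv_mul_cancel, RingAut.one_apply]
    exact constO_mul_teich_mem _ (hL.root_mem g hh)
  | zero => rw [map_zero]; exact zero_mem _
  | add a b _ _ ha hb => rw [map_add]; exact add_mem ha hb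
  | neg a _ ha => rw [map_neg]; exact neg_mem ha

lemma phi_zpow_mem_teichSpan (hL : Hahn.IsPerfectSub p L) (j : ℤ) {x : GammaImmAnCon p K}
    (hx : x ∈ teichSpan p K σ L) : (phi p K σ ^ j) x ∈ teichSpan p K σ L := by
  induction j generalizing x with
  | zero => simpa using hx
  | succ i ih =>
    rw [zpow_add_one, RingAut.mul_apply]
    exact ih (phi_mem_teichSpan hx)
  | pred i ih =>
    rw [zpow_sub_one, RingAut.mul_apply]
    exact ih (phi_inv_mem_teichSpan hL hx)

lemma phi_zpow_mem_gammaL (hL : Hahn.IsPerfectSub p L) (j : ℤ) {x : GammaImmAnCon p K}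
    (hx : x ∈ gammaL p K σ L) : (phi p K σ ^ j) x ∈ gammaL p K σ L := by
  refine ⟨SupLe.phi_zpow (mem_immCon_iff.1 hx.1) j, fun ε hε => ?_⟩
  obtain ⟨y, hy, hxy⟩ := hx.2 ε hε
  refine ⟨_, phi_zpow_mem_teichSpan hL j hy, ?_⟩
  rw [← map_sub]
  exact hxy.phi_zpow j

include hl in
-- Split h into its parts h₁ below j and h₂ from j on. Then [h] ≈ [h₁] + [h₂] + ps, and the two
-- lifts lie on the correct sides of j, so the cut of [h] is close to [h₁] plus p times the cut of
-- s. Repeating this on s gains a factor p each time.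
lemma exists_cut_approx (hL : Hahn.IsAdmissible p L) (j : ℚ) (N : ℕ) {x : GammaImmAnCon p K}
    (hx : x ∈ teichSpan p K σ L) :
    ∃ y ∈ teichSpan p K σ L, SupLe (cut (Set.Iio j) x - y) (rho K lam ^ N) := by
  have hr0 := rho_pos (lam := lam) K
  induction N generalizing x with
  | zero =>
    refine ⟨0, zero_mem _, ?_⟩
    rw [sub_zero, pow_zero]
    exact (mem_immCon_iff.1 (teichSpan_le hx)).cut _
  | succ N ih =>
    induction hx using AddSubgroup.closure_induction with
    | mem y hy =>
      obtain ⟨o, h, hh, rfl⟩ := hy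
      have h1 := hL.trunc_mem j h hh
      have h2 := L.sub_mem hh h1
      obtain ⟨s, hs, hs'⟩ := exists_teich_add (K := K) (lam := lam) (σ := σ) hL.1 h1 h2 N
      rw [add_sub_cancel] at hs'
      obtain ⟨s', hs1, hs2⟩ := ih hs
      have e1 : cut (Set.Iio j) (teich p K σ (HahnSeries.truncLT j h)) =
          teich p K σ (HahnSeries.truncLT j h) := by
        refine cut_eq_self fun n hn => ?_
        exact lt_of_coeff_teich_ne_zero (fun i hi =>
          (Hahn.lt_of_coeff_truncLT_ne_zero hi).1) hn
      have e2 : cut (Set.Iio j) (teich p K σ (h - HahnSeries.truncLT j h)) = 0 := by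
        refine cut_eq_zero fun n hn => ?_
        rw [Set.mem_Iio, not_lt]
        exact le_of_coeff_teich_ne_zero (fun i hi =>
          (Hahn.le_of_coeff_sub_truncLT_ne_zero hi).1) hn
      have h3 := hs'.cut (Set.Iio j)
      rw [natCast_eq_constHom, map_sub, map_add, map_add, e1, e2, add_zero, cut_constHom_mul,
        ← natCast_eq_constHom] at h3
      refine ⟨constO p K o * (teich p K σ (HahnSeries.truncLT j h) + p * s'),
        constO_mul_mem_teichSpan o (add_mem (teich_mem_teichSpan h1) ?_), ?_⟩
      · rw [← nsmul_eq_mul]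
        exact nsmul_mem hs1 p
      · rw [constO_apply, cut_constHom_mul, ← mul_sub]
        refine SupLe.mul_left (constO_mem o) (h3.trans_sub ?_)
        rw [add_sub_add_left_eq_sub, ← mul_sub, pow_succ']
        exact hs2.p_mul (by positivity)
    | zero =>
      exact ⟨0, zero_mem _, by rw [map_zero, sub_zero]; exact supLe_zero (by positivity)⟩
    | add a b _ _ ha hb =>
      obtain ⟨a', ha1, ha2⟩ := ha
      obtain ⟨b', hb1, hb2⟩ := hb
      refine ⟨a' + b', add_mem ha1 hb1, ?_⟩
      rw [map_add, add_sub_add_comm]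
      exact ha2.add hb2
    | neg a _ ha =>
      obtain ⟨a', ha1, ha2⟩ := ha
      refine ⟨-a', neg_mem ha1, ?_⟩
      rw [map_neg, neg_sub_neg]
      exact ha2.symm_sub

lemma cut_mem_gammaL (hL : Hahn.IsAdmissible p L) (j : ℚ) {x : GammaImmAnCon p K}
    (hx : x ∈ gammaL p K σ L) : cut (Set.Iio j) x ∈ gammaL p K σ L := by
  obtain ⟨lam, hlam⟩ := IsDiscreteValuationRing.exists_irreducible O
  have hl : Fact (Irreducible lam) := ⟨hlam⟩
  refine ⟨(mem_immCon_iff.1 hx.1).cut _, fun ε hε => ?_⟩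
  obtain ⟨y, hy, hxy⟩ := hx.2 ε hε
  obtain ⟨N, hN'⟩ := exists_rho_pow_lt (hN := hN) (lam := lam) hε
  obtain ⟨z, hz, hyz⟩ := exists_cut_approx (lam := lam) hL j N hy
  refine ⟨z, hz, SupLe.trans_sub (y := cut (Set.Iio j) y) ?_ (hyz.mono hN'.le)⟩
  rw [← map_sub]
  exact hxy.cut _

end GammaL

/-! ### Identification of both analytic rings with rings attached to an admissible L. -/

section Rings

set_option linter.unusedSectionVars false

variable {p : ℕ} {O K : Type*} [CommRing O] [NormedField K] [Algebra O K]
  [hp : Fact p.Prime] [IsUltrametricDist K] [CompleteSpace K]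
  [IsDomain O] [IsDiscreteValuationRing O] [IsFractionRing O K] [hN : IsNormalizedAbs p O K]
  {lam : O} [hl : Fact (Irreducible lam)] {σ : O ≃+* O}

open IsLocalRing GammaImmAnCon

/-- In the product of `x` with a part of `y` far to the right, the coefficients in a bounded range
are small. -/
lemma exists_norm_coeff_mul_cut_le (x y : GammaImmAnCon p K) (j : ℚ) {ε : ℝ} (hε : 0 < ε) :
    ∃ J : ℚ, ∀ S T : Set ℚ, T ⊆ Set.Ici J → ∀ m ≤ j, ‖(cut S x * cut T y).coeff m‖ ≤ ε := by
  obtain ⟨c, hc, hx⟩ := x.isImmAnCon.neg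
  obtain ⟨a, ha⟩ := eventually_atBot.1
    (hx.and (eventually_rpow_lt_atBot p (show 0 < c / 2 by positivity) hε))
  obtain ⟨b, hb⟩ := eventually_atTop.1 (y.isImmAnCon.pos (c / 2) (by positivity))
  -- If m - i ≥ J with m ≤ j, then i ≤ a and i + m ≤ a. The factors are at most p^{ci} and
  -- p^{(c/2)(m-i)}, so the product is at most p^{(c/2)(i+m)} < ε.
  refine ⟨max b (max (j - a) (2 * j - a)), fun S T hT m hm => ?_⟩
  rw [coeff_mul]
  refine norm_tsum_le_of_forall hε.le fun i => ?_
  by_cases hi : m - i ∈ T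
  · rw [coeff_cut_of_mem hi, norm_mul]
    have hi := hT hi
    rw [Set.mem_Ici, max_le_iff, max_le_iff] at hi
    obtain ⟨h1, h2, h3⟩ := hi
    have h4 : i ≤ a := by linarith
    have h5 : ‖(cut S x).coeff i‖ ≤ (p : ℝ) ^ (c * (i : ℝ)) := by
      rw [coeff_cut]
      split_ifs
      · exact (ha i h4).1.le
      · rw [norm_zero]
        exact (Real.rpow_pos_of_pos (base_pos p) _).le
    have h6 := (hb _ h1).le
    have h7 := (ha (i + m) (by linarith)).2.le
    refine (mul_le_mul h5 h6 (norm_nonneg _) (Real.rpow_pos_of_pos (base_pos p) _).le).trans ?_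
    rw [← Real.rpow_add (base_pos p)]
    convert h7 using 2
    push_cast
    ring
  · rw [coeff_cut_of_notMem hi, mul_zero, norm_zero]
    exact hε.le

lemma cut_Iio_add_cut_Ici (J : ℚ) (z : GammaImmAnCon p K) :
    cut (Set.Iio J) z + cut (Set.Ici J) z = z := by
  rw [← Set.compl_Iio, cut_compl]
  ring

lemma cut_univ (z : GammaImmAnCon p K) : cut Set.univ z = z :=
  cut_eq_self fun _ _ => Set.mem_univ _

lemma exists_norm_coeff_mul_sub_le (x y : GammaImmAnCon p K) (j : ℚ) {ε : ℝ} (hε : 0 < ε) :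
    ∃ J : ℚ, ∀ m ≤ j,
      ‖(x * y - cut (Set.Iio J) x * cut (Set.Iio J) y).coeff m‖ ≤ ε := by
  obtain ⟨J₁, h1⟩ := exists_norm_coeff_mul_cut_le x y j hε
  obtain ⟨J₂, h2⟩ := exists_norm_coeff_mul_cut_le y x j hε
  refine ⟨max J₁ J₂, fun m hm => ?_⟩
  have e2 : x * y - cut (Set.Iio (max J₁ J₂)) x * cut (Set.Iio (max J₁ J₂)) y =
      cut (Set.Iio (max J₁ J₂)) x * cut (Set.Ici (max J₁ J₂)) y +
        cut Set.univ y * cut (Set.Ici (max J₁ J₂)) x := by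
    rw [cut_univ]
    linear_combination -y * cut_Iio_add_cut_Ici (max J₁ J₂) x -
      cut (Set.Iio (max J₁ J₂)) x * cut_Iio_add_cut_Ici (max J₁ J₂) y
  rw [e2, coeff_add]
  exact (IsUltrametricDist.norm_add_le_max _ _).trans (max_le
    (h1 _ _ (Set.Ici_subset_Ici.2 (le_max_left _ _)) m hm)
    (h2 _ _ (Set.Ici_subset_Ici.2 (le_max_right _ _)) m hm))

variable [CharP (ResidueField O) p] [hs : Fact (∀ a : O, σ a - a ^ p ∈ maximalIdeal O)]
  {L : Subring (HahnSeries ℚ (ResidueField O))} [IsAlgClosed (ResidueField O)]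

lemma constHom_mul_mem_gammaL {a b : K} (ha : a ≠ 0) (hab : ‖b‖ ≤ ‖a‖) {x : GammaImmAnCon p K}
    (hx : constHom a * x ∈ gammaL p K σ L) : constHom b * x ∈ gammaL p K σ L := by
  have h1 : ‖b / a‖ ≤ 1 := by
    rw [norm_div]
    exact div_le_one_of_le₀ hab (norm_nonneg _)
  obtain ⟨o, ho⟩ := (hN.norm_le_one_iff _).1 h1
  have h2 := (gammaL p K σ L).mul_mem (constO_mem_gammaL o) hx
  rwa [constO_apply, ho, ← mul_assoc, ← map_mul, div_mul_cancel₀ _ ha] at h2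

variable (p K σ) in
/-- The ring `gammaL` with `p` inverted. -/
def gammaInv (L : Subring (HahnSeries ℚ (ResidueField O))) : Subring (GammaImmAnCon p K) where
  carrier := {x | ∃ a : K, a ≠ 0 ∧ constHom a * x ∈ gammaL p K σ L}
  zero_mem' := ⟨1, one_ne_zero, by rw [mul_zero]; exact zero_mem _⟩
  one_mem' := ⟨1, one_ne_zero, by rw [map_one, mul_one]; exact one_mem _⟩
  add_mem' {x y} hx hy := by
    obtain ⟨a, ha, hx⟩ := hx
    obtain ⟨b, hb, hy⟩ := hy
    rcases le_total ‖a‖ ‖b‖ with h | h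
    · exact ⟨a, ha, by rw [mul_add]; exact add_mem hx (constHom_mul_mem_gammaL hb h hy)⟩
    · exact ⟨b, hb, by rw [mul_add]; exact add_mem (constHom_mul_mem_gammaL ha h hx) hy⟩
  neg_mem' {x} hx := by
    obtain ⟨a, ha, hx⟩ := hx
    exact ⟨a, ha, by rw [mul_neg]; exact neg_mem hx⟩
  mul_mem' {x y} hx hy := by
    obtain ⟨a, ha, hx⟩ := hx
    obtain ⟨b, hb, hy⟩ := hy
    exact ⟨a * b, mul_ne_zero ha hb, by
      rw [map_mul, mul_mul_mul_comm]; exact mul_mem hx hy⟩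

lemma gammaL_le_gammaInv {x : GammaImmAnCon p K} (hx : x ∈ gammaL p K σ L) :
    x ∈ gammaInv p K σ L := ⟨1, one_ne_zero, by rwa [map_one, one_mul]⟩

lemma constHom_mem_gammaInv (a : K) : constHom a ∈ gammaInv p K σ L := by
  by_cases ha : a = 0
  · rw [ha, map_zero]
    exact zero_mem _
  · exact ⟨a⁻¹, inv_ne_zero ha, by
      rw [← map_mul, inv_mul_cancel₀ ha, map_one]; exact one_mem _⟩

lemma mem_gammaL_of_mem_gammaInv (hL : Hahn.IsPerfectSub p L) {x : GammaImmAnCon p K}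
    (h : x ∈ gammaInv p K σ L) (hx : SupLe x 1) : x ∈ gammaL p K σ L := by
  obtain ⟨lam, hlam⟩ := IsDiscreteValuationRing.exists_irreducible O
  have hl : Fact (Irreducible lam) := ⟨hlam⟩
  obtain ⟨a, ha, h⟩ := h
  obtain ⟨N, h1⟩ := exists_rho_pow_lt (K := K) (hN := hN) (lam := lam) (norm_pos_iff.2 ha)
  have h2 : constO p K (lam ^ N) * x ∈ gammaL p K σ L := by
    refine constHom_mul_mem_gammaL ha ?_ h
    rw [map_pow, norm_pow]
    exact h1.le
  clear h1
  induction N with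
  | zero => rwa [pow_zero, map_one, one_mul] at h2
  | succ N ih =>
    rw [pow_succ', map_mul, mul_assoc] at h2
    exact ih (mem_gammaL_of_lam_mul (lam := lam) hL
      ((GammaImmCon p K).mul_mem (constO_mem _) hx) h2)

/-- Inverting p does not spoil closure under uniform limits: relative to an approximant y within
distance 1, all finer approximants differ from y by integral elements, so x - y is a limit inside
the integral ring. -/
lemma gammaInv_of_forall (hL : Hahn.IsPerfectSub p L) {x : GammaImmAnCon p K}
    (h : ∀ ε : ℝ, 0 < ε → ∃ y ∈ gammaInv p K σ L, SupLe (x - y) ε) : x ∈ gammaInv p K σ L := by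
  obtain ⟨y, hy, hxy⟩ := h 1 one_pos
  have h1 : x - y ∈ gammaL p K σ L := by
    refine gammaL_of_forall fun ε hε => ?_
    obtain ⟨z, hz, hxz⟩ := h (min ε 1) (by positivity)
    have e : x - y - (z - y) = x - z := by ring
    refine ⟨z - y, mem_gammaL_of_mem_gammaInv hL (sub_mem hz hy) ?_, ?_⟩
    · exact (hxz.mono (min_le_right _ _)).symm_sub.trans_sub hxy
    · rw [e]
      exact hxz.mono (min_le_left _ _)
  have := add_mem (gammaL_le_gammaInv h1) hy
  rwa [sub_add_cancel] at this

lemma cut_mem_gammaInv (hL : Hahn.IsAdmissible p L) (j : ℚ) {x : GammaImmAnCon p K}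
    (hx : x ∈ gammaInv p K σ L) : cut (Set.Iio j) x ∈ gammaInv p K σ L := by
  obtain ⟨a, ha, h⟩ := hx
  refine ⟨a, ha, ?_⟩
  rw [← cut_constHom_mul]
  exact cut_mem_gammaL hL j h

lemma phi_zpow_constHom_mul (j : ℤ) (a : K) (x : GammaImmAnCon p K) :
    (phi p K σ ^ j) (constHom a * x) = constHom ((tau K σ ^ j) a) * (phi p K σ ^ j) x := by
  ext n
  rw [coeff_phi_zpow, coeff_constHom_mul, coeff_constHom_mul, coeff_phi_zpow, map_mul]

lemma phi_zpow_mem_gammaInv (hL : Hahn.IsPerfectSub p L) (j : ℤ) {x : GammaImmAnCon p K}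
    (hx : x ∈ gammaInv p K σ L) : (phi p K σ ^ j) x ∈ gammaInv p K σ L := by
  obtain ⟨a, ha, h⟩ := hx
  refine ⟨(tau K σ ^ j) a, ?_, ?_⟩
  · rw [← norm_ne_zero_iff, norm_tau_zpow (hN := hN), norm_ne_zero_iff]
    exact ha
  · rw [← phi_zpow_constHom_mul]
    exact phi_zpow_mem_gammaL hL j h

variable (p K σ) in
/-- The ring of the series all of whose truncations lie in `gammaInv`. -/
def ringL (hL : Hahn.IsAdmissible p L) : Subring (GammaImmAnCon p K) where
  carrier := {x | ∀ j : ℚ, cut (Set.Iio j) x ∈ gammaInv p K σ L}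
  zero_mem' j := by rw [map_zero]; exact zero_mem _
  one_mem' j := cut_mem_gammaInv hL j (one_mem _)
  add_mem' {x y} hx hy j := by rw [map_add]; exact add_mem (hx j) (hy j)
  neg_mem' {x} hx j := by rw [map_neg]; exact neg_mem (hx j)
  -- Below j the product is uniformly approximated by products of truncations, although no single
  -- truncation computes it exactly.
  mul_mem' {x y} hx hy j := by
    refine gammaInv_of_forall hL.1 fun ε hε => ?_
    obtain ⟨J, hJ⟩ := exists_norm_coeff_mul_sub_le x y j hε
    refine ⟨_, cut_mem_gammaInv hL j (mul_mem (hx J) (hy J)), fun m => ?_⟩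
    rw [← map_sub, coeff_cut]
    split_ifs with hm
    · exact hJ m (le_of_lt hm)
    · rw [norm_zero]
      exact hε.le

variable {hL : Hahn.IsAdmissible p L}

lemma gammaInv_le_ringL {x : GammaImmAnCon p K} (hx : x ∈ gammaInv p K σ L) :
    x ∈ ringL p K σ hL := fun j => cut_mem_gammaInv hL j hx

lemma constHom_mem_ringL (a : K) : constHom a ∈ ringL p K σ hL :=
  gammaInv_le_ringL (constHom_mem_gammaInv a)

lemma teich_mem_ringL {h : HahnSeries ℚ (ResidueField O)} (hh : h ∈ L) :
    teich p K σ h ∈ ringL p K σ hL :=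
  gammaInv_le_ringL (gammaL_le_gammaInv (teich_mem_gammaL hh))

lemma cut_Iio_mem_ringL {x : GammaImmAnCon p K} (hx : x ∈ ringL p K σ hL) (j : ℚ) :
    cut (Set.Iio j) x ∈ ringL p K σ hL := gammaInv_le_ringL (hx j)

lemma cut_Ici_mem_ringL {x : GammaImmAnCon p K} (hx : x ∈ ringL p K σ hL) (j : ℚ) :
    cut (Set.Ici j) x ∈ ringL p K σ hL := by
  have := sub_mem hx (cut_Iio_mem_ringL hx j)
  rwa [← cut_compl, Set.compl_Iio] at this

lemma phi_zpow_cut (j : ℤ) (m : ℚ) (x : GammaImmAnCon p K) :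
    cut (Set.Iio m) ((phi p K σ ^ j) x) =
      (phi p K σ ^ j) (cut (Set.Iio (m / (p : ℚ) ^ j)) x) := by
  have hpq : (0 : ℚ) < (p : ℚ) ^ j := zpow_pos (by exact_mod_cast hp.out.pos) j
  ext n
  rw [coeff_cut, coeff_phi_zpow, coeff_phi_zpow, coeff_cut]
  simp only [Set.mem_Iio, div_lt_div_iff_of_pos_right hpq]
  split_ifs
  · rfl
  · rw [map_zero]

lemma phi_zpow_mem_ringL {x : GammaImmAnCon p K} (hx : x ∈ ringL p K σ hL) (j : ℤ) :
    (phi p K σ ^ j) x ∈ ringL p K σ hL := fun m => by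
  rw [phi_zpow_cut]
  exact phi_zpow_mem_gammaInv hL.1 j (hx _)

/-- Membership can be tested by uniform approximation on half-lines. -/
lemma ringL_of_forall {x : GammaImmAnCon p K}
    (h : ∀ (j : ℚ) (ε : ℝ), 0 < ε → ∃ y ∈ ringL p K σ hL, ∀ m < j, ‖(x - y).coeff m‖ ≤ ε) :
    x ∈ ringL p K σ hL := fun j => by
  refine gammaInv_of_forall hL.1 fun ε hε => ?_
  obtain ⟨y, hy, hxy⟩ := h j ε hε
  refine ⟨_, hy j, fun m => ?_⟩
  rw [← map_sub, coeff_cut]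
  split_ifs with hm
  · exact hxy m hm
  · rw [norm_zero]
    exact hε.le

/-- Subtract the lift of the reduction, divide by λ, repeat: with L the whole field every digit is
allowed. -/
lemma immCon_le_gammaL_top {x : GammaImmAnCon p K} (hx : x ∈ GammaImmCon p K) :
    x ∈ gammaL p K σ ⊤ := by
  obtain ⟨lam, hlam⟩ := IsDiscreteValuationRing.exists_irreducible O
  have hl : Fact (Irreducible lam) := ⟨hlam⟩
  have hr0 := rho_pos (lam := lam) K
  have key : ∀ N : ℕ, ∀ x ∈ GammaImmCon p K, ∃ y ∈ teichSpan p K σ ⊤,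
      SupLe (x - y) (rho K lam ^ N) := by
    intro N
    induction N with
    | zero =>
      intro x hx
      exact ⟨0, zero_mem _, by rwa [sub_zero, pow_zero]⟩
    | succ N ih =>
      intro x hx
      obtain ⟨x', hx', h⟩ := exists_eq_teich_add (lam := lam) (σ := σ) x hx
      obtain ⟨y, hy, hxy⟩ := ih x' hx'
      refine ⟨teich p K σ (red x) + constO p K lam * y,
        add_mem (teich_mem_teichSpan trivial) (constO_mul_mem_teichSpan _ hy), ?_⟩
      nth_rewrite 1 [h]
      rw [add_sub_add_left_eq_sub, ← mul_sub, pow_succ']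
      exact hxy.constO_lam_mul
  refine ⟨hx, fun ε hε => ?_⟩
  obtain ⟨N, h1⟩ := exists_rho_pow_lt (K := K) (hN := hN) (lam := lam) hε
  obtain ⟨y, hy, h⟩ := key N x hx
  exact ⟨y, hy, h.mono h1.le⟩

lemma mem_ringL_top (x : GammaImmAnCon p K) :
    x ∈ ringL p K σ (Hahn.isAdmissible_top p (k := ResidueField O)) := fun j => by
  obtain ⟨lam, hlam⟩ := IsDiscreteValuationRing.exists_irreducible O
  have hl : Fact (Irreducible lam) := ⟨hlam⟩
  have hr0 := rho_pos (lam := lam) K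
  obtain ⟨B, hB⟩ := x.isImmAnCon.bounded j
  obtain ⟨N, h1⟩ := exists_rho_pow_lt (K := K) (hN := hN) (lam := lam)
    (show 0 < (|B| + 1)⁻¹ by positivity)
  have h0 := algebraMap_lam_ne_zero K (lam := lam)
  refine ⟨algebraMap O K lam ^ N, pow_ne_zero _ h0, immCon_le_gammaL_top fun n => ?_⟩
  rw [coeff_constHom_mul, norm_mul, norm_pow, coeff_cut]
  split_ifs with hn
  · have h2 : rho K lam ^ N * ‖x.coeff n‖ ≤ (|B| + 1)⁻¹ * (|B| + 1) := by
      refine mul_le_mul h1.le ?_ (norm_nonneg _) (by positivity)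
      have := hB n (le_of_lt hn)
      have := le_abs_self B
      linarith
    rwa [inv_mul_cancel₀ (by positivity)] at h2
  · rw [norm_zero, mul_zero]
    exact zero_le_one

lemma mem_teichmullerAlg_iff {x : GammaImmAnCon p K} :
    x ∈ teichmullerAlg p K σ ↔ ∃ h ∈ (Hahn.algField (ResidueField O)).toSubring,
      x = teich p K σ h := by
  constructor
  · rintro ⟨h1, h, h2, h3⟩
    have hx : x ∈ GammaImmCon p K := fun n => by
      obtain ⟨a, ha, -⟩ := h2 n
      rw [← ha]
      exact norm_algebraMap_le_one K hN a
    have hr : red x = h := by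
      ext n
      obtain ⟨a, ha, hah⟩ := h2 n
      rw [coeff_red, ← ha, resK_algebraMap, hah]
    refine ⟨h, Hahn.mem_algField.2 h3, ?_⟩
    rw [← hr]
    exact eq_teich hx h1
  · rintro ⟨h, hh, rfl⟩
    refine ⟨phi_teich h, h, fun n => ?_, Hahn.mem_algField.1 hh⟩
    obtain ⟨a, ha⟩ := (hN.norm_le_one_iff _).1 (teich_mem (p := p) (K := K) (σ := σ) h n)
    refine ⟨a, ha, ?_⟩
    rw [← resK_algebraMap (K := K) (p := p), ha, ← coeff_red, red_teich]

lemma mem_teichSubring_iff {x : GammaImmAnCon p K} :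
    x ∈ teichSubring p K σ ↔ x ∈ teichSpan p K σ (Hahn.algField (ResidueField O)).toSubring := by
  constructor
  · intro hx
    induction hx using Subring.closure_induction with
    | mem x hx =>
      rcases hx with ⟨a, rfl⟩ | hx
      · have := constO_mul_teich_mem (p := p) (K := K) (σ := σ) a
          (Hahn.algField (ResidueField O)).toSubring.one_mem
        rwa [teich_one, mul_one] at this
      · obtain ⟨h, hh, rfl⟩ := mem_teichmullerAlg_iff.1 hx
        exact teich_mem_teichSpan hh
    | zero => exact zero_mem _
    | one =>
      rw [← teich_one (σ := σ)]
      exact teich_mem_teichSpan (Subring.one_mem _)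
    | add x y _ _ hx hy => exact add_mem hx hy
    | neg x _ hx => exact neg_mem hx
    | mul x y _ _ hx hy => exact teichSpan_mul hx hy
  · intro hx
    induction hx using AddSubgroup.closure_induction with
    | mem x hx =>
      obtain ⟨o, h, hh, rfl⟩ := hx
      exact mul_mem (const_mem_teichSubring σ o)
        (Subring.subset_closure (Or.inr (mem_teichmullerAlg_iff.2 ⟨h, hh, rfl⟩)))
    | zero => exact zero_mem _
    | add x y _ _ hx hy => exact add_mem hx hy
    | neg x _ hx => exact neg_mem hx

lemma mem_algCon_iff {x : GammaImmAnCon p K} :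
    x ∈ GammaAlgCon p K σ ↔ x ∈ gammaL p K σ (Hahn.algField (ResidueField O)).toSubring := by
  have hp0 : 0 < ‖(p : K)‖ := by
    rw [hN.norm_p]
    exact inv_pos.2 (base_pos p)
  have hp1 : ‖(p : K)‖ < 1 := by
    rw [hN.norm_p]
    exact inv_lt_one_of_one_lt₀ (one_lt_base p)
  constructor
  · rintro ⟨h1, h2⟩
    refine ⟨h1, fun ε hε => ?_⟩
    obtain ⟨N, hN'⟩ := exists_pow_lt_of_lt_one hε hp1
    obtain ⟨y, hy, h⟩ := h2 N
    exact ⟨y, mem_teichSubring_iff.1 hy, SupLe.mono h hN'.le⟩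
  · rintro ⟨h1, h2⟩
    refine ⟨h1, fun N => ?_⟩
    obtain ⟨y, hy, h⟩ := h2 _ (pow_pos hp0 N)
    exact ⟨y, mem_teichSubring_iff.2 hy, h⟩

lemma mem_algConInvP_iff {x : GammaImmAnCon p K} :
    x ∈ algConInvP p K σ ↔ x ∈ gammaInv p K σ (Hahn.algField (ResidueField O)).toSubring := by
  have hp0 : 0 < ‖(p : K)‖ := by
    rw [hN.norm_p]
    exact inv_pos.2 (base_pos p)
  have hp1 : ‖(p : K)‖ < 1 := by
    rw [hN.norm_p]
    exact inv_lt_one_of_one_lt₀ (one_lt_base p)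
  have e : ∀ N : ℕ, (p : GammaImmAnCon p K) ^ N = constHom ((p : K) ^ N) := fun N => by
    rw [map_pow, map_natCast]
  constructor
  · rintro ⟨N, h⟩
    rw [mem_algCon_iff, e] at h
    exact ⟨_, pow_ne_zero _ (norm_pos_iff.1 hp0), h⟩
  · rintro ⟨a, ha, h⟩
    obtain ⟨N, hN'⟩ := exists_pow_lt_of_lt_one (norm_pos_iff.2 ha) hp1
    refine ⟨N, ?_⟩
    rw [mem_algCon_iff, e]
    refine constHom_mul_mem_gammaL ha ?_ h
    rw [norm_pow]
    exact hN'.le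

lemma teichSpan_mono {L L' : Subring (HahnSeries ℚ (ResidueField O))} (h : L ≤ L')
    {x : GammaImmAnCon p K} (hx : x ∈ teichSpan p K σ L) : x ∈ teichSpan p K σ L' := by
  refine AddSubgroup.closure_mono ?_ hx
  rintro _ ⟨o, g, hg, rfl⟩
  exact ⟨o, g, h hg, rfl⟩

lemma gammaL_mono {L L' : Subring (HahnSeries ℚ (ResidueField O))} (h : L ≤ L')
    {x : GammaImmAnCon p K} (hx : x ∈ gammaL p K σ L) : x ∈ gammaL p K σ L' :=
  ⟨hx.1, fun ε hε => by
    obtain ⟨y, hy, hxy⟩ := hx.2 ε hε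
    exact ⟨y, teichSpan_mono h hy, hxy⟩⟩

lemma algTrunc_le_algField :
    Hahn.algTrunc (ResidueField O) ≤ (Hahn.algField (ResidueField O)).toSubring :=
  fun _ h => h.1

/-- The truncations of the first digit of z are reductions of cuts of z, hence algebraic.
Subtracting the lift of this digit and dividing by λ preserves both hypotheses, since cuts of that
lift are already under control; so all digits have algebraic truncations. -/
lemma mem_gammaL_algTrunc {z : GammaImmAnCon p K}
    (hz : z ∈ gammaL p K σ (Hahn.algField (ResidueField O)).toSubring)
    (hcut : ∀ i : ℚ, cut (Set.Iio i) z ∈ gammaL p K σ (Hahn.algField (ResidueField O)).toSubring) :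
    z ∈ gammaL p K σ (Hahn.algTrunc (ResidueField O)) := by
  obtain ⟨lam, hlam⟩ := IsDiscreteValuationRing.exists_irreducible O
  have hl : Fact (Irreducible lam) := ⟨hlam⟩
  have hr0 := rho_pos (lam := lam) K
  have hF := Hahn.isPerfectSub_algField p (k := ResidueField O)
  have hT := Hahn.isAdmissible_algTrunc p (k := ResidueField O)
  have key : ∀ N : ℕ, ∀ z ∈ gammaL p K σ (Hahn.algField (ResidueField O)).toSubring,
      (∀ i : ℚ, cut (Set.Iio i) z ∈ gammaL p K σ (Hahn.algField (ResidueField O)).toSubring) →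
      ∃ y ∈ teichSpan p K σ (Hahn.algTrunc (ResidueField O)), SupLe (z - y) (rho K lam ^ N) := by
    intro N
    induction N with
    | zero =>
      intro z hz _
      exact ⟨0, zero_mem _, by rw [sub_zero, pow_zero]; exact hz.1⟩
    | succ N ih =>
      intro z hz hcut
      have hred : red z ∈ Hahn.algTrunc (ResidueField O) := by
        refine ⟨red_mem (lam := lam) hF hz, fun j => ?_⟩
        have h1 := red_mem (lam := lam) hF (hcut j)
        have h2 : HahnSeries.truncLT j (red z) = red (O := O) (cut (Set.Iio j) z) := by
          ext n
          rw [Hahn.coeff_truncLT_ite, coeff_red, coeff_red, coeff_cut]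
          by_cases h : n < j <;> simp [h]
        rw [h2]
        exact h1
      have ht := teich_mem_gammaL (p := p) (K := K) (σ := σ) hred
      obtain ⟨z', hz', h⟩ := exists_eq_teich_add_of_mem (lam := lam) (σ := σ) hF hz
      have hcut' : ∀ i : ℚ, cut (Set.Iio i) z' ∈
          gammaL p K σ (Hahn.algField (ResidueField O)).toSubring := by
        intro i
        refine mem_gammaL_of_lam_mul (lam := lam) hF ((mem_immCon_iff.1 hz'.1).cut _) ?_
        have e : constO p K lam * cut (Set.Iio i) z' = cut (Set.Iio i) z -
            cut (Set.Iio i) (teich p K σ (red z)) := by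
          rw [constO_apply, ← cut_constHom_mul, ← constO_apply, ← map_sub]
          congr 1
          rw [eq_sub_iff_add_eq, add_comm]
          exact h.symm
        rw [e]
        exact sub_mem (hcut i) (gammaL_mono algTrunc_le_algField (cut_mem_gammaL hT i ht))
      obtain ⟨y, hy, hxy⟩ := ih z' hz' hcut'
      refine ⟨teich p K σ (red z) + constO p K lam * y,
        add_mem (teich_mem_teichSpan hred) (constO_mul_mem_teichSpan _ hy), ?_⟩
      nth_rewrite 1 [h]
      rw [add_sub_add_left_eq_sub, ← mul_sub, pow_succ']
      exact hxy.constO_lam_mul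
  refine ⟨hz.1, fun ε hε => ?_⟩
  obtain ⟨N, h1⟩ := exists_rho_pow_lt (K := K) (hN := hN) (lam := lam) hε
  obtain ⟨y, hy, h⟩ := key N z hz hcut
  exact ⟨y, hy, h.mono h1.le⟩

lemma mem_truncAlg_iff {x : GammaImmAnCon p K} :
    x ∈ truncAlg p K σ ↔ x ∈ ringL p K σ (Hahn.isAdmissible_algTrunc p (k := ResidueField O)) := by
  have hF := Hahn.isPerfectSub_algField p (k := ResidueField O)
  constructor
  · intro hx
    have h1 : ∀ j : ℚ, cut (Set.Iio j) x ∈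
        gammaInv p K σ (Hahn.algField (ResidueField O)).toSubring := by
      intro j
      obtain ⟨y, hy, h⟩ := hx j
      have : cut (Set.Iio j) x = y := by
        ext n
        simp only [coeff_cut, h, Set.mem_Iio]
      rw [this]
      exact mem_algConInvP_iff.1 hy
    intro j
    obtain ⟨a, ha, h2⟩ := h1 j
    refine ⟨a, ha, mem_gammaL_algTrunc h2 fun i => ?_⟩
    refine mem_gammaL_of_mem_gammaInv hF ?_ ((mem_immCon_iff.1 h2.1).cut _)
    rw [cut_constHom_mul, cut_cut, Set.Iio_inter_Iio]
    exact mul_mem (constHom_mem_gammaInv a) (h1 _)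
  · intro hx j
    obtain ⟨a, ha, h⟩ := hx j
    refine ⟨cut (Set.Iio j) x, mem_algConInvP_iff.2 ⟨a, ha, gammaL_mono algTrunc_le_algField h⟩,
      fun i => by simp only [coeff_cut, Set.mem_Iio]⟩

/-- This allows the two cases to be treated uniformly. In the algebraic case it also shows that the
truncation condition already defines a ring, so the closure in the definition adds nothing. -/
lemma exists_ringL (d : Decoration) : ∃ (L : Subring (HahnSeries ℚ (ResidueField O)))
    (hL : Hahn.IsAdmissible p L), analyticRing p K σ d = ringL p K σ hL := by
  cases d with
  | alg =>
    refine ⟨_, Hahn.isAdmissible_algTrunc p (k := ResidueField O), ?_⟩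
    show Subring.closure (truncAlg p K σ) = _
    have : truncAlg p K σ = (ringL p K σ (Hahn.isAdmissible_algTrunc p (k := ResidueField O)) :
        Set (GammaImmAnCon p K)) := Set.ext fun x => mem_truncAlg_iff
    rw [this, Subring.closure_eq]
  | imm =>
    refine ⟨_, Hahn.isAdmissible_top p (k := ResidueField O), ?_⟩
    exact (Subring.eq_top_iff' _).2 mem_ringL_top |>.symm

end Rings

/-! ### Gauss norms and sums of families of series. -/

section Gauss

set_option linter.unusedSectionVars false

variable {p : ℕ} {O K : Type*} [CommRing O] [NormedField K] [Algebra O K]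
  [hp : Fact p.Prime] [IsUltrametricDist K] [CompleteSpace K]

open IsLocalRing GammaImmAnCon

/-- The Gauss norm `sup ‖x_n‖ p ^ (-s n)` of `x` is at most `C`. -/
def GaussLe (s : ℝ) (x : GammaImmAnCon p K) (C : ℝ) : Prop := ∀ m, ‖x.coeff m‖ * wt p s m ≤ C

variable {s C D : ℝ} {x y : GammaImmAnCon p K}

lemma GaussLe.mono (h : GaussLe s x C) (hCD : C ≤ D) : GaussLe s x D := fun m => (h m).trans hCD

lemma GaussLe.nonneg (h : GaussLe s x C) : 0 ≤ C := (nn s x.coeff 0).trans (h 0)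

lemma wt_mul_wt_neg (s : ℝ) (m : ℚ) : wt p s m * wt p (-s) m = 1 := by
  unfold wt
  rw [← Real.rpow_add (base_pos p)]
  simp

lemma GaussLe.norm_le (h : GaussLe s x C) (m : ℚ) : ‖x.coeff m‖ ≤ C * wt p (-s) m := by
  calc ‖x.coeff m‖ = ‖x.coeff m‖ * wt p s m * wt p (-s) m := by
        rw [mul_assoc, wt_mul_wt_neg, mul_one]
    _ ≤ _ := mul_le_mul_of_nonneg_right (h m) (wt_pos p _ m).le

lemma GaussLe.mul (hx : GaussLe s x C) (hy : GaussLe s y D) : GaussLe s (x * y) (C * D) := by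
  intro m
  have hw := wt_pos p s m
  have hCD := mul_nonneg hx.nonneg hy.nonneg
  rw [← le_div_iff₀ hw, coeff_mul]
  refine norm_tsum_le_of_forall (by positivity) fun i => ?_
  rw [le_div_iff₀ hw, norm_mul_wt]
  exact mul_le_mul (hx i) (hy _) (nn s y.coeff _) hx.nonneg

lemma GaussLe.constHom_mul (hx : GaussLe s x C) (a : K) :
    GaussLe s (constHom a * x) (‖a‖ * C) := fun m => by
  rw [coeff_constHom_mul, norm_mul, mul_assoc]
  exact mul_le_mul_of_nonneg_left (hx m) (norm_nonneg _)

lemma wt_anti (hs : 0 ≤ s) {a m : ℚ} (h : a ≤ m) : wt p s m ≤ wt p s a := by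
  refine Real.rpow_le_rpow_of_exponent_le (one_lt_base p).le (neg_le_neg ?_)
  exact mul_le_mul_of_nonneg_left (by exact_mod_cast h) hs

lemma SupLe.gaussLe (hx : SupLe x C) (hs : 0 ≤ s) {a : ℚ} (ha : ∀ m, x.coeff m ≠ 0 → a ≤ m) :
    GaussLe s x (C * wt p s a) := fun m => by
  have hC : 0 ≤ C := (norm_nonneg _).trans (hx 0)
  by_cases h : x.coeff m = 0
  · rw [h, norm_zero, zero_mul]
    exact mul_nonneg hC (wt_pos p s a).le
  · exact mul_le_mul (hx m) (wt_anti hs (ha m h)) (wt_pos p s m).le hC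

lemma good_of_bddBelow (hs : 0 < s) {a : ℚ} (ha : ∀ m, x.coeff m ≠ 0 → a ≤ m) :
    Good p s x.coeff := by
  have key : ∀ ε : ℝ, 0 < ε → ∃ b : ℚ, ∀ n, ε ≤ ‖x.coeff n‖ * wt p s n → n ≤ b := by
    intro ε hε
    obtain ⟨b, hb⟩ := eventually_atTop.1 ((x.isImmAnCon.pos (s / 2) (by positivity)).and
      (eventually_rpow_lt_atTop p (show s / 2 - s < 0 by linarith) hε))
    refine ⟨b, fun n hn => ?_⟩
    by_contra! h
    obtain ⟨h1, h2⟩ := hb n h.le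
    have := mul_le_mul_of_nonneg_right h1.le (wt_pos p s n).le
    rw [rpow_mul_wt] at this
    linarith
  have hwa := wt_pos p s a
  refine ⟨?_, fun ε hε => ?_⟩
  · obtain ⟨b, hb⟩ := key 1 one_pos
    obtain ⟨B, hB⟩ := x.isImmAnCon.bounded b
    refine ⟨max 1 (|B| * wt p s a), by positivity, fun n => ?_⟩
    by_cases h : 1 ≤ ‖x.coeff n‖ * wt p s n
    · refine le_max_of_le_right ?_
      have h0 : x.coeff n ≠ 0 := by
        intro h0
        rw [h0, norm_zero, zero_mul] at h
        linarith
      exact mul_le_mul ((hB n (hb n h)).trans (le_abs_self B)) (wt_anti hs.le (ha n h0))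
        (wt_pos p s n).le (abs_nonneg B)
    · exact le_max_of_le_left (not_le.1 h).le
  · refine (x.isPWO (ε := ε / wt p s a) (by positivity)).mono fun n hn => ?_
    have hn' : ε ≤ ‖x.coeff n‖ * wt p s n := hn
    have h0 : x.coeff n ≠ 0 := by
      intro h0
      rw [h0, norm_zero, zero_mul] at hn'
      linarith
    show ε / wt p s a ≤ ‖x.coeff n‖
    rw [div_le_iff₀ hwa]
    exact hn'.trans (mul_le_mul_of_nonneg_left (wt_anti hs.le (ha n h0)) (norm_nonneg _))

lemma Good.mono_norm {f g : ℚ → K} (hg : Good p s g) (h : ∀ n, ‖f n‖ ≤ ‖g n‖) : Good p s f := by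
  have h1 : ∀ n, ‖f n‖ * wt p s n ≤ ‖g n‖ * wt p s n := fun n =>
    mul_le_mul_of_nonneg_right (h n) (wt_pos p s n).le
  obtain ⟨⟨B, hB, h2⟩, h3⟩ := hg
  exact ⟨⟨B, hB, fun n => (h1 n).trans (h2 n)⟩, fun ε hε => (h3 ε hε).mono fun n hn =>
    (show ε ≤ _ from hn).trans (h1 n)⟩

lemma Good.const_mul {f : ℚ → K} (hf : Good p s f) (a : K) : Good p s (fun n => a * f n) := by
  by_cases ha : a = 0
  · simp only [ha, zero_mul]
    convert good_constFun (p := p) s (0 : K) using 1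
    funext n
    simp [constFun]
  · have ha' : 0 < ‖a‖ := norm_pos_iff.2 ha
    obtain ⟨⟨B, hB, h2⟩, h3⟩ := hf
    refine ⟨⟨‖a‖ * B, by positivity, fun n => ?_⟩, fun ε hε =>
      (h3 (ε / ‖a‖) (by positivity)).mono fun n hn => ?_⟩
    · rw [norm_mul, mul_assoc]
      exact mul_le_mul_of_nonneg_left (h2 n) ha'.le
    · show ε / ‖a‖ ≤ ‖f n‖ * wt p s n
      rw [div_le_iff₀ ha']
      have : ε ≤ ‖a * f n‖ * wt p s n := hn
      rw [norm_mul] at this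
      linarith

/-- A family of series whose Gauss norms tend to zero. -/
structure GSummable {ι : Type*} (c : ℝ) (x : ι → GammaImmAnCon p K) : Prop where
  pos : 0 < c
  good : ∀ s, 0 < s → s ≤ c → ∀ i, Good p s (x i).coeff
  bound : ∀ s, 0 < s → s ≤ c → ∃ β : ι → ℝ, Tendsto β cofinite (𝓝 0) ∧ ∀ i, GaussLe s (x i) (β i)

namespace GSummable

variable {ι : Type*} {c : ℝ} {x : ι → GammaImmAnCon p K}

lemma finite_gt (hx : GSummable c x) {s : ℝ} (hs : 0 < s) (hsc : s ≤ c) {ε : ℝ} (hε : 0 < ε) :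
    ∃ F : Finset ι, ∀ i ∉ F, GaussLe s (x i) ε := by
  obtain ⟨β, hβ, h⟩ := hx.bound s hs hsc
  have h1 := hβ.eventually_lt_const hε
  rw [eventually_cofinite] at h1
  refine ⟨h1.toFinset, fun i hi => (h i).mono ?_⟩
  rw [Set.Finite.mem_toFinset] at hi
  exact (not_not.1 hi).le

lemma summable (hx : GSummable c x) (m : ℚ) : Summable fun i => (x i).coeff m := by
  refine summable_of_finite fun ε hε => ?_
  have hw := wt_pos p (-c) m
  obtain ⟨F, hF⟩ := hx.finite_gt hx.pos le_rfl (show 0 < ε / 2 / wt p (-c) m by positivity)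
  refine F.finite_toSet.subset fun i hi => ?_
  by_contra hiF
  have h1 := (hF i hiF).norm_le m
  rw [div_mul_cancel₀ _ hw.ne'] at h1
  have h2 : ε ≤ ‖(x i).coeff m‖ := hi
  linarith

/-- For each radius and each ε only finitely many members contribute at least ε, so the relevant
exponents lie in a finite union of well-ordered sets. -/
lemma isImmAnCon (hx : GSummable c x) : IsImmAnCon p fun m => ∑' i, (x i).coeff m := by
  have key : ∀ {s : ℝ} (m : ℚ) {C : ℝ}, 0 ≤ C → (∀ i, ‖(x i).coeff m‖ * wt p s m ≤ C) →
      ‖∑' i, (x i).coeff m‖ * wt p s m ≤ C := by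
    intro s m C hC h
    have hw := wt_pos p s m
    rw [← le_div_iff₀ hw]
    exact norm_tsum_le_of_forall (by positivity) fun i => (le_div_iff₀ hw).2 (h i)
  refine isImmAnCon_iff.2 ⟨c, hx.pos, fun s hs hsc => ⟨?_, fun ε hε => ?_⟩⟩
  · obtain ⟨F, hF⟩ := hx.finite_gt hs hsc one_pos
    choose B hB0 hB using fun i => (hx.good s hs hsc i).1
    have h0 : 0 ≤ ∑ i ∈ F, B i := Finset.sum_nonneg fun i _ => (hB0 i).le
    refine ⟨1 + ∑ i ∈ F, B i, by linarith, fun m => key m (by linarith) fun i => ?_⟩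
    by_cases hi : i ∈ F
    · have := Finset.single_le_sum (f := B) (fun i _ => (hB0 i).le) hi
      have := hB i m
      linarith
    · have := hF i hi m
      linarith
  · obtain ⟨F, hF⟩ := hx.finite_gt hs hsc (half_pos hε)
    have h1 : (⋃ i ∈ F, {m : ℚ | ε / 2 ≤ ‖(x i).coeff m‖ * wt p s m}).IsPWO := by
      rw [Finset.isPWO_bUnion]
      exact fun i _ => (hx.good s hs hsc i).2 _ (half_pos hε)
    refine h1.mono fun m hm => ?_
    by_contra hm'
    simp only [Set.mem_iUnion, Set.mem_ofPred_eq, not_exists, not_le] at hm'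
    have h2 : ‖∑' i, (x i).coeff m‖ * wt p s m ≤ ε / 2 := key m (half_pos hε).le fun i => by
      by_cases hi : i ∈ F
      · exact (hm' i hi).le
      · exact hF i hi m
    have h3 : ε ≤ ‖∑' i, (x i).coeff m‖ * wt p s m := hm
    linarith

/-- The sum of a family of series whose Gauss norms tend to zero. -/
def sum (hx : GSummable c x) : GammaImmAnCon p K := ⟨fun m => ∑' i, (x i).coeff m, hx.isImmAnCon⟩

lemma coeff_sum (hx : GSummable c x) (m : ℚ) : hx.sum.coeff m = ∑' i, (x i).coeff m := rfl

lemma hasSum (hx : GSummable c x) (m : ℚ) : HasSum (fun i => (x i).coeff m) (hx.sum.coeff m) :=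
  (hx.summable m).hasSum

lemma gaussLe_sum (hx : GSummable c x) {s C : ℝ} (hC : 0 ≤ C) (h : ∀ i, GaussLe s (x i) C) :
    GaussLe s hx.sum C := fun m => by
  have hw := wt_pos p s m
  rw [← le_div_iff₀ hw]
  exact norm_tsum_le_of_forall (by positivity) fun i => (le_div_iff₀ hw).2 (h i m)

end GSummable

section Ring

variable [IsDomain O] [IsDiscreteValuationRing O] [IsFractionRing O K] [hN : IsNormalizedAbs p O K]
  {σ : O ≃+* O} [CharP (ResidueField O) p] [hs : Fact (∀ a : O, σ a - a ^ p ∈ maximalIdeal O)]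
  {L : Subring (HahnSeries ℚ (ResidueField O))} [IsAlgClosed (ResidueField O)]
  {hL : Hahn.IsAdmissible p L}

lemma GSummable.sum_mem_ringL {ι : Type*} {c : ℝ} {x : ι → GammaImmAnCon p K} (hx : GSummable c x)
    (h : ∀ i, x i ∈ ringL p K σ hL) : hx.sum ∈ ringL p K σ hL := by
  refine ringL_of_forall fun j ε hε => ?_
  have hw := wt_pos p (-c) j
  obtain ⟨F, hF⟩ := hx.finite_gt hx.pos le_rfl (show 0 < ε / wt p (-c) j by positivity)
  refine ⟨∑ i ∈ F, x i, sum_mem fun i _ => h i, fun m hm => ?_⟩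
  rw [coeff_sub, GenSeries.coeff_sum, hx.coeff_sum, norm_sub_rev]
  have h1 : ∀ i ∉ F, ‖(x i).coeff m‖ ≤ ε := by
    intro i hi
    refine ((hF i hi).norm_le m).trans ?_
    have h2 : wt p (-c) m ≤ wt p (-c) j := by
      refine Real.rpow_le_rpow_of_exponent_le (one_lt_base p).le ?_
      have : (m : ℝ) ≤ j := by exact_mod_cast hm.le
      have := hx.pos
      nlinarith
    calc _ ≤ ε / wt p (-c) j * wt p (-c) j := mul_le_mul_of_nonneg_left h2 (by positivity)
      _ = ε := div_mul_cancel₀ _ hw.ne'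
  rw [norm_sub_rev]
  exact norm_sub_sum_tsum_le (hx.summable m) F hε.le h1

lemma norm_mul_wt_phi_zpow (j : ℤ) (x : GammaImmAnCon p K) (s : ℝ) (n : ℚ) :
    ‖((phi p K σ ^ j) x).coeff n‖ * wt p s n =
      ‖x.coeff (n / (p : ℚ) ^ j)‖ * wt p (s * (p : ℝ) ^ j) (n / (p : ℚ) ^ j) := by
  have hpq : (p : ℝ) ^ j ≠ 0 := zpow_ne_zero _ (base_pos p).ne'
  rw [norm_coeff_phi_zpow]
  congr 1
  unfold wt
  congr 2
  push_cast
  rw [mul_assoc, mul_div_cancel₀ _ hpq]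

lemma good_phi_zpow {s : ℝ} {j : ℤ} {x : GammaImmAnCon p K}
    (hx : Good p (s * (p : ℝ) ^ j) x.coeff) : Good p s ((phi p K σ ^ j) x).coeff := by
  have hpq : (0 : ℚ) < (p : ℚ) ^ j := zpow_pos (by exact_mod_cast hp.out.pos) j
  obtain ⟨⟨B, hB, h1⟩, h2⟩ := hx
  refine ⟨⟨B, hB, fun m => ?_⟩, fun ε hε => ?_⟩
  · rw [norm_mul_wt_phi_zpow]
    exact h1 _
  · refine ((h2 ε hε).image_of_monotone (f := fun n : ℚ => n * (p : ℚ) ^ j)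
      (fun a b hab => mul_le_mul_of_nonneg_right hab hpq.le)).mono fun n hn => ?_
    refine ⟨n / (p : ℚ) ^ j, ?_, div_mul_cancel₀ _ hpq.ne'⟩
    have hn' : ε ≤ ‖((phi p K σ ^ j) x).coeff n‖ * wt p s n := hn
    rwa [norm_mul_wt_phi_zpow] at hn'

end Ring

/-- `R ^ i Q ^ (-a Q ^ i)` tends to zero. -/
lemma tendsto_pow_mul_rpow {Q : ℝ} (hQ : 1 < Q) {B : ℝ} (hB : 1 < B) {R a : ℝ} (hR : 0 < R)
    (ha : 0 < a) : Tendsto (fun i : ℕ => R ^ i * B ^ (-(a * Q ^ i))) atTop (𝓝 0) := by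
  have h1 := tendsto_rpow_mul_exp_neg_mul_atTop_nhds_zero (Real.logb Q R) (a * Real.log B)
    (mul_pos ha (Real.log_pos hB))
  have h2 : Tendsto (fun i : ℕ => Q ^ i) atTop atTop := tendsto_pow_atTop_atTop_of_one_lt hQ
  refine (h1.comp h2).congr fun i => ?_
  have hQ0 : 0 < Q := by linarith
  have hB0 : 0 < B := by linarith
  simp only [Function.comp_apply]
  congr 1
  · rw [← Real.rpow_natCast, ← Real.rpow_mul hQ0.le, mul_comm, Real.rpow_mul hQ0.le,
      Real.rpow_logb hQ0 hQ.ne' hR, Real.rpow_natCast]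
  · rw [Real.rpow_def_of_pos hB0]
    congr 1
    ring

end Gauss

/-! ### Coboundaries for 1 - μφ^n and orbit sums. -/

section Coboundary

set_option linter.unusedSectionVars false

variable {p : ℕ} {O K : Type*} [CommRing O] [NormedField K] [Algebra O K]
  [hp : Fact p.Prime] [IsUltrametricDist K] [CompleteSpace K]
  [IsDomain O] [IsDiscreteValuationRing O] [IsFractionRing O K] [hN : IsNormalizedAbs p O K]
  {σ : O ≃+* O}

open IsLocalRing GammaImmAnCon

lemma tau_zpow_eq_self {mu : K} (h : tau K σ mu = mu) (j : ℤ) : (tau K σ ^ j) mu = mu := by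
  have hinv : (tau K σ)⁻¹ mu = mu := by
    conv_lhs => rw [← h]
    rw [← RingAut.mul_apply, inv_mul_cancel, RingAut.one_apply]
  induction j with
  | zero => rw [zpow_zero, RingAut.one_apply]
  | succ i ih => rw [zpow_add_one, RingAut.mul_apply, h, ih]
  | pred i ih => rw [zpow_sub_one, RingAut.mul_apply, hinv, ih]

include hN in
lemma continuous_tau_zpow (j : ℤ) : Continuous (tau K σ ^ j) :=
  AddMonoidHomClass.continuous_of_bound (tau K σ ^ j) 1 fun a => by
    rw [norm_tau_zpow (hN := hN), one_mul]

variable (σ) in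
/-- The `j`-th term of the sum `∑ mu ^ j τ ^ (n j) (f_{m / p ^ (n j)})`. -/
def orbitTerm (n : ℕ) (mu : K) (f : GammaImmAnCon p K) (m : ℚ) (j : ℤ) : K :=
  mu ^ j * (tau K σ ^ ((n : ℤ) * j)) (f.coeff (m / (p : ℚ) ^ ((n : ℤ) * j)))

lemma orbitTerm_zero (n : ℕ) (mu : K) (f : GammaImmAnCon p K) (m : ℚ) :
    orbitTerm σ n mu f m 0 = f.coeff m := by
  unfold orbitTerm
  simp

lemma orbitTerm_shift {n : ℕ} {mu : K} (hmu0 : mu ≠ 0) (hmu : tau K σ mu = mu)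
    (f : GammaImmAnCon p K) (m : ℚ) (j : ℤ) :
    mu * (tau K σ ^ (n : ℤ)) (orbitTerm σ n mu f (m / (p : ℚ) ^ (n : ℤ)) j) =
      orbitTerm σ n mu f m (j + 1) := by
  have hpq : (p : ℚ) ≠ 0 := by exact_mod_cast hp.out.ne_zero
  unfold orbitTerm
  rw [map_mul, map_zpow₀, tau_zpow_eq_self hmu, ← RingAut.mul_apply, ← zpow_add, ← mul_assoc,
    zpow_add_one₀ hmu0, mul_comm mu, div_div, ← zpow_add₀ hpq]
  congr 3
  · ring
  · congr 3
    ring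

variable [CharP (ResidueField O) p] [hs : Fact (∀ a : O, σ a - a ^ p ∈ maximalIdeal O)]
  {L : Subring (HahnSeries ℚ (ResidueField O))} [IsAlgClosed (ResidueField O)]
  {hL : Hahn.IsAdmissible p L}

/-- A series is cohomologous for `1 - mu φ ^ n` to a series supported in `[-q r, -r)`, where
`q = p ^ n`. -/
lemma exists_coboundary {n : ℕ} (hn : 0 < n) {mu : K} (hmu : tau K σ mu = mu) (hmu0 : mu ≠ 0)
    (hmu1 : ‖mu‖ < 1) {r : ℚ} (hr : 0 < r) {f : GammaImmAnCon p K} (hf : f ∈ ringL p K σ hL) :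
    ∃ b ∈ ringL p K σ hL, ∃ c ∈ ringL p K σ hL,
      f = c + (b - constHom mu * (phi p K σ ^ (n : ℤ)) b) ∧
      (∀ m, c.coeff m ≠ 0 → -((p : ℚ) ^ n * r) ≤ m ∧ m < -r) ∧
      ∀ m, -((p : ℚ) ^ n * r) ≤ m → m < -r → HasSum (orbitTerm σ n mu f m) (c.coeff m) := by
  have hp0 := base_pos p
  have hp1 := one_lt_base p
  have hpq : (1 : ℚ) < p := by exact_mod_cast hp.out.one_lt
  have hq : (1 : ℚ) < (p : ℚ) ^ n := one_lt_pow₀ hpq hn.ne'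
  have hqR : (1 : ℝ) < (p : ℝ) ^ n := one_lt_pow₀ hp1 hn.ne'
  have hQ0 : ∀ j : ℤ, (0 : ℚ) < (p : ℚ) ^ j := fun j => zpow_pos (by linarith) j
  have hpnat : ∀ i : ℕ, (p : ℚ) ^ ((n : ℤ) * (i : ℤ)) = ((p : ℚ) ^ n) ^ i := fun i => by
    rw [zpow_mul, zpow_natCast, zpow_natCast]
  have hpneg : ∀ i : ℕ, (p : ℚ) ^ ((n : ℤ) * (-(i + 1 : ℤ))) = (((p : ℚ) ^ n) ^ (i + 1))⁻¹ := by
    intro i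
    rw [mul_neg, zpow_neg, ← Nat.cast_succ, hpnat]
  have hmun : 0 < ‖mu‖ := norm_pos_iff.2 hmu0
  obtain ⟨c, hc, hgood⟩ := f.exists_good
  have hf_bd : ∀ s, 0 < s → s ≤ c → ∃ G, GaussLe s f G := fun s hs hsc => by
    obtain ⟨⟨B, -, hB⟩, -⟩ := hgood s hs hsc
    exact ⟨B, hB⟩
  -- The forward terms (μφ^n)^i f, cut before applying φ so that the result lives on [-r, ∞).
  set x₁ : ℕ → GammaImmAnCon p K := fun i => constHom (mu ^ (i : ℤ)) *
    (phi p K σ ^ ((n : ℤ) * (i : ℤ))) (cut (Set.Ici (-(r / (p : ℚ) ^ ((n : ℤ) * (i : ℤ))))) f)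
    with hx₁
  -- The backward terms (μφ^n)^{-(i+1)} f, cut so that the result lives on (-∞, -r).
  set x₂ : ℕ → GammaImmAnCon p K := fun i => constHom (mu ^ (-(i + 1 : ℤ))) *
    (phi p K σ ^ ((n : ℤ) * (-(i + 1 : ℤ))))
      (cut (Set.Iio (-(r / (p : ℚ) ^ ((n : ℤ) * (-(i + 1 : ℤ)))))) f) with hx₂
  have div_lt : ∀ (m : ℚ) (j : ℤ), m / (p : ℚ) ^ j < -(r / (p : ℚ) ^ j) ↔ m < -r := fun m j => by
    rw [← neg_div, div_lt_div_iff_of_pos_right (hQ0 j)]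
  have c₁ : ∀ i m, (x₁ i).coeff m = if m < -r then 0 else orbitTerm σ n mu f m i := by
    intro i m
    simp only [hx₁]
    rw [coeff_constHom_mul, coeff_phi_zpow, coeff_cut, Set.mem_Ici, ← not_lt, div_lt]
    by_cases h : m < -r
    · rw [if_pos h, if_neg (not_not.2 h), map_zero, mul_zero]
    · rw [if_neg h, if_pos h]
      rfl
  have c₂ : ∀ i m, (x₂ i).coeff m = if m < -r then orbitTerm σ n mu f m (-(i + 1 : ℤ)) else 0 := by
    intro i m
    simp only [hx₂]
    rw [coeff_constHom_mul, coeff_phi_zpow, coeff_cut, Set.mem_Iio, div_lt]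
    split_ifs
    · rfl
    · rw [map_zero, mul_zero]
  have hnorm : ∀ m j, ‖orbitTerm σ n mu f m j‖ =
      ‖mu‖ ^ j * ‖f.coeff (m / (p : ℚ) ^ ((n : ℤ) * j))‖ := fun m j => by
    unfold orbitTerm
    rw [norm_mul, norm_zpow, norm_tau_zpow (hN := hN)]
  -- On [-r, ∞) contracting exponents costs at most p^{sr}, and |μ|^i gives convergence.
  have s₁ : GSummable c x₁ := by
    refine ⟨hc, fun s hs hsc i => ?_, fun s hs hsc => ?_⟩
    · refine good_of_bddBelow hs (a := -r) fun m hm => ?_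
      by_contra! h
      rw [c₁, if_pos h] at hm
      exact hm rfl
    · obtain ⟨G, hG⟩ := hf_bd s hs hsc
      refine ⟨fun i => ‖mu‖ ^ i * (G * (p : ℝ) ^ (s * (r : ℝ))), ?_, fun i m => ?_⟩
      · rw [Nat.cofinite_eq_atTop]
        have := (tendsto_pow_atTop_nhds_zero_of_lt_one hmun.le hmu1).mul_const
          (G * (p : ℝ) ^ (s * (r : ℝ)))
        rwa [zero_mul] at this
      · have hB : 0 ≤ ‖mu‖ ^ i * (G * (p : ℝ) ^ (s * (r : ℝ))) :=
          mul_nonneg (by positivity) (mul_nonneg hG.nonneg (by positivity))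
        rw [c₁]
        split_ifs with h
        · rwa [norm_zero, zero_mul]
        · rw [hnorm, mul_assoc, zpow_natCast]
          refine mul_le_mul_of_nonneg_left ?_ (by positivity)
          refine (mul_le_mul_of_nonneg_right (hG.norm_le _) (wt_pos p s m).le).trans ?_
          rw [mul_assoc]
          refine mul_le_mul_of_nonneg_left ?_ hG.nonneg
          unfold wt
          rw [← Real.rpow_add hp0]
          refine Real.rpow_le_rpow_of_exponent_le hp1.le ?_
          have h2 : m / (p : ℚ) ^ ((n : ℤ) * (i : ℤ)) - m ≤ r := by
            rw [hpnat]
            have h3 : (1 : ℚ) ≤ ((p : ℚ) ^ n) ^ i := one_le_pow₀ hq.le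
            rcases le_total 0 m with h0 | h0
            · have := div_le_self h0 h3
              linarith
            · have := div_nonpos_of_nonpos_of_nonneg h0 (zero_le_one.trans h3)
              linarith [not_lt.1 h]
          have h4 : ((m / (p : ℚ) ^ ((n : ℤ) * (i : ℤ)) - m : ℚ) : ℝ) ≤ r := by exact_mod_cast h2
          have h5 := mul_le_mul_of_nonneg_left h4 hs.le
          rw [Rat.cast_sub] at h5
          linarith
  -- On (-∞, -r) the coefficient of f at m q^{i+1} decays doubly exponentially in i, which beats the
  -- growth of |μ|^{-(i+1)}.
  have s₂ : GSummable c x₂ := by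
    refine ⟨hc, fun s hs hsc i => ?_, fun s hs hsc => ?_⟩
    · simp only [hx₂]
      have h1 : Good p s ((phi p K σ ^ ((n : ℤ) * (-(i + 1 : ℤ))))
          (cut (Set.Iio (-(r / (p : ℚ) ^ ((n : ℤ) * (-(i + 1 : ℤ)))))) f)).coeff := by
        refine good_phi_zpow ((hgood (s * (p : ℝ) ^ ((n : ℤ) * (-(i + 1 : ℤ)))) ?_ ?_).mono_norm
          fun m => ?_)
        · exact mul_pos hs (zpow_pos hp0 _)
        · refine (mul_le_of_le_one_right hs.le ?_).trans hsc
          refine zpow_le_one_of_nonpos₀ hp1.le ?_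
          rw [mul_neg, neg_nonpos]
          positivity
        · rw [coeff_cut]
          split_ifs
          · exact le_rfl
          · rw [norm_zero]
            exact norm_nonneg _
      have h2 := h1.const_mul (mu ^ (-(i + 1 : ℤ)))
      convert h2 using 1
      funext m
      rw [coeff_constHom_mul]
    · obtain ⟨G, hG⟩ := hf_bd s hs hsc
      have hrR : (0 : ℝ) < r := by exact_mod_cast hr
      refine ⟨fun i => (‖mu‖⁻¹ ^ (i + 1) * (p : ℝ) ^ (-(s * r * ((p : ℝ) ^ n) ^ (i + 1)))) *
        (G * (p : ℝ) ^ (s * (r : ℝ))), ?_, fun i m => ?_⟩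
      · rw [Nat.cofinite_eq_atTop]
        have h1 := tendsto_pow_mul_rpow hqR hp1 (inv_pos.2 hmun) (mul_pos hs hrR)
        have := (((tendsto_add_atTop_iff_nat 1).2 h1)).mul_const (G * (p : ℝ) ^ (s * (r : ℝ)))
        rwa [zero_mul] at this
      · rw [c₂]
        split_ifs with h
        · rw [hnorm, zpow_neg, ← inv_zpow, ← Nat.cast_succ, zpow_natCast, mul_assoc]
          show _ ≤ ‖mu‖⁻¹ ^ (i + 1) * (p : ℝ) ^ (-(s * r * ((p : ℝ) ^ n) ^ (i + 1))) *
            (G * (p : ℝ) ^ (s * (r : ℝ)))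
          rw [mul_assoc]
          refine mul_le_mul_of_nonneg_left ?_ (by positivity)
          refine (mul_le_mul_of_nonneg_right (hG.norm_le _) (wt_pos p s m).le).trans ?_
          rw [mul_assoc, mul_left_comm ((p : ℝ) ^ _) G]
          refine mul_le_mul_of_nonneg_left ?_ hG.nonneg
          unfold wt
          rw [← Real.rpow_add hp0, ← Real.rpow_add hp0]
          refine Real.rpow_le_rpow_of_exponent_le hp1.le ?_
          have h2 : m / (p : ℚ) ^ ((n : ℤ) * (-((i.succ : ℕ) : ℤ))) - m ≤
              -(r * ((p : ℚ) ^ n) ^ (i + 1)) + r := by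
            rw [Nat.cast_succ, hpneg, div_inv_eq_mul]
            have h3 : (1 : ℚ) ≤ ((p : ℚ) ^ n) ^ (i + 1) := one_le_pow₀ hq.le
            nlinarith
          have h4 : ((m / (p : ℚ) ^ ((n : ℤ) * (-((i.succ : ℕ) : ℤ))) - m : ℚ) : ℝ) ≤
              ((-(r * ((p : ℚ) ^ n) ^ (i + 1)) + r : ℚ) : ℝ) := by exact_mod_cast h2
          have h5 := mul_le_mul_of_nonneg_left h4 hs.le
          push_cast at h5 ⊢
          linarith
        · rw [norm_zero, zero_mul]
          exact mul_nonneg (by positivity) (mul_nonneg hG.nonneg (by positivity))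
  have m₁ : s₁.sum ∈ ringL p K σ hL := s₁.sum_mem_ringL fun i =>
    mul_mem (constHom_mem_ringL _) (phi_zpow_mem_ringL (cut_Ici_mem_ringL hf _) _)
  have m₂ : s₂.sum ∈ ringL p K σ hL := s₂.sum_mem_ringL fun i =>
    mul_mem (constHom_mem_ringL _) (phi_zpow_mem_ringL (cut_Iio_mem_ringL hf _) _)
  have mb := sub_mem m₁ m₂
  -- At m the coefficient of b is the half-sum over j ≥ 0 for m ≥ -r, and minus the half-sum over j
  -- < 0 for m < -r. Applying μφ^n shifts j by one and moves the boundary to -qr, so f and b - μφ^n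
  -- b differ only between the two boundaries, by the full orbit sum.
  set b := s₁.sum - s₂.sum with hb
  have hb1 : ∀ m, ¬ m < -r → HasSum (fun i : ℕ => orbitTerm σ n mu f m i) (b.coeff m) := by
    intro m hm
    have h1 := s₁.hasSum m
    have h2 := s₂.hasSum m
    simp only [c₁, c₂, if_neg hm] at h1 h2
    rw [hb, coeff_sub, h2.unique hasSum_zero, sub_zero]
    exact h1
  have hb2 : ∀ m, m < -r →
      HasSum (fun i : ℕ => orbitTerm σ n mu f m (-(i + 1 : ℤ))) (-b.coeff m) := by
    intro m hm
    have h1 := s₁.hasSum m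
    have h2 := s₂.hasSum m
    simp only [c₁, c₂, if_pos hm] at h1 h2
    rw [hb, coeff_sub, h1.unique hasSum_zero, zero_sub, neg_neg]
    exact h2
  have hcφ : ∀ m, (constHom mu * (phi p K σ ^ (n : ℤ)) b).coeff m =
      mu * (tau K σ ^ (n : ℤ)) (b.coeff (m / (p : ℚ) ^ (n : ℤ))) := fun m => by
    rw [coeff_constHom_mul, coeff_phi_zpow]
  have hmap : ∀ {g : ℕ → K} {a : K}, HasSum g a →
      HasSum (fun i => mu * (tau K σ ^ (n : ℤ)) (g i)) (mu * (tau K σ ^ (n : ℤ)) a) := by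
    intro g a h
    exact (h.map (tau K σ ^ (n : ℤ)) (continuous_tau_zpow (hN := hN) _)).mul_left mu
  have hφ1 : ∀ m, ¬ m < -((p : ℚ) ^ n * r) → HasSum (fun i : ℕ => orbitTerm σ n mu f m (i + 1))
      ((constHom mu * (phi p K σ ^ (n : ℤ)) b).coeff m) := by
    intro m hm
    have h1 : ¬ m / (p : ℚ) ^ (n : ℤ) < -r := by
      rw [zpow_natCast, div_lt_iff₀ (by linarith)]
      linarith
    have h2 := hmap (hb1 _ h1)
    simp only [orbitTerm_shift hmu0 hmu] at h2
    rw [hcφ]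
    exact h2
  have hφ2 : ∀ m, m < -((p : ℚ) ^ n * r) → HasSum (fun i : ℕ => orbitTerm σ n mu f m (-(i : ℤ)))
      (-(constHom mu * (phi p K σ ^ (n : ℤ)) b).coeff m) := by
    intro m hm
    have h1 : m / (p : ℚ) ^ (n : ℤ) < -r := by
      rw [zpow_natCast, div_lt_iff₀ (by linarith)]
      linarith
    have h2 := hmap (hb2 _ h1)
    simp only [orbitTerm_shift hmu0 hmu] at h2
    rw [hcφ]
    rw [map_neg, mul_neg] at h2
    convert h2 using 2 with i
    congr 1
    ring
  refine ⟨b, mb, f - (b - constHom mu * (phi p K σ ^ (n : ℤ)) b),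
    sub_mem hf (sub_mem mb (mul_mem (constHom_mem_ringL _) (phi_zpow_mem_ringL mb _))),
    by ring, fun m hm => ?_, fun m hm1 hm2 => ?_⟩
  · by_contra hcon
    apply hm
    rw [coeff_sub, coeff_sub, ← orbitTerm_zero (σ := σ) n mu f m]
    by_cases h1 : m < -r
    · have h2 : m < -((p : ℚ) ^ n * r) := by
        by_contra h3
        exact hcon ⟨not_lt.1 h3, h1⟩
      have h3 := (hb2 m h1).zero_add (f := fun i : ℕ => orbitTerm σ n mu f m (-(i : ℤ)))
        |>.unique (hφ2 m h2)
      simp only [Nat.cast_zero, neg_zero] at h3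
      linear_combination h3
    · have h2 : ¬ m < -((p : ℚ) ^ n * r) := by
        intro h3
        nlinarith
      have h3 := (hφ1 m h2).zero_add (f := fun i : ℕ => orbitTerm σ n mu f m (i : ℤ))
        |>.unique (hb1 m h1)
      simp only [Nat.cast_zero] at h3
      linear_combination h3
  · have h1 := hφ1 m (not_lt.2 hm1)
    have h2 := hb2 m hm2
    have h3 := h1.zero_add (f := fun i : ℕ => orbitTerm σ n mu f m (i : ℤ))
    have h4 := HasSum.of_nat_of_neg_add_one h3 h2
    convert h4 using 1
    rw [coeff_sub, coeff_sub, Nat.cast_zero, orbitTerm_zero]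
    ring

end Coboundary

/-! ### Integral powers of Frobenius on generalized power series. -/

namespace Hahn

open HahnSeries

variable {k : Type*} [Field k] [IsAlgClosed k] (p : ℕ) [hp : Fact p.Prime] [CharP k p]

variable (k) in
/-- The Frobenius automorphism of the field of generalized power series. -/
def frob : RingAut (HahnSeries ℚ k) :=
  RingEquiv.ofBijective (_root_.frobenius (HahnSeries ℚ k) p)
    ⟨pow_char_injective p, fun h => exists_pow_char_eq p h⟩

variable {p}

lemma frob_apply (h : HahnSeries ℚ k) : frob k p h = h ^ p := rfl

lemma frob_zpow_natCast (a : ℕ) (h : HahnSeries ℚ k) : (frob k p ^ (a : ℤ)) h = h ^ p ^ a := by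
  induction a generalizing h with
  | zero => simp
  | succ a ih =>
    rw [Nat.cast_succ, zpow_add_one, RingAut.mul_apply, ih, frob_apply, ← pow_mul, pow_succ']

lemma frob_inv_pow (h : HahnSeries ℚ k) : ((frob k p)⁻¹ h) ^ p = h := by
  rw [← frob_apply, ← RingAut.mul_apply, mul_inv_cancel, RingAut.one_apply]

lemma coeff_frob_zpow_ne_zero_iff (j : ℤ) (h : HahnSeries ℚ k) (i : ℚ) :
    ((frob k p ^ j) h).coeff i ≠ 0 ↔ h.coeff (i / (p : ℚ) ^ j) ≠ 0 := by
  have hpq := pq_pos p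
  have h1 : ∀ (h : HahnSeries ℚ k) i, (frob k p h).coeff i ≠ 0 ↔ h.coeff (i / p) ≠ 0 := by
    intro h i
    rw [frob_apply, coeff_pow_char]
    exact pow_ne_zero_iff hp.out.ne_zero
  have h2 : ∀ (h : HahnSeries ℚ k) i, ((frob k p)⁻¹ h).coeff i ≠ 0 ↔ h.coeff (i * p) ≠ 0 := by
    intro h i
    have := h1 ((frob k p)⁻¹ h) (i * p)
    rw [mul_div_cancel_right₀ _ hpq.ne', ← RingAut.mul_apply, mul_inv_cancel,
      RingAut.one_apply] at this
    exact this.symm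
  induction j generalizing h i with
  | zero => simp
  | succ j ih =>
    rw [zpow_add_one, RingAut.mul_apply]
    refine (ih _ _).trans ?_
    rw [h1, zpow_add_one₀ hpq.ne', div_div]
  | pred j ih =>
    rw [zpow_sub_one, RingAut.mul_apply]
    refine (ih _ _).trans ?_
    rw [h2, zpow_sub_one₀ hpq.ne', ← div_div, div_inv_eq_mul]

lemma frob_zpow_mem {L : Subring (HahnSeries ℚ k)} (hL : IsPerfectSub p L) (j : ℤ)
    {h : HahnSeries ℚ k} (hh : h ∈ L) : (frob k p ^ j) h ∈ L := by
  induction j generalizing h with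
  | zero => simpa using hh
  | succ i ih =>
    rw [zpow_add_one, RingAut.mul_apply]
    exact ih (pow_mem hh p)
  | pred i ih =>
    rw [zpow_sub_one, RingAut.mul_apply]
    exact ih (hL.root_mem _ (by rwa [frob_inv_pow]))

end Hahn

/-! ### The eigenvectors δ(u). -/

section Delta

open IsLocalRing GammaImmAnCon

set_option linter.unusedSectionVars false

variable {p : ℕ} {O K : Type*} [CommRing O] [NormedField K] [Algebra O K]
  [hp : Fact p.Prime] [IsUltrametricDist K] [CompleteSpace K]
  [IsDomain O] [IsDiscreteValuationRing O] [IsFractionRing O K] [hN : IsNormalizedAbs p O K]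
  {lam : O} [hl : Fact (Irreducible lam)] {σ : O ≃+* O}
  [CharP (ResidueField O) p] [hs : Fact (∀ a : O, σ a - a ^ p ∈ maximalIdeal O)]
  [IsAlgClosed (ResidueField O)]

lemma phi_zpow_teich (j : ℤ) (h : HahnSeries ℚ (ResidueField O)) :
    (phi p K σ ^ j) (teich p K σ h) = teich p K σ ((Hahn.frob (ResidueField O) p ^ j) h) := by
  induction j generalizing h with
  | zero => simp
  | succ i ih =>
    rw [zpow_add_one, RingAut.mul_apply, phi_teich', ih, zpow_add_one, RingAut.mul_apply,
      Hahn.frob_apply]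
  | pred i ih =>
    have h1 : (phi p K σ)⁻¹ (teich p K σ h) =
        teich p K σ ((Hahn.frob (ResidueField O) p)⁻¹ h) := by
      conv_lhs => rw [← Hahn.frob_inv_pow (p := p) h, ← phi_teich']
      rw [← RingAut.mul_apply, inv_mul_cancel, RingAut.one_apply]
    rw [zpow_sub_one, RingAut.mul_apply, h1, ih, zpow_sub_one, RingAut.mul_apply]

lemma tendsto_cofinite_int {β : ℤ → ℝ} {a : ℝ} (h1 : Tendsto (fun i : ℕ => β i) atTop (𝓝 a))
    (h2 : Tendsto (fun i : ℕ => β (-(i : ℤ))) atTop (𝓝 a)) : Tendsto β cofinite (𝓝 a) := by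
  rw [← Nat.cofinite_eq_atTop] at h1 h2
  intro s hs
  have f1 := h1 hs
  have f2 := h2 hs
  rw [mem_map, mem_cofinite] at f1 f2 ⊢
  refine ((f1.image (fun i : ℕ => (i : ℤ))).union (f2.image (fun i : ℕ => -(i : ℤ)))).subset ?_
  intro i hi
  obtain ⟨k, rfl | rfl⟩ := i.eq_nat_or_neg
  · exact Or.inl ⟨k, hi, rfl⟩
  · exact Or.inr ⟨k, hi, rfl⟩

variable (p K lam) in
/-- A bound for the Gauss norm of the terms of `delta`. -/
def deltaBound (s : ℝ) (g : ℚ) (i : ℤ) : ℝ :=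
  rho K lam ^ (-i) * wt p s ((p : ℚ) ^ i * g)

include hN hl in
-- Two mechanisms: for i → ∞ the exponents p^i g grow geometrically and the weight beats ρ^{-i}; for
-- i → -∞ the factor λ^{-i} itself tends to zero.
lemma tendsto_deltaBound {s : ℝ} (hs : 0 < s) {g : ℚ} (hg : 0 < g) :
    Tendsto (deltaBound p K lam s g) cofinite (𝓝 0) := by
  have hr0 := rho_pos (lam := lam) K
  have hr1 := rho_lt_one (hN := hN) (lam := lam)
  have hgR : (0 : ℝ) < g := by exact_mod_cast hg
  have hp0 := base_pos p
  refine tendsto_cofinite_int ?_ ?_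
  · refine (tendsto_pow_mul_rpow (one_lt_base p) (one_lt_base p) (inv_pos.2 hr0)
      (mul_pos hs hgR)).congr fun i => ?_
    unfold deltaBound wt
    rw [zpow_neg, zpow_natCast, inv_pow]
    congr 3
    push_cast
    rw [zpow_natCast]
    ring
  · refine squeeze_zero (fun i => ?_) (fun i => ?_) (tendsto_pow_atTop_nhds_zero_of_lt_one hr0.le hr1)
    · exact mul_nonneg (zpow_nonneg hr0.le _) (wt_pos p _ _).le
    · unfold deltaBound
      rw [neg_neg, zpow_natCast]
      refine mul_le_of_le_one_right (by positivity) ?_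
      unfold wt
      refine Real.rpow_le_one_of_one_le_of_nonpos (one_lt_base p).le ?_
      rw [neg_nonpos]
      push_cast
      positivity

lemma exists_deltaBound_le (lam : O) [hl : Fact (Irreducible lam)] {s : ℝ} (hs : 0 < s) {g : ℚ}
    (hg : 0 < g) : ∃ M : ℝ, 0 < M ∧ ∀ i, deltaBound p K lam s g i ≤ M := by
  obtain ⟨M, hM⟩ := (tendsto_deltaBound (p := p) (K := K) (lam := lam) hs hg).bddAbove_range_of_cofinite
  exact ⟨max M 1, by positivity, fun i => (hM (Set.mem_range_self i)).trans (le_max_left _ _)⟩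

variable (p K σ lam) in
/-- The terms of the series `delta`. -/
def deltaTerm (u : HahnSeries ℚ (ResidueField O)) (i : ℤ) : GammaImmAnCon p K :=
  constHom (algebraMap O K lam ^ (-i)) * (phi p K σ ^ i) (teich p K σ u)

variable {u : HahnSeries ℚ (ResidueField O)} {g : ℚ}

lemma supLe_deltaTerm (i : ℤ) : SupLe (deltaTerm p K lam σ u i) (rho K lam ^ (-i)) := by
  have h0 : SupLe ((phi p K σ ^ i) (teich p K σ u)) 1 :=
    SupLe.phi_zpow (mem_immCon_iff.1 (teich_mem u)) i
  have h1 := h0.const_mul (algebraMap O K lam ^ (-i))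
  rwa [mul_one, norm_zpow] at h1

lemma le_of_coeff_deltaTerm_ne_zero (hu : ∀ m, u.coeff m ≠ 0 → g ≤ m) {i : ℤ} {m : ℚ}
    (hm : (deltaTerm p K lam σ u i).coeff m ≠ 0) : (p : ℚ) ^ i * g ≤ m := by
  unfold deltaTerm at hm
  rw [coeff_constHom_mul, phi_zpow_teich] at hm
  refine le_of_coeff_teich_ne_zero (fun k hk => ?_) (right_ne_zero_of_mul hm)
  rw [Hahn.coeff_frob_zpow_ne_zero_iff] at hk
  have := hu _ hk
  rwa [le_div_iff₀' (zpow_pos (by exact_mod_cast hp.out.pos) i)] at this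

lemma gaussLe_deltaTerm {s : ℝ} (hs : 0 < s) (hu : ∀ m, u.coeff m ≠ 0 → g ≤ m) (i : ℤ) :
    GaussLe s (deltaTerm p K lam σ u i) (deltaBound p K lam s g i) :=
  (supLe_deltaTerm i).gaussLe hs.le fun _ hm => le_of_coeff_deltaTerm_ne_zero hu hm

lemma gsummable_deltaTerm (hg : 0 < g) (hu : ∀ m, u.coeff m ≠ 0 → g ≤ m) :
    GSummable 1 (deltaTerm p K lam σ u) where
  pos := one_pos
  good _ hs _ _ := good_of_bddBelow hs fun _ hm => le_of_coeff_deltaTerm_ne_zero hu hm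
  bound _ hs _ := ⟨_, tendsto_deltaBound hs hg, gaussLe_deltaTerm hs hu⟩

open Classical in
variable (p K σ lam) in
/-- The series `∑ lam ^ (-i) φ ^ i [u]`, for `u` with positive support. -/
def delta (u : HahnSeries ℚ (ResidueField O)) : GammaImmAnCon p K :=
  -- The value 0 is a default; a positive lower bound on the support of u guarantees the first case.
  if h : GSummable 1 (deltaTerm p K lam σ u) then h.sum else 0

lemma delta_eq (hg : 0 < g) (hu : ∀ m, u.coeff m ≠ 0 → g ≤ m) :
    delta p K lam σ u = (gsummable_deltaTerm (lam := lam) (σ := σ) hg hu).sum := dif_pos (gsummable_deltaTerm (lam := lam) (σ := σ) hg hu)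

lemma hasSum_delta (hg : 0 < g) (hu : ∀ m, u.coeff m ≠ 0 → g ≤ m) (m : ℚ) :
    HasSum (fun i => (deltaTerm p K lam σ u i).coeff m) ((delta p K lam σ u).coeff m) := by
  rw [delta_eq hg hu]
  exact GSummable.hasSum _ m

lemma gaussLe_delta {s : ℝ} (hs : 0 < s) (hg : 0 < g) (hu : ∀ m, u.coeff m ≠ 0 → g ≤ m) {M : ℝ}
    (hM0 : 0 < M) (hM : ∀ i, deltaBound p K lam s g i ≤ M) : GaussLe s (delta p K lam σ u) M := by
  rw [delta_eq hg hu]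
  exact GSummable.gaussLe_sum _ hM0.le fun i => (gaussLe_deltaTerm hs hu i).mono (hM i)

lemma delta_mem_ringL {L : Subring (HahnSeries ℚ (ResidueField O))} {hL : Hahn.IsAdmissible p L}
    (hg : 0 < g) (hu : ∀ m, u.coeff m ≠ 0 → g ≤ m) (huL : u ∈ L) :
    delta p K lam σ u ∈ ringL p K σ hL := by
  rw [delta_eq hg hu]
  exact GSummable.sum_mem_ringL _ fun i =>
    mul_mem (constHom_mem_ringL _) (phi_zpow_mem_ringL (teich_mem_ringL huL) i)

lemma le_of_coeff_frob_zpow_ne_zero (hu : ∀ m, u.coeff m ≠ 0 → g ≤ m) (j : ℤ) (m : ℚ)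
    (hm : ((Hahn.frob (ResidueField O) p ^ j) u).coeff m ≠ 0) : (p : ℚ) ^ j * g ≤ m := by
  rw [Hahn.coeff_frob_zpow_ne_zero_iff] at hm
  have := hu _ hm
  rwa [le_div_iff₀' (zpow_pos (by exact_mod_cast hp.out.pos) j)] at this

/-- A shift of the summation index. Scaling by λ^j is thus absorbed into u, which turns orbit sums
into polynomials in u. -/
lemma delta_frob_zpow (hg : 0 < g) (hu : ∀ m, u.coeff m ≠ 0 → g ≤ m) (j : ℤ) :
    delta p K lam σ ((Hahn.frob (ResidueField O) p ^ j) u) =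
      constHom (algebraMap O K lam ^ j) * delta p K lam σ u := by
  have hpj : (0 : ℚ) < (p : ℚ) ^ j := zpow_pos (by exact_mod_cast hp.out.pos) j
  have h0 := algebraMap_lam_ne_zero K (lam := lam)
  ext m
  have h1 := hasSum_delta (p := p) (K := K) (σ := σ) (lam := lam) (mul_pos hpj hg)
    (le_of_coeff_frob_zpow_ne_zero hu j) m
  have h2 := (hasSum_delta (p := p) (K := K) (σ := σ) (lam := lam) hg hu m).mul_left
    (algebraMap O K lam ^ j)
  rw [coeff_constHom_mul]
  refine h1.unique ?_
  rw [← (Equiv.addRight j).hasSum_iff] at h2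
  have e : ∀ i : ℤ,
      (deltaTerm p K lam σ ((Hahn.frob (ResidueField O) p ^ j) u) i).coeff m =
      algebraMap O K lam ^ j * (deltaTerm p K lam σ u (i + j)).coeff m := by
    intro i
    unfold deltaTerm
    rw [coeff_constHom_mul, coeff_constHom_mul, ← phi_zpow_teich, ← RingAut.mul_apply, ← zpow_add,
      ← mul_assoc, ← zpow_add₀ h0]
    congr 2
    ring
  simp only [e]
  exact h2

lemma phi_zpow_delta (hlam : σ lam = lam) (hg : 0 < g) (hu : ∀ m, u.coeff m ≠ 0 → g ≤ m) (j : ℤ) :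
    (phi p K σ ^ j) (delta p K lam σ u) =
      constHom (algebraMap O K lam ^ j) * delta p K lam σ u := by
  have hpj : (0 : ℚ) < (p : ℚ) ^ j := zpow_pos (by exact_mod_cast hp.out.pos) j
  have htau : tau K σ (algebraMap O K lam) = algebraMap O K lam := by
    rw [tau_algebraMap, hlam]
  rw [← delta_frob_zpow hg hu]
  ext m
  have h1 := hasSum_delta (p := p) (K := K) (σ := σ) (lam := lam) (mul_pos hpj hg)
    (le_of_coeff_frob_zpow_ne_zero hu j) m
  have h2 := (hasSum_delta (p := p) (K := K) (σ := σ) (lam := lam) hg hu (m / (p : ℚ) ^ j)).map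
    (tau K σ ^ j) (continuous_tau_zpow (hN := hN) j)
  rw [coeff_phi_zpow]
  refine h2.unique ?_
  convert h1 using 2 with i
  simp only [Function.comp_apply]
  rw [← coeff_phi_zpow]
  unfold deltaTerm
  rw [phi_zpow_constHom_mul, map_zpow₀, tau_zpow_eq_self htau, ← RingAut.mul_apply, ← zpow_add,
    add_comm, zpow_add, RingAut.mul_apply, phi_zpow_teich j]

/-- Below pg the terms with i > 0 vanish, and those with i < 0 are divisible by λ; what remains is i
= 0, the lift of u. -/
lemma norm_coeff_delta_sub_le (hg : 0 < g) (hu : ∀ m, u.coeff m ≠ 0 → g ≤ m) {m : ℚ}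
    (hm : m < p * g) : ‖(delta p K lam σ u - teich p K σ u).coeff m‖ ≤ rho K lam := by
  have hr0 := rho_pos (lam := lam) K
  have hr1 := rho_lt_one (hN := hN) (lam := lam)
  have h1 := hasSum_delta (p := p) (K := K) (σ := σ) (lam := lam) hg hu m
  have h2 := norm_sub_sum_tsum_le h1.summable {0} hr0.le fun i hi => ?_
  · rw [h1.tsum_eq, Finset.sum_singleton] at h2
    unfold deltaTerm at h2
    simpa using h2
  · rw [Finset.mem_singleton] at hi
    rcases lt_or_gt_of_ne hi with h | h
    · refine (supLe_deltaTerm i m).trans ?_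
      calc rho K lam ^ (-i) ≤ rho K lam ^ (1 : ℤ) := zpow_le_zpow_right_of_le_one₀ hr0 hr1.le (by omega)
        _ = rho K lam := zpow_one _
    · have : (deltaTerm p K lam σ u i).coeff m = 0 := by
        by_contra hne
        have h3 := le_of_coeff_deltaTerm_ne_zero hu hne
        have hpq : (1 : ℚ) ≤ p := by exact_mod_cast hp.out.one_lt.le
        have h4 : (p : ℚ) ^ (1 : ℤ) ≤ (p : ℚ) ^ i := zpow_le_zpow_right₀ hpq (by omega)
        rw [zpow_one] at h4
        nlinarith
      rw [this, norm_zero]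
      exact hr0.le

lemma norm_coeff_delta_mul_sub_le (hg : 0 < g) (hu : ∀ m, u.coeff m ≠ 0 → g ≤ m)
    {y : GammaImmAnCon p K} (hy : SupLe y 1) {w : ℚ} (hw : ∀ m, y.coeff m ≠ 0 → w ≤ m) {m : ℚ}
    (hm : m < p * g + w) :
    ‖(delta p K lam σ u * y - teich p K σ u * y).coeff m‖ ≤ rho K lam := by
  have hr0 := rho_pos (lam := lam) K
  rw [← sub_mul, coeff_mul]
  refine norm_tsum_le_of_forall hr0.le fun i => ?_
  by_cases h : y.coeff (m - i) = 0
  · rw [h, mul_zero, norm_zero]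
    exact hr0.le
  · have h1 := hw _ h
    rw [norm_mul]
    exact (mul_le_of_le_one_right (norm_nonneg _) (hy _)).trans
      (norm_coeff_delta_sub_le hg hu (by linarith))

lemma norm_coeff_delta_mul_le (hg : 0 < g) (hu : ∀ m, u.coeff m ≠ 0 → g ≤ m)
    {y : GammaImmAnCon p K} (hy : SupLe y 1) {w : ℚ} (hw : ∀ m, y.coeff m ≠ 0 → w ≤ m) {m : ℚ}
    (hm : m < g + w) : ‖(delta p K lam σ u * y).coeff m‖ ≤ rho K lam := by
  have hpq : (1 : ℚ) ≤ p := by exact_mod_cast hp.out.one_lt.le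
  have h1 := norm_coeff_delta_mul_sub_le (lam := lam) (σ := σ) hg hu hy hw (m := m) (by nlinarith)
  have h2 : (teich p K σ u * y).coeff m = 0 := by
    by_contra hne
    obtain ⟨a, b, h3, h4, h5⟩ := exists_of_coeff_mul_ne_zero hne
    have := le_of_coeff_teich_ne_zero hu h3
    have := hw _ h4
    linarith
  rwa [coeff_sub, h2, sub_zero] at h1

end Delta

/-! ### Breakpoints of lower envelopes of lines. -/

section Break

/-- A family of affine functions has a breakpoint of its lower envelope, under finiteness
conditions. -/
lemma exists_break {ι : Type*} (s b : ι → ℚ)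
    (hfin : ∀ γ η : ℚ, 0 < γ → 0 < η → {i | s i * γ + b i ≤ -η}.Finite)
    (hcross : ∀ i, ∃ i' γ, s i' < s i ∧ s i' * γ + b i' = s i * γ + b i ∧ s i * γ + b i < 0)
    (hs : ∀ i, 0 < s i) (hneg : ∃ i, s i * 1 + b i < 0) :
    ∃ γ r : ℚ, 0 < γ ∧ 0 < r ∧ (∀ i, -r ≤ s i * γ + b i) ∧
      ∃ i i', s i' ≠ s i ∧ s i * γ + b i = -r ∧ s i' * γ + b i' = -r := by
  obtain ⟨i₀, hi₀⟩ := hneg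
  -- Start on a line that is lowest at abscissa 1. Lines of larger slope stay above it to the right.
  obtain ⟨i, hi, hmin⟩ := (hfin 1 (-(s i₀ * 1 + b i₀)) one_pos (by linarith)).exists_minimalFor
    (fun i => s i * 1 + b i) _ ⟨i₀, by simp⟩
  have hmin1 : ∀ k, s i * 1 + b i ≤ s k * 1 + b k := by
    intro k
    by_cases hk : s k * 1 + b k ≤ - -(s i₀ * 1 + b i₀)
    · rcases le_total (s i * 1 + b i) (s k * 1 + b k) with h | h
      · exact h
      · exact hmin hk h
    · have : s i * 1 + b i ≤ - -(s i₀ * 1 + b i₀) := hi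
      linarith
  obtain ⟨i', γ', h1, h2, h3⟩ := hcross i
  have hγ' : 1 ≤ γ' := by
    have := hmin1 i'
    nlinarith
  -- Of the finitely many lines of smaller slope that have met line i by γ', take the one meeting it
  -- first. The meeting point lies in [1, γ'], and positivity of the slope of i keeps the value
  -- negative.
  obtain ⟨k, ⟨hk1, hk2⟩, hkmin⟩ := ((hfin γ' (-(s i * γ' + b i)) (by linarith)
    (by linarith)).inter_of_right {k | s k < s i}).exists_minimalFor
    (fun k => (b k - b i) / (s i - s k)) _ ⟨i', h1, by
      show s i' * γ' + b i' ≤ - -(s i * γ' + b i)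
      linarith⟩
  have hk1' : s k < s i := hk1
  have hk2' : s k * γ' + b k ≤ - -(s i * γ' + b i) := hk2
  set γ := (b k - b i) / (s i - s k) with hγ
  have hsub : 0 < s i - s k := by linarith
  have heq : γ * (s i - s k) = b k - b i := div_mul_cancel₀ _ hsub.ne'
  have hγ1 : 1 ≤ γ := by
    rw [hγ, le_div_iff₀ hsub]
    have := hmin1 k
    linarith
  have hγ2 : γ ≤ γ' := by
    rw [hγ, div_le_iff₀ hsub]
    linarith
  have hsi := hs i
  refine ⟨γ, -(s i * γ + b i), by linarith, by nlinarith, fun l => ?_, i, k, hk1'.ne, by ring,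
    by linarith⟩
  rw [neg_neg]
  have hl := hmin1 l
  by_cases h : s l < s i
  · by_cases h' : s l * γ' + b l ≤ - -(s i * γ' + b i)
    · have h4 : γ ≤ (b l - b i) / (s i - s l) := by
        rcases le_total γ ((b l - b i) / (s i - s l)) with h5 | h5
        · exact h5
        · exact hkmin ⟨h, h'⟩ h5
      rw [le_div_iff₀ (by linarith)] at h4
      linarith
    · nlinarith
  · nlinarith

lemma crossing_value {P Q X v : ℚ} (hX : X ≠ 0) (hPQ : P * Q - 1 ≠ 0) :
    X * (P * (Q - 1) * (-v) / ((P * Q - 1) * X)) + v = v * (P - 1) / (P * Q - 1) := by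
  field_simp
  ring

lemma crossing_eq {P Q X Z v : ℚ} (hP : P ≠ 0) (hQ : Q ≠ 0) (hX : X ≠ 0) (hPQ : P * Q - 1 ≠ 0) :
    Z / Q * (X / P * (P * (Q - 1) * (-v) / ((P * Q - 1) * X)) + v) =
      Z * (X * (P * (Q - 1) * (-v) / ((P * Q - 1) * X)) + v) := by
  obtain ⟨D, hD⟩ : ∃ D, D = P * Q - 1 := ⟨_, rfl⟩
  rw [← hD] at hPQ ⊢
  field_simp
  rw [hD]
  ring

end Break

/-! ### The additive polynomial attached to the digits, and its Newton polygon. -/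

namespace Hahn

open HahnSeries

set_option linter.unusedSectionVars false

variable {k : Type*} [Field k] [IsAlgClosed k] {p : ℕ} [hp : Fact p.Prime] [CharP k p]

variable (p) in
/-- The additive polynomial `∑ c_l ^ (q ^ j) u ^ (p ^ ((n + 1) j + l))` with `q = p ^ n`, where
`|j| ≤ N` and `l < N`. -/
def digitPoly (n N : ℕ) (c : ℕ → HahnSeries ℚ k) (u : HahnSeries ℚ k) : HahnSeries ℚ k :=
  ∑ x ∈ Finset.Icc (-(N : ℤ)) N ×ˢ Finset.range N,
    (frob k p ^ ((n : ℤ) * x.1)) (c x.2) * (frob k p ^ (((n : ℤ) + 1) * x.1 + x.2)) u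

/-- The lower bound for the exponents in `digitPoly` for `u` of valuation `γ`. -/
def IsDigitBound (p n : ℕ) (c : ℕ → HahnSeries ℚ k) (γ r : ℚ) : Prop :=
  ∀ (j : ℤ) (l : ℕ) (e : ℚ), (c l).coeff e ≠ 0 →
    -r ≤ (p : ℚ) ^ ((n : ℤ) * j) * ((p : ℚ) ^ (j + l) * γ + e)

section

variable {n : ℕ} (hn : 0 < n) {c : ℕ → HahnSeries ℚ k}
  (hc1 : ∀ l e, (c l).coeff e ≠ 0 → -(p : ℚ) ^ n ≤ e) (hc2 : ∀ l e, (c l).coeff e ≠ 0 → e < -1)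
  (hc0 : ∃ l, c l ≠ 0)

include hn hc1 hc2 hc0

/-- The existence of a breakpoint for the lines attached to the digits. -/
lemma exists_break_digit : ∃ γ r : ℚ, 0 < γ ∧ 0 < r ∧ IsDigitBound p n c γ r ∧
    ∃ (j j' : ℤ) (l l' : ℕ) (e e' : ℚ), (c l).coeff e ≠ 0 ∧ (c l').coeff e' ≠ 0 ∧
      ((n : ℤ) + 1) * j + l ≠ ((n : ℤ) + 1) * j' + l' ∧
      (p : ℚ) ^ ((n : ℤ) * j) * ((p : ℚ) ^ (j + l) * γ + e) = -r ∧
      (p : ℚ) ^ ((n : ℤ) * j') * ((p : ℚ) ^ (j' + l') * γ + e') = -r := by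
  have hpq : (1 : ℚ) < p := by exact_mod_cast hp.out.one_lt
  have hp0 : (0 : ℚ) < p := by linarith
  have hq : (1 : ℚ) < (p : ℚ) ^ n := one_lt_pow₀ hpq hn.ne'
  have hz : ∀ j : ℤ, (0 : ℚ) < (p : ℚ) ^ j := fun j => zpow_pos hp0 j
  -- The monomial (j, l) gives the line γ ↦ q^j (p^{j+l} γ + val(c_l)).
  let ι := ℤ × {l : ℕ // c l ≠ 0}
  let v : ι → ℚ := fun i => (c i.2).order
  have hv : ∀ i : ι, (c i.2).coeff (v i) ≠ 0 := fun i => by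
    rw [Ne, coeff_order_eq_zero]
    exact i.2.2
  have hv1 : ∀ i, -(p : ℚ) ^ n ≤ v i := fun i => hc1 _ _ (hv i)
  have hv2 : ∀ i, v i < -1 := fun i => hc2 _ _ (hv i)
  let s : ι → ℚ := fun i => (p : ℚ) ^ ((n : ℤ) * i.1) * (p : ℚ) ^ (i.1 + (i.2 : ℕ))
  let b : ι → ℚ := fun i => (p : ℚ) ^ ((n : ℤ) * i.1) * v i
  have hsb : ∀ i γ, s i * γ + b i =
      (p : ℚ) ^ ((n : ℤ) * i.1) * ((p : ℚ) ^ (i.1 + (i.2 : ℕ)) * γ + v i) := fun i γ => by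
    simp only [s, b]
    ring
  have hfin : ∀ γ η : ℚ, 0 < γ → 0 < η → {i | s i * γ + b i ≤ -η}.Finite := by
    intro γ η hγ hη
    obtain ⟨B, hB⟩ := pow_unbounded_of_one_lt (1 / η) hq
    obtain ⟨A, hA⟩ := pow_unbounded_of_one_lt ((p : ℚ) ^ n / γ) hpq
    rw [div_lt_iff₀ hη] at hB
    rw [div_lt_iff₀ hγ] at hA
    -- As val(c_l) ≥ -q, a value at most -η forces q^{j+1} not to be too small and p^{j+l} γ < q;
    -- with l ≥ 0 this leaves finitely many pairs.
    have key : ∀ i : ι, s i * γ + b i ≤ -η → -(B : ℤ) ≤ i.1 + 1 ∧ i.1 + (i.2 : ℕ) ≤ A := by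
      intro i hi
      rw [hsb] at hi
      have h5 := hz ((n : ℤ) * i.1)
      have h6 := hz (i.1 + (i.2 : ℕ))
      constructor
      · by_contra! h
        have h7 : (p : ℚ) ^ ((n : ℤ) * i.1) * (p : ℚ) ^ n ≤ (((p : ℚ) ^ n) ^ B)⁻¹ := by
          rw [← zpow_natCast (p : ℚ) n, ← zpow_add₀ hp0.ne', ← zpow_natCast, ← zpow_mul, ← zpow_neg]
          refine zpow_le_zpow_right₀ hpq.le ?_
          have : (1 : ℤ) ≤ n := by exact_mod_cast hn
          nlinarith
        have h8 : (((p : ℚ) ^ n) ^ B)⁻¹ < η := by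
          rw [inv_lt_iff_one_lt_mul₀ (by positivity)]
          linarith
        have h9 : 0 < (p : ℚ) ^ ((n : ℤ) * i.1) * ((p : ℚ) ^ (i.1 + (i.2 : ℕ)) * γ) := by positivity
        have := hv1 i
        nlinarith
      · by_contra! h
        have h7 : (p : ℚ) ^ A ≤ (p : ℚ) ^ (i.1 + (i.2 : ℕ)) := by
          rw [← zpow_natCast]
          exact zpow_le_zpow_right₀ hpq.le h.le
        have h8 : 0 ≤ (p : ℚ) ^ (i.1 + (i.2 : ℕ)) * γ + v i := by
          have := hv1 i
          nlinarith
        have := mul_nonneg h5.le h8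
        linarith
    have hinj : Function.Injective (fun i : ι => (i.1, (i.2 : ℕ))) := by
      rintro ⟨a, b⟩ ⟨c, d⟩ h
      simp only [Prod.mk.injEq] at h
      exact Prod.ext h.1 (Subtype.ext h.2)
    refine Set.Finite.of_finite_image (Set.Finite.subset ((Finset.Icc (-(B : ℤ) - 1) A ×ˢ
      Finset.range (A + B + 2)).finite_toSet) ?_) hinj.injOn
    rintro _ ⟨i, hi, rfl⟩
    obtain ⟨h5, h6⟩ := key i hi
    simp only [Finset.coe_product, Set.mem_prod, Finset.mem_coe, Finset.mem_Icc, Finset.mem_range]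
    omega
  have hcross : ∀ i, ∃ i' γ, s i' < s i ∧ s i' * γ + b i' = s i * γ + b i ∧ s i * γ + b i < 0 := by
    rintro ⟨j, l⟩
    set X := (p : ℚ) ^ (j + ((l : ℕ) : ℤ)) with hX
    have hX0 : 0 < X := hz _
    have hQ : 0 < (p : ℚ) * (p : ℚ) ^ n - 1 := by nlinarith
    have e1 : (p : ℚ) ^ (j - 1 + ((l : ℕ) : ℤ)) = X / p := by
      rw [hX, div_eq_mul_inv, ← zpow_sub_one₀ hp0.ne']
      congr 1
      ring
    have e2 : (p : ℚ) ^ ((n : ℤ) * (j - 1)) = (p : ℚ) ^ ((n : ℤ) * j) / (p : ℚ) ^ n := by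
      rw [mul_sub_one, zpow_sub₀ hp0.ne', zpow_natCast]
    have hv' : v (j - 1, l) = v (j, l) := rfl
    have hZ := hz ((n : ℤ) * j)
    have hvn := hv2 (j, l)
    -- The lines (j, l) and (j-1, l) meet at this abscissa, with common value q^j val(c_l)(p -
    -- 1)/(pq - 1), negative because val(c_l) < -1.
    refine ⟨(j - 1, l), p * ((p : ℚ) ^ n - 1) * (-v (j, l)) / ((p * (p : ℚ) ^ n - 1) * X), ?_, ?_, ?_⟩
    · simp only [s]
      rw [e1, e2]
      have h5 : X / p < X := div_lt_self hX0 hpq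
      have h6 : (p : ℚ) ^ ((n : ℤ) * j) / (p : ℚ) ^ n < (p : ℚ) ^ ((n : ℤ) * j) :=
        div_lt_self hZ hq
      exact mul_lt_mul'' h6 h5 (by positivity) (by positivity)
    · rw [hsb, hsb]
      simp only
      rw [e1, e2, hv', ← hX]
      exact crossing_eq hp0.ne' (by positivity) hX0.ne' hQ.ne'
    · rw [hsb]
      simp only
      rw [← hX]
      have h5 : X * (p * ((p : ℚ) ^ n - 1) * (-v (j, l)) / ((p * (p : ℚ) ^ n - 1) * X)) + v (j, l) =
          v (j, l) * (p - 1) / (p * (p : ℚ) ^ n - 1) := crossing_value hX0.ne' hQ.ne'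
      rw [h5]
      refine mul_neg_of_pos_of_neg hZ (div_neg_of_neg_of_pos ?_ hQ)
      exact mul_neg_of_neg_of_pos (by linarith) (by linarith)
  have hneg : ∃ i, s i * 1 + b i < 0 := by
    obtain ⟨l, hl⟩ := hc0
    refine ⟨(-(l : ℤ), ⟨l, hl⟩), ?_⟩
    rw [hsb]
    simp only [neg_add_cancel, zpow_zero, one_mul]
    refine mul_neg_of_pos_of_neg (hz _) ?_
    have := hv2 (-(l : ℤ), ⟨l, hl⟩)
    linarith
  obtain ⟨γ, r, hγ, hr, h1, i, i', h2, h3, h4⟩ :=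
    exists_break s b hfin hcross (fun i => mul_pos (hz _) (hz _)) hneg
  refine ⟨γ, r, hγ, hr, fun j l e he => ?_, i.1, i'.1, i.2, i'.2, v i, v i', hv i, hv i', ?_,
    ?_, ?_⟩
  · have hl : c l ≠ 0 := by
      rintro h
      rw [h] at he
      exact he rfl
    have h5 := h1 (j, ⟨l, hl⟩)
    rw [hsb] at h5
    refine h5.trans (mul_le_mul_of_nonneg_left ?_ (hz _).le)
    have : v (j, ⟨l, hl⟩) ≤ e := order_le_of_coeff_ne_zero he
    simpa using this
  · intro h
    apply h2
    simp only [s]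
    rw [← zpow_add₀ hp0.ne', ← zpow_add₀ hp0.ne']
    congr 1
    linarith
  · rw [← hsb, h3]
  · rw [← hsb, h4]

/-- Solving the equations given by `digitPoly` at a breakpoint. -/
lemma exists_digitPoly_solutions {L : Subring (HahnSeries ℚ k)} (hL : IsAdmissible p L)
    (hcL : ∀ l, c l ∈ L) :
    ∃ γ r : ℚ, 0 < γ ∧ 0 < r ∧ IsDigitBound p n c γ r ∧ ∃ N₀ : ℕ, ∀ N ≥ N₀,
      (∀ t ∈ L, (∀ i, t.coeff i ≠ 0 → -r ≤ i) →
        ∃ u ∈ L, (∀ i, u.coeff i ≠ 0 → γ ≤ i) ∧ digitPoly p n N c u = t) ∧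
      ∃ u ∈ L, (∀ i, u.coeff i ≠ 0 → γ ≤ i) ∧ u.coeff γ ≠ 0 ∧ digitPoly p n N c u = 0 := by
  have hpq : (1 : ℚ) < p := by exact_mod_cast hp.out.one_lt
  have hp0 : (0 : ℚ) < p := by linarith
  have hz : ∀ j : ℤ, (0 : ℚ) < (p : ℚ) ^ j := fun j => zpow_pos hp0 j
  obtain ⟨γ, r, hγ, hr, hbd, j₁, j₂, l₁, l₂, e₁, e₂, he₁, he₂, hne, hv₁, hv₂⟩ :=
    exists_break_digit hn hc1 hc2 hc0
  -- Large enough for both monomials at the breakpoint to occur in the finite sum.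
  refine ⟨γ, r, hγ, hr, hbd, j₁.natAbs + j₂.natAbs + l₁ + l₂ + 1, fun N hN => ?_⟩
  set R := Finset.Icc (-(N : ℤ)) N ×ˢ Finset.range N with hR
  -- Substituting u = z^{p^S} with S = (n+1)N makes all Frobenius powers nonnegative, giving a
  -- genuine additive polynomial in z; the abscissa γ becomes g = γ/p^S.
  set a : ℤ × ℕ → ℕ := fun x => ((n + 1) * (x.1 + N)).toNat + x.2 with ha
  set M := (n + 1) * (2 * N) + N with hM
  have haR : ∀ x ∈ R, a x ∈ Finset.range M ∧
      (a x : ℤ) = ((n : ℤ) + 1) * x.1 + x.2 + ((n + 1) * N : ℕ) := by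
    rintro ⟨j, l⟩ hx
    simp only [hR, Finset.mem_product, Finset.mem_Icc, Finset.mem_range] at hx
    obtain ⟨⟨h1, h2⟩, h3⟩ := hx
    have h4 : (0 : ℤ) ≤ (n + 1) * (j + N) := by
      refine mul_nonneg (by positivity) (by linarith)
    have h5 : ((n + 1) * (j + N) : ℤ) ≤ (n + 1) * (2 * N) :=
      mul_le_mul_of_nonneg_left (by linarith) (by positivity)
    have h6 : (a (j, l) : ℤ) = (n + 1) * (j + N) + l := by
      simp only [ha]
      rw [Nat.cast_add, Int.toNat_of_nonneg h4]
    constructor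
    · rw [Finset.mem_range]
      have : (a (j, l) : ℤ) < (M : ℤ) := by
        rw [h6, hM]
        push_cast
        have : (l : ℤ) < N := by exact_mod_cast h3
        linarith
      exact_mod_cast this
    · rw [h6]
      push_cast
      ring
  let A : ℕ → HahnSeries ℚ k := fun b => ∑ x ∈ R with a x = b, (frob k p ^ ((n : ℤ) * x.1)) (c x.2)
  set S := (n + 1) * N with hS
  set g : ℚ := γ / (p : ℚ) ^ S with hg
  have hpS : (0 : ℚ) < (p : ℚ) ^ S := by positivity
  have hAL : ∀ b, A b ∈ L := fun b => sum_mem fun x _ => frob_zpow_mem hL.1 _ (hcL _)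
  have hpoly : ∀ z, addPoly p M A z = digitPoly p n N c (z ^ p ^ S) := by
    intro z
    unfold addPoly digitPoly
    rw [← Finset.sum_fiberwise_of_maps_to (g := a) (t := Finset.range M) fun x hx => (haR x hx).1]
    refine Finset.sum_congr rfl fun b _ => ?_
    rw [Finset.sum_mul]
    refine Finset.sum_congr rfl fun x hx => ?_
    obtain ⟨hxR, rfl⟩ := Finset.mem_filter.1 hx
    congr 1
    rw [← frob_zpow_natCast, ← frob_zpow_natCast, ← RingAut.mul_apply, ← zpow_add, (haR x hxR).2]
  have hpg : ∀ x ∈ R, (p : ℚ) ^ a x * g =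
      (p : ℚ) ^ ((n : ℤ) * x.1) * ((p : ℚ) ^ (x.1 + x.2) * γ) := by
    intro x hx
    rw [← zpow_natCast, (haR x hx).2, zpow_add₀ hp0.ne', zpow_natCast, hg, mul_assoc,
      mul_div_cancel₀ _ hpS.ne', ← mul_assoc, ← zpow_add₀ hp0.ne']
    congr 2
    ring
  have hfc : ∀ (x : ℤ × ℕ) e, ((frob k p ^ ((n : ℤ) * x.1)) (c x.2)).coeff e ≠ 0 →
      ∃ e', (c x.2).coeff e' ≠ 0 ∧ e = (p : ℚ) ^ ((n : ℤ) * x.1) * e' := by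
    intro x e he
    rw [coeff_frob_zpow_ne_zero_iff] at he
    exact ⟨_, he, (mul_div_cancel₀ _ (hz _).ne').symm⟩
  have hAbd : ∀ b e, (A b).coeff e ≠ 0 → -r ≤ e + (p : ℚ) ^ b * g := by
    intro b e he
    rw [coeff_sum'] at he
    obtain ⟨x, hx, hxe⟩ := Finset.exists_ne_zero_of_sum_ne_zero he
    obtain ⟨hxR, rfl⟩ := Finset.mem_filter.1 hx
    obtain ⟨e', he', rfl⟩ := hfc x e hxe
    have := hbd x.1 x.2 e' he'
    rw [hpg x hxR]
    linarith
  -- Several (j, l) may share one power of z, but their coefficients cannot cancel: c_l^{q^j} is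
  -- supported in [-q^{j+1}, -q^j), and these intervals are disjoint for different j.
  have hlead : ∀ j l e, (j, l) ∈ R → (c l).coeff e ≠ 0 →
      (A (a (j, l))).coeff ((p : ℚ) ^ ((n : ℤ) * j) * e) ≠ 0 := by
    intro j l e hx he
    rw [coeff_sum', Finset.sum_eq_single (j, l)]
    · rw [coeff_frob_zpow_ne_zero_iff, mul_div_cancel_left₀ _ (hz _).ne']
      exact he
    · rintro ⟨j', l'⟩ hx' hne'
      obtain ⟨hx', hab⟩ := Finset.mem_filter.1 hx'
      by_contra hcon
      obtain ⟨e', he', h1⟩ := hfc _ _ hcon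
      have h2 := (haR _ hx').2
      rw [hab, (haR _ hx).2] at h2
      simp only at h1 h2 he'
      have h3 : j ≠ j' := by
        rintro rfl
        apply hne'
        congr 1
        linarith
      have aux : ∀ {i i' : ℤ} {l l' : ℕ} {f f' : ℚ}, i < i' → (c l).coeff f ≠ 0 →
          (c l').coeff f' ≠ 0 → (p : ℚ) ^ ((n : ℤ) * i') * f' < (p : ℚ) ^ ((n : ℤ) * i) * f := by
        intro i i' l l' f f' hi hf hf'
        have h4 := hc1 _ _ hf
        have h5 := hc2 _ _ hf'
        have h6 := hz ((n : ℤ) * i)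
        have h7 := hz ((n : ℤ) * i')
        have h8 : (p : ℚ) ^ ((n : ℤ) * i) * (p : ℚ) ^ n ≤ (p : ℚ) ^ ((n : ℤ) * i') := by
          rw [← zpow_natCast (p : ℚ) n, ← zpow_add₀ hp0.ne']
          refine zpow_le_zpow_right₀ hpq.le ?_
          have : (0 : ℤ) < n := by exact_mod_cast hn
          nlinarith
        nlinarith
      rcases lt_or_gt_of_ne h3 with h | h
      · exact absurd h1 (aux h he he').ne'
      · exact absurd h1 (aux h he' he).ne
    · intro h
      exact absurd (by rw [Finset.mem_filter]; exact ⟨hx, rfl⟩) h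
  have hx₁ : (j₁, l₁) ∈ R := by
    simp only [hR, Finset.mem_product, Finset.mem_Icc, Finset.mem_range]
    omega
  have hx₂ : (j₂, l₂) ∈ R := by
    simp only [hR, Finset.mem_product, Finset.mem_Icc, Finset.mem_range]
    omega
  have hlead₁ := hlead _ _ _ hx₁ he₁
  have hlead₂ := hlead _ _ _ hx₂ he₂
  have hval₁ : (p : ℚ) ^ ((n : ℤ) * j₁) * e₁ = -r - (p : ℚ) ^ a (j₁, l₁) * g := by
    rw [hpg _ hx₁, ← hv₁]
    ring
  have hval₂ : (p : ℚ) ^ ((n : ℤ) * j₂) * e₂ = -r - (p : ℚ) ^ a (j₂, l₂) * g := by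
    rw [hpg _ hx₂, ← hv₂]
    ring
  have hsuppow : ∀ z : HahnSeries ℚ k, (∀ i, z.coeff i ≠ 0 → g ≤ i) →
      ∀ i, (z ^ p ^ S).coeff i ≠ 0 → γ ≤ i := by
    intro z hz' i hi
    rw [coeff_pow_char_pow] at hi
    have := hz' _ (fun h => hi (by rw [h, zero_pow (pow_ne_zero _ hp.out.ne_zero)]))
    rwa [hg, div_le_div_iff_of_pos_right hpS] at this
  constructor
  · intro t ht hti
    obtain ⟨z, hzL, hz1, hz2⟩ := hL.solve M A t g (-r) hAL ht hti
      ⟨_, (haR _ hx₁).1, _, hlead₁, by rw [hval₁]; linarith⟩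
    exact ⟨z ^ p ^ S, pow_mem hzL _, hsuppow z hz1, by rw [← hpoly, hz2]⟩
  -- The two monomials at the breakpoint give two nonzero coefficients of the residual equation at
  -- exponent -r. Its nonzero root β makes β t^g an approximate zero, with error supported strictly
  -- beyond -r.
  · obtain ⟨β, hβ0, hβ⟩ := exists_ne_zero_root_addPoly_field (p := p) M
      (fun b => (A b).coeff (-r - (p : ℚ) ^ b * g))
      ⟨_, (haR _ hx₁).1, _, (haR _ hx₂).1, by
        intro h
        have h1 := (haR _ hx₁).2
        rw [h, (haR _ hx₂).2] at h1
        simp only at h1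
        exact hne (by linarith), by rw [← hval₁]; exact hlead₁, by rw [← hval₂]; exact hlead₂⟩
    set z₀ : HahnSeries ℚ k := single g β with hz₀
    have hz₀L : z₀ ∈ L := hL.single_mem _ _
    have hcoef : ∀ i, (addPoly p M A z₀).coeff i =
        ∑ b ∈ Finset.range M, (A b).coeff (i - (p : ℚ) ^ b * g) * β ^ p ^ b := by
      intro i
      unfold addPoly
      rw [coeff_sum']
      refine Finset.sum_congr rfl fun b _ => ?_
      rw [hz₀, single_pow]
      have e : i = (i - (p : ℚ) ^ b * g) + (p ^ b) • g := by
        rw [nsmul_eq_mul]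
        push_cast
        ring
      conv_lhs => rw [e]
      rw [coeff_mul_single_add]
    have hsupp : ∀ i, (addPoly p M A z₀).coeff i ≠ 0 → -r < i := by
      intro i hi
      rw [hcoef] at hi
      refine lt_of_le_of_ne ?_ ?_
      · obtain ⟨b, -, hb⟩ := Finset.exists_ne_zero_of_sum_ne_zero hi
        have := hAbd b _ (left_ne_zero_of_mul hb)
        linarith
      · rintro rfl
        exact hi hβ
    have hTL : -addPoly p M A z₀ ∈ L :=
      neg_mem (sum_mem fun b _ => mul_mem (hAL b) (pow_mem hz₀L _))
    obtain ⟨β', hβ', hT⟩ : ∃ β' : ℚ, -r < β' ∧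
        ∀ i, (-addPoly p M A z₀).coeff i ≠ 0 → β' ≤ i := by
      by_cases h0 : -addPoly p M A z₀ = 0
      · refine ⟨-r + 1, by linarith, fun i hi => ?_⟩
        rw [h0] at hi
        exact absurd rfl hi
      · refine ⟨_, hsupp (-addPoly p M A z₀).order ?_, fun i hi => order_le_of_coeff_ne_zero hi⟩
        have h1 : (-addPoly p M A z₀).coeff (-addPoly p M A z₀).order ≠ 0 := by
          rwa [Ne, coeff_order_eq_zero]
        rw [coeff_neg] at h1
        exact neg_ne_zero.1 h1
    have hpa : (0 : ℚ) < (p : ℚ) ^ a (j₁, l₁) := by positivity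
    -- With this bound the first breakpoint monomial has value exactly β', and the correction z
    -- starts strictly after g, so it cannot cancel the leading term.
    obtain ⟨z, hzL, hz1, hz2⟩ := hL.solve M A _ (g + (β' + r) / (p : ℚ) ^ a (j₁, l₁)) β' hAL hTL hT
      ⟨_, (haR _ hx₁).1, _, hlead₁, by
        rw [hval₁, mul_add, mul_div_cancel₀ _ hpa.ne']
        linarith⟩
    have hzg : ∀ i, z.coeff i ≠ 0 → g < i := by
      intro i hi
      have h1 := hz1 i hi
      have h2 : 0 < (β' + r) / (p : ℚ) ^ a (j₁, l₁) := div_pos (by linarith) hpa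
      linarith
    have hsz : ∀ i, (z₀ + z).coeff i ≠ 0 → g ≤ i := by
      intro i hi
      by_contra! h
      apply hi
      rw [coeff_add, hz₀, coeff_single_of_ne h.ne, zero_add]
      by_contra h1
      exact absurd (hzg i h1) (not_lt.2 h.le)
    refine ⟨(z₀ + z) ^ p ^ S, pow_mem (add_mem hz₀L hzL) _, hsuppow _ hsz, ?_, ?_⟩
    · rw [coeff_pow_char_pow, ← hg]
      refine pow_ne_zero _ ?_
      rw [coeff_add, hz₀, coeff_single_same]
      have : z.coeff g = 0 := by
        by_contra h1
        exact absurd (hzg g h1) (lt_irrefl _)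
      rwa [this, add_zero]
    · rw [← hpoly, addPoly_add, hz2, add_neg_cancel]

end

end Hahn

/-! ### Orbit sums of δ(u)x modulo the maximal ideal. -/

section Congruence

open IsLocalRing GammaImmAnCon

set_option linter.unusedSectionVars false

variable {p : ℕ} {O K : Type*} [CommRing O] [NormedField K] [Algebra O K]
  [hp : Fact p.Prime] [IsUltrametricDist K] [CompleteSpace K]
  [IsDomain O] [IsDiscreteValuationRing O] [IsFractionRing O K] [hN : IsNormalizedAbs p O K]
  {lam : O} [hl : Fact (Irreducible lam)] {σ : O ≃+* O}
  [CharP (ResidueField O) p] [hs : Fact (∀ a : O, σ a - a ^ p ∈ maximalIdeal O)]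
  [IsAlgClosed (ResidueField O)]
  {L : Subring (HahnSeries ℚ (ResidueField O))}

lemma coeff_ne_zero_of_coeff_red_ne_zero {x : GammaImmAnCon p K} {m : ℚ}
    (h : (red (O := O) x).coeff m ≠ 0) : x.coeff m ≠ 0 := fun h0 => h (by
  rw [coeff_red, h0, resK_zero])

include hl in
/-- The expansion of an integral series into Teichmüller lifts. -/
lemma exists_digits (hL : Hahn.IsPerfectSub p L) {x : GammaImmAnCon p K} (hx : x ∈ gammaL p K σ L)
    {a b : ℚ} (hsupp : ∀ m, x.coeff m ≠ 0 → a ≤ m ∧ m < b) :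
    ∃ (c : ℕ → HahnSeries ℚ (ResidueField O)) (y : ℕ → GammaImmAnCon p K),
      (∀ l, c l ∈ L) ∧ (∀ l m, (c l).coeff m ≠ 0 → a ≤ m ∧ m < b) ∧
      (∀ l, SupLe (y l) 1) ∧ (∀ l m, (y l).coeff m ≠ 0 → a ≤ m ∧ m < b) ∧
      ∀ N, x = ∑ l ∈ Finset.range N, constHom (algebraMap O K lam ^ l) * teich p K σ (c l) +
        constHom (algebraMap O K lam ^ N) * y N := by
  choose! f hf1 hf2 using fun x hx => exists_eq_teich_add_of_mem (K := K) (lam := lam) (σ := σ) hL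
    (x := x) hx
  set y : ℕ → GammaImmAnCon p K := fun l => f^[l] x with hy
  have hysucc : ∀ l, y (l + 1) = f (y l) := fun l => Function.iterate_succ_apply' f l x
  have hyL : ∀ l, y l ∈ gammaL p K σ L := by
    intro l
    induction l with
    | zero => exact hx
    | succ l ih =>
      rw [hysucc]
      exact hf1 _ ih
  have hrec : ∀ l, y l = teich p K σ (red (y l)) + constO p K lam * y (l + 1) := fun l => by
    rw [hysucc]
    exact hf2 _ (hyL l)
  have hteich : ∀ l m, (∀ m, (y l).coeff m ≠ 0 → a ≤ m ∧ m < b) →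
      (teich p K σ (red (y l))).coeff m ≠ 0 → a ≤ m ∧ m < b := fun l m h hm =>
    ⟨le_of_coeff_teich_ne_zero (fun i hi => (h i (coeff_ne_zero_of_coeff_red_ne_zero hi)).1) hm,
      lt_of_coeff_teich_ne_zero (fun i hi => (h i (coeff_ne_zero_of_coeff_red_ne_zero hi)).2) hm⟩
  -- Reduction and Teichmüller lifting both preserve the interval [a, b), so every digit and every
  -- remainder stays in it.
  have hsy : ∀ l m, (y l).coeff m ≠ 0 → a ≤ m ∧ m < b := by
    intro l
    induction l with
    | zero => exact hsupp
    | succ l ih =>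
      intro m hm
      by_contra hcon
      have h1 : (y l).coeff m = 0 := by
        by_contra h
        exact hcon (ih m h)
      have h2 : (teich p K σ (red (y l))).coeff m = 0 := by
        by_contra h
        exact hcon (hteich l m ih h)
      have h3 := congrArg (fun z => z.coeff m) (hrec l)
      simp only [coeff_add, h1, h2, zero_add, constO_apply, coeff_constHom_mul] at h3
      rcases mul_eq_zero.1 h3.symm with h4 | h4
      · exact algebraMap_lam_ne_zero K h4
      · exact hm h4
  refine ⟨fun l => red (y l), y, fun l => red_mem (lam := lam) hL (hyL l), fun l m hm =>
    hsy l m (coeff_ne_zero_of_coeff_red_ne_zero hm), fun l => mem_immCon_iff.1 (hyL l).1, hsy,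
    fun N => ?_⟩
  induction N with
  | zero => simp [hy]
  | succ N ih =>
    rw [Finset.sum_range_succ, pow_succ, map_mul, add_assoc, mul_assoc, ← mul_add, ← constO_apply,
      ← hrec]
    exact ih

lemma red_sum {ι : Type*} (s : Finset ι) (f : ι → GammaImmAnCon p K)
    (hf : ∀ i ∈ s, f i ∈ GammaImmCon p K) :
    red (O := O) (∑ i ∈ s, f i) = ∑ i ∈ s, red (O := O) (f i) := by
  classical
  induction s using Finset.induction_on with
  | empty => simp [red_zero]
  | insert a s ha ih =>
    have h1 := fun i hi => hf i (Finset.mem_insert_of_mem hi)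
    rw [Finset.sum_insert ha, Finset.sum_insert ha,
      red_add (hf a (Finset.mem_insert_self _ _)) (sum_mem h1), ih h1]

lemma orbitTerm_eq (n : ℕ) (mu : K) (f : GammaImmAnCon p K) (m : ℚ) (j : ℤ) :
    orbitTerm σ n mu f m j = (constHom (mu ^ j) * (phi p K σ ^ ((n : ℤ) * j)) f).coeff m := by
  rw [coeff_constHom_mul, coeff_phi_zpow]
  rfl

lemma orbitTerm_add (n : ℕ) (mu : K) (f g : GammaImmAnCon p K) (m : ℚ) (j : ℤ) :
    orbitTerm σ n mu (f + g) m j = orbitTerm σ n mu f m j + orbitTerm σ n mu g m j := by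
  rw [orbitTerm_eq, orbitTerm_eq, orbitTerm_eq, map_add, mul_add, coeff_add]

lemma orbitTerm_constHom_mul (n : ℕ) (mu : K) {a : K} (ha : tau K σ a = a)
    (f : GammaImmAnCon p K) (m : ℚ) (j : ℤ) :
    orbitTerm σ n mu (constHom a * f) m j = a * orbitTerm σ n mu f m j := by
  rw [orbitTerm_eq, orbitTerm_eq, phi_zpow_constHom_mul, tau_zpow_eq_self ha, mul_left_comm,
    coeff_constHom_mul]

variable {γ : ℚ} {u : HahnSeries ℚ (ResidueField O)}

/-- The factor λ^j of the orbit, λ^{nj} from φ^{nj} on δ(u) and λ^l from the digit combine to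
λ^{(n+1)j+l}, which is absorbed as a Frobenius power of u. -/
lemma orbitTerm_delta_mul (hlam : σ lam = lam) (n : ℕ) (hγ : 0 < γ)
    (hu : ∀ m, u.coeff m ≠ 0 → γ ≤ m) (l : ℕ) (y : GammaImmAnCon p K) (m : ℚ) (j : ℤ) :
    orbitTerm σ n (algebraMap O K lam)
      (delta p K lam σ u * (constHom (algebraMap O K lam ^ l) * y)) m j =
    (delta p K lam σ ((Hahn.frob (ResidueField O) p ^ (((n : ℤ) + 1) * j + l)) u) *
      (phi p K σ ^ ((n : ℤ) * j)) y).coeff m := by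
  have h0 := algebraMap_lam_ne_zero K (lam := lam)
  have htau : tau K σ (algebraMap O K lam) = algebraMap O K lam := by
    rw [tau_algebraMap, hlam]
  rw [orbitTerm_eq, map_mul, phi_zpow_delta hlam hγ hu, phi_zpow_constHom_mul, map_pow,
    tau_zpow_eq_self htau, delta_frob_zpow hγ hu]
  congr 1
  have e : algebraMap O K lam ^ (((n : ℤ) + 1) * j + l) =
      algebraMap O K lam ^ j * algebraMap O K lam ^ ((n : ℤ) * j) * algebraMap O K lam ^ l := by
    rw [← zpow_add₀ h0, ← zpow_natCast _ l, ← zpow_add₀ h0]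
    congr 1
    ring
  rw [e, map_mul, map_mul]
  ring

/-- The orbit sum of `delta u * x` agrees with the additive polynomial of the digits of `x` at `u`
modulo the maximal ideal. -/
lemma exists_norm_orbitSum_sub_le (hlam : σ lam = lam) {n : ℕ} (hn : 0 < n) {r : ℚ} (hγ : 0 < γ)
    (hr : 0 < r) {x : GammaImmAnCon p K} {c : ℕ → HahnSeries ℚ (ResidueField O)}
    {y : ℕ → GammaImmAnCon p K} (hx : SupLe x 1) (hxs : ∀ m, x.coeff m ≠ 0 → -(p : ℚ) ^ n ≤ m)
    (hbd : Hahn.IsDigitBound p n c γ r) (hy : ∀ l, SupLe (y l) 1)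
    (hys : ∀ l m, (y l).coeff m ≠ 0 → -(p : ℚ) ^ n ≤ m)
    (hxy : ∀ N, x = ∑ l ∈ Finset.range N, constHom (algebraMap O K lam ^ l) * teich p K σ (c l) +
        constHom (algebraMap O K lam ^ N) * y N) :
    ∃ N₁ : ℕ, ∀ N ≥ N₁, ∀ u : HahnSeries ℚ (ResidueField O), (∀ m, u.coeff m ≠ 0 → γ ≤ m) →
      ∀ m < -(r / (p : ℚ) ^ n), ∀ S : K,
        HasSum (orbitTerm σ n (algebraMap O K lam) (delta p K lam σ u * x) m) S →
        ‖S - (teich p K σ (Hahn.digitPoly p n N c u)).coeff m‖ ≤ rho K lam := by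
  have hpq : (1 : ℚ) < p := by exact_mod_cast hp.out.one_lt
  have hp0 : (0 : ℚ) < p := by linarith
  have hq : (1 : ℚ) < (p : ℚ) ^ n := one_lt_pow₀ hpq hn.ne'
  have hz : ∀ j : ℤ, (0 : ℚ) < (p : ℚ) ^ j := fun j => zpow_pos hp0 j
  have hr0 := rho_pos (lam := lam) K
  -- For j ≤ -B the term starts beyond -q^{j+1} ≥ -r/q; for j + l ≥ A, with A below, it starts at a
  -- nonnegative exponent. Both lie past the window.
  obtain ⟨B, hB⟩ := pow_unbounded_of_one_lt (((p : ℚ) ^ n) ^ 2 / r) hq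
  obtain ⟨A, hA⟩ := pow_unbounded_of_one_lt ((p : ℚ) ^ n / γ) hpq
  rw [div_lt_iff₀ hr] at hB
  rw [div_lt_iff₀ hγ] at hA
  refine ⟨A + B, fun N hNAB u hu m hm S hS => ?_⟩
  have hm0 : m < 0 := hm.trans (by
    rw [neg_lt_zero]
    positivity)
  -- the terms with small `j`
  have small : ∀ (j : ℤ) (l : ℕ), (A : ℤ) ≤ j + l ∨ j ≤ -(B : ℤ) → ∀ z : GammaImmAnCon p K,
      SupLe z 1 → (∀ m, z.coeff m ≠ 0 → -(p : ℚ) ^ n ≤ m) →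
      ‖(delta p K lam σ ((Hahn.frob (ResidueField O) p ^ (((n : ℤ) + 1) * j + l)) u) *
        (phi p K σ ^ ((n : ℤ) * j)) z).coeff m‖ ≤ rho K lam := by
    intro j l hjl z hz1 hzs
    have hZ := hz ((n : ℤ) * j)
    refine norm_coeff_delta_mul_le (mul_pos (hz _) hγ) (le_of_coeff_frob_zpow_ne_zero hu _)
      (hz1.phi_zpow _) (w := (p : ℚ) ^ ((n : ℤ) * j) * (-(p : ℚ) ^ n)) (fun i hi => ?_) ?_
    · rw [coeff_phi_zpow] at hi
      have h1 := hzs _ (fun h => hi (by rw [h, map_zero]))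
      rwa [le_div_iff₀' hZ] at h1
    · have e : (p : ℚ) ^ (((n : ℤ) + 1) * j + l) =
          (p : ℚ) ^ ((n : ℤ) * j) * (p : ℚ) ^ (j + l) := by
        rw [← zpow_add₀ hp0.ne']
        congr 1
        ring
      rw [e]
      rcases hjl with h | h
      · have h1 : (p : ℚ) ^ A ≤ (p : ℚ) ^ (j + l) := by
          rw [← zpow_natCast]
          exact zpow_le_zpow_right₀ hpq.le h
        have h2 : 0 ≤ (p : ℚ) ^ (j + l) * γ - (p : ℚ) ^ n := by nlinarith
        have := mul_nonneg hZ.le h2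
        linarith
      · have h1 : (p : ℚ) ^ ((n : ℤ) * j) * ((p : ℚ) ^ n) ^ B ≤ 1 := by
          rw [← pow_mul, ← zpow_natCast, ← zpow_add₀ hp0.ne']
          refine zpow_le_one_of_nonpos₀ hpq.le ?_
          push_cast
          have : (0 : ℤ) < n := by exact_mod_cast hn
          nlinarith
        have h2 : (p : ℚ) ^ ((n : ℤ) * j) * ((p : ℚ) ^ n) ≤ r / (p : ℚ) ^ n := by
          rw [le_div_iff₀ (by positivity)]
          nlinarith
        have h3 : 0 < (p : ℚ) ^ ((n : ℤ) * j) * ((p : ℚ) ^ (j + l) * γ) := by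
          have := hz (j + l)
          positivity
        linarith
  have main : ∀ (j : ℤ) (l : ℕ),
      ‖(delta p K lam σ ((Hahn.frob (ResidueField O) p ^ (((n : ℤ) + 1) * j + l)) u) *
        (phi p K σ ^ ((n : ℤ) * j)) (teich p K σ (c l))).coeff m -
      (teich p K σ ((Hahn.frob (ResidueField O) p ^ ((n : ℤ) * j)) (c l) *
        (Hahn.frob (ResidueField O) p ^ (((n : ℤ) + 1) * j + l)) u)).coeff m‖ ≤ rho K lam := by
    intro j l
    have hZ := hz ((n : ℤ) * j)
    rw [phi_zpow_teich, mul_comm ((Hahn.frob (ResidueField O) p ^ ((n : ℤ) * j)) (c l)), teich_mul,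
      ← coeff_sub]
    refine norm_coeff_delta_mul_sub_le (mul_pos (hz _) hγ) (le_of_coeff_frob_zpow_ne_zero hu _)
      (mem_immCon_iff.1 (teich_mem _))
      (w := -(r / (p : ℚ) ^ n) - p * ((p : ℚ) ^ (((n : ℤ) + 1) * j + l) * γ)) (fun i hi => ?_)
      (by linarith)
    refine le_of_coeff_teich_ne_zero (fun e he => ?_) hi
    rw [Hahn.coeff_frob_zpow_ne_zero_iff] at he
    -- The bound for (j+1, l), divided by q, is the bound for the first exponent where δ of the
    -- Frobenius power of u and its Teichmüller lift can differ modulo λ in the product. Hence the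
    -- discrepancy starts at -r/q or later.
    have h1 := hbd (j + 1) l _ he
    have e1 : (p : ℚ) ^ ((n : ℤ) * (j + 1)) = (p : ℚ) ^ ((n : ℤ) * j) * (p : ℚ) ^ n := by
      rw [← zpow_natCast (p : ℚ) n, ← zpow_add₀ hp0.ne']
      congr 1
      ring
    have e2 : (p : ℚ) ^ (((n : ℤ) + 1) * j + l) * p =
        (p : ℚ) ^ ((n : ℤ) * j) * (p : ℚ) ^ (j + 1 + l) := by
      rw [← zpow_add_one₀ hp0.ne', ← zpow_add₀ hp0.ne']
      congr 1
      ring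
    have e3 : (p : ℚ) ^ ((n : ℤ) * (j + 1)) * ((p : ℚ) ^ (j + 1 + l) * γ +
        e / (p : ℚ) ^ ((n : ℤ) * j)) = (p : ℚ) ^ n *
        (p * ((p : ℚ) ^ (((n : ℤ) + 1) * j + l) * γ) + e) := by
      have : p * ((p : ℚ) ^ (((n : ℤ) + 1) * j + l) * γ) =
          (p : ℚ) ^ ((n : ℤ) * j) * (p : ℚ) ^ (j + 1 + l) * γ := by
        rw [← e2]
        ring
      rw [this, e1]
      field_simp
    rw [e3, neg_le_iff_add_nonneg] at h1
    have h2 : 0 ≤ r / (p : ℚ) ^ n + (p * ((p : ℚ) ^ (((n : ℤ) + 1) * j + l) * γ) + e) := by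
      have : r / (p : ℚ) ^ n + (p * ((p : ℚ) ^ (((n : ℤ) + 1) * j + l) * γ) + e) =
          ((p : ℚ) ^ n * (p * ((p : ℚ) ^ (((n : ℤ) + 1) * j + l) * γ) + e) + r) / (p : ℚ) ^ n := by
        field_simp
        ring
      rw [this]
      exact div_nonneg h1 (by positivity)
    linarith
  set R := Finset.Icc (-(N : ℤ)) N with hR
  set T : ℤ → ℕ → GammaImmAnCon p K := fun j l =>
    teich p K σ ((Hahn.frob (ResidueField O) p ^ ((n : ℤ) * j)) (c l) *
        (Hahn.frob (ResidueField O) p ^ (((n : ℤ) + 1) * j + l)) u) with hT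
  have h1 : ‖S - ∑ j ∈ R, orbitTerm σ n (algebraMap O K lam) (delta p K lam σ u * x) m j‖ ≤
      rho K lam := by
    have h2 := norm_sub_sum_tsum_le hS.summable R hr0.le fun j hj => ?_
    · rwa [hS.tsum_eq] at h2
    · have h3 := orbitTerm_delta_mul (K := K) hlam n hγ hu 0 x m j
      rw [pow_zero, map_one, one_mul] at h3
      rw [h3]
      refine small j 0 ?_ x hx hxs
      rw [hR, Finset.mem_Icc] at hj
      push_cast
      omega
  have h2 : ∀ j ∈ R, ‖orbitTerm σ n (algebraMap O K lam) (delta p K lam σ u * x) m j -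
      ∑ l ∈ Finset.range N, (T j l).coeff m‖ ≤ rho K lam := by
    intro j hj
    rw [hR, Finset.mem_Icc] at hj
    have e : delta p K lam σ u * x = ∑ l ∈ Finset.range N, delta p K lam σ u *
        (constHom (algebraMap O K lam ^ l) * teich p K σ (c l)) +
        delta p K lam σ u * (constHom (algebraMap O K lam ^ N) * y N) := by
      conv_lhs => rw [hxy N]
      rw [mul_add, Finset.mul_sum]
    have esum : ∀ s : Finset ℕ, ∀ f : ℕ → GammaImmAnCon p K,
        orbitTerm σ n (algebraMap O K lam) (∑ l ∈ s, f l) m j =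
        ∑ l ∈ s, orbitTerm σ n (algebraMap O K lam) (f l) m j := by
      intro s f
      simp only [orbitTerm_eq, map_sum, Finset.mul_sum, GenSeries.coeff_sum]
    rw [e, orbitTerm_add, esum, add_sub_right_comm, ← Finset.sum_sub_distrib]
    refine (IsUltrametricDist.norm_add_le_max _ _).trans (max_le ?_ ?_)
    · refine IsUltrametricDist.norm_sum_le_of_forall_le_of_nonneg hr0.le fun l _ => ?_
      rw [orbitTerm_delta_mul hlam n hγ hu]
      exact main j l
    · rw [orbitTerm_delta_mul hlam n hγ hu]
      refine small j N ?_ _ (hy N) (hys N)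
      -- As N ≥ A + B, the remainder after N digits is harmless for every j: either j + N ≥ A or j ≤
      -- -B.
      omega
  have h3 : SupLe (∑ j ∈ R, ∑ l ∈ Finset.range N, T j l -
      teich p K σ (Hahn.digitPoly p n N c u)) (rho K lam) := by
    have hTm : ∀ j l, T j l ∈ GammaImmCon p K := fun j l => teich_mem _
    refine supLe_sub_of_red_eq (O := O) (sum_mem fun j _ => sum_mem fun l _ => hTm j l)
      (teich_mem _) ?_
    rw [red_teich, red_sum _ _ fun j _ => sum_mem fun l _ => hTm j l, Hahn.digitPoly,
      Finset.sum_product]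
    refine Finset.sum_congr rfl fun j _ => ?_
    rw [red_sum _ _ fun l _ => hTm j l]
    exact Finset.sum_congr rfl fun l _ => red_teich _
  have h4 := h3 m
  rw [coeff_sub, GenSeries.coeff_sum] at h4
  simp only [GenSeries.coeff_sum] at h4
  have e : S - (teich p K σ (Hahn.digitPoly p n N c u)).coeff m =
      (S - ∑ j ∈ R, orbitTerm σ n (algebraMap O K lam) (delta p K lam σ u * x) m j) +
      (∑ j ∈ R, (orbitTerm σ n (algebraMap O K lam) (delta p K lam σ u * x) m j -
        ∑ l ∈ Finset.range N, (T j l).coeff m) +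
      (∑ j ∈ R, ∑ l ∈ Finset.range N, (T j l).coeff m -
        (teich p K σ (Hahn.digitPoly p n N c u)).coeff m)) := by
    rw [Finset.sum_sub_distrib]
    ring
  rw [e]
  refine (IsUltrametricDist.norm_add_le_max _ _).trans (max_le h1 ?_)
  refine (IsUltrametricDist.norm_add_le_max _ _).trans (max_le ?_ h4)
  exact IsUltrametricDist.norm_sum_le_of_forall_le_of_nonneg hr0.le h2

end Congruence

/-! ### Successive improvement modulo powers of λ. -/

section Iteration

open IsLocalRing GammaImmAnCon

set_option linter.unusedSectionVars false

variable {p : ℕ} {O K : Type*} [CommRing O] [NormedField K] [Algebra O K]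
  [hp : Fact p.Prime] [IsUltrametricDist K] [CompleteSpace K]
  [IsDomain O] [IsDiscreteValuationRing O] [IsFractionRing O K] [hN : IsNormalizedAbs p O K]
  {lam : O} [hl : Fact (Irreducible lam)] {σ : O ≃+* O}
  [CharP (ResidueField O) p] [hs : Fact (∀ a : O, σ a - a ^ p ∈ maximalIdeal O)]
  [IsAlgClosed (ResidueField O)]
  {L : Subring (HahnSeries ℚ (ResidueField O))} {hL : Hahn.IsAdmissible p L}

lemma norm_le_of_hasSum {ι : Type*} {f : ι → K} {S : K} {C : ℝ} (hf : HasSum f S) (hC : 0 ≤ C)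
    (h : ∀ i, ‖f i‖ ≤ C) : ‖S‖ ≤ C := by
  rw [← hf.tsum_eq]
  exact norm_tsum_le_of_forall hC h

variable (p K σ lam) in
/-- The terms of the orbit sums are controlled by the Gauss norm. -/
lemma exists_norm_orbitTerm_le {n : ℕ} (hn : 0 < n) {m : ℚ} (hm : m < 0) :
    ∃ M : ℝ, 0 < M ∧ ∀ (f : GammaImmAnCon p K) (G : ℝ), GaussLe 1 f G → ∀ j,
      ‖orbitTerm σ n (algebraMap O K lam) f m j‖ ≤ M * G := by
  have hr0 := rho_pos (lam := lam) K
  have hr1 := rho_lt_one (hN := hN) (lam := lam)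
  have hpq : (1 : ℚ) < p := by exact_mod_cast hp.out.one_lt
  obtain ⟨M, hM0, hM⟩ := exists_deltaBound_le (p := p) (K := K) lam one_pos (neg_pos.2 hm)
  refine ⟨max M 1, by positivity, fun f G hf j => ?_⟩
  have hG := hf.nonneg
  have h1 : ‖orbitTerm σ n (algebraMap O K lam) f m j‖ ≤
      rho K lam ^ j * wt p (-1) (m / (p : ℚ) ^ ((n : ℤ) * j)) * G := by
    unfold orbitTerm
    rw [norm_mul, norm_zpow, norm_tau_zpow (hN := hN), mul_assoc, mul_comm (wt p _ _)]
    exact mul_le_mul_of_nonneg_left (hf.norm_le _) (zpow_nonneg (norm_nonneg _) _)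
  refine h1.trans (mul_le_mul_of_nonneg_right ?_ hG)
  -- For j ≤ 0 the growth of ρ^j is beaten by the weight at m/q^j, uniformly in j because m < 0;
  -- this is the estimate already used for δ.
  have e : wt p (-1) (m / (p : ℚ) ^ ((n : ℤ) * j)) = wt p 1 ((p : ℚ) ^ (-((n : ℤ) * j)) * -m) := by
    unfold wt
    congr 1
    rw [zpow_neg]
    push_cast
    ring
  rw [e]
  obtain hj | hj := le_total 0 j
  · refine le_max_of_le_right ?_
    refine mul_le_one₀ ?_ (wt_pos p _ _).le ?_
    · lift j to ℕ using hj
      rw [zpow_natCast]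
      exact pow_le_one₀ hr0.le hr1.le
    · refine (wt_anti (a := 0) zero_le_one ?_).trans ?_
      · exact mul_nonneg (zpow_pos (by linarith) _).le (by linarith)
      · simp [wt]
  · refine le_max_of_le_left (le_trans ?_ (hM (-j)))
    unfold deltaBound
    rw [neg_neg]
    refine mul_le_mul_of_nonneg_left (wt_anti zero_le_one ?_) (zpow_pos hr0 _).le
    refine mul_le_mul_of_nonneg_right ?_ (by linarith)
    refine zpow_le_zpow_right₀ hpq.le ?_
    nlinarith

include hL in
/-- The congruence for the orbit sums of `delta u * x` can be solved. -/
lemma exists_delta_mul_congr (hlam : σ lam = lam) {n : ℕ} (hn : 0 < n) {x : GammaImmAnCon p K}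
    (hx : x ∈ gammaL p K σ L) (hx0 : x ≠ 0)
    (hsupp : ∀ m, x.coeff m ≠ 0 → -(p : ℚ) ^ n ≤ m ∧ m < -1) :
    ∃ γ r : ℚ, 0 < γ ∧ 0 < r ∧
      (∀ t ∈ L, (∀ i, t.coeff i ≠ 0 → -r ≤ i) → ∃ u ∈ L, (∀ m, u.coeff m ≠ 0 → γ ≤ m) ∧
        ∀ m < -(r / (p : ℚ) ^ n), ∀ S : K,
          HasSum (orbitTerm σ n (algebraMap O K lam) (delta p K lam σ u * x) m) S →
          ‖S - (teich p K σ t).coeff m‖ ≤ rho K lam) ∧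
      ∃ u ∈ L, (∀ m, u.coeff m ≠ 0 → γ ≤ m) ∧ u.coeff γ ≠ 0 ∧
        ∀ m < -(r / (p : ℚ) ^ n), ∀ S : K,
          HasSum (orbitTerm σ n (algebraMap O K lam) (delta p K lam σ u * x) m) S →
          ‖S‖ ≤ rho K lam := by
  obtain ⟨c, y, hcL, hcs, hy, hys, hxy⟩ := exists_digits (lam := lam) hL.1 hx hsupp
  have hx1 : SupLe x 1 := mem_immCon_iff.1 hx.1
  -- If all digits vanished, x would be divisible by every power of λ.
  have hc0 : ∃ l, c l ≠ 0 := by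
    by_contra! h
    refine hx0 (eq_of_forall_supLe (hN := hN) (lam := lam) fun N => ?_)
    have h1 := (hy N).const_mul (algebraMap O K lam ^ N)
    have e := hxy N
    simp only [h, teich_zero, mul_zero, Finset.sum_const_zero, zero_add] at e
    rw [sub_zero, e]
    rwa [mul_one, norm_pow] at h1
  obtain ⟨γ, r, hγ, hr, hbd, N₀, hN₀⟩ := Hahn.exists_digitPoly_solutions hn
    (fun l e h => (hcs l e h).1) (fun l e h => (hcs l e h).2) hc0 hL hcL
  obtain ⟨N₁, hN₁⟩ := exists_norm_orbitSum_sub_le hlam hn hγ hr hx1 (fun m h => (hsupp m h).1) hbd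
    hy (fun l m h => (hys l m h).1) hxy
  obtain ⟨h1, u, huL, hu, hu0, h2⟩ := hN₀ (max N₀ N₁) (le_max_left _ _)
  have h3 := hN₁ (max N₀ N₁) (le_max_right _ _)
  refine ⟨γ, r, hγ, hr, fun t ht hts => ?_, u, huL, hu, hu0, fun m hm S hS => ?_⟩
  · obtain ⟨u, huL, hu, e⟩ := h1 t ht hts
    refine ⟨u, huL, hu, fun m hm S hS => ?_⟩
    rw [← e]
    exact h3 u hu m hm S hS
  · have := h3 u hu m hm S hS
    rwa [h2, teich_zero, coeff_zero, sub_zero] at this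

lemma le_of_coeff_delta_ne_zero {u : HahnSeries ℚ (ResidueField O)} {g : ℚ} (hg : 0 < g)
    (hu : ∀ m, u.coeff m ≠ 0 → g ≤ m) {m : ℚ} (hm : (delta p K lam σ u).coeff m ≠ 0) : 0 ≤ m := by
  by_contra! h
  refine hm ?_
  rw [← (hasSum_delta hg hu m).tsum_eq]
  refine (tsum_congr fun i => ?_).trans tsum_zero
  by_contra h1
  have h2 := le_of_coeff_deltaTerm_ne_zero hu h1
  have : (0 : ℚ) < (p : ℚ) ^ i * g := mul_pos (zpow_pos (by exact_mod_cast hp.out.pos) i) hg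
  linarith

variable (σ lam) in
/-- The orbit sums of `f` on `[-r, -r / p ^ n)` have norm at most `C`. -/
def OrbitLe (n : ℕ) (r : ℚ) (f : GammaImmAnCon p K) (C : ℝ) : Prop :=
  ∀ m, -r ≤ m → m < -(r / (p : ℚ) ^ n) → ∀ S : K,
    HasSum (orbitTerm σ n (algebraMap O K lam) f m) S → ‖S‖ ≤ C

lemma exists_coboundary_lam (hlam : σ lam = lam) {n : ℕ} (hn : 0 < n) {r : ℚ} (hr : 0 < r)
    {f : GammaImmAnCon p K} (hf : f ∈ ringL p K σ hL) :
    ∃ b ∈ ringL p K σ hL, ∃ c ∈ ringL p K σ hL,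
      f = c + (b - constHom (algebraMap O K lam) * (phi p K σ ^ (n : ℤ)) b) ∧
      (∀ m, c.coeff m ≠ 0 → -r ≤ m ∧ m < -(r / (p : ℚ) ^ n)) ∧
      ∀ m, -r ≤ m → m < -(r / (p : ℚ) ^ n) →
        HasSum (orbitTerm σ n (algebraMap O K lam) f m) (c.coeff m) := by
  have hq : (0 : ℚ) < (p : ℚ) ^ n := pow_pos (by exact_mod_cast hp.out.pos) n
  have h := exists_coboundary hn (by rw [tau_algebraMap, hlam])
    (algebraMap_lam_ne_zero K (lam := lam)) (rho_lt_one (hN := hN) (lam := lam))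
    (div_pos hr hq) hf
  rwa [mul_div_cancel₀ _ hq.ne'] at h

/-- The representative of Dx on the window is λ^k y with y integral. Solving the congruence for
minus the reduction of y gives a correction that cancels y modulo λ. -/
lemma orbitLe_step (hlam : σ lam = lam) {n : ℕ} (hn : 0 < n) {γ r : ℚ} (hγ : 0 < γ) (hr : 0 < r)
    {x : GammaImmAnCon p K} (hx : x ∈ ringL p K σ hL)
    (hsol : ∀ t ∈ L, (∀ i, t.coeff i ≠ 0 → -r ≤ i) → ∃ u ∈ L, (∀ m, u.coeff m ≠ 0 → γ ≤ m) ∧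
        ∀ m < -(r / (p : ℚ) ^ n), ∀ S : K,
          HasSum (orbitTerm σ n (algebraMap O K lam) (delta p K lam σ u * x) m) S →
          ‖S - (teich p K σ t).coeff m‖ ≤ rho K lam)
    (k : ℕ) (D : GammaImmAnCon p K) (hD : D ∈ ringL p K σ hL)
    (hDx : OrbitLe lam σ n r (D * x) (rho K lam ^ k)) :
    ∃ w ∈ L, (∀ m, w.coeff m ≠ 0 → γ ≤ m) ∧
      OrbitLe lam σ n r ((D + constHom (algebraMap O K lam ^ k) * delta p K lam σ w) * x)
        (rho K lam ^ (k + 1)) := by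
  have hr0 := rho_pos (lam := lam) K
  have h0 := algebraMap_lam_ne_zero K (lam := lam)
  have hq : (0 : ℚ) < (p : ℚ) ^ n := pow_pos (by exact_mod_cast hp.out.pos) n
  have htau : tau K σ (algebraMap O K lam ^ k) = algebraMap O K lam ^ k := by
    rw [map_pow, tau_algebraMap, hlam]
  obtain ⟨-, -, c, hc, -, hcs, hcsum⟩ := exists_coboundary_lam (hL := hL) hlam hn hr (mul_mem hD hx)
  have hc1 : SupLe c (rho K lam ^ k) := by
    intro m
    by_cases h : c.coeff m = 0
    · rw [h, norm_zero]
      positivity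
    · obtain ⟨h1, h2⟩ := hcs m h
      exact hDx m h1 h2 _ (hcsum m h1 h2)
  set y := constHom (p := p) ((algebraMap O K lam ^ k)⁻¹) * c with hy
  have hyc : ∀ m, c.coeff m = algebraMap O K lam ^ k * y.coeff m := fun m => by
    rw [hy, coeff_constHom_mul, mul_inv_cancel_left₀ (pow_ne_zero k h0)]
  have hys : ∀ m, y.coeff m ≠ 0 → -r ≤ m ∧ m < -(r / (p : ℚ) ^ n) := fun m hm =>
    hcs m fun h => hm (by rw [hy, coeff_constHom_mul, h, mul_zero])
  have hy1 : SupLe y 1 := by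
    have := hc1.const_mul ((algebraMap O K lam ^ k)⁻¹)
    rwa [norm_inv, norm_pow, ← rho, inv_mul_cancel₀ (pow_pos hr0 k).ne'] at this
  have hyL : y ∈ gammaL p K σ L := by
    refine mem_gammaL_of_mem_gammaInv hL.1 ?_ hy1
    have h1 : cut (Set.Iio 0) y = y := cut_eq_self fun m hm => by
      have := div_pos hr hq
      have := (hys m hm).2
      rw [Set.mem_Iio]
      linarith
    rw [← h1]
    exact (mul_mem (constHom_mem_ringL _) hc : y ∈ ringL p K σ hL) 0
  obtain ⟨w, hwL, hws, hw⟩ := hsol (-red y) (neg_mem (red_mem (lam := lam) hL.1 hyL)) (fun i hi =>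
    (hys i (coeff_ne_zero_of_coeff_red_ne_zero (O := O) fun h => hi (by
      rw [HahnSeries.coeff_neg, h, neg_zero]))).1)
  refine ⟨w, hwL, hws, fun m hm1 hm2 S hS => ?_⟩
  obtain ⟨-, -, c', -, -, -, hc'⟩ := exists_coboundary_lam (hL := hL) (K := K) hlam hn hr
    (mul_mem (delta_mem_ringL (lam := lam) hγ hws hwL) hx)
  have hS2 := hc' m hm1 hm2
  have hS1 := (hcsum m hm1 hm2).add (hS2.mul_left (algebraMap O K lam ^ k))
  have e : ∀ j, orbitTerm σ n (algebraMap O K lam)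
      ((D + constHom (algebraMap O K lam ^ k) * delta p K lam σ w) * x) m j =
      orbitTerm σ n (algebraMap O K lam) (D * x) m j + algebraMap O K lam ^ k *
        orbitTerm σ n (algebraMap O K lam) (delta p K lam σ w * x) m j := fun j => by
    rw [add_mul, orbitTerm_add, mul_assoc, orbitTerm_constHom_mul n _ htau]
  simp only [← e] at hS1
  rw [hS.unique hS1, hyc, ← mul_add, norm_mul, norm_pow, pow_succ]
  refine mul_le_mul_of_nonneg_left ?_ (pow_nonneg (norm_nonneg _) k)
  have h2 : SupLe (teich p K σ (-red y) - -y) (rho K lam) := by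
    refine supLe_sub_of_red_eq (O := O) (teich_mem _) (neg_mem (mem_immCon_iff.2 hy1)) ?_
    rw [red_teich, red_neg (mem_immCon_iff.2 hy1)]
  have h3 := h2 m
  rw [coeff_sub, coeff_neg, sub_neg_eq_add] at h3
  have h4 := hw m hm2 _ hS2
  calc ‖y.coeff m + c'.coeff m‖ = ‖(c'.coeff m - (teich p K σ (-red y)).coeff m) +
        ((teich p K σ (-red y)).coeff m + y.coeff m)‖ := by congr 1; ring
    _ ≤ _ := (IsUltrametricDist.norm_add_le_max _ _).trans (max_le h4 h3)

end Iteration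

/-! ### The limit eigenvector and the solution of the scalar equation. -/

section Limit

open IsLocalRing GammaImmAnCon

set_option linter.unusedSectionVars false

variable {p : ℕ} {O K : Type*} [CommRing O] [NormedField K] [Algebra O K]
  [hp : Fact p.Prime] [IsUltrametricDist K] [CompleteSpace K]
  [IsDomain O] [IsDiscreteValuationRing O] [IsFractionRing O K] [hN : IsNormalizedAbs p O K]
  {lam : O} [hl : Fact (Irreducible lam)] {σ : O ≃+* O}
  [CharP (ResidueField O) p] [hs : Fact (∀ a : O, σ a - a ^ p ∈ maximalIdeal O)]
  [IsAlgClosed (ResidueField O)]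
  {L : Subring (HahnSeries ℚ (ResidueField O))} {hL : Hahn.IsAdmissible p L}

variable (p K σ lam) in
/-- The terms `lam ^ i * delta (w i)`. -/
def deltaSeq (w : ℕ → HahnSeries ℚ (ResidueField O)) (i : ℕ) : GammaImmAnCon p K :=
  constHom (algebraMap O K lam ^ i) * delta p K lam σ (w i)

lemma exists_seq (hlam : σ lam = lam) {n : ℕ} (hn : 0 < n) {γ r : ℚ} (hγ : 0 < γ) (hr : 0 < r)
    {x : GammaImmAnCon p K} (hx : x ∈ ringL p K σ hL)
    (hsol : ∀ t ∈ L, (∀ i, t.coeff i ≠ 0 → -r ≤ i) → ∃ u ∈ L, (∀ m, u.coeff m ≠ 0 → γ ≤ m) ∧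
        ∀ m < -(r / (p : ℚ) ^ n), ∀ S : K,
          HasSum (orbitTerm σ n (algebraMap O K lam) (delta p K lam σ u * x) m) S →
          ‖S - (teich p K σ t).coeff m‖ ≤ rho K lam)
    {u : HahnSeries ℚ (ResidueField O)} (huL : u ∈ L) (hu : ∀ m, u.coeff m ≠ 0 → γ ≤ m)
    (hux : ∀ m < -(r / (p : ℚ) ^ n), ∀ S : K,
          HasSum (orbitTerm σ n (algebraMap O K lam) (delta p K lam σ u * x) m) S →
          ‖S‖ ≤ rho K lam) :
    ∃ w : ℕ → HahnSeries ℚ (ResidueField O), w 0 = u ∧ (∀ i, w i ∈ L) ∧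
      (∀ i m, (w i).coeff m ≠ 0 → γ ≤ m) ∧ ∀ k, OrbitLe lam σ n r
        ((∑ i ∈ Finset.range (k + 1), deltaSeq p K lam σ w i) * x) (rho K lam ^ (k + 1)) := by
  choose! g hgL hgs hg using orbitLe_step hlam hn hγ hr hx hsol
  -- The state is the last w_k together with the partial sum through index k, since the next
  -- correction depends on that partial sum.
  let st : ℕ → HahnSeries ℚ (ResidueField O) × GammaImmAnCon p K := fun k => Nat.rec
    (u, delta p K lam σ u) (fun k s => (g (k + 1) s.2,
      s.2 + constHom (algebraMap O K lam ^ (k + 1)) * delta p K lam σ (g (k + 1) s.2))) k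
  have st_succ : ∀ k, st (k + 1) = (g (k + 1) (st k).2, (st k).2 +
      constHom (algebraMap O K lam ^ (k + 1)) * delta p K lam σ (g (k + 1) (st k).2)) :=
    fun k => rfl
  have h2 : ∀ k, (st k).2 = ∑ i ∈ Finset.range (k + 1), deltaSeq p K lam σ (fun i => (st i).1) i := by
    intro k
    induction k with
    | zero =>
      rw [zero_add, Finset.sum_range_one]
      show delta p K lam σ u = constHom (algebraMap O K lam ^ 0) * delta p K lam σ u
      rw [pow_zero, map_one, one_mul]
    | succ k ih =>
      rw [Finset.sum_range_succ, ← ih, st_succ]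
      rfl
  have h1 : ∀ k, ((st k).1 ∈ L ∧ ∀ m, (st k).1.coeff m ≠ 0 → γ ≤ m) ∧
      (st k).2 ∈ ringL p K σ hL ∧ OrbitLe lam σ n r ((st k).2 * x) (rho K lam ^ (k + 1)) := by
    intro k
    induction k with
    | zero =>
      refine ⟨⟨huL, hu⟩, delta_mem_ringL hγ hu huL, fun m _ hm S hS => ?_⟩
      rw [zero_add, pow_one]
      exact hux m hm S hS
    | succ k ih =>
      obtain ⟨-, h3, h4⟩ := ih
      rw [st_succ]
      have h5 := hgL (k + 1) _ h3 h4
      have h6 := hgs (k + 1) _ h3 h4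
      exact ⟨⟨h5, h6⟩, add_mem h3 (mul_mem (constHom_mem_ringL _) (delta_mem_ringL hγ h6 h5)),
        hg (k + 1) _ h3 h4⟩
  refine ⟨fun i => (st i).1, rfl, fun i => (h1 i).1.1, fun i => (h1 i).1.2, fun k => ?_⟩
  rw [← h2]
  exact (h1 k).2.2

variable {w : ℕ → HahnSeries ℚ (ResidueField O)} {γ : ℚ}

lemma gaussLe_deltaSeq (hγ : 0 < γ) (hw : ∀ i m, (w i).coeff m ≠ 0 → γ ≤ m) {s M : ℝ} (hs : 0 < s)
    (hM0 : 0 < M) (hM : ∀ i, deltaBound p K lam s γ i ≤ M) (i : ℕ) :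
    GaussLe s (deltaSeq p K lam σ w i) (rho K lam ^ i * M) := by
  have h := (gaussLe_delta (σ := σ) hs hγ (hw i) hM0 hM).constHom_mul (algebraMap O K lam ^ i)
  rwa [norm_pow] at h

lemma gsummable_deltaSeq (hγ : 0 < γ) (hw : ∀ i m, (w i).coeff m ≠ 0 → γ ≤ m) :
    GSummable 1 (deltaSeq p K lam σ w) where
  pos := one_pos
  good s hs _ i := good_of_bddBelow hs (a := 0) fun m hm => by
    unfold deltaSeq at hm
    rw [coeff_constHom_mul] at hm
    exact le_of_coeff_delta_ne_zero hγ (hw i) (right_ne_zero_of_mul hm)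
  bound s hs _ := by
    obtain ⟨M, hM0, hM⟩ := exists_deltaBound_le (p := p) (K := K) lam hs hγ
    refine ⟨fun i => rho K lam ^ i * M, ?_, gaussLe_deltaSeq hγ hw hs hM0 hM⟩
    rw [Nat.cofinite_eq_atTop]
    have := (tendsto_pow_atTop_nhds_zero_of_lt_one (rho_pos (lam := lam) K).le
      (rho_lt_one (hN := hN) (lam := lam))).mul_const M
    rwa [zero_mul] at this

lemma phi_sum_deltaSeq (hlam : σ lam = lam) (hγ : 0 < γ)
    (hw : ∀ i m, (w i).coeff m ≠ 0 → γ ≤ m) (h : GSummable 1 (deltaSeq p K lam σ w)) :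
    phi p K σ h.sum = constHom (algebraMap O K lam) * h.sum := by
  have htau : tau K σ (algebraMap O K lam) = algebraMap O K lam := by
    rw [tau_algebraMap, hlam]
  ext m
  have h1 := (h.hasSum (m / p)).map (tau K σ) (by
    have := continuous_tau_zpow (hN := hN) (σ := σ) 1
    rwa [zpow_one] at this)
  have h2 := (h.hasSum m).mul_left (algebraMap O K lam)
  rw [coeff_constHom_mul, coeff_phi]
  refine h1.unique ?_
  have e : ∀ i, ((tau K σ : K → K) ∘ fun i => (deltaSeq p K lam σ w i).coeff (m / p)) i =
      algebraMap O K lam * (deltaSeq p K lam σ w i).coeff m := by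
    intro i
    have h3 := phi_zpow_delta (K := K) (p := p) hlam hγ (hw i) 1
    rw [zpow_one, zpow_one] at h3
    have h4 : phi p K σ (deltaSeq p K lam σ w i) =
        constHom (algebraMap O K lam) * deltaSeq p K lam σ w i := by
      have h5 := phi_zpow_constHom_mul (p := p) (σ := σ) 1 (algebraMap O K lam ^ i)
        (delta p K lam σ (w i))
      rw [zpow_one, zpow_one, map_pow (tau K σ), htau, h3] at h5
      unfold deltaSeq
      rw [h5]
      ring
    rw [Function.comp_apply, ← coeff_phi, h4, coeff_constHom_mul]
  simp only [funext e]
  exact h2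

/-- As γ < pγ, the coefficient at γ is congruent modulo λ to that of the lift of w_0, which is a
unit. -/
lemma sum_deltaSeq_ne_zero (hγ : 0 < γ) (hw : ∀ i m, (w i).coeff m ≠ 0 → γ ≤ m)
    (h0 : (w 0).coeff γ ≠ 0) (h : GSummable 1 (deltaSeq p K lam σ w)) : h.sum ≠ 0 := by
  have hr0 := rho_pos (lam := lam) K
  have hr1 := rho_lt_one (hN := hN) (lam := lam)
  have hpq : (1 : ℚ) < p := by exact_mod_cast hp.out.one_lt
  intro hsum
  have hd : ∀ i, ‖(delta p K lam σ (w i)).coeff γ‖ ≤ 1 := by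
    intro i
    have h1 := norm_coeff_delta_sub_le (K := K) (lam := lam) (σ := σ) hγ (hw i) (m := γ)
      (by nlinarith)
    have h2 := mem_immCon_iff.1 (teich_mem (p := p) (K := K) (σ := σ) (w i)) γ
    rw [coeff_sub] at h1
    rw [← sub_add_cancel ((delta p K lam σ (w i)).coeff γ) ((teich p K σ (w i)).coeff γ)]
    exact (IsUltrametricDist.norm_add_le_max _ _).trans (max_le (h1.trans hr1.le) h2)
  have h1 := norm_sub_sum_tsum_le (h.summable γ) {0} hr0.le fun i hi => by
    rw [Finset.mem_singleton] at hi
    unfold deltaSeq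
    rw [coeff_constHom_mul, norm_mul, norm_pow]
    calc rho K lam ^ i * ‖(delta p K lam σ (w i)).coeff γ‖ ≤ rho K lam ^ i * 1 :=
          mul_le_mul_of_nonneg_left (hd i) (by positivity)
      _ ≤ rho K lam := by
          rw [mul_one]
          exact pow_le_of_le_one hr0.le hr1.le hi
  rw [← h.coeff_sum, hsum, coeff_zero, zero_sub, norm_neg, Finset.sum_singleton] at h1
  unfold deltaSeq at h1
  rw [pow_zero, map_one, one_mul] at h1
  have h2 := norm_coeff_delta_sub_le (K := K) (lam := lam) (σ := σ) hγ (hw 0) (m := γ)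
      (by nlinarith)
  rw [coeff_sub] at h2
  have h3 : ‖(teich p K σ (w 0)).coeff γ‖ ≤ rho K lam := by
    rw [← sub_add_cancel ((teich p K σ (w 0)).coeff γ) ((delta p K lam σ (w 0)).coeff γ)]
    exact (IsUltrametricDist.norm_add_le_max _ _).trans (max_le ((norm_sub_rev _ _).trans_le h2) h1)
  refine h0 ?_
  rw [← red_teich (p := p) (K := K) (σ := σ) (w 0), coeff_red]
  rw [resK_eq_zero_iff (h3.trans hr1.le)]
  exact h3.trans_lt hr1

lemma gaussLe_sum_sub (hγ : 0 < γ) (hw : ∀ i m, (w i).coeff m ≠ 0 → γ ≤ m) {s M : ℝ} (hs : 0 < s)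
    (hM0 : 0 < M) (hM : ∀ i, deltaBound p K lam s γ i ≤ M)
    (h : GSummable 1 (deltaSeq p K lam σ w)) (k : ℕ) :
    GaussLe s (h.sum - ∑ i ∈ Finset.range k, deltaSeq p K lam σ w i) (rho K lam ^ k * M) := by
  have hr0 := rho_pos (lam := lam) K
  have hr1 := rho_lt_one (hN := hN) (lam := lam)
  intro m
  have hwt := wt_pos p s m
  rw [coeff_sub, h.coeff_sum, GenSeries.coeff_sum, ← le_div_iff₀ hwt]
  refine norm_sub_sum_tsum_le (h.summable m) _ (by positivity) fun i hi => ?_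
  rw [le_div_iff₀ hwt]
  refine (gaussLe_deltaSeq hγ hw hs hM0 hM i m).trans ?_
  rw [Finset.mem_range, not_lt] at hi
  exact mul_le_mul_of_nonneg_right (pow_le_pow_of_le_one hr0.le hr1.le hi) hM0.le

include hL in
/-- Every integral series with support in `[-p ^ n, -1)` has a nonzero multiple by an eigenvector of
`phi` that is a coboundary. -/
lemma exists_mul_eq_coboundary (hlam : σ lam = lam) {n : ℕ} (hn : 0 < n) {x : GammaImmAnCon p K}
    (hx : x ∈ gammaL p K σ L) (hx0 : x ≠ 0)
    (hsupp : ∀ m, x.coeff m ≠ 0 → -(p : ℚ) ^ n ≤ m ∧ m < -1) :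
    ∃ d ∈ ringL p K σ hL, d ≠ 0 ∧ phi p K σ d = constHom (algebraMap O K lam) * d ∧
      ∃ b ∈ ringL p K σ hL,
        b - constHom (algebraMap O K lam) * (phi p K σ ^ (n : ℤ)) b = d * x := by
  have hr0 := rho_pos (lam := lam) K
  have hr1 := rho_lt_one (hN := hN) (lam := lam)
  obtain ⟨γ, r, hγ, hr, hsol, u, huL, hu, hu0, hux⟩ :=
    exists_delta_mul_congr (hL := hL) hlam hn hx hx0 hsupp
  have hxR : x ∈ ringL p K σ hL := gammaInv_le_ringL (gammaL_le_gammaInv hx)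
  obtain ⟨w, hw0, hwL, hw, hwx⟩ := exists_seq hlam hn hγ hr hxR hsol huL hu hux
  have hG := gsummable_deltaSeq (K := K) (lam := lam) (σ := σ) hγ hw
  have hmem : ∀ i, deltaSeq p K lam σ w i ∈ ringL p K σ hL := fun i =>
    mul_mem (constHom_mem_ringL _) (delta_mem_ringL hγ (hw i) (hwL i))
  have hd := hG.sum_mem_ringL hmem
  refine ⟨hG.sum, hd, sum_deltaSeq_ne_zero hγ hw (hw0 ▸ hu0) hG,
    phi_sum_deltaSeq hlam hγ hw hG, ?_⟩
  obtain ⟨b, hb, c, hc, he, hcs, hcsum⟩ := exists_coboundary_lam hlam hn hr (mul_mem hd hxR)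
  refine ⟨b, hb, ?_⟩
  suffices h : c = 0 by
    rw [he, h, zero_add]
  ext m
  rw [coeff_zero]
  by_contra hcm
  obtain ⟨hm1, hm2⟩ := hcs m hcm
  have hm0 : m < 0 := hm2.trans (by
    have : (0 : ℚ) < (p : ℚ) ^ n := pow_pos (by exact_mod_cast hp.out.pos) n
    rw [neg_lt_zero]
    positivity)
  obtain ⟨M, hM0, hM⟩ := exists_deltaBound_le (p := p) (K := K) lam one_pos hγ
  obtain ⟨M', hM'0, hM'⟩ := exists_norm_orbitTerm_le p K lam σ hn hm0
  have hxG := (mem_immCon_iff.1 hx.1).gaussLe zero_le_one fun m hm => (hsupp m hm).1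
  set X : ℝ := 1 * wt p 1 (-(p : ℚ) ^ n) with hX
  have hX0 : 0 < X := by
    rw [hX, one_mul]
    exact wt_pos p _ _
  -- Compare with the partial sum D: its orbit sum is at most ρ^{k+1} by construction, and that of
  -- the tail is bounded through its Gauss norm.
  have key : ∀ k : ℕ, ‖c.coeff m‖ ≤ rho K lam ^ (k + 1) * max 1 (M' * (M * X)) := by
    intro k
    set D := ∑ i ∈ Finset.range (k + 1), deltaSeq p K lam σ w i with hD
    have hDR : D ∈ ringL p K σ hL := sum_mem fun i _ => hmem i
    obtain ⟨-, -, c', -, -, -, hc'⟩ := exists_coboundary_lam hlam hn hr (mul_mem hDR hxR)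
    have h1 := hwx k m hm1 hm2 _ (hc' m hm1 hm2)
    have h2 := (hcsum m hm1 hm2).sub (hc' m hm1 hm2)
    have h3 := (gaussLe_sum_sub hγ hw one_pos hM0 hM hG (k + 1)).mul hxG
    rw [← hD] at h3
    have h4 : ‖c.coeff m - c'.coeff m‖ ≤ M' * (rho K lam ^ (k + 1) * M * X) := by
      refine norm_le_of_hasSum h2 (by positivity) fun j => ?_
      have e : orbitTerm σ n (algebraMap O K lam) (hG.sum * x) m j =
          orbitTerm σ n (algebraMap O K lam) ((hG.sum - D) * x) m j +
          orbitTerm σ n (algebraMap O K lam) (D * x) m j := by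
        rw [← orbitTerm_add, ← add_mul, sub_add_cancel]
      rw [e, add_sub_cancel_right]
      exact hM' _ _ h3 j
    rw [← sub_add_cancel (c.coeff m) (c'.coeff m)]
    refine (IsUltrametricDist.norm_add_le_max _ _).trans (max_le (h4.trans ?_) (h1.trans ?_))
    · rw [show M' * (rho K lam ^ (k + 1) * M * X) = rho K lam ^ (k + 1) * (M' * (M * X)) by ring]
      exact mul_le_mul_of_nonneg_left (le_max_right _ _) (by positivity)
    · exact le_mul_of_one_le_right (by positivity) (le_max_left _ _)
  have hlim := ((tendsto_pow_atTop_nhds_zero_of_lt_one hr0.le hr1).comp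
    (tendsto_add_atTop_nat 1)).mul_const (max 1 (M' * (M * X)))
  rw [zero_mul] at hlim
  have := ge_of_tendsto' hlim key
  exact hcm (norm_le_zero_iff.1 this)

/-- Every element of the ring has a nonzero multiple by an eigenvector of `phi` that is a
coboundary. -/
lemma exists_eigen_mul_eq_coboundary (hlam : σ lam = lam) {n : ℕ} (hn : 0 < n)
    {C : GammaImmAnCon p K} (hC : C ∈ ringL p K σ hL) :
    ∃ d ∈ ringL p K σ hL, d ≠ 0 ∧ phi p K σ d = constHom (algebraMap O K lam) * d ∧
      ∃ b ∈ ringL p K σ hL,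
        b - constHom (algebraMap O K lam) * (phi p K σ ^ (n : ℤ)) b = d * C := by
  have hr1 := rho_lt_one (hN := hN) (lam := lam)
  have hr0 := rho_pos (lam := lam) K
  have h0 := algebraMap_lam_ne_zero K (lam := lam)
  have htau : tau K σ (algebraMap O K lam) = algebraMap O K lam := by
    rw [tau_algebraMap, hlam]
  have hphin : ∀ d : GammaImmAnCon p K, phi p K σ d = constHom (algebraMap O K lam) * d →
      ∀ j : ℕ, (phi p K σ ^ (j : ℤ)) d = constHom (algebraMap O K lam ^ j) * d := by
    intro d hd j
    induction j with
    | zero => simp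
    | succ j ih =>
      have h1 := phi_zpow_constHom_mul (p := p) (σ := σ) j (algebraMap O K lam) d
      rw [tau_zpow_eq_self htau, ih] at h1
      rw [Nat.cast_succ, zpow_add_one, RingAut.mul_apply, hd, h1, pow_succ, map_mul]
      ring
  obtain ⟨e, he, c, hc, hCe, hcs, -⟩ := exists_coboundary (hL := hL) (K := K) (σ := σ) hn
    (mu := algebraMap O K lam ^ (n + 1)) (by rw [map_pow, htau]) (pow_ne_zero _ h0)
    (by rw [norm_pow]; exact pow_lt_one₀ (norm_nonneg _) hr1 n.succ_ne_zero) one_pos hC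
  -- The reason for μ = λ^{n+1}: multiplying by an eigenvector d uses up λ^n, because φ^n(d) = λ^n
  -- d.
  have hde : ∀ d : GammaImmAnCon p K, phi p K σ d = constHom (algebraMap O K lam) * d →
      d * (e - constHom (algebraMap O K lam ^ (n + 1)) * (phi p K σ ^ (n : ℤ)) e) =
      d * e - constHom (algebraMap O K lam) * (phi p K σ ^ (n : ℤ)) (d * e) := by
    intro d hd
    rw [map_mul, hphin d hd, pow_succ, map_mul]
    ring
  -- If C is already a coboundary any nonzero eigenvector will do, for instance δ(t).
  by_cases hc0 : c = 0
  · have hu : ∀ m, (HahnSeries.single (1 : ℚ) (1 : ResidueField O)).coeff m ≠ 0 → 1 ≤ m := by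
      intro m hm
      by_contra! h
      exact hm (HahnSeries.coeff_single_of_ne h.ne)
    have hdR : delta p K lam σ (HahnSeries.single (1 : ℚ) 1) ∈ ringL p K σ hL :=
      delta_mem_ringL one_pos hu (hL.single_mem _ _)
    have hphi := phi_zpow_delta (K := K) (lam := lam) hlam one_pos hu 1
    rw [zpow_one, zpow_one] at hphi
    refine ⟨_, hdR, ?_, hphi, _, mul_mem hdR he, ?_⟩
    · intro hd
      have h1 := norm_coeff_delta_sub_le (K := K) (lam := lam) (σ := σ) one_pos hu (m := 1)
        (by rw [mul_one]; exact_mod_cast hp.out.one_lt)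
      rw [hd, zero_sub, coeff_neg, norm_neg] at h1
      have h2 := coeff_red (O := O) (teich p K σ (HahnSeries.single (1 : ℚ) (1 : ResidueField O))) 1
      rw [red_teich, HahnSeries.coeff_single_same] at h2
      rw [eq_comm, (resK_eq_zero_iff (O := O) (h1.trans hr1.le)).2 (h1.trans_lt hr1)] at h2
      exact zero_ne_one h2
    · rw [hCe, hc0, zero_add, hde _ hphi]
  · have hcI : c ∈ gammaInv p K σ L := by
      have h1 : cut (Set.Iio 0) c = c := cut_eq_self fun m hm => by
        have := (hcs m hm).2
        rw [Set.mem_Iio]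
        linarith
      rw [← h1]
      exact hc 0
    obtain ⟨a, ha, hac⟩ := hcI
    obtain ⟨N, hN⟩ := exists_rho_pow_lt (hN := hN) (lam := lam) (norm_pos_iff.2 ha)
    have hx : constHom (algebraMap O K lam ^ N) * c ∈ gammaL p K σ L :=
      constHom_mul_mem_gammaL ha (by rw [norm_pow]; exact hN.le) hac
    have hN0 : algebraMap O K lam ^ N ≠ 0 := pow_ne_zero N h0
    have hinv : constHom (p := p) ((algebraMap O K lam ^ N)⁻¹) * constHom (algebraMap O K lam ^ N) = 1 := by
      rw [← map_mul, inv_mul_cancel₀ hN0, map_one]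
    obtain ⟨d, hd, hd0, hphi, b, hb, hbd⟩ := exists_mul_eq_coboundary (hL := hL) hlam hn hx
      (fun h => hc0 (by
        rw [← one_mul c, ← hinv, mul_assoc, h, mul_zero])) (fun m hm => by
        rw [coeff_constHom_mul] at hm
        have := hcs m (right_ne_zero_of_mul hm)
        rwa [mul_one] at this)
    refine ⟨d, hd, hd0, hphi, constHom ((algebraMap O K lam ^ N)⁻¹) * b + d * e,
      add_mem (mul_mem (constHom_mem_ringL _) hb) (mul_mem hd he), ?_⟩
    have htau' : (tau K σ ^ (n : ℤ)) ((algebraMap O K lam ^ N)⁻¹) = (algebraMap O K lam ^ N)⁻¹ :=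
      tau_zpow_eq_self (by rw [map_inv₀, map_pow, htau]) _
    rw [map_add, phi_zpow_constHom_mul, htau']
    have h1 : d * c = constHom ((algebraMap O K lam ^ N)⁻¹) *
        (b - constHom (algebraMap O K lam) * (phi p K σ ^ (n : ℤ)) b) := by
      rw [hbd, mul_left_comm, ← mul_assoc (constHom _), hinv, one_mul]
    have h2 := hde d hphi
    conv_rhs => rw [hCe, mul_add, h2, h1]
    ring

end Limit

/-! ### From the scalar equation to an eigenvector of F. -/

section Descent

/-- An eigenvector of a cyclic extension, from a solution of the corresponding scalar equation. -/
lemma exists_eigenvector {R M : Type*} [CommRing R] [AddCommGroup M] [Module R M] {φ : R →+* R}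
    (F : M →ₛₗ[φ] M) {m : ℕ} (b : Module.Basis (Fin (m + 1) ⊕ Unit) R M) {lam nu : R}
    (hnu : φ nu = nu) (hln : lam * nu = 1)
    (hsol : ∀ C : R, ∃ d, d ≠ 0 ∧ φ d = lam * d ∧ ∃ e, e - lam * φ^[m + 1] e = d * C)
    (c : Fin (m + 1) → R)
    (hFv : ∀ i : Fin m, F (b (Sum.inl i.castSucc)) = b (Sum.inl i.succ))
    (hFvn : F (b (Sum.inl (Fin.last m))) = lam ^ (m + 1 + 1) • b (Sum.inl 0))
    (hFw : F (b (Sum.inr ())) = b (Sum.inr ()) + ∑ i, c i • b (Sum.inl i)) :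
    ∃ y : M, y ≠ 0 ∧ F y = lam • y := by
  let c' : ℕ → R := fun i => if h : i < m + 1 then c ⟨i, h⟩ else 0
  have hc' : ∀ i : Fin (m + 1), c' i = c i := fun i => dif_pos i.2
  -- Solving β_{i+1} = d c_{i+1} + λ^{-1} φ(β_i) from β_0 = e gives β_i = d s_i + λ^{-i} φ^i(e),
  -- because φ(d) = λd cancels λ^{-1}. The remaining equation, from F applied to the last v, is the
  -- scalar one with C = c_0 + λ^{m+2} φ(s_m).
  let s : ℕ → R := fun i => Nat.rec 0 (fun i s => c' (i + 1) + φ s) i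
  have hs : ∀ i, s (i + 1) = c' (i + 1) + φ (s i) := fun i => rfl
  obtain ⟨d, hd0, hd, e, he⟩ := hsol (c' 0 + lam ^ (m + 2) * φ (s m))
  let β : ℕ → R := fun i => d * s i + nu ^ i * φ^[i] e
  have hβ0 : β 0 = e := by simp [β, s]
  have hφβ : ∀ i, φ (β i) = lam * d * φ (s i) + nu ^ i * φ^[i + 1] e := fun i => by
    simp only [β, map_add, map_mul, map_pow, hd, hnu, Function.iterate_succ_apply']
  have hβs : ∀ i, lam * β (i + 1) = lam * d * c' (i + 1) + φ (β i) := fun i => by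
    rw [hφβ]
    simp only [β, hs]
    linear_combination (nu ^ i * φ^[i + 1] e) * hln
  have hβm : lam * β 0 = lam * d * c' 0 + lam ^ (m + 2) * φ (β m) := by
    have h1 : lam ^ m * nu ^ m = 1 := by rw [← mul_pow, hln, one_pow]
    rw [hφβ, hβ0]
    linear_combination lam * he - lam ^ 2 * φ^[m + 1] e * h1
  refine ⟨d • b (Sum.inr ()) + ∑ i : Fin (m + 1), β i • b (Sum.inl i), fun h => hd0 ?_, ?_⟩
  · have h1 := congrArg (fun y => b.repr y (Sum.inr ())) h
    simpa [Finsupp.single_apply] using h1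
  · have h1 : ∑ i : Fin (m + 1), φ (β i) • F (b (Sum.inl i)) =
        ∑ i : Fin (m + 1), (lam * β i - lam * d * c i) • b (Sum.inl i) := by
      rw [Fin.sum_univ_castSucc, Fin.sum_univ_succ, hFvn, add_comm]
      congr 1
      · rw [smul_smul, ← hc' 0]
        congr 1
        rw [Fin.val_last, Fin.val_zero, hβm]
        ring
      · refine Finset.sum_congr rfl fun i _ => ?_
        rw [hFv, ← hc' i.succ]
        congr 1
        rw [Fin.val_succ, hβs, Fin.val_castSucc]
        ring
    rw [map_add, map_sum, F.map_smulₛₗ]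
    simp only [F.map_smulₛₗ]
    rw [h1, hFw, hd, smul_add, smul_add, Finset.smul_sum, Finset.smul_sum, add_assoc,
      ← Finset.sum_add_distrib, smul_smul]
    congr 1
    refine Finset.sum_congr rfl fun i _ => ?_
    rw [smul_smul, smul_smul, ← add_smul]
    congr 1
    ring

end Descent

/-! ### The residue field of O is algebraically closed of characteristic p. -/

section ResidueField

open IsLocalRing

/-- The residue field of a finite extension of the Witt vectors of `k` is `k`. -/
lemma exists_residueField_hom (p : ℕ) [Fact p.Prime] (k : Type*) [Field k] [CharP k p] [IsAlgClosed k]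
    (O : Type*) [CommRing O] [IsLocalRing O] [Algebra (WittVector p k) O]
    [FaithfulSMul (WittVector p k) O] [Module.Finite (WittVector p k) O] :
    ∃ f : k →+* ResidueField O, Function.Bijective f := by
  -- An injective integral extension reflects units, so the Witt vectors with zero constant
  -- coefficient land in the maximal ideal and k maps to the residue field. That map is integral,
  -- hence bijective since k is algebraically closed.
  have h1 : ∀ x : WittVector p k, WittVector.constantCoeff x = 0 →
      residue O (algebraMap (WittVector p k) O x) = 0 := by
    intro x hx
    rw [residue_eq_zero_iff, mem_maximalIdeal, mem_nonunits_iff]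
    intro h
    have h2 := (isUnit_of_map_unit (algebraMap (WittVector p k) O) x h).map
      (WittVector.constantCoeff : WittVector p k →+* k)
    rw [hx] at h2
    exact not_isUnit_zero h2
  let g : WittVector p k →+* ResidueField O := (residue O).comp (algebraMap (WittVector p k) O)
  have hr := Function.rightInverse_surjInv (WittVector.constantCoeff_surjective (R := k) p)
  let f : k →+* ResidueField O := (WittVector.constantCoeff : WittVector p k →+* k).liftOfRightInverse
    _ hr ⟨g, fun x hx => h1 x hx⟩
  have hf : f.comp WittVector.constantCoeff = g := RingHom.ext fun x =>
    RingHom.liftOfRightInverse_comp_apply _ _ hr ⟨g, fun x hx => h1 x hx⟩ x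
  have hint : g.IsIntegral := by
    refine RingHom.IsIntegral.trans _ _ ?_ (RingHom.isIntegral_of_surjective _ residue_surjective)
    exact algebraMap_isIntegral_iff.2 inferInstance
  rw [← hf] at hint
  exact ⟨f, IsAlgClosed.ringHom_bijective_of_isIntegral f (RingHom.IsIntegral.tower_top _ _ hint)⟩

lemma charP_residueField (p : ℕ) [Fact p.Prime] (k : Type*) [Field k] [CharP k p] [IsAlgClosed k]
    (O : Type*) [CommRing O] [IsLocalRing O] [Algebra (WittVector p k) O]
    [FaithfulSMul (WittVector p k) O] [Module.Finite (WittVector p k) O] :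
    CharP (ResidueField O) p := by
  obtain ⟨f, hf⟩ := exists_residueField_hom p k O
  exact charP_of_injective_ringHom hf.1 p

lemma isAlgClosed_residueField (p : ℕ) [Fact p.Prime] (k : Type*) [Field k] [CharP k p] [IsAlgClosed k]
    (O : Type*) [CommRing O] [IsLocalRing O] [Algebra (WittVector p k) O]
    [FaithfulSMul (WittVector p k) O] [Module.Finite (WittVector p k) O] :
    IsAlgClosed (ResidueField O) := by
  obtain ⟨f, hf⟩ := exists_residueField_hom p k O
  let e : k ≃+* ResidueField O := RingEquiv.ofBijective f hf
  refine IsAlgClosed.of_exists_root _ fun q _ hq => ?_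
  have hd : (q.map (e.symm : ResidueField O →+* k)).degree ≠ 0 := by
    rw [Polynomial.degree_map]
    exact (Polynomial.degree_pos_of_irreducible hq).ne'
  obtain ⟨x, hx⟩ := IsAlgClosed.exists_root _ hd
  refine ⟨e x, ?_⟩
  rw [Polynomial.IsRoot, Polynomial.eval_map, Polynomial.eval₂_eq_eval_map] at hx
  have h2 := Polynomial.eval_map_apply (e.symm : ResidueField O →+* k) (p := q) (e x)
  rw [RingEquiv.coe_toRingHom, RingEquiv.symm_apply_apply] at h2
  rw [h2] at hx
  exact (map_eq_zero_iff _ e.symm.injective).1 hx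

end ResidueField

/-! ### Transfer to the subring R and conclusion. -/

section Ring

open IsLocalRing GammaImmAnCon

variable {p : ℕ} {O K : Type*} [CommRing O] [NormedField K] [Algebra O K]
  [hp : Fact p.Prime] [IsUltrametricDist K] [CompleteSpace K]
  [IsDomain O] [IsDiscreteValuationRing O] [IsFractionRing O K] [hN : IsNormalizedAbs p O K]
  {lam : O} {σ : O ≃+* O}

lemma coe_frobenius (d : Decoration) (x : analyticRing p K σ d) :
    ((frobenius p K σ d x : analyticRing p K σ d) : GammaImmAnCon p K) = phi p K σ x := rfl

lemma frobenius_ofO (d : Decoration) (a : O) :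
    frobenius p K σ d (ofO p K σ d a) = ofO p K σ d (σ a) :=
  Subtype.ext (phi_const a)

lemma exists_analyticRing_solution [CharP (ResidueField O) p] [IsAlgClosed (ResidueField O)]
    (hσ : ∀ a : O, σ a - a ^ p ∈ maximalIdeal O)
    (hirr : Irreducible lam) (hlam : σ lam = lam) (d : Decoration) :
    (∃ nu, ofO p K σ d lam * nu = 1) ∧ ∀ {n : ℕ}, 0 < n → ∀ C : analyticRing p K σ d,
      ∃ D, D ≠ 0 ∧ frobenius p K σ d D = ofO p K σ d lam * D ∧
        ∃ e, e - ofO p K σ d lam * (frobenius p K σ d)^[n] e = D * C := by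
  have hs : Fact (∀ a : O, σ a - a ^ p ∈ maximalIdeal O) := ⟨hσ⟩
  have hl : Fact (Irreducible lam) := ⟨hirr⟩
  obtain ⟨L, hL, hR⟩ := exists_ringL (p := p) (K := K) (σ := σ) d
  refine ⟨⟨⟨constHom (algebraMap O K lam)⁻¹, hR ▸ constHom_mem_ringL _⟩, Subtype.ext ?_⟩, ?_⟩
  · show constHom (algebraMap O K lam) * constHom (algebraMap O K lam)⁻¹ = 1
    rw [← map_mul, mul_inv_cancel₀ (algebraMap_lam_ne_zero K), map_one]
  · intro n hn C
    have hC : (C : GammaImmAnCon p K) ∈ ringL p K σ hL := hR ▸ C.2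
    obtain ⟨D, hD, hD0, hphi, e, he, heq⟩ := exists_eigen_mul_eq_coboundary hlam hn hC
    have hiter : ∀ (j : ℕ) (x : analyticRing p K σ d),
        (((frobenius p K σ d)^[j] x : analyticRing p K σ d) : GammaImmAnCon p K) =
          (phi p K σ ^ (j : ℤ)) x := by
      intro j
      induction j with
      | zero => intro x; simp
      | succ j ih =>
        intro x
        rw [Function.iterate_succ_apply, ih, coe_frobenius, Nat.cast_succ, zpow_add_one,
          RingAut.mul_apply]
    refine ⟨⟨D, hR ▸ hD⟩, fun h => hD0 (congrArg Subtype.val h), Subtype.ext hphi, ⟨e, hR ▸ he⟩,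
      Subtype.ext ?_⟩
    rw [AddSubgroupClass.coe_sub, Subring.coe_mul, Subring.coe_mul, hiter]
    exact heq

end Ring

end

end GenSeries

theorem mainTheorem7
    (p : ℕ) [Fact p.Prime] (k : Type*) [Field k] [CharP k p] [IsAlgClosed k]
    (O : Type*) [CommRing O] [IsDomain O] [IsDiscreteValuationRing O]
    [Algebra (WittVector p k) O] [FaithfulSMul (WittVector p k) O]
    [Module.Finite (WittVector p k) O]
    (K : Type*) [NormedField K] [IsUltrametricDist K] [CompleteSpace K]
    [Algebra O K] [IsFractionRing O K] [GenSeries.IsNormalizedAbs p O K]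
    (σ : O ≃+* O) (hσ : ∀ a : O, σ a - a ^ p ∈ IsLocalRing.maximalIdeal O)
    (d : GenSeries.Decoration)
    (M : Type*) [AddCommGroup M] [Module (GenSeries.analyticRing p K σ d) M]
    (F : M →ₛₗ[GenSeries.frobenius p K σ d] M)
    (hM : GenSeries.IsFCrystal p (GenSeries.frobenius p K σ d) F)
    (lam : O) (hlam : Irreducible lam) (hlam_fixed : σ lam = lam)
    (n : ℕ) (hn : 0 < n)
    (b : Module.Basis (Fin n ⊕ Unit) (GenSeries.analyticRing p K σ d) M)
    (v : Fin n → M) (hv : ∀ i, v i = b (Sum.inl i))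
    (w : M) (hw : w = b (Sum.inr ()))
    (c : Fin n → GenSeries.analyticRing p K σ d)
    (hFv : ∀ (i : ℕ) (hi : i + 1 < n), F (v ⟨i, i.lt_succ_self.trans hi⟩) = v ⟨i + 1, hi⟩)
    (hFvn : F (v ⟨n - 1, Nat.sub_one_lt_of_lt hn⟩) =
      GenSeries.ofO p K σ d lam ^ (n + 1) • v ⟨0, hn⟩)
    (hFw : F w = w + ∑ i, c i • v i) :
    ∃ y : M, y ≠ 0 ∧ F y = GenSeries.ofO p K σ d lam • y := by
  have := GenSeries.charP_residueField p k O
  have := GenSeries.isAlgClosed_residueField p k O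
  obtain ⟨⟨nu, hnu⟩, hsol⟩ :=
    GenSeries.exists_analyticRing_solution (K := K) hσ hlam hlam_fixed d
  obtain ⟨m, rfl⟩ : ∃ m, n = m + 1 := ⟨n - 1, by omega⟩
  have hphi : GenSeries.frobenius p K σ d (GenSeries.ofO p K σ d lam) =
      GenSeries.ofO p K σ d lam := by
    rw [GenSeries.frobenius_ofO, hlam_fixed]
  have hphinu : GenSeries.frobenius p K σ d nu = nu := by
    have h1 := congrArg (GenSeries.frobenius p K σ d) hnu
    rw [map_mul, map_one, hphi] at h1
    exact left_inv_eq_right_inv (a := GenSeries.ofO p K σ d lam) (by rwa [mul_comm]) hnu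
  obtain rfl : v = fun i => b (Sum.inl i) := funext hv
  subst hw
  exact GenSeries.exists_eigenvector F b hphinu hnu (hsol hn) c
    (fun i => hFv i (Nat.succ_lt_succ i.2)) hFvn hFw
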